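/- Work over $\mathbf C$ and let $R=\mathbf C[u_0,u_1,u_2]$ act on $S=\mathbf C[x_0,x_1,x_2]$ by differentiation, $u_i=\partial/\partial x_i$. Points and closed subschemes of $\mathbf P^2=\operatorname{Proj} R$ are given by their saturated homogeneous ideals in $R$. Let $\Lambda\subseteq S_4$ be a pencil of planar quartics, i.e. a $2$-dimensional subspace. A polar octahedron of $\Lambda$ is a zero-dimensional subscheme $Z\subseteq\mathbf P^2$ of length $8$ such that - $Z$ is apolar to $\Lambda$: every $\varphi\in I_Z$ satisfies $\varphi\circ F=0$ for all $F\in\Lambda$; and - $Z$ is resolution-general: the graded Betti numbers of the minimal free resolution of $I_Z$ are those of the ideal of $8$ general points of $\mathbf P^2$. Let $\mathcal A=\mathcal A(8,\Lambda)\subseteq \operatorname{Hilb}(8,\mathbf P^2)$ be the set of polar octahedra of $\Lambda$, where $\operatorname{Hilb}(8,\mathbf P^2)$ is embedded in the Grassmannian of $37$-dimensional subspaces of $R_8$ by $Z\mapsto (I_Z)_8$. For $Z\in\mathcal A$, let $\Gamma_Z$ be the intersection of the cubics through $Z$. The associated point $\alpha(Z)\in\mathbf P^2$ is the residual scheme of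 $Z$ in $\Gamma_Z$, that is, the point whose ideal is $(I_{\Gamma_Z}:I_Z)$, where $I_{\Gamma_Z}$ is generated by the cubic forms in $I_Z$. **Theorem.** For a general pencil $\Lambda$ of planar quartics (that is, for all $\Lambda$ in some nonempty Zariski open subset of $G(2,S_4)$), every $Z\in\mathcal A$ has an associated point, and $\alpha:\mathcal A\to\mathbf P^2$ is a morphism which admits a rational inverse: there are a dense open subset $U\subseteq\mathbf P^2$ and a morphism $\beta:U\to\mathcal A$ such that $\alpha^{-1}(U)$ is dense in $\mathcal A$ and $\alpha|_{\alpha^{-1}(U)}$ and $\beta$ are mutually inverse. Hence $\mathcal A$ is a rational surface: it is an irreducible, locally closed subset of $\operatorname{Hilb}(8,\mathbf P^2)$ that is birational to $\mathbf P^2$. -/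

import Mathlib

open scoped LinearAlgebra.Projectivization

noncomputable section

namespace Apolar

/-! ### Classical projective geometry over `ℂ` -/

/-- Projective space with homogeneous coordinates indexed by `σ`; `ProjSp (Fin (n + 1))` is `ℙⁿ`. -/
abbrev ProjSp (σ : Type) : Type := ℙ ℂ (σ → ℂ)

/-- The Zariski topology on projective space: the sets `{f ≠ 0}`, for `f` a homogeneous
polynomial, form a basis of open sets. -/
instance zariskiTopology (σ : Type) : TopologicalSpace (ProjSp σ) :=
  TopologicalSpace.generateFrom
    {U | ∃ (d : ℕ) (f : MvPolynomial σ ℂ), f.IsHomogeneous d ∧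
      U = {p : ProjSp σ | MvPolynomial.eval p.rep f ≠ 0}}

/-- `f` is a regular map (a morphism) on the subset `X` of a projective space: locally on `X`, in
the Zariski topology, it is given by homogeneous polynomials of one common degree without common
zero. -/
def IsRegularOn {σ τ : Type} (f : ProjSp σ → ProjSp τ) (X : Set (ProjSp σ)) : Prop :=
  ∀ x ∈ X, ∃ (d : ℕ) (g : τ → MvPolynomial σ ℂ),
    (∀ j, (g j).IsHomogeneous d) ∧
    (fun j => MvPolynomial.eval x.rep (g j)) ≠ 0 ∧
    ∀ y ∈ X, ∀ h : (fun j => MvPolynomial.eval y.rep (g j)) ≠ 0,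
      f y = Projectivization.mk ℂ (fun j => MvPolynomial.eval y.rep (g j)) h

/-- The map `f`, given on `X`, has a rational inverse: a regular map `g` from a dense open subset
`U` of the target projective space to `X` such that `f` and `g` are inverse to each other between
`U` and the dense open subset `X ∩ f⁻¹(U)` of `X`. -/
def HasRationalInverse {σ τ : Type} (f : ProjSp σ → ProjSp τ) (X : Set (ProjSp σ)) : Prop :=
  ∃ (U : Set (ProjSp τ)) (g : ProjSp τ → ProjSp σ),
    IsOpen U ∧ Dense U ∧ X ⊆ closure (X ∩ f ⁻¹' U) ∧
    IsRegularOn g U ∧ Set.MapsTo g U X ∧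
    (∀ q ∈ U, f (g q) = q) ∧ ∀ x ∈ X, f x ∈ U → g (f x) = x

/-- `X` is a rational quasi-projective variety of dimension `m`: it is locally closed and
irreducible, and a nonempty open subset `X ∩ V` of it is isomorphic to a nonempty open subset `U`
of `ℙᵐ`. -/
def IsRationalVariety {σ : Type} (m : ℕ) (X : Set (ProjSp σ)) : Prop :=
  IsLocallyClosed X ∧ IsIrreducible X ∧
  ∃ (V : Set (ProjSp σ)) (U : Set (ProjSp (Fin (m + 1))))
    (f : ProjSp σ → ProjSp (Fin (m + 1))) (g : ProjSp (Fin (m + 1)) → ProjSp σ),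
    IsOpen V ∧ (X ∩ V).Nonempty ∧ IsOpen U ∧ U.Nonempty ∧
    IsRegularOn f (X ∩ V) ∧ Set.MapsTo f (X ∩ V) U ∧
    IsRegularOn g U ∧ Set.MapsTo g U (X ∩ V) ∧
    (∀ x ∈ X ∩ V, g (f x) = x) ∧ ∀ q ∈ U, f (g q) = q

/-! ### Forms, ideals and zero-dimensional schemes -/

/-- The polynomial ring in `n + 1` variables. It serves both as `R = ℂ[u₀, …, uₙ]` and as
`S = ℂ[x₀, …, xₙ]`. -/
abbrev Poly (n : ℕ) : Type := MvPolynomial (Fin (n + 1)) ℂ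

/-- The exponents of the monomials of degree `d` in `n + 1` variables (a finite type). -/
abbrev Mon (n d : ℕ) : Type :=
  ↥(Finset.finsuppAntidiag (Finset.univ : Finset (Fin (n + 1))) d)

/-- The degree `t` part `I_t` of an ideal. -/
def degPart {n : ℕ} (I : Ideal (Poly n)) (t : ℕ) : Submodule ℂ (Poly n) :=
  I.restrictScalars ℂ ⊓ MvPolynomial.homogeneousSubmodule (Fin (n + 1)) ℂ t

/-- `I` is the saturated homogeneous ideal of a zero-dimensional closed subscheme of length `s` of
`ℙⁿ = Proj R`. Such subschemes correspond one-to-one to their saturated homogeneous ideals, and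
the length is the (constant) Hilbert polynomial of `R / I`. -/
structure IsSchemeIdeal {n : ℕ} (s : ℕ) (I : Ideal (Poly n)) : Prop where
  homogeneous : ∀ f ∈ I, ∀ t, MvPolynomial.homogeneousComponent t f ∈ I
  saturated : ∀ f : Poly n, (∀ i, MvPolynomial.X i * f ∈ I) → f ∈ I
  length : ∀ᶠ t in Filter.atTop,
    Module.finrank ℂ (MvPolynomial.homogeneousSubmodule (Fin (n + 1)) ℂ t) =
      Module.finrank ℂ (degPart I t) + s

/-- The homogeneous ideal of a point of `ℙⁿ`: the polynomials that vanish on the corresponding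
line through the origin. -/
def pointIdeal {n : ℕ} (p : ProjSp (Fin (n + 1))) : Ideal (Poly n) :=
  ⨅ c : ℂ, RingHom.ker (MvPolynomial.eval (c • p.rep))

/-! ### Minimal free resolutions -/

/-- A minimal graded free resolution
`⋯ → ⨁ₖ R(-deg 1 k) → ⨁ₖ R(-deg 0 k) → I → 0`. The differentials are given by the matrices
`d i`, and `gen` lists the generators of `I`. -/
structure MinimalResolution {n : ℕ} (I : Ideal (Poly n)) where
  rank : ℕ → ℕ
  deg : (i : ℕ) → Fin (rank i) → ℕ
  gen : Fin (rank 0) → Poly n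
  d : (i : ℕ) → Matrix (Fin (rank i)) (Fin (rank (i + 1))) (Poly n)
  gen_homogeneous : ∀ k, (gen k).IsHomogeneous (deg 0 k)
  d_homogeneous : ∀ i a b, d i a b = 0 ∨
    ∃ e : ℕ, deg i a + e = deg (i + 1) b ∧ (d i a b).IsHomogeneous e
  minimal : ∀ i a b, MvPolynomial.constantCoeff (d i a b) = 0
  span_gen : Ideal.span (Set.range gen) = I
  exact_zero : ∀ v : Fin (rank 0) → Poly n,
    v ⬝ᵥ gen = 0 ↔ ∃ w, (d 0).mulVec w = v
  exact_succ : ∀ (i : ℕ) (v : Fin (rank (i + 1)) → Poly n),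
    (d i).mulVec v = 0 ↔ ∃ w, (d (i + 1)).mulVec w = v

/-- `β i j` are the graded Betti numbers of `I`: the number of summands `R(-j)` at step `i` of a
minimal graded free resolution of `I`. -/
def HasBettiNumbers {n : ℕ} (I : Ideal (Poly n)) (β : ℕ → ℕ → ℕ) : Prop :=
  ∃ res : MinimalResolution I, ∀ i j,
    Nat.card {k : Fin (res.rank i) // res.deg i k = j} = β i j

/-- `β` are the graded Betti numbers of the ideal of `s` general points of `ℙⁿ`, where general
means: for all `s`-tuples of points in some nonempty Zariski open subset of `(ℙⁿ)ˢ`. -/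
def GeneralPointsHaveBettiNumbers (n s : ℕ) (β : ℕ → ℕ → ℕ) : Prop :=
  ∃ G : MvPolynomial (Fin s × Fin (n + 1)) ℂ, G ≠ 0 ∧
    ∀ (v : Fin s → Fin (n + 1) → ℂ) (hv : ∀ i, v i ≠ 0),
      MvPolynomial.eval (fun q => v q.1 q.2) G ≠ 0 →
        HasBettiNumbers (⨅ i, pointIdeal (Projectivization.mk ℂ (v i) (hv i))) β

/-- The graded Betti numbers of `I` are those of `s` general points. -/
def IsResolutionGeneral {n : ℕ} (s : ℕ) (I : Ideal (Poly n)) : Prop :=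
  ∃ β : ℕ → ℕ → ℕ, HasBettiNumbers I β ∧ GeneralPointsHaveBettiNumbers n s β

/-! ### Apolarity -/

/-- The differential operator `∂^m = ∏ᵢ (∂/∂xᵢ)^(m i)`. -/
def partialOp {n : ℕ} (m : Fin (n + 1) →₀ ℕ) : Module.End ℂ (Poly n) :=
  ((List.finRange (n + 1)).map fun i =>
    ((MvPolynomial.pderiv i).toLinearMap : Module.End ℂ (Poly n)) ^ m i).prod

/-- `φ ∘ F`: the differential operator `φ(∂/∂x₀, …, ∂/∂xₙ)` applied to `F`. -/
def contract {n : ℕ} (φ F : Poly n) : Poly n :=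
  ∑ m ∈ φ.support, MvPolynomial.coeff m φ • partialOp m F

/-- The subscheme with ideal `I` is apolar to `Λ`, that is, `I ⊆ Λ^⊥`. -/
def IsApolar {n : ℕ} (I : Ideal (Poly n)) (Λ : Submodule ℂ (Poly n)) : Prop :=
  ∀ φ ∈ I, ∀ F ∈ Λ, contract φ F = 0

/-- `I` is the ideal of a polar `s`-hedron of `Λ`: a resolution-general zero-dimensional subscheme
of length `s` that is apolar to `Λ`. -/
def IsPolarPolyhedron {n : ℕ} (s : ℕ) (Λ : Submodule ℂ (Poly n)) (I : Ideal (Poly n)) : Prop :=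
  IsSchemeIdeal s I ∧ IsResolutionGeneral s I ∧ IsApolar I Λ

/-- The property `P` holds for a general point of the Grassmannian `G(r, S_d)`: for all
`r`-dimensional spaces of forms of degree `d` in some nonempty Zariski open set, which is given
through the coefficients of bases. -/
def ForGeneralSubspace (n d r : ℕ) (P : Submodule ℂ (Poly n) → Prop) : Prop :=
  ∃ G : MvPolynomial (Fin r × Mon n d) ℂ, G ≠ 0 ∧
    ∀ F : Fin r → Poly n, (∀ i, (F i).IsHomogeneous d) → LinearIndependent ℂ F →
      MvPolynomial.eval (fun q => MvPolynomial.coeff (q.2 : Fin (n + 1) →₀ ℕ) (F q.1)) G ≠ 0 →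
        P (Submodule.span ℂ (Set.range F))

/-! ### The Hilbert scheme of points -/

/-- The Plücker coordinates of `k` forms of degree `d`: all `k × k` minors of the matrix of their
coefficients, indexed by the `k`-tuples of monomials. -/
def pluckerVec {n d k : ℕ} (b : Fin k → Poly n) : (Fin k → Mon n d) → ℂ := fun c =>
  Matrix.det (Matrix.of fun i j => MvPolynomial.coeff (c j : Fin (n + 1) →₀ ℕ) (b i))

/-- `p` is the Plücker point of the `k`-dimensional space `W` of forms of degree `d`. -/
def IsPluckerPoint {n d k : ℕ} (W : Submodule ℂ (Poly n)) (p : ProjSp (Fin k → Mon n d)) : Prop :=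
  ∃ (b : Fin k → Poly n) (h : pluckerVec (d := d) b ≠ 0),
    LinearIndependent ℂ b ∧ Submodule.span ℂ (Set.range b) = W ∧
      p = Projectivization.mk ℂ (pluckerVec b) h

/-- The projective space that contains `Hilb(s, ℙⁿ)`: the Plücker space of the Grassmannian of
subspaces of codimension `s` in the space `R_s` of forms of degree `s`. -/
abbrev HilbSpace (n s : ℕ) : Type :=
  ProjSp (Fin ((n + s).choose n - s) → Mon n s)

/-- `z` is the point of `Hilb(s, ℙⁿ)` that corresponds to the subscheme with ideal `I`. The Gotzmann
number of the constant Hilbert polynomial `s` is `s`, so `Hilb(s, ℙⁿ)` is embedded as a closed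
subset in the Grassmannian by `I ↦ I_s`. -/
def IsHilbPoint {n : ℕ} (s : ℕ) (I : Ideal (Poly n)) (z : HilbSpace n s) : Prop :=
  IsPluckerPoint (degPart I s) z

/-- The family `𝒜(s, Λ) ⊆ Hilb(s, ℙⁿ)` of the polar `s`-hedra of `Λ`. -/
def polarFamily {n : ℕ} (s : ℕ) (Λ : Submodule ℂ (Poly n)) : Set (HilbSpace n s) :=
  {z | ∃ I : Ideal (Poly n), IsPolarPolyhedron s Λ I ∧ IsHilbPoint s I z}

/-- `p` is the associated point of the subscheme `Z ⊆ ℙ²` with ideal `I`: the residual scheme of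
`Z` in the intersection `Γ` of all cubics through `Z` is the (reduced) point `p`. The ideal of the
residual scheme is the colon ideal `I_Γ : I_Z`. -/
def IsAssociatedPoint (I : Ideal (Poly 2)) (p : ProjSp (Fin 3)) : Prop :=
  (Ideal.span (degPart I 3 : Set (Poly 2))).colon (I : Set (Poly 2)) = pointIdeal p

end Apolar

end

/-! Linkage turns octahedra into pencils of cubics. The ideal of eight general points is generated
by the minors of a 3 × 2 matrix with two rows of quadratic forms and one row `l` of linear forms,
that is, by two cubics and a quartic (`HilbertBurch`). The cubics meet in nine points: the scheme Z
and the zero p of `l`, which is the associated point. Linkage is symmetric, so I_Z = (C₁, C₂) : I_p,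
and Z is determined by p and its pencil of cubics (`HilbertBurch.ideal_eq_of_degPart_three_eq`).
Conversely, any two coprime cubics through p arise in this way (`exists_hilbertBurch_of_isFrame`).

It remains to see which pencils of cubics through p give a scheme apolar to Λ. Read the two quartics
as functionals `lam`, `mu` on forms of degree four. The cubics all of whose linear multiples are
killed by both form a space N, cut out by 6 conditions in a space of dimension 10; for general Λ it
has dimension 4, and the subspace N_p of cubics through p has dimension 3. Only the quartic minor is
left. If C_i = x_i l₁ - y_i l₀, the minor x₀y₁ - x₁y₀ is well defined up to linear multiples of the
C_i, which both functionals kill. So `lam` of the minor is an alternating form on the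
three-dimensional N_p. Its radical is a line, and a pencil is isotropic exactly when it contains
this line; the same holds for `mu` (`Transfer.cubic_mem_span_iff`). Where the two radicals differ,
they span the only pencil that works, so exactly one octahedron lies over p.

The radical is given by a formula polynomial in p. Let T be the operator on quadratic forms with
lam(Tq · q') = δ mu(q · q'). A linear form m yields the cubic T(m l₀) l₁ - T(m l₁) l₀, which is
automatically apolar to `lam`; its apolarity to `mu` is governed by an alternating form on the
three-dimensional space of linear forms, and this form again has a radical. Hence the inverse map is
regular on the open set where the radicals differ (`exists_plucker_section`). The associated point
is regular on the whole family, because its coordinates are determinants in sections of the graded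
pieces of the ideal (`isRegularOn_assocPoint`).

Over a point p₀ where the radicals coincide there may be many octahedra, and each must be a limit of
those over good points. Such an octahedron is given by the common radical and a further cubic D'.
This D' moves to a section of the spaces N_p, and the points p where the moved cubic lies in the
plane of both radicals are controlled by a determinant that vanishes at p₀. The determinantal curve
cannot consist of bad points, since no bad point lies on a fixed line, which every plane curve meets
(`GeneralPencil.family_subset_closure`). The family is therefore irreducible, as the closure in it
of an image of an open part of the plane; it is locally closed because it is described by ranks of
matrices of Plücker coordinates (`GeneralPencil.mem_family_iff`).

All genericity conditions say that some system, homogeneous in an auxiliary vector, has no nonzero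
solution, so by `elimination` each holds for general Λ as soon as it holds for one. Two explicit
pencils of sparse quartics suffice, because finitely many nonzero polynomials have a nonzero
product. -/

noncomputable section

namespace Apolar

/-! ### Forms and their coefficients -/

section Forms

open MvPolynomial

/-- The space of forms of degree `d` in `n + 1` variables. -/
abbrev Form (n d : ℕ) : Submodule ℂ (Poly n) := homogeneousSubmodule (Fin (n + 1)) ℂ d

theorem mem_antidiag {σ : Type*} [Fintype σ] [DecidableEq σ] {d : ℕ} {m : σ →₀ ℕ} :
    m ∈ Finset.finsuppAntidiag (Finset.univ : Finset σ) d ↔ m.degree = d := by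
  rw [Finset.mem_finsuppAntidiag, Finsupp.degree_eq_sum]
  exact and_iff_left (Finset.subset_univ _)

theorem mon_degree {n d : ℕ} (m : Mon n d) : (m : Fin (n + 1) →₀ ℕ).degree = d :=
  mem_antidiag.1 m.2

theorem mem_mon {n d : ℕ} {m : Fin (n + 1) →₀ ℕ} (h : m.degree = d) :
    m ∈ Finset.finsuppAntidiag (Finset.univ : Finset (Fin (n + 1))) d :=
  mem_antidiag.2 h

theorem eq_sum_monomial {σ R : Type*} [Fintype σ] [DecidableEq σ] [CommSemiring R] {d : ℕ}
    {f : MvPolynomial σ R} (hf : f.IsHomogeneous d) :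
    f = ∑ m : ↥(Finset.finsuppAntidiag (Finset.univ : Finset σ) d),
      monomial (m : σ →₀ ℕ) (coeff m f) := by
  ext e
  rw [coeff_sum]
  simp only [coeff_monomial]
  by_cases he : e.degree = d
  · rw [Finset.sum_eq_single ⟨e, mem_antidiag.2 he⟩]
    · simp
    · intro b _ hb
      rw [if_neg]
      intro h
      exact hb (Subtype.ext h)
    · simp
  · rw [hf.coeff_eq_zero he, Finset.sum_eq_zero]
    intro m _
    rw [if_neg]
    rintro rfl
    exact he (mem_antidiag.1 m.2)

theorem form_eq_sum {n d : ℕ} {f : Poly n} (hf : f.IsHomogeneous d) :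
    f = ∑ m : Mon n d, monomial (m : Fin (n + 1) →₀ ℕ) (coeff m f) :=
  eq_sum_monomial hf

theorem form_ext {n d : ℕ} {f g : Poly n} (hf : f.IsHomogeneous d) (hg : g.IsHomogeneous d)
    (h : ∀ m : Mon n d, coeff (m : Fin (n + 1) →₀ ℕ) f = coeff (m : Fin (n + 1) →₀ ℕ) g) :
    f = g := by
  rw [form_eq_sum hf, form_eq_sum hg]
  exact Finset.sum_congr rfl fun m _ => by rw [h m]

theorem isHomogeneous_mon {n d : ℕ} (m : Mon n d) (c : ℂ) :
    (monomial (m : Fin (n + 1) →₀ ℕ) c : Poly n).IsHomogeneous d :=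
  isHomogeneous_monomial c (mon_degree m)

/-- The coordinates of a form with respect to the monomials. -/
def formEquiv (n d : ℕ) : Form n d ≃ₗ[ℂ] (Mon n d → ℂ) where
  toFun f m := coeff (m : Fin (n + 1) →₀ ℕ) (f : Poly n)
  map_add' f g := by ext; simp
  map_smul' c f := by ext; simp
  invFun c := ⟨∑ m : Mon n d, monomial (m : Fin (n + 1) →₀ ℕ) (c m),
    Submodule.sum_mem _ fun m _ => isHomogeneous_mon m _⟩
  left_inv f := Subtype.ext (form_eq_sum f.2).symm
  right_inv c := by
    ext m
    simp only [coeff_sum, coeff_monomial]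
    rw [Finset.sum_eq_single m]
    · simp
    · intro b _ hb
      rw [if_neg]
      intro h
      exact hb (Subtype.ext h)
    · simp

instance (n d : ℕ) : FiniteDimensional ℂ (Form n d) :=
  LinearEquiv.finiteDimensional (formEquiv n d).symm

theorem card_mon (n d : ℕ) : Fintype.card (Mon n d) = (n + d).choose n := by
  rw [Fintype.card_coe, Finset.card_finsuppAntidiag_nat_eq_choose]
  simp
  rw [Nat.add_comm]
  exact (Nat.choose_symm_add)

theorem finrank_form (n d : ℕ) : Module.finrank ℂ (Form n d) = (n + d).choose n := by
  rw [(formEquiv n d).finrank_eq, Module.finrank_fintype_fun_eq_card, card_mon]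

/-- Doubling avoids division, so that later dimension counts become polynomial or linear arithmetic.
-/
theorem two_mul_finrank_form_two (d : ℕ) :
    2 * Module.finrank ℂ (Form 2 d) = (d + 2) * (d + 1) := by
  rw [finrank_form, Nat.add_comm 2 d, Nat.choose_two_right, Nat.mul_div_cancel']
  · rfl
  · exact (Nat.even_mul_pred_self (d + 2)).two_dvd

instance (n t : ℕ) (I : Ideal (Poly n)) : FiniteDimensional ℂ (degPart I t) :=
  Submodule.finiteDimensional_of_le (inf_le_right : _ ≤ Form n t)

variable {σ : Type*}

theorem homogeneousComponent_mul_right {d : ℕ} {g : MvPolynomial σ ℂ} (hg : g.IsHomogeneous d)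
    (a : MvPolynomial σ ℂ) (e : ℕ) :
    homogeneousComponent (e + d) (a * g) = homogeneousComponent e a * g := by
  conv_lhs => rw [← sum_homogeneousComponent a, Finset.sum_mul, map_sum]
  have : ∀ i, homogeneousComponent (e + d) (homogeneousComponent i a * g)
      = if i = e then homogeneousComponent e a * g else 0 := by
    intro i
    have h1 : homogeneousComponent i a * g ∈ homogeneousSubmodule σ ℂ (i + d) :=
      (homogeneousComponent_isHomogeneous i a).mul hg
    rw [homogeneousComponent_of_mem h1]
    by_cases h : i = e
    · subst h; simp
    · rw [if_neg (by omega), if_neg h]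
  simp only [this, Finset.sum_ite_eq', Finset.mem_range]
  split_ifs with h
  · rfl
  · rw [homogeneousComponent_eq_zero _ _ (by omega), zero_mul]

theorem homogeneousComponent_mul_right_of_lt {d t : ℕ} {g : MvPolynomial σ ℂ}
    (hg : g.IsHomogeneous d) (a : MvPolynomial σ ℂ) (h : t < d) :
    homogeneousComponent t (a * g) = 0 := by
  rw [← sum_homogeneousComponent a, Finset.sum_mul, map_sum]
  refine Finset.sum_eq_zero fun i _ => ?_
  have h1 : homogeneousComponent i a * g ∈ homogeneousSubmodule σ ℂ (i + d) :=
    (homogeneousComponent_isHomogeneous i a).mul hg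
  rw [homogeneousComponent_of_mem h1, if_neg (by omega)]

/-- The component of degree `t - d`, which is zero for `t < d`. -/
def shiftComponent (t d : ℕ) (a : MvPolynomial σ ℂ) : MvPolynomial σ ℂ :=
  if d ≤ t then homogeneousComponent (t - d) a else 0

theorem homogeneousComponent_mul {d t : ℕ} {g : MvPolynomial σ ℂ} (hg : g.IsHomogeneous d)
    (a : MvPolynomial σ ℂ) : homogeneousComponent t (a * g) = shiftComponent t d a * g := by
  unfold shiftComponent
  split_ifs with h
  · obtain ⟨e, rfl⟩ := Nat.exists_eq_add_of_le' h
    rw [homogeneousComponent_mul_right hg, Nat.add_sub_cancel]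
  · rw [homogeneousComponent_mul_right_of_lt hg _ (by omega), zero_mul]

/-- An ideal that is generated by forms is homogeneous. -/
theorem homogeneousComponent_mem_span {ι : Type*} [Finite ι] {g : ι → MvPolynomial σ ℂ} {d : ι → ℕ}
    (hg : ∀ i, (g i).IsHomogeneous (d i)) {f : MvPolynomial σ ℂ}
    (hf : f ∈ Ideal.span (Set.range g)) (t : ℕ) :
    homogeneousComponent t f ∈ Ideal.span (Set.range g) := by
  cases nonempty_fintype ι
  obtain ⟨c, rfl⟩ := (Ideal.mem_span_range_iff_exists_fun).1 hf
  rw [map_sum]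
  refine Ideal.sum_mem _ fun i _ => ?_
  rw [homogeneousComponent_mul (hg i)]
  exact Ideal.mul_mem_left _ _ (Ideal.subset_span ⟨i, rfl⟩)

theorem isHomogeneous_zero_exists {f : MvPolynomial σ ℂ} (hf : f.IsHomogeneous 0) :
    ∃ c, f = C c := by
  refine ⟨coeff 0 f, ?_⟩
  rw [← homogeneousComponent_zero, homogeneousComponent_eq_self hf]

theorem constantCoeff_of_isHomogeneous {f : MvPolynomial σ ℂ} {d : ℕ} (hf : f.IsHomogeneous d)
    (hd : d ≠ 0) : constantCoeff f = 0 := by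
  rw [constantCoeff_eq]
  exact hf.coeff_eq_zero (by simpa using hd.symm)

theorem eval_smul_of_isHomogeneous {f : MvPolynomial σ ℂ} {d : ℕ} (hf : f.IsHomogeneous d)
    (c : ℂ) (x : σ → ℂ) : eval (c • x) f = c ^ d * eval x f := by
  rw [eval_eq, eval_eq, Finset.mul_sum]
  refine Finset.sum_congr rfl fun m hm => ?_
  have : m.degree = d := by
    by_contra h
    exact (mem_support_iff.1 hm) (hf.coeff_eq_zero h)
  simp only [Pi.smul_apply, smul_eq_mul, mul_pow, Finset.prod_mul_distrib]
  rw [Finset.prod_pow_eq_pow_sum, ← this, Finsupp.degree_apply]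
  ring

end Forms

/-! ### Polynomial functions that are homogeneous in a group of variables -/

section BiHom

open MvPolynomial

variable {κ σ : Type*}

/-- `φ a y` is a polynomial in `a` and `y` that is homogeneous of degree `d` in `y`. -/
def BiHom (d : ℕ) (φ : (κ → ℂ) → (σ → ℂ) → ℂ) : Prop :=
  ∃ P : MvPolynomial σ (MvPolynomial κ ℂ), P.IsHomogeneous d ∧
    ∀ a y, φ a y = eval y (map (eval a) P)

/-- `φ` is given by a homogeneous polynomial of degree `d`. -/
def HomFun (d : ℕ) (φ : (σ → ℂ) → ℂ) : Prop :=
  ∃ P : MvPolynomial σ ℂ, P.IsHomogeneous d ∧ ∀ y, φ y = eval y P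

theorem BiHom.homFun {d : ℕ} {φ : (κ → ℂ) → (σ → ℂ) → ℂ} (h : BiHom d φ) (a : κ → ℂ) :
    HomFun d (φ a) := by
  obtain ⟨P, hP, h⟩ := h
  exact ⟨map (eval a) P, hP.map _, fun y => h a y⟩

theorem HomFun.biHom {d : ℕ} {φ : (σ → ℂ) → ℂ} (h : HomFun d φ) :
    BiHom d (fun (_ : κ → ℂ) y => φ y) := by
  obtain ⟨P, hP, h⟩ := h
  refine ⟨map C P, hP.map _, fun a y => ?_⟩
  change φ y = _
  rw [map_map, h]
  congr 1
  have : (eval a).comp (C : ℂ →+* MvPolynomial κ ℂ) = RingHom.id ℂ := by ext; simp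
  rw [this, map_id]

theorem biHom_param (i : κ) : BiHom 0 (fun a (_ : σ → ℂ) => a i) :=
  ⟨C (X i), isHomogeneous_C _ _, fun a y => by simp⟩

theorem biHom_const (c : ℂ) : BiHom 0 (fun (_ : κ → ℂ) (_ : σ → ℂ) => c) :=
  ⟨C (C c), isHomogeneous_C _ _, fun a y => by simp⟩

theorem biHom_zero (d : ℕ) : BiHom d (fun (_ : κ → ℂ) (_ : σ → ℂ) => 0) :=
  ⟨0, isHomogeneous_zero _ _ _, fun a y => by simp⟩

theorem biHom_coord (i : σ) : BiHom 1 (fun (_ : κ → ℂ) y => y i) :=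
  ⟨X i, isHomogeneous_X _ _, fun a y => by simp⟩

namespace BiHom

variable {d e : ℕ} {φ ψ : (κ → ℂ) → (σ → ℂ) → ℂ}

theorem add (h : BiHom d φ) (h' : BiHom d ψ) : BiHom d (fun a y => φ a y + ψ a y) := by
  obtain ⟨P, hP, h⟩ := h
  obtain ⟨Q, hQ, h'⟩ := h'
  exact ⟨P + Q, hP.add hQ, fun a y => by simp [h, h']⟩

theorem mul (h : BiHom d φ) (h' : BiHom e ψ) : BiHom (d + e) (fun a y => φ a y * ψ a y) := by
  obtain ⟨P, hP, h⟩ := h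
  obtain ⟨Q, hQ, h'⟩ := h'
  exact ⟨P * Q, hP.mul hQ, fun a y => by simp [h, h']⟩

theorem cast (h : BiHom d φ) (hd : d = e) : BiHom e φ := hd ▸ h

theorem const_mul (c : ℂ) (h : BiHom d φ) : BiHom d (fun a y => c * φ a y) :=
  ((biHom_const c).mul h).cast (zero_add d)

theorem neg (h : BiHom d φ) : BiHom d (fun a y => -φ a y) := by
  simpa using h.const_mul (-1)

theorem sub (h : BiHom d φ) (h' : BiHom d ψ) : BiHom d (fun a y => φ a y - ψ a y) := by
  simpa only [sub_eq_add_neg] using h.add h'.neg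

theorem pow (h : BiHom d φ) (n : ℕ) : BiHom (n * d) (fun a y => φ a y ^ n) := by
  obtain ⟨P, hP, h⟩ := h
  exact ⟨P ^ n, Nat.mul_comm d n ▸ hP.pow n, fun a y => by simp [h]⟩

theorem sum {ι : Type*} (s : Finset ι) {f : ι → (κ → ℂ) → (σ → ℂ) → ℂ}
    (h : ∀ i ∈ s, BiHom d (f i)) : BiHom d (fun a y => ∑ i ∈ s, f i a y) := by
  classical
  induction s using Finset.induction_on with
  | empty => simpa using biHom_zero d
  | insert i s hi ih =>
    simp only [Finset.sum_insert hi]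
    exact (h i (Finset.mem_insert_self _ _)).add
      (ih fun j hj => h j (Finset.mem_insert_of_mem hj))

theorem prod {ι : Type*} (s : Finset ι) {f : ι → (κ → ℂ) → (σ → ℂ) → ℂ} {r : ι → ℕ}
    (h : ∀ i ∈ s, BiHom (r i) (f i)) : BiHom (∑ i ∈ s, r i) (fun a y => ∏ i ∈ s, f i a y) := by
  classical
  induction s using Finset.induction_on with
  | empty => simpa using biHom_const 1
  | insert i s hi ih =>
    simp only [Finset.sum_insert hi, Finset.prod_insert hi]
    exact (h i (Finset.mem_insert_self _ _)).mul
      (ih fun j hj => h j (Finset.mem_insert_of_mem hj))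

/-- The degree may vary with the row, since each Leibniz term takes exactly one entry from every
row. -/
theorem det {ι : Type*} [Fintype ι] [DecidableEq ι] {M : (κ → ℂ) → (σ → ℂ) → Matrix ι ι ℂ}
    {r : ι → ℕ} (h : ∀ i j, BiHom (r i) (fun a y => M a y i j)) :
    BiHom (∑ i, r i) (fun a y => (M a y).det) := by
  have h1 : ∀ a y, (M a y).det
      = ∑ s : Equiv.Perm ι, ((Equiv.Perm.sign s : ℤ) : ℂ) * ∏ i, M a y i (s i) := by
    intro a y
    rw [← Matrix.det_transpose, Matrix.det_apply']
    rfl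
  simp only [h1]
  exact BiHom.sum _ fun s _ => (BiHom.prod _ fun i _ => h i (s i)).const_mul _

theorem matrix_mul {ι ι' ι'' : Type*} [Fintype ι'] {M : (κ → ℂ) → (σ → ℂ) → Matrix ι ι' ℂ}
    {N : (κ → ℂ) → (σ → ℂ) → Matrix ι' ι'' ℂ} (i : ι) (k : ι'')
    (h : ∀ j, BiHom d (fun a y => M a y i j)) (h' : ∀ j, BiHom e (fun a y => N a y j k)) :
    BiHom (d + e) (fun a y => (M a y * N a y) i k) := by
  simp only [Matrix.mul_apply]
  exact BiHom.sum _ fun j _ => (h j).mul (h' j)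

end BiHom

/-- The calculus of `HomFun` is that of `BiHom` with an empty set of parameters. -/
theorem homFun_const (c : ℂ) : HomFun 0 (fun _ : σ → ℂ => c) :=
  (biHom_const (κ := Empty) c).homFun Empty.elim

theorem homFun_zero (d : ℕ) : HomFun d (fun _ : σ → ℂ => 0) :=
  (biHom_zero (κ := Empty) d).homFun Empty.elim

theorem homFun_coord (i : σ) : HomFun 1 (fun y => y i) :=
  (biHom_coord (κ := Empty) i).homFun Empty.elim

namespace HomFun

variable {d e : ℕ} {φ ψ : (σ → ℂ) → ℂ}

theorem add (h : HomFun d φ) (h' : HomFun d ψ) : HomFun d (fun y => φ y + ψ y) :=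
  ((h.biHom (κ := Empty)).add h'.biHom).homFun Empty.elim

theorem sub (h : HomFun d φ) (h' : HomFun d ψ) : HomFun d (fun y => φ y - ψ y) :=
  ((h.biHom (κ := Empty)).sub h'.biHom).homFun Empty.elim

theorem mul (h : HomFun d φ) (h' : HomFun e ψ) : HomFun (d + e) (fun y => φ y * ψ y) :=
  ((h.biHom (κ := Empty)).mul h'.biHom).homFun Empty.elim

theorem const_mul (c : ℂ) (h : HomFun d φ) : HomFun d (fun y => c * φ y) :=
  ((h.biHom (κ := Empty)).const_mul c).homFun Empty.elim

theorem pow (h : HomFun d φ) (n : ℕ) : HomFun (n * d) (fun y => φ y ^ n) :=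
  ((h.biHom (κ := Empty)).pow n).homFun Empty.elim

theorem cast (h : HomFun d φ) (hd : d = e) : HomFun e φ := hd ▸ h

theorem sum {ι : Type*} (s : Finset ι) {f : ι → (σ → ℂ) → ℂ} (h : ∀ i ∈ s, HomFun d (f i)) :
    HomFun d (fun y => ∑ i ∈ s, f i y) :=
  (BiHom.sum (κ := Empty) s fun i hi => (h i hi).biHom).homFun Empty.elim

theorem det {ι : Type*} [Fintype ι] [DecidableEq ι] {M : (σ → ℂ) → Matrix ι ι ℂ}
    {r : ι → ℕ} (h : ∀ i j, HomFun (r i) (fun y => M y i j)) :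
    HomFun (∑ i, r i) (fun y => (M y).det) :=
  (BiHom.det (κ := Empty) (M := fun _ => M) fun i j => (h i j).biHom).homFun Empty.elim

theorem smul_apply (h : HomFun d φ) (c : ℂ) (y : σ → ℂ) : φ (c • y) = c ^ d * φ y := by
  obtain ⟨P, hP, h⟩ := h
  rw [h, h, eval_smul_of_isHomogeneous hP]

end HomFun

end BiHom

/-! ### Ranks of matrices -/

section Rank

variable {m n : Type*} [Fintype m] [Fintype n]

theorem exists_mul_mul_eq_one (M : Matrix m n ℂ) {r : ℕ} (h : r ≤ M.rank) :
    ∃ (A : Matrix (Fin r) m ℂ) (B : Matrix n (Fin r) ℂ), A * M * B = 1 := by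
  classical
  obtain ⟨v, hv⟩ := exists_linearIndependent_of_le_finrank (R := ℂ)
    (M := LinearMap.range M.mulVecLin) h
  choose b hb using fun i => (v i).2
  have hli : LinearIndependent ℂ fun i => M.mulVecLin (b i) := by
    simp only [hb]
    exact hv.map' (Submodule.subtype _) (Submodule.ker_subtype _)
  set g : (Fin r → ℂ) →ₗ[ℂ] (n → ℂ) := Fintype.linearCombination ℂ b
  have hfg : LinearMap.ker (M.mulVecLin ∘ₗ g) = ⊥ := by
    rw [LinearMap.ker_eq_bot']
    intro c hc
    have : ∑ i, c i • M.mulVecLin (b i) = 0 := by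
      simpa [g, Fintype.linearCombination_apply] using hc
    exact funext (Fintype.linearIndependent_iff.1 hli c this)
  obtain ⟨k, hk⟩ := LinearMap.exists_leftInverse_of_injective _ hfg
  refine ⟨LinearMap.toMatrix' k, LinearMap.toMatrix' g, ?_⟩
  have : M = LinearMap.toMatrix' M.mulVecLin := (LinearMap.toMatrix'_toLin' M).symm
  rw [this, Matrix.mul_assoc, ← LinearMap.toMatrix'_comp, ← LinearMap.toMatrix'_comp, hk,
    LinearMap.toMatrix'_id]

theorem le_rank_of_det_ne_zero {M : Matrix m n ℂ} {r : ℕ} {A : Matrix (Fin r) m ℂ}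
    {B : Matrix n (Fin r) ℂ} (h : (A * M * B).det ≠ 0) : r ≤ M.rank := by
  have h1 : (A * M * B).rank = r := by
    rw [Matrix.rank_of_isUnit _ ((Matrix.isUnit_iff_isUnit_det _).2 (isUnit_iff_ne_zero.2 h)),
      Fintype.card_fin]
  calc r = (A * M * B).rank := h1.symm
    _ ≤ (A * M).rank := Matrix.rank_mul_le_left _ _
    _ ≤ M.rank := Matrix.rank_mul_le_right _ _

/-- Constant matrices `A`, `B` play the role of a choice of minor: for fixed `A` and `B` the
condition is the nonvanishing of one polynomial in the entries of `M`, which is what semicontinuity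
arguments need. -/
theorem le_rank_iff (M : Matrix m n ℂ) (r : ℕ) :
    r ≤ M.rank ↔ ∃ (A : Matrix (Fin r) m ℂ) (B : Matrix n (Fin r) ℂ), (A * M * B).det ≠ 0 := by
  refine ⟨fun h => ?_, fun ⟨A, B, h⟩ => le_rank_of_det_ne_zero h⟩
  obtain ⟨A, B, h⟩ := exists_mul_mul_eq_one M h
  exact ⟨A, B, by simp [h]⟩

theorem rank_add_finrank_ker {l n : Type*} [Fintype n] (M : Matrix l n ℂ) :
    M.rank + Module.finrank ℂ (LinearMap.ker M.mulVecLin) = Fintype.card n := by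
  rw [Matrix.rank, LinearMap.finrank_range_add_finrank_ker, Module.finrank_fintype_fun_eq_card]

/-- If `M` has constant rank on `X`, then every vector in the kernel of `M x₀` extends to a
polynomial section of the kernels of `M x` for `x ∈ X`. -/
theorem exists_kernel_section {σ : Type*} {X : Set (σ → ℂ)} {M : (σ → ℂ) → Matrix m n ℂ} {d r : ℕ}
    (hM : ∀ i j, HomFun d fun x => M x i j) (hr : ∀ x ∈ X, (M x).rank = r) {x₀ : σ → ℂ}
    (hx₀ : x₀ ∈ X) {v₀ : n → ℂ} (hv₀ : (M x₀).mulVec v₀ = 0) :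
    ∃ (e : ℕ) (v : (σ → ℂ) → n → ℂ), (∀ j, HomFun e fun x => v x j) ∧
      (∀ x ∈ X, (M x).mulVec (v x) = 0) ∧ ∃ c : ℂ, c ≠ 0 ∧ v x₀ = c • v₀ := by
  obtain ⟨A, B, hAB⟩ := exists_mul_mul_eq_one (M x₀) (hr x₀ hx₀).ge
  set D : (σ → ℂ) → Matrix (Fin r) (Fin r) ℂ := fun x => A * M x * B with hD
  -- Cramer's rule: when D = AMB is invertible, det D · v₀ - B adj(D) A M v₀ is the multiple of the
  -- correction of v₀ inside the image of B that AM kills. It equals v₀ at `x₀`, where D = 1 and M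
  -- v₀ = 0.
  set w : (σ → ℂ) → n → ℂ := fun x =>
    (D x).det • v₀ - B.mulVec (Matrix.cramer (D x) ((A * M x).mulVec v₀)) with hw
  have hAM : ∀ i j, HomFun d fun x => (A * M x) i j := by
    intro i j
    simp only [Matrix.mul_apply]
    exact HomFun.sum _ fun k _ => (hM k j).const_mul _
  have hDh : ∀ i j, HomFun d fun x => D x i j := by
    intro i j
    simp only [hD]
    simp only [Matrix.mul_apply (M := A * M _)]
    refine HomFun.sum _ fun k _ => ?_
    simpa only [mul_comm] using (hAM i k).const_mul (B k j)
  have hdet : HomFun (r * d) fun x => (D x).det := by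
    have := HomFun.det (M := D) (r := fun _ => d) hDh
    simpa using this
  have hcr : ∀ i, HomFun (r * d) fun x => Matrix.cramer (D x) ((A * M x).mulVec v₀) i := by
    intro i
    simp only [Matrix.cramer_apply]
    have := HomFun.det (M := fun x => (D x).updateCol i ((A * M x).mulVec v₀)) (r := fun _ => d)
      (by
        intro k l
        by_cases h : l = i
        · subst h
          simp only [Matrix.updateCol_self, Matrix.mulVec, dotProduct]
          refine HomFun.sum _ fun j _ => ?_
          simpa only [mul_comm] using (hAM k j).const_mul (v₀ j)
        · simp only [Matrix.updateCol_ne h]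
          exact hDh k l)
    simpa using this
  have hwh : ∀ j, HomFun (r * d) fun x => w x j := by
    intro j
    simp only [hw, Pi.sub_apply, Pi.smul_apply, smul_eq_mul, Matrix.mulVec, dotProduct]
    refine HomFun.sub ?_ (HomFun.sum _ fun k _ => (hcr k).const_mul _)
    simpa only [mul_comm] using hdet.const_mul (v₀ j)
  have hker : ∀ x, (A * M x).mulVec (w x) = 0 := by
    intro x
    simp only [hw, Matrix.mulVec_sub, Matrix.mulVec_smul]
    rw [Matrix.mulVec_mulVec, show A * M x * B = D x from rfl, Matrix.mulVec_cramer, sub_self]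
  -- The kernels of AM and M agree only where AM still has rank r. The extra factor det D makes the
  -- section zero wherever this is not guaranteed.
  refine ⟨r * d + r * d, fun x => (D x).det • w x, fun j => ?_, fun x hx => ?_, 1, one_ne_zero, ?_⟩
  · simp only [Pi.smul_apply, smul_eq_mul]
    exact hdet.mul (hwh j)
  · by_cases h : (D x).det = 0
    · simp [h]
    · rw [Matrix.mulVec_smul]
      have h1 : r ≤ (A * M x).rank := by
        refine le_rank_of_det_ne_zero (A := (1 : Matrix (Fin r) (Fin r) ℂ)) (B := B) ?_
        rwa [Matrix.one_mul]
      have h2 : LinearMap.ker (M x).mulVecLin ≤ LinearMap.ker (A * M x).mulVecLin := by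
        intro v hv
        rw [LinearMap.mem_ker, Matrix.mulVecLin_apply] at hv ⊢
        rw [← Matrix.mulVec_mulVec, hv, Matrix.mulVec_zero]
      have h3 : LinearMap.ker (M x).mulVecLin = LinearMap.ker (A * M x).mulVecLin := by
        apply Submodule.eq_of_le_of_finrank_le h2
        have h4 := rank_add_finrank_ker (M x)
        have h5 := rank_add_finrank_ker (A * M x)
        have h6 := hr x hx
        omega
      have h4 : w x ∈ LinearMap.ker (M x).mulVecLin := by
        rw [h3, LinearMap.mem_ker]
        exact hker x
      rw [LinearMap.mem_ker, Matrix.mulVecLin_apply] at h4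
      rw [h4, smul_zero]
  · simp only [hw, hD, hAB, ← Matrix.mulVec_mulVec, hv₀]
    simp

end Rank

/-! ### Elimination -/

section Elimination

open MvPolynomial

variable {κ σ : Type*} [Fintype σ]

/-- Main theorem of elimination theory: if equations that are homogeneous in `y` have no common
nonzero solution `y` for one value of the parameter `a`, then the same holds for general `a`. -/
theorem elimination {J : Type*} {d : J → ℕ} {f : J → (κ → ℂ) → (σ → ℂ) → ℂ}
    (hf : ∀ j, BiHom (d j) (f j)) (a₀ : κ → ℂ) (h₀ : ∀ y, y ≠ 0 → ∃ j, f j a₀ y ≠ 0) :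
    ∃ G : MvPolynomial κ ℂ, eval a₀ G ≠ 0 ∧
      ∀ a, eval a G ≠ 0 → ∀ y, y ≠ 0 → ∃ j, f j a y ≠ 0 := by
  classical
  choose P hP hfP using hf
  set p : J → MvPolynomial σ ℂ := fun j => map (eval a₀) (P j) with hp
  -- Nullstellensatz: the origin is the only possible common zero at `a₀`, so each variable has a
  -- power in the ideal.
  have hrad : ∀ i : σ, X i ∈ (Ideal.span (Set.range p)).radical := by
    intro i
    rw [← vanishingIdeal_zeroLocus_eq_radical (K := ℂ), mem_vanishingIdeal_iff]
    intro y hy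
    rw [zeroLocus_span] at hy
    have : y = 0 := by
      by_contra hne
      obtain ⟨j, hj⟩ := h₀ y hne
      refine hj ?_
      rw [hfP]
      have := hy (p j) ⟨j, rfl⟩
      simpa [hp, aeval_eq_eval] using this
    simp [this]
  choose N₀ hN₀ using hrad
  set N := (∑ i, N₀ i) + 1 with hN
  have hXN : ∀ i, (X i : MvPolynomial σ ℂ) ^ N ∈ Ideal.span (Set.range p) := by
    intro i
    refine Ideal.pow_mem_of_pow_mem _ (hN₀ i) ?_
    have := Finset.single_le_sum (f := N₀) (fun j _ => Nat.zero_le _) (Finset.mem_univ i)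
    omega
  set D := Fintype.card σ * N with hD
  -- Pigeonhole: a monomial in |σ| variables of degree |σ| · N has some exponent at least N, so it
  -- is a multiple of some X_i ^ N.
  have hmon : ∀ m : ↥(Finset.finsuppAntidiag (Finset.univ : Finset σ) D), Nonempty σ →
      monomial (m : σ →₀ ℕ) (1 : ℂ) ∈ Ideal.span (Set.range p) := by
    intro m hσ
    have hm : ∑ i, (m : σ →₀ ℕ) i = D := (Finset.mem_finsuppAntidiag.1 m.2).1
    obtain ⟨i, hi⟩ : ∃ i, N ≤ (m : σ →₀ ℕ) i := by
      by_contra hcon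
      push Not at hcon
      have : ∑ i, (m : σ →₀ ℕ) i < ∑ _i : σ, N :=
        Finset.sum_lt_sum_of_nonempty Finset.univ_nonempty fun i _ => hcon i
      simp [hm, hD] at this
    have : (monomial (m : σ →₀ ℕ) (1 : ℂ)) =
        monomial ((m : σ →₀ ℕ) - Finsupp.single i N) 1 * X i ^ N := by
      rw [X_pow_eq_monomial, monomial_mul, one_mul, tsub_add_cancel_of_le]
      simpa using hi
    rw [this]
    exact Ideal.mul_mem_left _ _ (hXN i)
  by_cases hσ : Nonempty σ
  swap
  · refine ⟨1, by simp, fun a _ y hy => (hy ?_).elim⟩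
    rw [not_nonempty_iff] at hσ
    exact Subsingleton.elim _ _
  have hc : ∀ m : ↥(Finset.finsuppAntidiag (Finset.univ : Finset σ) D),
      ∃ c : J →₀ MvPolynomial σ ℂ, (c.sum fun j b => b * p j) = monomial (m : σ →₀ ℕ) (1 : ℂ) :=
    fun m => by
      have := (Finsupp.mem_ideal_span_range_iff_exists_finsupp).1 (hmon m hσ)
      simpa using this
  choose c hc using hc
  -- Each monomial of degree D is a combination of the equations at `a₀`. Keeping the multipliers
  -- and letting the equations vary with the parameter deforms this monomial; the coefficient matrix
  -- Γ of the deformed forms is the identity at `a₀`, and its determinant is the polynomial sought.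
  set row : ↥(Finset.finsuppAntidiag (Finset.univ : Finset σ) D) →
      MvPolynomial σ (MvPolynomial κ ℂ) := fun m =>
    ∑ j ∈ (c m).support, map C (shiftComponent D (d j) (c m j)) * P j with hrow
  have hrow_hom : ∀ m, (row m).IsHomogeneous D := by
    intro m
    refine IsHomogeneous.sum _ _ _ fun j _ => ?_
    unfold shiftComponent
    split_ifs with h
    · have := ((homogeneousComponent_isHomogeneous (D - d j) (c m j)).map
        (C : ℂ →+* MvPolynomial κ ℂ)).mul (hP j)
      rwa [Nat.sub_add_cancel h] at this
    · simpa using isHomogeneous_zero _ _ _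
  have hrow_eval : ∀ m a, map (eval a) (row m)
      = ∑ j ∈ (c m).support, shiftComponent D (d j) (c m j) * map (eval a) (P j) := by
    intro m a
    have h1 : (eval a).comp (C : ℂ →+* MvPolynomial κ ℂ) = RingHom.id ℂ := by ext; simp
    simp only [hrow, map_sum, map_mul, map_map, h1, map_id]
  set Γ : Matrix ↥(Finset.finsuppAntidiag (Finset.univ : Finset σ) D)
      ↥(Finset.finsuppAntidiag (Finset.univ : Finset σ) D) (MvPolynomial κ ℂ) :=
    Matrix.of fun m m' => coeff (m' : σ →₀ ℕ) (row m) with hΓ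
  refine ⟨Γ.det, ?_, fun a ha y hy => ?_⟩
  · have h1 : (eval a₀).mapMatrix Γ = 1 := by
      ext m m'
      rw [RingHom.mapMatrix_apply, Matrix.map_apply, hΓ, Matrix.of_apply, ← coeff_map, hrow_eval]
      have h2 : ∑ j ∈ (c m).support, shiftComponent D (d j) (c m j) * map (eval a₀) (P j)
          = monomial (m : σ →₀ ℕ) (1 : ℂ) := by
        have h3 : homogeneousComponent D (monomial (m : σ →₀ ℕ) (1 : ℂ))
            = monomial (m : σ →₀ ℕ) (1 : ℂ) :=
          homogeneousComponent_eq_self (isHomogeneous_monomial _ (mem_antidiag.1 m.2))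
        rw [← h3, ← hc m, Finsupp.sum, map_sum]
        exact Finset.sum_congr rfl fun j _ => (homogeneousComponent_mul ((hP j).map _) _).symm
      rw [h2, coeff_monomial, Matrix.one_apply]
      exact if_congr Subtype.ext_iff.symm rfl rfl
    rw [RingHom.map_det, h1, Matrix.det_one]
    exact one_ne_zero
  · by_contra hcon
    push Not at hcon
    -- At a common zero y all deformed forms vanish, so Γ kills the vector of monomials in y. If Γ
    -- is invertible, the pure powers y_i ^ D vanish, hence y = 0.
    have h1 : ((eval a).mapMatrix Γ).mulVec
        (fun m => ∏ i, y i ^ (m : σ →₀ ℕ) i) = 0 := by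
      ext m
      have h2 : eval y (map (eval a) (row m)) = 0 := by
        rw [hrow_eval, map_sum]
        refine Finset.sum_eq_zero fun j _ => ?_
        rw [map_mul, ← hfP, hcon j, mul_zero]
      rw [eq_sum_monomial ((hrow_hom m).map _), map_sum] at h2
      simp only [Matrix.mulVec, dotProduct, Pi.zero_apply]
      rw [← h2]
      refine Finset.sum_congr rfl fun m' _ => ?_
      rw [eval_monomial, coeff_map, Finsupp.prod_fintype _ _ (by simp)]
      rfl
    have h2 : ((eval a).mapMatrix Γ).det ≠ 0 := by rwa [← RingHom.map_det]
    have h3 := Matrix.eq_zero_of_mulVec_eq_zero h2 h1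
    refine hy (funext fun i => ?_)
    have h4 := congrFun h3 ⟨Finsupp.single i D, mem_antidiag.2 (by simp)⟩
    simp only [Pi.zero_apply] at h4
    rw [Finset.prod_eq_single i] at h4
    · simpa using eq_zero_of_pow_eq_zero h4
    · intro j _ hj
      rw [Finsupp.single_eq_of_ne hj, pow_zero]
    · simp

end Elimination

/-! ### The Zariski topology on projective space -/

section Zariski

open MvPolynomial Topology

variable {σ τ : Type}

/-- `rep` is an arbitrary representative; for a homogeneous function any other one detects vanishing
equally well. -/
theorem HomFun.ne_zero_congr {d : ℕ} {φ : (σ → ℂ) → ℂ} (h : HomFun d φ) {v : σ → ℂ} (hv : v ≠ 0) :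
    φ (Projectivization.mk ℂ v hv).rep ≠ 0 ↔ φ v ≠ 0 := by
  obtain ⟨a, ha⟩ := Projectivization.exists_smul_eq_mk_rep ℂ v hv
  rw [← ha, Units.smul_def, h.smul_apply]
  simp

theorem isOpen_ne_zero {d : ℕ} {φ : (σ → ℂ) → ℂ} (h : HomFun d φ) :
    IsOpen {p : ProjSp σ | φ p.rep ≠ 0} := by
  obtain ⟨P, hP, h⟩ := h
  refine TopologicalSpace.isOpen_generateFrom_of_mem ⟨d, P, hP, ?_⟩
  simp only [h]

theorem isClosed_eq_zero {d : ℕ} {φ : (σ → ℂ) → ℂ} (h : HomFun d φ) :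
    IsClosed {p : ProjSp σ | φ p.rep = 0} := by
  rw [← isOpen_compl_iff]
  exact isOpen_ne_zero h

theorem isTopologicalBasis_ne_zero (σ : Type) : TopologicalSpace.IsTopologicalBasis
    {U : Set (ProjSp σ) | ∃ (d : ℕ) (φ : (σ → ℂ) → ℂ), HomFun d φ ∧ U = {p | φ p.rep ≠ 0}} := by
  constructor
  · rintro _ ⟨d, φ, hφ, rfl⟩ _ ⟨e, ψ, hψ, rfl⟩ x hx
    refine ⟨_, ⟨d + e, _, hφ.mul hψ, rfl⟩, ?_, ?_⟩
    · exact mul_ne_zero hx.1 hx.2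
    · intro y hy
      exact ⟨left_ne_zero_of_mul hy, right_ne_zero_of_mul hy⟩
  · refine Set.eq_univ_of_forall fun x => ?_
    exact Set.mem_sUnion.2 ⟨_, ⟨0, _, homFun_const 1, rfl⟩, one_ne_zero⟩
  · apply congrArg TopologicalSpace.generateFrom
    ext U
    constructor
    · rintro ⟨d, f, hf, rfl⟩
      exact ⟨d, fun y => eval y f, ⟨f, hf, fun _ => rfl⟩, rfl⟩
    · rintro ⟨d, φ, ⟨f, hf, h⟩, rfl⟩
      exact ⟨d, f, hf, by simp only [h]⟩

theorem mem_closure_iff_homFun {X : Set (ProjSp σ)} {x : ProjSp σ} :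
    x ∈ closure X ↔ ∀ (d : ℕ) (φ : (σ → ℂ) → ℂ), HomFun d φ → φ x.rep ≠ 0 →
      ∃ y ∈ X, φ y.rep ≠ 0 := by
  rw [(isTopologicalBasis_ne_zero σ).mem_closure_iff]
  constructor
  · intro h d φ hφ hx
    obtain ⟨y, hy, hyX⟩ := h _ ⟨d, φ, hφ, rfl⟩ hx
    exact ⟨y, hyX, hy⟩
  · rintro h _ ⟨d, φ, hφ, rfl⟩ hx
    obtain ⟨y, hyX, hy⟩ := h d φ hφ hx
    exact ⟨y, hy, hyX⟩

theorem exists_homFun_of_isOpen {U : Set (ProjSp σ)} (hU : IsOpen U) {x : ProjSp σ} (hx : x ∈ U) :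
    ∃ (d : ℕ) (φ : (σ → ℂ) → ℂ), HomFun d φ ∧ φ x.rep ≠ 0 ∧ ∀ y, φ y.rep ≠ 0 → y ∈ U := by
  obtain ⟨_, ⟨d, φ, hφ, rfl⟩, hxφ, hsub⟩ :=
    (isTopologicalBasis_ne_zero σ).exists_subset_of_mem_open hx hU
  exact ⟨d, φ, hφ, hxφ, fun y hy => hsub hy⟩

theorem exists_rep_ne_zero_of_mul {d e : ℕ} {φ ψ : (σ → ℂ) → ℂ} (hφ : HomFun d φ)
    (hψ : HomFun e ψ) {x y : σ → ℂ} (hx : x ≠ 0) (hxφ : φ x ≠ 0) (hyψ : ψ y ≠ 0) :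
    ∃ z, z ≠ 0 ∧ φ z ≠ 0 ∧ ψ z ≠ 0 := by
  obtain ⟨i, hi⟩ := Function.ne_iff.1 hx
  obtain ⟨f, -, hf⟩ := hφ
  obtain ⟨g, -, hg⟩ := hψ
  -- The factor `X i` forces the point found below to be a nonzero vector, including when both
  -- degrees are zero.
  have hne : X i * f * g ≠ 0 := by
    refine mul_ne_zero (mul_ne_zero (X_ne_zero i) ?_) ?_
    · rintro rfl
      exact hxφ (by simp [hf])
    · rintro rfl
      exact hyψ (by simp [hg])
  obtain ⟨z, hz⟩ : ∃ z, eval z (X i * f * g) ≠ 0 := by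
    by_contra h
    push Not at h
    exact hne (MvPolynomial.funext fun z => by rw [h z, map_zero])
  simp only [map_mul, eval_X] at hz
  refine ⟨z, ?_, ?_, ?_⟩
  · rintro rfl
    simp at hz
  · rw [hf]
    exact right_ne_zero_of_mul (left_ne_zero_of_mul hz)
  · rw [hg]
    exact right_ne_zero_of_mul hz

instance [Nonempty σ] : IrreducibleSpace (ProjSp σ) where
  toNonempty := ⟨Projectivization.mk ℂ (fun _ => 1) fun h =>
    one_ne_zero (congrFun h (Classical.arbitrary σ))⟩
  isPreirreducible_univ := by
    rintro U V hU hV ⟨x, -, hx⟩ ⟨y, -, hy⟩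
    obtain ⟨d, φ, hφ, hxφ, hφU⟩ := exists_homFun_of_isOpen hU hx
    obtain ⟨e, ψ, hψ, hyψ, hψV⟩ := exists_homFun_of_isOpen hV hy
    obtain ⟨z, hz, hzφ, hzψ⟩ := exists_rep_ne_zero_of_mul hφ hψ x.rep_nonzero hxφ hyψ
    exact ⟨Projectivization.mk ℂ z hz, trivial, hφU _ ((hφ.ne_zero_congr hz).2 hzφ),
      hψV _ ((hψ.ne_zero_congr hz).2 hzψ)⟩

/-- A map that is given locally by homogeneous polynomial functions is regular. -/
theorem isRegularOn_of_homFun {f : ProjSp σ → ProjSp τ} {X : Set (ProjSp σ)}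
    (h : ∀ x ∈ X, ∃ (d : ℕ) (g : (σ → ℂ) → τ → ℂ), (∀ j, HomFun d fun y => g y j) ∧
      g x.rep ≠ 0 ∧ ∀ y ∈ X, ∀ h : g y.rep ≠ 0, f y = Projectivization.mk ℂ (g y.rep) h) :
    IsRegularOn f X := by
  intro x hx
  obtain ⟨d, g, hg, hx0, hf⟩ := h x hx
  choose P hP hPg using hg
  have hP' : ∀ y, (fun j => eval y (P j)) = g y := fun y => funext fun j => (hPg j y).symm
  refine ⟨d, P, hP, by rwa [hP'], fun y hy h => ?_⟩
  simp only [hP'] at h ⊢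
  exact hf y hy h

theorem IsRegularOn.mono {f : ProjSp σ → ProjSp τ} {X Y : Set (ProjSp σ)} (h : IsRegularOn f X)
    (hY : Y ⊆ X) : IsRegularOn f Y := fun x hx => by
  obtain ⟨d, g, hg, hx0, hf⟩ := h x (hY hx)
  exact ⟨d, g, hg, hx0, fun y hy => hf y (hY hy)⟩

theorem IsRegularOn.exists_homFun {f : ProjSp σ → ProjSp τ} {X : Set (ProjSp σ)}
    (h : IsRegularOn f X) {x : ProjSp σ} (hx : x ∈ X) {e : ℕ} {φ : (τ → ℂ) → ℂ} (hφ : HomFun e φ)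
    (hfx : φ (f x).rep ≠ 0) :
    ∃ (d : ℕ) (ψ : (σ → ℂ) → ℂ), HomFun d ψ ∧ ψ x.rep ≠ 0 ∧
      ∀ y ∈ X, ψ y.rep ≠ 0 → φ (f y).rep ≠ 0 := by
  obtain ⟨d, g, hg, hx0, hf⟩ := h x hx
  obtain ⟨i, hi⟩ := Function.ne_iff.1 hx0
  simp only [Pi.zero_apply] at hi
  have hcomp : HomFun (d * e) fun y => φ fun j => eval y (g j) := by
    obtain ⟨P, hP, hφP⟩ := hφ
    refine ⟨bind₁ g P, ?_, fun y => ?_⟩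
    · exact hP.aeval g hg
    · simp only [hφP]
      exact (eval₂Hom_bind₁ (RingHom.id ℂ) y g P).symm
  -- The factor `g i` confines the neighbourhood to points at which the local formula for `f` is
  -- defined.
  refine ⟨d + d * e, fun y => eval y (g i) * φ fun j => eval y (g j),
    HomFun.mul ⟨g i, hg i, fun _ => rfl⟩ hcomp, mul_ne_zero hi ?_, fun y hy hne => ?_⟩
  · rw [hf x hx hx0] at hfx
    exact (hφ.ne_zero_congr hx0).1 hfx
  · have hy0 : (fun j => eval y.rep (g j)) ≠ 0 :=
      Function.ne_iff.2 ⟨i, left_ne_zero_of_mul hne⟩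
    rw [hf y hy hy0]
    exact (hφ.ne_zero_congr hy0).2 (right_ne_zero_of_mul hne)

theorem IsRegularOn.continuousOn {f : ProjSp σ → ProjSp τ} {X : Set (ProjSp σ)}
    (h : IsRegularOn f X) : ContinuousOn f X := by
  rw [continuousOn_iff']
  intro U hU
  have hex : ∀ x : ↥(X ∩ f ⁻¹' U), ∃ V : Set (ProjSp σ), IsOpen V ∧ (x : ProjSp σ) ∈ V ∧
      ∀ y ∈ X, y ∈ V → f y ∈ U := by
    rintro ⟨x, hx, hxU⟩
    obtain ⟨e, φ, hφ, hxφ, hφU⟩ := exists_homFun_of_isOpen hU hxU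
    obtain ⟨d, ψ, hψ, hxψ, hψφ⟩ := h.exists_homFun hx hφ hxφ
    exact ⟨_, isOpen_ne_zero hψ, hxψ, fun y hy hyV => hφU _ (hψφ y hy hyV)⟩
  choose V hV hxV hVU using hex
  refine ⟨⋃ x, V x, isOpen_iUnion hV, ?_⟩
  ext y
  constructor
  · rintro ⟨hyU, hyX⟩
    exact ⟨Set.mem_iUnion.2 ⟨⟨y, hyX, hyU⟩, hxV _⟩, hyX⟩
  · rintro ⟨hyV, hyX⟩
    obtain ⟨x, hx⟩ := Set.mem_iUnion.1 hyV
    exact ⟨hVU x y hyX hx, hyX⟩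

/-- By `le_rank_iff`, rank at most r means that det(AMB) vanishes for all constant A, B of size r +
1; these are homogeneous equations. -/
theorem isClosed_rank_le {m n : Type*} [Fintype m] [Fintype n] {M : (σ → ℂ) → Matrix m n ℂ} {d : ℕ}
    (hM : ∀ i j, HomFun d fun x => M x i j) (r : ℕ) :
    IsClosed {p : ProjSp σ | (M p.rep).rank ≤ r} := by
  have : {p : ProjSp σ | (M p.rep).rank ≤ r} =
      ⋂ (A : Matrix (Fin (r + 1)) m ℂ) (B : Matrix n (Fin (r + 1)) ℂ),
        {p | (A * M p.rep * B).det = 0} := by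
    ext p
    simp only [Set.mem_ofPred_eq, Set.mem_iInter]
    rw [← not_lt, ← Nat.succ_le_iff, le_rank_iff]
    push Not
    rfl
  rw [this]
  refine isClosed_iInter fun A => isClosed_iInter fun B => ?_
  refine isClosed_eq_zero (φ := fun x => (A * M x * B).det) (d := ∑ _i : Fin (r + 1), d)
    (HomFun.det fun i j => ?_)
  simp only [Matrix.mul_apply, Finset.sum_mul]
  refine HomFun.sum _ fun k _ => HomFun.sum _ fun l _ => ?_
  have := (hM l k).const_mul (A i l * B k j)
  convert this using 2
  ring

end Zariski

/-! ### Plücker coordinates -/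

section Pluecker

open MvPolynomial

variable {n d k : ℕ}

theorem exists_det_ne_zero_of_linearIndependent {b : Fin k → Poly n}
    (hb : ∀ i, (b i).IsHomogeneous d) (hli : LinearIndependent ℂ b) :
    pluckerVec (d := d) b ≠ 0 := by
  set M : Matrix (Fin k) (Mon n d) ℂ :=
    Matrix.of fun i m => coeff (m : Fin (n + 1) →₀ ℕ) (b i) with hM
  have hrow : LinearIndependent ℂ M.row := by
    rw [Fintype.linearIndependent_iff] at hli ⊢
    intro g hg
    refine hli g (form_ext (d := d) ?_ (isHomogeneous_zero _ _ _) fun m => ?_)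
    · exact Submodule.sum_mem (Form n d) fun i _ => Submodule.smul_mem _ _ (hb i)
    · have := congrFun hg m
      simpa [hM, coeff_sum, Finset.sum_apply] using this
  have hrank : k ≤ M.rank := by
    rw [hrow.rank_matrix, Fintype.card_fin]
  obtain ⟨A, B, hAB⟩ := (le_rank_iff M k).1 hrank
  intro h
  apply hAB
  -- The qualitative half of Cauchy–Binet: the columns of MB are combinations of columns of M, so by
  -- multilinearity its determinant is a combination of Plücker coordinates.
  have h1 : (M * B).det = 0 := by
    rw [← Matrix.det_transpose]
    have h2 : (M * B).transpose = fun j => ∑ m, B m j • fun i => M i m := by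
      ext j i
      simp [Matrix.mul_apply, Finset.sum_apply, mul_comm]
    rw [h2]
    change Matrix.detRowAlternating (fun j => ∑ m, B m j • fun i => M i m) = 0
    rw [← AlternatingMap.coe_multilinearMap, MultilinearMap.map_sum]
    refine Finset.sum_eq_zero fun c _ => ?_
    rw [MultilinearMap.map_smul_univ]
    have h3 := congrFun h c
    rw [AlternatingMap.coe_multilinearMap]
    have h4 : Matrix.detRowAlternating (fun j => fun i => M i (c j)) = pluckerVec (d := d) b c := by
      rw [pluckerVec, ← Matrix.det_transpose]
      rfl
    rw [h4, h3]
    simp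
  rw [Matrix.mul_assoc, Matrix.det_mul, h1, mul_zero]

theorem linearIndependent_of_pluckerVec_ne_zero {b : Fin k → Poly n}
    (h : pluckerVec (d := d) b ≠ 0) : LinearIndependent ℂ b := by
  obtain ⟨c, hc⟩ := Function.ne_iff.1 h
  rw [Fintype.linearIndependent_iff]
  intro g hg
  refine congrFun (Matrix.eq_zero_of_vecMul_eq_zero hc (v := g) ?_)
  ext j
  have := congrArg (coeff (c j : Fin (n + 1) →₀ ℕ)) hg
  simpa [Matrix.vecMul, dotProduct, coeff_sum] using this

/-- The linear equations of the space with Plücker coordinates `z`. -/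
def pluckerEq (z : (Fin k → Mon n d) → ℂ) (c : Fin (k + 1) → Mon n d) (f : Poly n) : ℂ :=
  ∑ j : Fin (k + 1), (-1) ^ (j : ℕ) * coeff (c j : Fin (n + 1) →₀ ℕ) f * z (c ∘ j.succAbove)

theorem pluckerEq_pluckerVec (b : Fin k → Poly n) (c : Fin (k + 1) → Mon n d) (f : Poly n) :
    pluckerEq (pluckerVec b) c f = pluckerVec (Fin.cons f b : Fin (k + 1) → Poly n) c := by
  rw [pluckerVec, Matrix.det_succ_row_zero]
  rfl

/-- A vector lies in the span of an independent family exactly when adjoining it kills all maximal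
minors; expanding these along the new row gives equations linear in the Plücker coordinates. -/
theorem mem_span_iff_pluckerEq {b : Fin k → Poly n} (hb : ∀ i, (b i).IsHomogeneous d)
    (hli : LinearIndependent ℂ b) {f : Poly n} (hf : f.IsHomogeneous d) :
    f ∈ Submodule.span ℂ (Set.range b) ↔ ∀ c, pluckerEq (d := d) (pluckerVec b) c f = 0 := by
  simp only [pluckerEq_pluckerVec]
  constructor
  · intro hmem c
    by_contra h
    have := linearIndependent_of_pluckerVec_ne_zero (Function.ne_iff.2 ⟨c, h⟩)
    rw [linearIndependent_finCons] at this
    exact this.2 hmem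
  · intro h
    by_contra hmem
    refine exists_det_ne_zero_of_linearIndependent (d := d) (b := (Fin.cons f b : Fin (k + 1) → _))
      ?_ ?_ (funext h)
    · intro i
      refine Fin.cases ?_ (fun i => ?_) i
      · simpa using hf
      · simpa using hb i
    · rw [linearIndependent_finCons]
      exact ⟨hli, hmem⟩

theorem pluckerEq_smul (a : ℂ) (z : (Fin k → Mon n d) → ℂ) (c : Fin (k + 1) → Mon n d)
    (f : Poly n) : pluckerEq (a • z) c f = a * pluckerEq z c f := by
  simp only [pluckerEq, Finset.mul_sum, Pi.smul_apply, smul_eq_mul]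
  exact Finset.sum_congr rfl fun j _ => by ring

theorem IsPluckerPoint.mem_iff {W : Submodule ℂ (Poly n)} {z : ProjSp (Fin k → Mon n d)}
    (h : IsPluckerPoint W z) (hW : W ≤ Form n d) {f : Poly n} (hf : f.IsHomogeneous d) :
    f ∈ W ↔ ∀ c, pluckerEq z.rep c f = 0 := by
  obtain ⟨b, hb0, hli, rfl, rfl⟩ := h
  obtain ⟨a, ha⟩ := Projectivization.exists_smul_eq_mk_rep ℂ _ hb0
  rw [mem_span_iff_pluckerEq (fun i => hW (Submodule.subset_span ⟨i, rfl⟩)) hli hf, ← ha]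
  simp only [Units.smul_def, pluckerEq_smul]
  simp

theorem IsPluckerPoint.ext {W W' : Submodule ℂ (Poly n)} {z : ProjSp (Fin k → Mon n d)}
    (h : IsPluckerPoint W z) (h' : IsPluckerPoint W' z) (hW : W ≤ Form n d)
    (hW' : W' ≤ Form n d) : W = W' := by
  ext f
  constructor
  · intro hf
    exact (h'.mem_iff hW' (hW hf)).2 ((h.mem_iff hW (hW hf)).1 hf)
  · intro hf
    exact (h.mem_iff hW (hW' hf)).2 ((h'.mem_iff hW' (hW' hf)).1 hf)

theorem IsPluckerPoint.finrank {W : Submodule ℂ (Poly n)} {z : ProjSp (Fin k → Mon n d)}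
    (h : IsPluckerPoint W z) : Module.finrank ℂ W = k := by
  obtain ⟨b, -, hli, rfl, -⟩ := h
  rw [finrank_span_eq_card hli, Fintype.card_fin]

theorem exists_isPluckerPoint {W : Submodule ℂ (Poly n)} (hW : W ≤ Form n d)
    (hk : Module.finrank ℂ W = k) : ∃ z : ProjSp (Fin k → Mon n d), IsPluckerPoint W z := by
  have : FiniteDimensional ℂ W := Submodule.finiteDimensional_of_le hW
  let e := Module.finBasisOfFinrankEq ℂ W hk
  have hli : LinearIndependent ℂ fun i => (e i : Poly n) :=
    e.linearIndependent.map' W.subtype W.ker_subtype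
  refine ⟨_, fun i => e i, exists_det_ne_zero_of_linearIndependent (fun i => hW (e i).2) hli, hli,
    ?_, rfl⟩
  have h1 : Set.range (fun i => (e i : Poly n)) = W.subtype '' Set.range e := by
    rw [← Set.range_comp]
    rfl
  rw [h1, ← Submodule.map_span, e.span_eq, Submodule.map_top, Submodule.range_subtype]

theorem IsPluckerPoint.unique {W : Submodule ℂ (Poly n)} {z z' : ProjSp (Fin k → Mon n d)}
    (h : IsPluckerPoint W z) (h' : IsPluckerPoint W z') : z = z' := by
  obtain ⟨b, hb0, hli, rfl, rfl⟩ := h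
  obtain ⟨b', hb0', hli', hW, rfl⟩ := h'
  have hmem : ∀ i, b' i ∈ Submodule.span ℂ (Set.range b) := fun i =>
    hW ▸ Submodule.subset_span ⟨i, rfl⟩
  choose g hg using fun i => (Submodule.mem_span_range_iff_exists_fun ℂ).1 (hmem i)
  rw [Projectivization.mk_eq_mk_iff']
  have hdet : pluckerVec (d := d) b' = (Matrix.of g).det • pluckerVec (d := d) b := by
    ext c
    rw [Pi.smul_apply, smul_eq_mul, pluckerVec, pluckerVec, ← Matrix.det_mul]
    congr 1
    ext i j
    rw [Matrix.mul_apply, Matrix.of_apply, ← hg i, coeff_sum]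
    simp
  have hg0 : (Matrix.of g).det ≠ 0 := by
    intro h
    rw [h, zero_smul] at hdet
    exact hb0' hdet
  refine ⟨(Matrix.of g).det⁻¹, ?_⟩
  rw [hdet, smul_smul, inv_mul_cancel₀ hg0, one_smul]

/-- If `b` are forms in a `k`-dimensional space and their Plücker vector is not zero, then it
represents the Plücker point of this space. -/
theorem isPluckerPoint_mk {W : Submodule ℂ (Poly n)} [FiniteDimensional ℂ W]
    (hk : Module.finrank ℂ W = k) {b : Fin k → Poly n} (hb : ∀ i, b i ∈ W)
    (h : pluckerVec (d := d) b ≠ 0) :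
    IsPluckerPoint W (Projectivization.mk ℂ (pluckerVec (d := d) b) h) := by
  have hli := linearIndependent_of_pluckerVec_ne_zero h
  refine ⟨b, h, hli, ?_, rfl⟩
  refine Submodule.eq_of_le_of_finrank_eq (Submodule.span_le.2 ?_) ?_
  · rintro _ ⟨i, rfl⟩
    exact hb i
  · rw [finrank_span_eq_card hli, Fintype.card_fin, hk]

/-- The Grassmannian of `k`-dimensional spaces of forms of degree `d`, in its Plücker embedding. -/
def grassmannian (n d k : ℕ) : Set (ProjSp (Fin k → Mon n d)) :=
  {z | ∃ W ≤ Form n d, IsPluckerPoint W z}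

/-- Let B₀, B be the submatrices with columns c₀, c. By Cramer's rule the coordinates exchanged in
one index form the matrix adj(B₀) B; multiplying by B₀ gives det(B₀) · B, and the relation compares
determinants. -/
theorem pluckerVec_relation (b : Fin k → Poly n) (c₀ c : Fin k → Mon n d) :
    pluckerVec b c₀ ^ k * pluckerVec b c = pluckerVec b c₀ *
      (Matrix.of fun i j => pluckerVec b (Function.update c₀ i (c j))).det := by
  set B₀ : Matrix (Fin k) (Fin k) ℂ :=
    Matrix.of fun i j => coeff (c₀ j : Fin (n + 1) →₀ ℕ) (b i) with hB₀
  set B : Matrix (Fin k) (Fin k) ℂ :=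
    Matrix.of fun i j => coeff (c j : Fin (n + 1) →₀ ℕ) (b i) with hB
  have h1 : (Matrix.of fun i j => pluckerVec b (Function.update c₀ i (c j)))
      = Matrix.of fun i j => Matrix.cramer B₀ (fun l => B l j) i := by
    ext i j
    rw [Matrix.of_apply, Matrix.of_apply, Matrix.cramer_apply, pluckerVec]
    congr 1
    ext l m
    by_cases hm : m = i
    · subst hm
      simp [hB]
    · simp [Matrix.updateCol_ne hm, Function.update_of_ne hm, hB₀]
  have h2 : B₀ * (Matrix.of fun i j => Matrix.cramer B₀ (fun l => B l j) i) = B₀.det • B := by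
    ext l j
    have := congrFun (Matrix.mulVec_cramer B₀ (fun l => B l j)) l
    simpa [Matrix.mulVec, dotProduct, Matrix.mul_apply] using this
  rw [h1]
  change B₀.det ^ k * B.det = B₀.det * _
  rw [← Matrix.det_mul, h2, Matrix.det_smul, Fintype.card_fin]

theorem isClosed_grassmannian (n d k : ℕ) : IsClosed (grassmannian n d k) := by
  have : grassmannian n d k = ⋂ (c₀ : Fin k → Mon n d) (c : Fin k → Mon n d),
      {z | z.rep c₀ ^ k * z.rep c - z.rep c₀ *
        (Matrix.of fun i j => z.rep (Function.update c₀ i (c j))).det = 0} := by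
    ext z
    simp only [Set.mem_iInter, Set.mem_ofPred_eq]
    constructor
    · rintro ⟨W, -, b, hb0, -, -, rfl⟩ c₀ c
      obtain ⟨a, ha⟩ := Projectivization.exists_smul_eq_mk_rep ℂ _ hb0
      rw [← ha, Units.smul_def]
      have h1 : (Matrix.of fun i j => ((a : ℂ) • pluckerVec b) (Function.update c₀ i (c j)))
          = (a : ℂ) • Matrix.of fun i j => pluckerVec (d := d) b (Function.update c₀ i (c j)) := by
        ext i j
        simp
      rw [h1, Matrix.det_smul, Fintype.card_fin]
      simp only [Pi.smul_apply, smul_eq_mul, mul_pow]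
      linear_combination (a : ℂ) ^ (k + 1) * pluckerVec_relation b c₀ c
    · intro h
      obtain ⟨c₀, hc₀⟩ := Function.ne_iff.1 z.rep_nonzero
      rw [Pi.zero_apply] at hc₀
      -- Where the coordinate at c₀ is not zero, the space has a basis whose coefficients are, up to
      -- a common factor, the coordinates with one index of c₀ exchanged. The relations then say
      -- that its Plücker vector is proportional to z.
      set b : Fin k → Poly n := fun i =>
        ((formEquiv n d).symm fun m => z.rep (Function.update c₀ i m) : Form n d) with hb
      have hcoeff : ∀ i (m : Mon n d), coeff (m : Fin (n + 1) →₀ ℕ) (b i)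
          = z.rep (Function.update c₀ i m) := by
        intro i m
        exact congrFun ((formEquiv n d).apply_symm_apply _) m
      have hpl : z.rep c₀ • pluckerVec (d := d) b = z.rep c₀ ^ k • z.rep := by
        ext c
        rw [Pi.smul_apply, Pi.smul_apply, smul_eq_mul, smul_eq_mul, pluckerVec]
        simp only [hcoeff]
        exact (sub_eq_zero.1 (h c₀ c)).symm
      have hne : pluckerVec (d := d) b ≠ 0 := by
        intro h0
        rw [h0, smul_zero] at hpl
        exact smul_ne_zero (pow_ne_zero k hc₀) z.rep_nonzero hpl.symm
      refine ⟨Submodule.span ℂ (Set.range b), ?_, b, hne,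
        linearIndependent_of_pluckerVec_ne_zero hne, rfl, ?_⟩
      · rw [Submodule.span_le]
        rintro _ ⟨i, rfl⟩
        exact Submodule.coe_mem _
      · conv_lhs => rw [← z.mk_rep]
        rw [Projectivization.mk_eq_mk_iff']
        refine ⟨(z.rep c₀ ^ k)⁻¹ * z.rep c₀, ?_⟩
        rw [mul_smul, hpl, smul_smul, inv_mul_cancel₀ (pow_ne_zero k hc₀), one_smul]
  rw [this]
  refine isClosed_iInter fun c₀ => isClosed_iInter fun c => ?_
  refine isClosed_eq_zero (d := k + 1) (φ := fun v => v c₀ ^ k * v c - v c₀ *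
    (Matrix.of fun i j => v (Function.update c₀ i (c j))).det) (HomFun.sub ?_ ?_)
  · exact (((homFun_coord c₀).pow k).mul (homFun_coord c)).cast (by omega)
  · refine ((homFun_coord c₀).mul (HomFun.det (r := fun _ => 1) fun i j => ?_)).cast ?_
    · simp only [Matrix.of_apply]
      exact homFun_coord _
    · simp [Nat.add_comm]

end Pluecker

/-! ### Factors of forms, linear forms, and the Koszul complex -/

section Algebra

open MvPolynomial

/-- Substituting X_i t for X_i records the degree in a single variable t. For factors of a form the
product is a monomial in t, so by comparing highest and lowest degrees each factor is one as well.
-/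
theorem coeff_aeval_C_mul_X {σ : Type*} (f : MvPolynomial σ ℂ) (k : ℕ) :
    (aeval (fun i => Polynomial.C (X i : MvPolynomial σ ℂ) * Polynomial.X) f).coeff k =
      homogeneousComponent k f := by
  induction f using MvPolynomial.induction_on' with
  | monomial m c =>
    have h1 : (aeval (fun i => Polynomial.C (X i : MvPolynomial σ ℂ) * Polynomial.X)
        (monomial m c)) = Polynomial.C (monomial m c) * Polynomial.X ^ m.degree := by
      rw [aeval_monomial, Finsupp.prod, Finsupp.degree_apply]
      simp only [mul_pow, Finset.prod_mul_distrib, Finset.prod_pow_eq_pow_sum]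
      rw [← mul_assoc]
      congr 1
      rw [monomial_eq, Finsupp.prod, Polynomial.C_mul, map_prod]
      simp only [Polynomial.C_pow]
      rfl
    rw [h1, Polynomial.coeff_C_mul_X_pow,
      homogeneousComponent_of_mem (isHomogeneous_monomial c rfl)]
  | add p q hp hq => rw [map_add, Polynomial.coeff_add, hp, hq, map_add]

/-- A factor of a nonzero form is a form. -/
theorem isHomogeneous_of_mul {σ : Type*} {f g : MvPolynomial σ ℂ} {d : ℕ}
    (h : (f * g).IsHomogeneous d) (hne : f * g ≠ 0) : ∃ e, f.IsHomogeneous e := by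
  obtain ⟨Φ, hcoeff⟩ : ∃ Φ : MvPolynomial σ ℂ →ₐ[ℂ] Polynomial (MvPolynomial σ ℂ),
      ∀ p k, (Φ p).coeff k = homogeneousComponent k p := ⟨_, coeff_aeval_C_mul_X⟩
  have hprod : Φ f * Φ g = Polynomial.monomial d (f * g) := by
    rw [← map_mul]
    ext1 k
    rw [hcoeff, Polynomial.coeff_monomial, homogeneousComponent_of_mem h]
    simp only [eq_comm]
  have hne' : Φ f * Φ g ≠ 0 := by
    rw [hprod]
    simpa using hne
  have h1 := Polynomial.natDegree_mul (left_ne_zero_of_mul hne') (right_ne_zero_of_mul hne')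
  have h2 := Polynomial.natTrailingDegree_mul (left_ne_zero_of_mul hne')
    (right_ne_zero_of_mul hne')
  rw [hprod, Polynomial.natDegree_monomial_eq _ hne] at h1
  rw [hprod, Polynomial.natTrailingDegree_monomial hne] at h2
  have h3 := Polynomial.natTrailingDegree_le_natDegree (Φ f)
  have h4 := Polynomial.natTrailingDegree_le_natDegree (Φ g)
  have h5 : (Φ f).natTrailingDegree = (Φ f).natDegree := by omega
  refine ⟨(Φ f).natDegree, ?_⟩
  have h6 : homogeneousComponent (Φ f).natDegree f = f := by
    conv_rhs => rw [← sum_homogeneousComponent f]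
    have h7 : ∀ i, i ≠ (Φ f).natDegree → homogeneousComponent i f = 0 := by
      intro i hi
      rw [← hcoeff]
      rcases lt_or_gt_of_ne hi with hlt | hgt
      · exact Polynomial.coeff_eq_zero_of_lt_natTrailingDegree (h5 ▸ hlt)
      · exact Polynomial.coeff_eq_zero_of_natDegree_lt hgt
    rw [Finset.sum_eq_single (Φ f).natDegree (fun i _ => h7 i)]
    intro hi
    exact homogeneousComponent_eq_zero (Φ f).natDegree f (by simpa using hi)
  have h8 := homogeneousComponent_isHomogeneous (Φ f).natDegree f
  rwa [h6] at h8

theorem isHomogeneous_of_dvd {σ : Type*} {f g : MvPolynomial σ ℂ} {d : ℕ}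
    (hg : g.IsHomogeneous d) (hne : g ≠ 0) (h : f ∣ g) : ∃ e, f.IsHomogeneous e := by
  obtain ⟨k, rfl⟩ := h
  exact isHomogeneous_of_mul hg hne

theorem isUnit_of_isHomogeneous_zero {σ : Type*} {f : MvPolynomial σ ℂ} (hf : f.IsHomogeneous 0)
    (hne : f ≠ 0) : IsUnit f := by
  obtain ⟨c, rfl⟩ := isHomogeneous_zero_exists hf
  have : c ≠ 0 := by
    rintro rfl
    exact hne C_0
  exact (isUnit_iff_ne_zero.2 this).map C

theorem isHomogeneous_of_mul_eq {σ : Type*} {f g : MvPolynomial σ ℂ} {d e : ℕ}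
    (hg : g.IsHomogeneous e) (hne : g ≠ 0) (h : (f * g).IsHomogeneous (d + e)) :
    f.IsHomogeneous d := by
  have h1 := homogeneousComponent_mul_right hg f d
  rw [homogeneousComponent_eq_self h] at h1
  rw [mul_right_cancel₀ hne h1]
  exact homogeneousComponent_isHomogeneous _ _

theorem irreducible_linear {σ : Type*} {l : MvPolynomial σ ℂ} (hl : l.IsHomogeneous 1)
    (hne : l ≠ 0) : Irreducible l := by
  refine irreducible_of_totalDegree_eq_one (hl.totalDegree hne) fun x hx => ?_
  rw [isUnit_iff_ne_zero]
  rintro rfl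
  exact hne (MvPolynomial.ext _ _ fun i => by simpa using hx i)

theorem isRelPrime_linear {σ : Type*} {l l' : MvPolynomial σ ℂ} (hl : l.IsHomogeneous 1)
    (hl' : l'.IsHomogeneous 1) (h : LinearIndependent ℂ ![l, l']) : IsRelPrime l l' := by
  have hne : l ≠ 0 := h.ne_zero 0
  refine ((irreducible_linear hl hne).isRelPrime_iff_not_dvd).2 ?_
  rintro ⟨k, rfl⟩
  have hk : k.IsHomogeneous 0 :=
    isHomogeneous_of_mul_eq hl hne (by rw [mul_comm k]; simpa using hl')
  obtain ⟨c, rfl⟩ := isHomogeneous_zero_exists hk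
  rw [LinearIndependent.pair_iff] at h
  have := (h c (-1) (by rw [mul_comm, ← smul_eq_C_mul, neg_one_smul, add_neg_cancel])).2
  norm_num at this

theorem syzygy_of_isRelPrime {σ : Type*} {f g x y : MvPolynomial σ ℂ} (h : IsRelPrime f g)
    (hg : g ≠ 0) (hxy : x * f + y * g = 0) : ∃ z, x = z * g ∧ y = -(z * f) := by
  have h1 : g ∣ x * f := ⟨-y, by linear_combination hxy⟩
  obtain ⟨z, rfl⟩ := h.symm.dvd_of_dvd_mul_right h1
  refine ⟨z, mul_comm _ _, mul_right_cancel₀ hg ?_⟩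
  linear_combination hxy

theorem isRelPrime_X {i j : Fin 3} (h : i ≠ j) : IsRelPrime (X i : Poly 2) (X j) := by
  refine ((irreducible_linear (isHomogeneous_X ℂ i) (X_ne_zero i)).isRelPrime_iff_not_dvd).2 ?_
  rw [X_dvd_X]
  exact h

theorem koszul_zero {x : Fin 3 → Poly 2} (h : ∀ i j, X j * x i = X i * x j) :
    ∃ w, ∀ i, x i = X i * w := by
  have h1 : (X 0 : Poly 2) ∣ X 1 * x 0 := ⟨x 1, h 0 1⟩
  obtain ⟨w, hw⟩ := (isRelPrime_X (i := 0) (j := 1) (by decide)).dvd_of_dvd_mul_left h1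
  refine ⟨w, fun i => mul_left_cancel₀ (X_ne_zero (0 : Fin 3)) ?_⟩
  rw [h i 0, hw]
  ring

/-- The difference between a polynomial and its image under a substitution lies in every ideal
that contains the differences for the variables. -/
theorem sub_mem_of_X_sub_mem {σ : Type*} {J : Ideal (MvPolynomial σ ℂ)}
    {φ : MvPolynomial σ ℂ →ₐ[ℂ] MvPolynomial σ ℂ} (h : ∀ i, X i - φ (X i) ∈ J)
    (f : MvPolynomial σ ℂ) : f - φ f ∈ J := by
  have : (Ideal.Quotient.mkₐ ℂ J).comp φ = Ideal.Quotient.mkₐ ℂ J := by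
    ext i
    exact (Ideal.Quotient.eq.2 (h i)).symm
  exact Ideal.Quotient.eq.1 (DFunLike.congr_fun this f).symm

/-- Exactness of the Koszul complex of the three variables in its middle spot. Setting the first two
variables to zero kills `s`, so `s` lies in the ideal they generate; the other two components follow
by cancelling X₀. -/
theorem koszul_one {s t w : Poly 2} (h : X 2 * s - X 1 * t + X 0 * w = 0) :
    ∃ a b c : Poly 2, s = X 1 * a - X 0 * b ∧ t = X 2 * a - X 0 * c ∧ w = X 2 * b - X 1 * c := by
  obtain ⟨ρ, h0, h1, h2⟩ : ∃ ρ : Poly 2 →ₐ[ℂ] Poly 2, ρ (X 0) = 0 ∧ ρ (X 1) = 0 ∧ ρ (X 2) = X 2 :=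
    ⟨aeval ![0, 0, X 2], by simp, by simp, by simp⟩
  have hs : ρ s = 0 := by
    have h3 := congrArg ρ h
    rw [map_add, map_sub, map_mul, map_mul, map_mul, h0, h1, h2, map_zero] at h3
    have : (X 2 : Poly 2) * ρ s = 0 := by linear_combination h3
    exact (mul_eq_zero.1 this).resolve_left (X_ne_zero _)
  have hmem : s - ρ s ∈ Ideal.span {(X 0 : Poly 2), X 1} := by
    refine sub_mem_of_X_sub_mem (fun i => ?_) s
    fin_cases i
    · simpa [h0] using Ideal.subset_span (by simp)
    · simpa [h1] using Ideal.subset_span (by simp)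
    · simp [h2]
  rw [hs, sub_zero, Ideal.mem_span_pair] at hmem
  obtain ⟨b, a, hab⟩ := hmem
  have h2 : (X 0 : Poly 2) ∣ X 1 * (t - X 2 * a) :=
    ⟨w + X 2 * b, by linear_combination (-1 : Poly 2) * h - X 2 * hab⟩
  obtain ⟨c, hc⟩ := (isRelPrime_X (i := 0) (j := 1) (by decide)).dvd_of_dvd_mul_left h2
  refine ⟨a, -b, -c, ?_, ?_, ?_⟩
  · linear_combination -hab
  · linear_combination hc
  · refine mul_left_cancel₀ (X_ne_zero (0 : Fin 3)) ?_
    linear_combination h + X 2 * hab + X 1 * hc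

end Algebra

/-! ### Hilbert–Burch presentations of ideals of eight points -/

section HilbertBurch

open MvPolynomial

/-- A `3 × 2` matrix with two rows `a`, `b` of quadratic forms and one row `l` of linear forms,
whose minors have no common factor. -/
structure HilbertBurch where
  l : Fin 2 → Poly 2
  a : Fin 2 → Poly 2
  b : Fin 2 → Poly 2
  hl : ∀ i, (l i).IsHomogeneous 1
  ha : ∀ i, (a i).IsHomogeneous 2
  hb : ∀ i, (b i).IsHomogeneous 2
  indep : LinearIndependent ℂ l
  coprime : IsRelPrime (b 1 * l 0 - b 0 * l 1) (a 0 * l 1 - a 1 * l 0)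

namespace HilbertBurch

variable (D : HilbertBurch)

/-- The first cubic minor. -/
def cub₁ : Poly 2 := D.b 1 * D.l 0 - D.b 0 * D.l 1

/-- The second cubic minor. -/
def cub₂ : Poly 2 := D.a 0 * D.l 1 - D.a 1 * D.l 0

/-- The quartic minor. -/
def quart : Poly 2 := D.a 0 * D.b 1 - D.a 1 * D.b 0

/-- The three minors. -/
def gen : Fin 3 → Poly 2 := ![D.cub₁, D.cub₂, D.quart]

/-- The ideal of the minors. -/
def ideal : Ideal (Poly 2) := Ideal.span (Set.range D.gen)

/-- The ideal of the cubic minors. -/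
def cubicIdeal : Ideal (Poly 2) := Ideal.span {D.cub₁, D.cub₂}

theorem cub₁_hom : D.cub₁.IsHomogeneous 3 :=
  ((D.hb 1).mul (D.hl 0)).sub ((D.hb 0).mul (D.hl 1))

theorem cub₂_hom : D.cub₂.IsHomogeneous 3 :=
  ((D.ha 0).mul (D.hl 1)).sub ((D.ha 1).mul (D.hl 0))

theorem quart_hom : D.quart.IsHomogeneous 4 :=
  ((D.ha 0).mul (D.hb 1)).sub ((D.ha 1).mul (D.hb 0))

theorem isRelPrime : IsRelPrime D.cub₁ D.cub₂ := D.coprime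

theorem l_ne_zero (i : Fin 2) : D.l i ≠ 0 := D.indep.ne_zero i

theorem not_isUnit_of_isHomogeneous {f : Poly 2} {d : ℕ} (hf : f.IsHomogeneous d) (hd : d ≠ 0) :
    ¬IsUnit f := by
  intro h
  have h1 := h.map (constantCoeff : Poly 2 →+* ℂ)
  rw [constantCoeff_of_isHomogeneous hf hd] at h1
  exact not_isUnit_zero h1

theorem cub₂_ne_zero : D.cub₂ ≠ 0 := by
  intro h
  have := D.isRelPrime
  rw [h, isRelPrime_zero_right] at this
  exact not_isUnit_of_isHomogeneous D.cub₁_hom (by norm_num) this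

theorem relation (i : Fin 2) :
    D.a i * D.cub₁ + D.b i * D.cub₂ - D.l i * D.quart = 0 := by
  unfold cub₁ cub₂ quart
  fin_cases i <;> simp <;> ring

/-- The syzygies of the minors are the linear combinations of the columns. -/
theorem syzygy {x y z : Poly 2} (h : x * D.cub₁ + y * D.cub₂ + z * D.quart = 0) :
    ∃ s t, x = s * D.a 0 + t * D.a 1 ∧ y = s * D.b 0 + t * D.b 1 ∧
      z = -(s * D.l 0 + t * D.l 1) := by
  -- Multiplying the syzygy by an entry of `l` and using the relation from the same column
  -- eliminates the quartic. What remains is a syzygy of the coprime cubics, hence a multiple of the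
  -- Koszul one.
  obtain ⟨p, hp1, hp2⟩ := syzygy_of_isRelPrime D.isRelPrime D.cub₂_ne_zero
    (x := z * D.a 0 + x * D.l 0) (y := z * D.b 0 + y * D.l 0)
    (by linear_combination D.l 0 * h + z * D.relation 0)
  obtain ⟨q, hq1, hq2⟩ := syzygy_of_isRelPrime D.isRelPrime D.cub₂_ne_zero
    (x := z * D.a 1 + x * D.l 1) (y := z * D.b 1 + y * D.l 1)
    (by linear_combination D.l 1 * h + z * D.relation 1)
  have hz : z = p * D.l 1 - q * D.l 0 := by
    refine mul_right_cancel₀ D.cub₂_ne_zero ?_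
    have : z * D.cub₂ = z * (D.a 0 * D.l 1 - D.a 1 * D.l 0) := rfl
    linear_combination this + D.l 1 * hp1 - D.l 0 * hq1
  refine ⟨q, -p, ?_, ?_, by rw [hz]; ring⟩
  · refine mul_right_cancel₀ (D.l_ne_zero 0) ?_
    have : p * D.cub₂ = p * (D.a 0 * D.l 1 - D.a 1 * D.l 0) := rfl
    linear_combination hp1 - D.a 0 * hz + this
  · refine mul_right_cancel₀ (D.l_ne_zero 0) ?_
    have : p * D.cub₁ = p * (D.b 1 * D.l 0 - D.b 0 * D.l 1) := rfl
    linear_combination hp2 - D.b 0 * hz - this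

theorem column_injective {s t : Poly 2} (ha : s * D.a 0 + t * D.a 1 = 0)
    (hl : s * D.l 0 + t * D.l 1 = 0) : s = 0 ∧ t = 0 := by
  constructor
  · refine (mul_eq_zero.1 (?_ : s * D.cub₂ = 0)).resolve_right D.cub₂_ne_zero
    unfold cub₂
    linear_combination D.l 1 * ha - D.a 1 * hl
  · refine (mul_eq_zero.1 (?_ : t * D.cub₂ = 0)).resolve_right D.cub₂_ne_zero
    unfold cub₂
    linear_combination D.a 0 * hl - D.l 0 * ha

theorem mem_ideal {f : Poly 2} :
    f ∈ D.ideal ↔ ∃ x y z, x * D.cub₁ + y * D.cub₂ + z * D.quart = f := by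
  rw [ideal, Ideal.mem_span_range_iff_exists_fun]
  constructor
  · rintro ⟨c, rfl⟩
    exact ⟨c 0, c 1, c 2, by simp [gen, Fin.sum_univ_three]⟩
  · rintro ⟨x, y, z, rfl⟩
    exact ⟨![x, y, z], by simp [gen, Fin.sum_univ_three]⟩

theorem cub₁_mem : D.cub₁ ∈ D.ideal := Ideal.subset_span ⟨0, rfl⟩

theorem cub₂_mem : D.cub₂ ∈ D.ideal := Ideal.subset_span ⟨1, rfl⟩

theorem quart_mem : D.quart ∈ D.ideal := Ideal.subset_span ⟨2, rfl⟩

theorem gen_hom (k : Fin 3) : (D.gen k).IsHomogeneous (![3, 3, 4] k) := by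
  fin_cases k
  · exact D.cub₁_hom
  · exact D.cub₂_hom
  · exact D.quart_hom

theorem homogeneous (f : Poly 2) (hf : f ∈ D.ideal) (t : ℕ) :
    homogeneousComponent t f ∈ D.ideal :=
  homogeneousComponent_mem_span D.gen_hom hf t

/-- The ideal of the minors is saturated. -/
theorem saturated (f : Poly 2) (hf : ∀ i, X i * f ∈ D.ideal) : f ∈ D.ideal := by
  choose x y z hxyz using fun i => D.mem_ideal.1 (hf i)
  -- The differences of the three representations are syzygies, so they lift uniquely to the free
  -- module of columns, where they form a Koszul cycle. The cycle is a boundary, and subtracting it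
  -- turns the representations of X_i f into X_i times one fixed representation, which is that of f.
  have hsyz : ∀ i j, ∃ s t, X j * x i - X i * x j = s * D.a 0 + t * D.a 1 ∧
      X j * y i - X i * y j = s * D.b 0 + t * D.b 1 ∧
      X j * z i - X i * z j = -(s * D.l 0 + t * D.l 1) := fun i j =>
    D.syzygy (by linear_combination X j * hxyz i - X i * hxyz j)
  obtain ⟨s01, t01, hx01, hy01, hz01⟩ := hsyz 0 1
  obtain ⟨s02, t02, hx02, hy02, hz02⟩ := hsyz 0 2
  obtain ⟨s12, t12, hx12, hy12, hz12⟩ := hsyz 1 2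
  obtain ⟨hs, ht⟩ := D.column_injective
    (s := X 2 * s01 - X 1 * s02 + X 0 * s12) (t := X 2 * t01 - X 1 * t02 + X 0 * t12)
    (by linear_combination -X 2 * hx01 + X 1 * hx02 - X 0 * hx12)
    (by linear_combination X 2 * hz01 - X 1 * hz02 + X 0 * hz12)
  obtain ⟨a, b, c, hs1, hs2, hs3⟩ := koszul_one hs
  obtain ⟨a', b', c', ht1, ht2, ht3⟩ := koszul_one ht
  set σ : Fin 3 → Poly 2 := ![a, b, c] with hσ
  set τ : Fin 3 → Poly 2 := ![a', b', c'] with hτ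
  have hswap : ∀ (g : Fin 3 → Poly 2), X 1 * g 0 = X 0 * g 1 → X 2 * g 0 = X 0 * g 2 →
      X 2 * g 1 = X 1 * g 2 → ∀ i j, X j * g i = X i * g j := by
    intro g h1 h2 h3 i j
    fin_cases i <;> fin_cases j <;>
      simp only [Fin.zero_eta, Fin.mk_one, Fin.reduceFinMk, h1, h2, h3]
  obtain ⟨p, hp⟩ := koszul_zero (x := fun i => x i - (σ i * D.a 0 + τ i * D.a 1))
    (hswap _ (by simp [hσ, hτ]; linear_combination hx01 + D.a 0 * hs1 + D.a 1 * ht1)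
      (by simp [hσ, hτ]; linear_combination hx02 + D.a 0 * hs2 + D.a 1 * ht2)
      (by simp [hσ, hτ]; linear_combination hx12 + D.a 0 * hs3 + D.a 1 * ht3))
  obtain ⟨q, hq⟩ := koszul_zero (x := fun i => y i - (σ i * D.b 0 + τ i * D.b 1))
    (hswap _ (by simp [hσ, hτ]; linear_combination hy01 + D.b 0 * hs1 + D.b 1 * ht1)
      (by simp [hσ, hτ]; linear_combination hy02 + D.b 0 * hs2 + D.b 1 * ht2)
      (by simp [hσ, hτ]; linear_combination hy12 + D.b 0 * hs3 + D.b 1 * ht3))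
  obtain ⟨r, hr⟩ := koszul_zero (x := fun i => z i + (σ i * D.l 0 + τ i * D.l 1))
    (hswap _ (by simp [hσ, hτ]; linear_combination hz01 - D.l 0 * hs1 - D.l 1 * ht1)
      (by simp [hσ, hτ]; linear_combination hz02 - D.l 0 * hs2 - D.l 1 * ht2)
      (by simp [hσ, hτ]; linear_combination hz12 - D.l 0 * hs3 - D.l 1 * ht3))
  refine D.mem_ideal.2 ⟨p, q, r, mul_left_cancel₀ (X_ne_zero (0 : Fin 3)) ?_⟩
  linear_combination hxyz 0 - D.cub₁ * hp 0 - D.cub₂ * hq 0 - D.quart * hr 0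
    - σ 0 * D.relation 0 - τ 0 * D.relation 1

theorem mem_cubicIdeal {f : Poly 2} :
    f ∈ D.cubicIdeal ↔ ∃ x y, x * D.cub₁ + y * D.cub₂ = f := Ideal.mem_span_pair

/-- The coefficients of the quartic in syzygies are exactly the combinations of the row `l`. This
identifies the residual scheme of Z in its cubics with the zero of `l`. -/
theorem mul_quart_mem_cubicIdeal {f : Poly 2} :
    f * D.quart ∈ D.cubicIdeal ↔ f ∈ Ideal.span {D.l 0, D.l 1} := by
  rw [mem_cubicIdeal, Ideal.mem_span_pair]
  constructor
  · rintro ⟨x, y, h⟩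
    obtain ⟨s, t, -, -, hz⟩ := D.syzygy (x := x) (y := y) (z := -f) (by linear_combination h)
    exact ⟨s, t, by linear_combination hz⟩
  · rintro ⟨s, t, rfl⟩
    exact ⟨s * D.a 0 + t * D.a 1, s * D.b 0 + t * D.b 1,
      by linear_combination s * D.relation 0 + t * D.relation 1⟩

theorem colon_eq : D.cubicIdeal.colon (D.ideal : Set (Poly 2)) = Ideal.span {D.l 0, D.l 1} := by
  ext f
  rw [Submodule.mem_colon]
  constructor
  · intro h
    exact D.mul_quart_mem_cubicIdeal.1 (h _ D.quart_mem)
  · intro h g hg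
    obtain ⟨x, y, z, rfl⟩ := D.mem_ideal.1 hg
    have h1 := D.mul_quart_mem_cubicIdeal.2 h
    have h2 : f • (x * D.cub₁ + y * D.cub₂ + z * D.quart)
        = (f * x * D.cub₁ + f * y * D.cub₂) + z * (f * D.quart) := by
      rw [smul_eq_mul]
      ring
    rw [h2]
    exact add_mem (D.mem_cubicIdeal.2 ⟨_, _, rfl⟩) (Ideal.mul_mem_left _ _ h1)

end HilbertBurch

end HilbertBurch

/-! ### Linear forms and ideals of points -/

section Points

open MvPolynomial

theorem eq_sum_X_of_isHomogeneous_one {l : Poly 2} (hl : l.IsHomogeneous 1) :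
    ∃ c : Fin 3 → ℂ, l = ∑ i, c i • X i := by
  have : l ∈ homogeneousSubmodule (Fin 3) ℂ 1 := hl
  rw [homogeneousSubmodule_one_eq_span_X, Submodule.mem_span_range_iff_exists_fun] at this
  obtain ⟨c, hc⟩ := this
  exact ⟨c, hc.symm⟩

theorem mem_span_of_eval_eq_zero {l : Fin 2 → Poly 2} (hl : ∀ i, (l i).IsHomogeneous 1)
    (hli : LinearIndependent ℂ l) {v : Fin 3 → ℂ} (hv : v ≠ 0) (hlv : ∀ i, eval v (l i) = 0)
    {m : Poly 2} (hm : m.IsHomogeneous 1) (hmv : eval v m = 0) :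
    m ∈ Submodule.span ℂ (Set.range l) := by
  set ev : Form 2 1 →ₗ[ℂ] ℂ := (aeval v).toLinearMap ∘ₗ (Form 2 1).subtype with hev
  have hev_apply : ∀ f : Form 2 1, ev f = eval v (f : Poly 2) := fun f => by
    simp [hev, aeval_eq_eval]
  have h1 : LinearMap.range ev = ⊤ := by
    obtain ⟨i, hi⟩ := Function.ne_iff.1 hv
    refine LinearMap.range_eq_top.2 (LinearMap.surjective fun h => hi ?_)
    have := LinearMap.congr_fun h ⟨X i, isHomogeneous_X ℂ i⟩
    rw [hev_apply] at this
    simpa using this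
  have h2 : Module.finrank ℂ (LinearMap.ker ev) = 2 := by
    have h3 := LinearMap.finrank_range_add_finrank_ker ev
    have h4 : Module.finrank ℂ (Form 2 1) = 3 := by
      rw [finrank_form]
      rfl
    rw [h1, finrank_top, Module.finrank_self, h4] at h3
    omega
  have h3 : Submodule.span ℂ (Set.range l) ≤ (LinearMap.ker ev).map (Form 2 1).subtype := by
    rw [Submodule.span_le]
    rintro _ ⟨i, rfl⟩
    exact ⟨⟨l i, hl i⟩, by simpa [hev_apply] using hlv i, rfl⟩
  have h4 : Submodule.span ℂ (Set.range l) = (LinearMap.ker ev).map (Form 2 1).subtype := by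
    refine Submodule.eq_of_le_of_finrank_eq h3 ?_
    rw [finrank_span_eq_card hli, Fintype.card_fin,
      Submodule.finrank_map_subtype_eq, h2]
  rw [h4]
  exact ⟨⟨m, hm⟩, by simpa [hev_apply] using hmv, rfl⟩

theorem exists_common_zero {l : Fin 2 → Poly 2} (hl : ∀ i, (l i).IsHomogeneous 1) :
    ∃ v : Fin 3 → ℂ, v ≠ 0 ∧ ∀ i, eval v (l i) = 0 := by
  choose c hc using fun i => eq_sum_X_of_isHomogeneous_one (hl i)
  set M : (Fin 3 → ℂ) →ₗ[ℂ] (Fin 2 → ℂ) := (Matrix.of c).mulVecLin with hM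
  obtain ⟨v, hv, hv0⟩ := (Submodule.ne_bot_iff _).1
    (LinearMap.ker_ne_bot_of_finrank_lt (f := M) (by simp))
  refine ⟨v, hv0, fun i => ?_⟩
  have := congrFun (LinearMap.mem_ker.1 hv) i
  rw [hc i]
  simpa [hM, Matrix.mulVec, dotProduct, smul_eq_C_mul] using this

/-- The ideal of a point is generated by two independent linear forms that vanish there. -/
theorem pointIdeal_eq {l : Fin 2 → Poly 2} (hl : ∀ i, (l i).IsHomogeneous 1)
    (hli : LinearIndependent ℂ l) {p : ProjSp (Fin 3)} (hlp : ∀ i, eval p.rep (l i) = 0) :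
    pointIdeal p = Ideal.span {l 0, l 1} := by
  have hmem : ∀ m : Poly 2, m.IsHomogeneous 1 → eval p.rep m = 0 →
      m ∈ Ideal.span {l 0, l 1} := by
    intro m hm hmp
    obtain ⟨c, rfl⟩ := (Submodule.mem_span_range_iff_exists_fun ℂ).1
      (mem_span_of_eval_eq_zero hl hli p.rep_nonzero hlp hm hmp)
    rw [Ideal.mem_span_pair, Fin.sum_univ_two]
    exact ⟨C (c 0), C (c 1), by simp only [smul_eq_C_mul]⟩
  ext f
  rw [pointIdeal, Ideal.mem_iInf]
  simp only [RingHom.mem_ker]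
  constructor
  · intro hf
    obtain ⟨k, hk⟩ := Function.ne_iff.1 p.rep_nonzero
    rw [Pi.zero_apply] at hk
    set w : Fin 3 → ℂ := fun i => p.rep i / p.rep k with hw
    -- The substitution X_i ↦ (p_i / p_k) X_k restricts to the line of p and parametrises it by X_k.
    -- It changes f only modulo linear forms that vanish at p, and it kills every f that vanishes on
    -- the line.
    obtain ⟨φ, hφ⟩ : ∃ φ : Poly 2 →ₐ[ℂ] Poly 2, ∀ i, φ (X i) = C (w i) * X k :=
      ⟨aeval fun i => C (w i) * X k, fun i => by simp⟩
    have h1 : f - φ f ∈ Ideal.span {l 0, l 1} := by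
      refine sub_mem_of_X_sub_mem (fun i => ?_) f
      rw [hφ]
      refine hmem _ ((isHomogeneous_X ℂ i).sub (isHomogeneous_C_mul_X (w i) k)) ?_
      simp only [map_sub, map_mul, eval_X, eval_C, hw]
      field_simp
      ring
    have h2 : φ f = 0 := by
      refine MvPolynomial.funext fun y => ?_
      have h3 : (aeval y).comp φ = (aeval fun i => w i * y k : Poly 2 →ₐ[ℂ] ℂ) := by
        ext i
        simp [hφ]
      have h4 := DFunLike.congr_fun h3 f
      rw [AlgHom.comp_apply, aeval_eq_eval, aeval_eq_eval] at h4
      have h5 : (fun i => w i * y k) = (y k / p.rep k) • p.rep := by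
        ext i
        simp only [hw, Pi.smul_apply, smul_eq_mul]
        ring
      rw [h5] at h4
      rw [map_zero]
      exact h4.trans (hf _)
    rwa [h2, sub_zero] at h1
  · intro hf c
    obtain ⟨x, y, rfl⟩ := Ideal.mem_span_pair.1 hf
    rw [map_add, map_mul, map_mul, eval_smul_of_isHomogeneous (hl 0),
      eval_smul_of_isHomogeneous (hl 1), hlp 0, hlp 1]
    ring

theorem pointIdeal_injective {p q : ProjSp (Fin 3)} (h : pointIdeal p = pointIdeal q) : p = q := by
  have hmin : ∀ i j, p.rep i * q.rep j = p.rep j * q.rep i := by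
    intro i j
    have hm : (C (p.rep j) * X i - C (p.rep i) * X j : Poly 2) ∈ pointIdeal p := by
      rw [pointIdeal, Ideal.mem_iInf]
      intro c
      rw [RingHom.mem_ker]
      simp
      ring
    rw [h, pointIdeal, Ideal.mem_iInf] at hm
    have := hm 1
    rw [RingHom.mem_ker] at this
    simp at this
    linear_combination -this
  obtain ⟨k, hk⟩ := Function.ne_iff.1 q.rep_nonzero
  rw [Pi.zero_apply] at hk
  rw [← p.mk_rep, ← q.mk_rep, Projectivization.mk_eq_mk_iff']
  refine ⟨p.rep k / q.rep k, ?_⟩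
  ext i
  simp only [Pi.smul_apply, smul_eq_mul]
  rw [div_mul_eq_mul_div, div_eq_iff hk]
  linear_combination -hmin i k

end Points

/-! ### The Hilbert function and the resolution -/

section Hilbert

open MvPolynomial

namespace HilbertBurch

variable (D : HilbertBurch)

/-- The degree s + 5 part of the exact sequence 0 → R(-5)² → R(-3)² ⊕ R(-4) → I → 0, with Ψ the
matrix and Φ the augmentation. -/
theorem finrank_degPart (s : ℕ) :
    Module.finrank ℂ (degPart D.ideal (s + 5)) + 8 = Module.finrank ℂ (Form 2 (s + 5)) := by
  set Φ : (Form 2 (s + 2) × Form 2 (s + 2) × Form 2 (s + 1)) →ₗ[ℂ] Poly 2 :=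
    { toFun := fun v => v.1 * D.cub₁ + v.2.1 * D.cub₂ + v.2.2 * D.quart
      map_add' := fun v w => by
        simp only [Prod.fst_add, Prod.snd_add, Submodule.coe_add]
        ring
      map_smul' := fun c v => by
        simp only [Prod.smul_fst, Prod.smul_snd, Submodule.coe_smul, smul_eq_C_mul, RingHom.id_apply]
        ring } with hΦ
  set Ψ : (Form 2 s × Form 2 s) →ₗ[ℂ] (Form 2 (s + 2) × Form 2 (s + 2) × Form 2 (s + 1)) :=
    { toFun := fun v =>
        (⟨v.1 * D.a 0 + v.2 * D.a 1, (v.1.2.mul (D.ha 0)).add (v.2.2.mul (D.ha 1))⟩,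
          ⟨v.1 * D.b 0 + v.2 * D.b 1, (v.1.2.mul (D.hb 0)).add (v.2.2.mul (D.hb 1))⟩,
          ⟨-(v.1 * D.l 0 + v.2 * D.l 1), ((v.1.2.mul (D.hl 0)).add (v.2.2.mul (D.hl 1))).neg⟩)
      map_add' := fun v w => by
        ext1
        · ext1
          simp only [Prod.fst_add, Prod.snd_add, Submodule.coe_add]
          ring
        · ext1 <;> ext1 <;> simp only [Prod.fst_add, Prod.snd_add, Submodule.coe_add] <;> ring
      map_smul' := fun c v => by
        ext1
        · ext1
          simp only [Prod.smul_fst, Prod.smul_snd, Submodule.coe_smul, smul_eq_C_mul,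
            RingHom.id_apply]
          ring
        · ext1 <;> ext1 <;> simp only [Prod.smul_fst, Prod.smul_snd, Submodule.coe_smul,
            smul_eq_C_mul, RingHom.id_apply] <;> ring } with hΨ
  have hrange : LinearMap.range Φ = degPart D.ideal (s + 5) := by
    ext f
    constructor
    · rintro ⟨v, rfl⟩
      exact ⟨D.mem_ideal.2 ⟨_, _, _, rfl⟩, ((v.1.2.mul D.cub₁_hom).add
        (v.2.1.2.mul D.cub₂_hom)).add (v.2.2.2.mul D.quart_hom)⟩
    · rintro ⟨hf, hhom⟩
      obtain ⟨x, y, z, rfl⟩ := D.mem_ideal.1 hf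
      refine ⟨(⟨homogeneousComponent (s + 2) x, homogeneousComponent_isHomogeneous _ _⟩,
        ⟨homogeneousComponent (s + 2) y, homogeneousComponent_isHomogeneous _ _⟩,
        ⟨homogeneousComponent (s + 1) z, homogeneousComponent_isHomogeneous _ _⟩), ?_⟩
      have h := homogeneousComponent_eq_self (show IsHomogeneous _ (s + 5) from hhom)
      rw [← h, map_add, map_add, homogeneousComponent_mul_right D.cub₁_hom _ (s + 2),
        homogeneousComponent_mul_right D.cub₂_hom _ (s + 2),
        homogeneousComponent_mul_right D.quart_hom _ (s + 1)]
      rfl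
  have hker : LinearMap.range Ψ = LinearMap.ker Φ := by
    ext v
    constructor
    · rintro ⟨w, rfl⟩
      rw [LinearMap.mem_ker]
      change (w.1 * D.a 0 + w.2 * D.a 1) * D.cub₁ + (w.1 * D.b 0 + w.2 * D.b 1) * D.cub₂
        + -(w.1 * D.l 0 + w.2 * D.l 1) * D.quart = 0
      linear_combination (w.1 : Poly 2) * D.relation 0 + (w.2 : Poly 2) * D.relation 1
    · intro hv
      obtain ⟨p, q, hx, hy, hz⟩ := D.syzygy (LinearMap.mem_ker.1 hv)
      refine ⟨(⟨homogeneousComponent s p, homogeneousComponent_isHomogeneous _ _⟩,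
        ⟨homogeneousComponent s q, homogeneousComponent_isHomogeneous _ _⟩), ?_⟩
      ext1
      · ext1
        rw [← homogeneousComponent_eq_self v.1.2, hx, map_add,
          homogeneousComponent_mul_right (D.ha 0), homogeneousComponent_mul_right (D.ha 1)]
        rfl
      · ext1
        · ext1
          rw [← homogeneousComponent_eq_self v.2.1.2, hy, map_add,
            homogeneousComponent_mul_right (D.hb 0), homogeneousComponent_mul_right (D.hb 1)]
          rfl
        · ext1
          rw [← homogeneousComponent_eq_self v.2.2.2, hz, map_neg, map_add,
            homogeneousComponent_mul_right (D.hl 0), homogeneousComponent_mul_right (D.hl 1)]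
          rfl
  have hinj : Function.Injective Ψ := by
    rw [← LinearMap.ker_eq_bot, LinearMap.ker_eq_bot']
    intro v hv
    have h1 : (v.1 : Poly 2) * D.a 0 + v.2 * D.a 1 = 0 := congrArg (fun w => (w.1 : Poly 2)) hv
    have h2 : -((v.1 : Poly 2) * D.l 0 + v.2 * D.l 1) = 0 :=
      congrArg (fun w => (w.2.2 : Poly 2)) hv
    obtain ⟨h3, h4⟩ := D.column_injective h1 (neg_eq_zero.1 h2)
    ext1
    · exact Subtype.ext h3
    · exact Subtype.ext h4
  have h1 := LinearMap.finrank_range_add_finrank_ker Φ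
  rw [hrange, ← hker, LinearMap.finrank_range_of_inj hinj] at h1
  simp only [Module.finrank_prod] at h1
  have e0 := two_mul_finrank_form_two s
  have e1 := two_mul_finrank_form_two (s + 1)
  have e2 := two_mul_finrank_form_two (s + 2)
  have e5 := two_mul_finrank_form_two (s + 5)
  -- 2 dim R_{s+2} + dim R_{s+1} - 2 dim R_s and dim R_{s+5} are quadratic polynomials in s that
  -- differ by the constant 8.
  nlinarith

theorem isSchemeIdeal : IsSchemeIdeal 8 D.ideal where
  homogeneous := D.homogeneous
  saturated := D.saturated
  length := by
    filter_upwards [Filter.eventually_ge_atTop 5] with t ht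
    obtain ⟨s, rfl⟩ := Nat.exists_eq_add_of_le' ht
    exact (D.finrank_degPart s).symm

end HilbertBurch

/-- The ranks in the resolution of the ideal of eight general points of the plane. -/
def hbRank : ℕ → ℕ
  | 0 => 3
  | 1 => 2
  | _ + 2 => 0

/-- The degrees in the resolution of the ideal of eight general points of the plane. -/
def hbDeg : (i : ℕ) → Fin (hbRank i) → ℕ
  | 0 => ![3, 3, 4]
  | 1 => ![5, 5]
  | _ + 2 => fun k => k.elim0

/-- The graded Betti numbers of the ideal of eight general points of the plane. -/
def hbBetti (i j : ℕ) : ℕ := Nat.card {k : Fin (hbRank i) // hbDeg i k = j}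

namespace HilbertBurch

variable (D : HilbertBurch)

/-- The differentials of the resolution. -/
def diff : (i : ℕ) → Matrix (Fin (hbRank i)) (Fin (hbRank (i + 1))) (Poly 2)
  | 0 => Matrix.of ![D.a, D.b, -D.l]
  | _ + 1 => 0

/-- The Hilbert–Burch resolution. -/
def resolution : MinimalResolution D.ideal where
  rank := hbRank
  deg := hbDeg
  gen := D.gen
  d := D.diff
  gen_homogeneous := D.gen_hom
  d_homogeneous i := by
    match i with
    | 0 =>
      intro r c
      right
      change Fin 3 at r
      change Fin 2 at c
      fin_cases r
      · exact ⟨2, by fin_cases c <;> rfl, D.ha c⟩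
      · exact ⟨2, by fin_cases c <;> rfl, D.hb c⟩
      · exact ⟨1, by fin_cases c <;> rfl, (D.hl c).neg⟩
    | _ + 1 => exact fun _ c => (Fin.elim0 c)
  minimal i := by
    match i with
    | 0 =>
      intro r c
      change Fin 3 at r
      change Fin 2 at c
      fin_cases r
      · exact constantCoeff_of_isHomogeneous (D.ha c) (by norm_num)
      · exact constantCoeff_of_isHomogeneous (D.hb c) (by norm_num)
      · exact constantCoeff_of_isHomogeneous (D.hl c).neg (by norm_num)
    | _ + 1 => exact fun _ c => (Fin.elim0 c)
  span_gen := rfl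
  exact_zero v := by
    change Fin 3 → Poly 2 at v
    have h0 : v ⬝ᵥ D.gen = v 0 * D.cub₁ + v 1 * D.cub₂ + v 2 * D.quart := by
      simp [dotProduct, gen, Fin.sum_univ_three]
    have h1 : ∀ (w : Fin 2 → Poly 2), (Matrix.of ![D.a, D.b, -D.l]).mulVec w =
        ![w 0 * D.a 0 + w 1 * D.a 1, w 0 * D.b 0 + w 1 * D.b 1,
          -(w 0 * D.l 0 + w 1 * D.l 1)] := by
      intro w
      ext1 r
      fin_cases r <;> simp [Matrix.mulVec, dotProduct, Fin.sum_univ_two] <;> ring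
    change v ⬝ᵥ D.gen = 0 ↔ ∃ w : Fin 2 → Poly 2, (Matrix.of ![D.a, D.b, -D.l]).mulVec w = v
    rw [h0]
    constructor
    · intro h
      obtain ⟨s, t, hx, hy, hz⟩ := D.syzygy h
      refine ⟨![s, t], ?_⟩
      rw [h1]
      ext1 r
      fin_cases r
      · exact hx.symm
      · exact hy.symm
      · exact hz.symm
    · rintro ⟨w, rfl⟩
      rw [h1]
      simp only [Matrix.cons_val_zero, Matrix.cons_val_one, Matrix.cons_val]
      linear_combination w 0 * D.relation 0 + w 1 * D.relation 1
  exact_succ i := by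
    match i with
    | 0 =>
      intro v
      change Fin 2 → Poly 2 at v
      constructor
      · intro h
        change (Matrix.of ![D.a, D.b, -D.l]).mulVec v = 0 at h
        have ha : v 0 * D.a 0 + v 1 * D.a 1 = 0 := by
          have := congrFun h 0
          simp [Matrix.mulVec, dotProduct, Fin.sum_univ_two] at this
          linear_combination this
        have hl : v 0 * D.l 0 + v 1 * D.l 1 = 0 := by
          have := congrFun h 2
          simp [Matrix.mulVec, dotProduct, Fin.sum_univ_two] at this
          linear_combination -this
        obtain ⟨h0, h1⟩ := D.column_injective ha hl
        refine ⟨0, ?_⟩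
        rw [Matrix.mulVec_zero]
        ext1 r
        change Fin 2 at r
        fin_cases r
        · exact h0.symm
        · exact h1.symm
      · rintro ⟨w, rfl⟩
        change (D.diff 0).mulVec ((0 : Matrix _ _ _).mulVec w) = 0
        rw [Matrix.zero_mulVec, Matrix.mulVec_zero]
    | j + 1 =>
      intro v
      constructor
      · intro _
        exact ⟨0, funext fun r => Fin.elim0 r⟩
      · intro _
        exact Matrix.zero_mulVec v

theorem hasBettiNumbers : HasBettiNumbers D.ideal hbBetti := ⟨D.resolution, fun _ _ => rfl⟩

end HilbertBurch

end Hilbert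

/-! ### Existence of Hilbert–Burch presentations -/

section Structure

open MvPolynomial

theorem isRelPrime_left_ne_zero {f g : Poly 2} {d : ℕ} (h : IsRelPrime f g)
    (hg : g.IsHomogeneous d) (hd : d ≠ 0) : f ≠ 0 := by
  rintro rfl
  exact HilbertBurch.not_isUnit_of_isHomogeneous hg hd (isRelPrime_zero_left.1 h)

/-- The value of the relation with coefficients `v` on `Q`, `C₁`, `C₂`. -/
def relationMap (C₁ C₂ Q : Poly 2) : (Form 2 1 × Form 2 2 × Form 2 2) →ₗ[ℂ] Poly 2 where
  toFun v := v.1 * Q - v.2.1 * C₁ - v.2.2 * C₂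
  map_add' v w := by
    simp only [Prod.fst_add, Prod.snd_add, Submodule.coe_add]
    ring
  map_smul' c v := by
    simp only [Prod.smul_fst, Prod.smul_snd, Submodule.coe_smul, smul_eq_C_mul, RingHom.id_apply]
    ring

theorem exists_linearIndependent_ker {M N : Type*} [AddCommGroup M] [Module ℂ M]
    [FiniteDimensional ℂ M] [AddCommGroup N] [Module ℂ N] (f : M →ₗ[ℂ] N) {V : Submodule ℂ N}
    [FiniteDimensional ℂ V] (hf : ∀ x, f x ∈ V) {k : ℕ}
    (h : k + Module.finrank ℂ V ≤ Module.finrank ℂ M) :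
    ∃ w : Fin k → M, LinearIndependent ℂ w ∧ ∀ i, f (w i) = 0 := by
  have e := LinearMap.finrank_range_add_finrank_ker f
  have e3 : Module.finrank ℂ (LinearMap.range f) ≤ Module.finrank ℂ V := by
    refine Submodule.finrank_mono ?_
    rintro _ ⟨v, rfl⟩
    exact hf v
  obtain ⟨v, hv⟩ := exists_linearIndependent_of_le_finrank
    (show k ≤ Module.finrank ℂ (LinearMap.ker f) by omega)
  exact ⟨fun i => v i, hv.map' (LinearMap.ker f).subtype (Submodule.ker_subtype _),
    fun i => (v i).2⟩

theorem finrank_relations :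
    Module.finrank ℂ (Form 2 1 × Form 2 2 × Form 2 2) = 15 := by
  have e1 := two_mul_finrank_form_two 1
  have e2 := two_mul_finrank_form_two 2
  rw [Module.finrank_prod, Module.finrank_prod]
  omega

/-- There are 3 + 6 + 6 = 15 coefficients, and the values lie in a space of dimension at most 13 =
21 - 8, the dimension of the quintics through eight general points. So at least two independent
relations remain, and these are the columns of the matrix. -/
theorem exists_relations {C₁ C₂ Q : Poly 2}
    {V : Submodule ℂ (Poly 2)} [FiniteDimensional ℂ V] (hV : Module.finrank ℂ V ≤ 13)
    (hmem : ∀ x y z : Poly 2, x.IsHomogeneous 2 → y.IsHomogeneous 2 → z.IsHomogeneous 1 →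
      z * Q - x * C₁ - y * C₂ ∈ V) :
    ∃ l a b : Fin 2 → Poly 2, (∀ i, (l i).IsHomogeneous 1) ∧ (∀ i, (a i).IsHomogeneous 2) ∧
      (∀ i, (b i).IsHomogeneous 2) ∧ (∀ i, l i * Q - a i * C₁ - b i * C₂ = 0) ∧
      ∀ g : Fin 2 → ℂ, ∑ i, g i • l i = 0 → ∑ i, g i • a i = 0 → ∑ i, g i • b i = 0 → g = 0 := by
  obtain ⟨w, hw, hwk⟩ := exists_linearIndependent_ker (relationMap C₁ C₂ Q) (V := V)
    (fun v => hmem _ _ _ v.2.1.2 v.2.2.2 v.1.2) (k := 2) (by rw [finrank_relations]; omega)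
  refine ⟨fun i => (w i).1, fun i => (w i).2.1, fun i => (w i).2.2, fun i => (w i).1.2,
    fun i => (w i).2.1.2, fun i => (w i).2.2.2, hwk, fun g h1 h2 h3 => ?_⟩
  refine funext (Fintype.linearIndependent_iff.1 hw g ?_)
  rw [Fin.sum_univ_two] at h1 h2 h3 ⊢
  exact Prod.ext (Subtype.ext h1) (Prod.ext (Subtype.ext h2) (Subtype.ext h3))

/-- A Hilbert–Burch theorem obtained by counting: two linear relations among Q, C₁, C₂ form a 3 × 2
matrix, and its minors agree with the given forms up to a constant because the cubics are coprime
and Q is not in their ideal. -/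
theorem exists_hilbertBurch {C₁ C₂ Q : Poly 2} (h₁ : C₁.IsHomogeneous 3) (h₂ : C₂.IsHomogeneous 3)
    (hrel : IsRelPrime C₁ C₂) (hQJ : Q ∉ Ideal.span {C₁, C₂})
    {V : Submodule ℂ (Poly 2)} [FiniteDimensional ℂ V] (hV : Module.finrank ℂ V ≤ 13)
    (hmem : ∀ x y z : Poly 2, x.IsHomogeneous 2 → y.IsHomogeneous 2 → z.IsHomogeneous 1 →
      z * Q - x * C₁ - y * C₂ ∈ V) :
    ∃ (D : HilbertBurch) (c : ℂ), c ≠ 0 ∧ D.cub₁ = C₁ ∧ D.cub₂ = C₂ ∧ Q = c • D.quart := by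
  have hC₁ : C₁ ≠ 0 := isRelPrime_left_ne_zero hrel h₂ (by norm_num)
  have hC₂ : C₂ ≠ 0 := isRelPrime_left_ne_zero hrel.symm h₁ (by norm_num)
  obtain ⟨l, a, b, hlh, hah, hbh, hrelv, hind⟩ := exists_relations hV hmem
  have hquad : ∀ x y : Poly 2, x.IsHomogeneous 2 → x * C₁ + y * C₂ = 0 → x = 0 ∧ y = 0 := by
    intro x y hx hxy
    obtain ⟨z, rfl, rfl⟩ := syzygy_of_isRelPrime hrel hC₂ hxy
    have h0 : homogeneousComponent 2 (z * C₂) = 0 :=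
      homogeneousComponent_mul_right_of_lt h₂ z (by norm_num)
    rw [homogeneousComponent_eq_self hx] at h0
    have hz : z = 0 := (mul_eq_zero.1 h0).resolve_right hC₂
    simp [hz]
  -- If a combination of the two relations has no Q term, it is a syzygy of the cubics with
  -- quadratic coefficients; coprime cubics have none, so the whole combination vanishes.
  have hli : LinearIndependent ℂ l := by
    refine Fintype.linearIndependent_iff.2 fun g hg => congrFun (hind g hg ?_ ?_) <;>
    · rw [Fin.sum_univ_two] at hg ⊢
      have h0 : (g 0 • a 0 + g 1 • a 1) * C₁ + (g 0 • b 0 + g 1 • b 1) * C₂ = 0 := by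
        simp only [smul_eq_C_mul] at hg ⊢
        linear_combination Q * hg - C (g 0) * hrelv 0 - C (g 1) * hrelv 1
      obtain ⟨hx, hy⟩ := hquad _ _ (Submodule.add_mem (Form 2 2)
        (Submodule.smul_mem _ _ (hah 0)) (Submodule.smul_mem _ _ (hah 1))) h0
      first | exact hx | exact hy
  -- Eliminating Q between the relations leaves a syzygy of the cubics whose coefficients are minors
  -- of the matrix. It is a multiple of (C₂, -C₁), and by degrees the multiplier is a constant.
  obtain ⟨h, hh1, hh2⟩ := syzygy_of_isRelPrime hrel hC₂ (x := l 1 * a 0 - l 0 * a 1)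
    (y := l 1 * b 0 - l 0 * b 1) (by linear_combination l 0 * hrelv 1 - l 1 * hrelv 0)
  have hhom : h.IsHomogeneous 0 := by
    refine isHomogeneous_of_mul_eq h₂ hC₂ ?_
    rw [← hh1, zero_add]
    exact ((hlh 1).mul (hah 0)).sub ((hlh 0).mul (hah 1))
  obtain ⟨c, rfl⟩ := isHomogeneous_zero_exists hhom
  -- If the constant were zero, `l 0` would divide both quadratic entries of its relation, and
  -- cancelling it would express Q through the cubics.
  have hc : c ≠ 0 := by
    rintro rfl
    have hrl : IsRelPrime (l 0) (l 1) := by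
      refine isRelPrime_linear (hlh 0) (hlh 1) ?_
      convert hli using 1
      ext i
      fin_cases i <;> rfl
    simp only [C_0, zero_mul, neg_zero] at hh1 hh2
    obtain ⟨s, hs⟩ : l 0 ∣ a 0 := hrl.dvd_of_dvd_mul_left ⟨a 1, by linear_combination hh1⟩
    obtain ⟨t, ht⟩ : l 0 ∣ b 0 := hrl.dvd_of_dvd_mul_left ⟨b 1, by linear_combination hh2⟩
    refine hQJ (Ideal.mem_span_pair.2 ⟨s, t, mul_left_cancel₀ (hli.ne_zero 0) ?_⟩)
    linear_combination -hrelv 0 - C₁ * hs - C₂ * ht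
  have hcc : (C c : Poly 2) * C c⁻¹ = 1 := by
    rw [← C_mul, mul_inv_cancel₀ hc, C_1]
  have e1 : C c⁻¹ * b 1 * l 0 - C c⁻¹ * b 0 * l 1 = C₁ := by
    linear_combination -C c⁻¹ * hh2 + C₁ * hcc
  have e2 : C c⁻¹ * a 0 * l 1 - C c⁻¹ * a 1 * l 0 = C₂ := by
    linear_combination C c⁻¹ * hh1 + C₂ * hcc
  refine ⟨⟨l, fun i => C c⁻¹ * a i, fun i => C c⁻¹ * b i, hlh, fun i => (hah i).C_mul _,
    fun i => (hbh i).C_mul _, hli, ?_⟩, c, hc, e1, e2, ?_⟩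
  · rw [e1, e2]
    exact hrel
  · refine mul_left_cancel₀ (hli.ne_zero 0) ?_
    rw [smul_eq_C_mul]
    change l 0 * Q = l 0 * (C c * (C c⁻¹ * a 0 * (C c⁻¹ * b 1) - C c⁻¹ * a 1 * (C c⁻¹ * b 0)))
    linear_combination hrelv 0 - a 0 * e1 - b 0 * e2
      - l 0 * C c⁻¹ * (a 0 * b 1 - a 1 * b 0) * hcc

end Structure

/-! ### Betti numbers determine the Hilbert function -/

section Betti

open MvPolynomial

variable {n : ℕ}

/-- The degree `t` part of `R(-d)`. -/
def shiftForm (n d t : ℕ) : Submodule ℂ (Poly n) := if d ≤ t then Form n (t - d) else ⊥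

theorem shiftForm_of_le {d t : ℕ} (h : d ≤ t) : shiftForm n d t = Form n (t - d) := if_pos h

theorem shiftForm_of_lt {d t : ℕ} (h : t < d) : shiftForm n d t = ⊥ := if_neg (by omega)

instance (d t : ℕ) : FiniteDimensional ℂ (shiftForm n d t) := by
  by_cases h : d ≤ t
  · rw [shiftForm_of_le h]
    infer_instance
  · rw [shiftForm_of_lt (not_le.1 h)]
    infer_instance

theorem shiftComponent_mem (d t : ℕ) (a : Poly n) : shiftComponent t d a ∈ shiftForm n d t := by
  unfold shiftComponent shiftForm
  split_ifs
  · exact homogeneousComponent_isHomogeneous _ _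
  · exact zero_mem _

theorem shiftComponent_of_mem {d t : ℕ} {a : Poly n} (ha : a ∈ shiftForm n d t) :
    shiftComponent t d a = a := by
  unfold shiftComponent
  unfold shiftForm at ha
  split_ifs at ha ⊢
  · exact homogeneousComponent_eq_self ha
  · exact ((Submodule.mem_bot ℂ).1 ha).symm

theorem shiftComponent_sum {ι : Type*} (s : Finset ι) (f : ι → Poly n) (t d : ℕ) :
    shiftComponent t d (∑ i ∈ s, f i) = ∑ i ∈ s, shiftComponent t d (f i) := by
  unfold shiftComponent
  split_ifs
  · exact map_sum _ _ _
  · simp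

theorem shiftComponent_mul {d d' e t : ℕ} {g : Poly n} (hg : g.IsHomogeneous e) (h : d + e = d')
    (a : Poly n) : shiftComponent t d (g * a) = g * shiftComponent t d' a := by
  unfold shiftComponent
  rw [mul_comm g a]
  by_cases h1 : d' ≤ t
  · rw [if_pos h1, if_pos (by omega), show t - d = (t - d') + e by omega,
      homogeneousComponent_mul_right hg, mul_comm]
  · rw [if_neg h1, mul_zero]
    split_ifs with h2
    · exact homogeneousComponent_mul_right_of_lt hg a (by omega)
    · rfl

theorem mul_mem_shiftForm {d d' e t : ℕ} {g a : Poly n} (hg : g.IsHomogeneous e) (h : d + e = d')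
    (ha : a ∈ shiftForm n d' t) : g * a ∈ shiftForm n d t := by
  rw [← shiftComponent_of_mem ha, ← shiftComponent_mul hg h]
  exact shiftComponent_mem _ _ _

theorem mul_gen_isHomogeneous {d t : ℕ} {g a : Poly n} (hg : g.IsHomogeneous d)
    (ha : a ∈ shiftForm n d t) : (a * g).IsHomogeneous t := by
  rw [← shiftComponent_of_mem ha, ← homogeneousComponent_mul hg]
  exact homogeneousComponent_isHomogeneous _ _

namespace MinimalResolution

variable {I : Ideal (Poly n)} (res : MinimalResolution I)

/-- The degree `t` part of the `i`-th module of a resolution. -/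
abbrev Piece (i t : ℕ) : Type := (k : Fin (res.rank i)) → shiftForm n (res.deg i k) t

theorem d_mul_mem (i t : ℕ) (a : Fin (res.rank i)) (b : Fin (res.rank (i + 1))) {f : Poly n}
    (hf : f ∈ shiftForm n (res.deg (i + 1) b) t) :
    res.d i a b * f ∈ shiftForm n (res.deg i a) t := by
  rcases res.d_homogeneous i a b with h | ⟨e, he, hhom⟩
  · rw [h, zero_mul]
    exact zero_mem _
  · exact mul_mem_shiftForm hhom he hf

/-- The degree `t` part of a differential. -/
def diffPiece (i t : ℕ) : res.Piece (i + 1) t →ₗ[ℂ] res.Piece i t where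
  toFun v a := ⟨∑ b, res.d i a b * v b, Submodule.sum_mem _ fun b _ => res.d_mul_mem i t a b (v b).2⟩
  map_add' v w := by
    ext1 a
    ext1
    simp only [Pi.add_apply, Submodule.coe_add, mul_add, Finset.sum_add_distrib]
  map_smul' c v := by
    ext1 a
    ext1
    simp only [Pi.smul_apply, Submodule.coe_smul, mul_smul_comm, Finset.smul_sum, RingHom.id_apply]

/-- The degree `t` part of the augmentation. -/
def augPiece (t : ℕ) : res.Piece 0 t →ₗ[ℂ] Poly n where
  toFun v := ∑ b, (v b : Poly n) * res.gen b
  map_add' v w := by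
    simp only [Pi.add_apply, Submodule.coe_add, add_mul, Finset.sum_add_distrib]
  map_smul' c v := by
    simp only [Pi.smul_apply, Submodule.coe_smul, smul_mul_assoc, Finset.smul_sum, RingHom.id_apply]

theorem range_augPiece (t : ℕ) : LinearMap.range (res.augPiece t) = degPart I t := by
  ext f
  constructor
  · rintro ⟨v, rfl⟩
    refine ⟨?_, Submodule.sum_mem (Form n t) fun b _ =>
      mul_gen_isHomogeneous (res.gen_homogeneous b) (v b).2⟩
    change ∑ b, (v b : Poly n) * res.gen b ∈ I
    refine Ideal.sum_mem _ fun b _ => Ideal.mul_mem_left _ _ ?_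
    exact res.span_gen.le (Ideal.subset_span ⟨b, rfl⟩)
  · rintro ⟨hf, hhom⟩
    obtain ⟨c, rfl⟩ := Ideal.mem_span_range_iff_exists_fun.1 (res.span_gen.ge hf)
    refine ⟨fun b => ⟨shiftComponent t _ (c b), shiftComponent_mem _ _ _⟩, ?_⟩
    change ∑ b, shiftComponent t _ (c b) * res.gen b = _
    rw [← homogeneousComponent_eq_self hhom, map_sum]
    exact Finset.sum_congr rfl fun b _ => (homogeneousComponent_mul (res.gen_homogeneous b) _).symm

theorem mulVec_shiftComponent (i t : ℕ) (w : Fin (res.rank (i + 1)) → Poly n)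
    (a : Fin (res.rank i)) :
    ∑ b, res.d i a b * shiftComponent t (res.deg (i + 1) b) (w b) =
      shiftComponent t (res.deg i a) ((res.d i).mulVec w a) := by
  rw [Matrix.mulVec, dotProduct, shiftComponent_sum]
  refine Finset.sum_congr rfl fun b _ => ?_
  rcases res.d_homogeneous i a b with h | ⟨e, he, hhom⟩
  · rw [h, zero_mul, zero_mul]
    unfold shiftComponent
    simp
  · exact (shiftComponent_mul hhom he _).symm

theorem exists_piece (i t : ℕ) (v : res.Piece i t)
    (h : ∃ w, (res.d i).mulVec w = fun a => (v a : Poly n)) :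
    v ∈ LinearMap.range (res.diffPiece i t) := by
  obtain ⟨w, hw⟩ := h
  refine ⟨fun b => ⟨shiftComponent t _ (w b), shiftComponent_mem _ _ _⟩, ?_⟩
  ext1 a
  ext1
  change ∑ b, res.d i a b * shiftComponent t (res.deg (i + 1) b) (w b) = _
  rw [mulVec_shiftComponent, hw]
  exact shiftComponent_of_mem (v a).2

theorem ker_augPiece (t : ℕ) :
    LinearMap.ker (res.augPiece t) = LinearMap.range (res.diffPiece 0 t) := by
  ext v
  constructor
  · intro hv
    exact res.exists_piece 0 t v ((res.exact_zero _).1 (LinearMap.mem_ker.1 hv))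
  · rintro ⟨w, rfl⟩
    exact (res.exact_zero _).2 ⟨fun b => w b, rfl⟩

theorem ker_diffPiece (i t : ℕ) :
    LinearMap.ker (res.diffPiece i t) = LinearMap.range (res.diffPiece (i + 1) t) := by
  ext v
  constructor
  · intro hv
    refine res.exists_piece (i + 1) t v ((res.exact_succ i _).1 ?_)
    ext1 a
    exact congrArg Subtype.val (congrFun (LinearMap.mem_ker.1 hv) a)
  · rintro ⟨w, rfl⟩
    have := (res.exact_succ i _).2 ⟨fun b => (w b : Poly n), rfl⟩
    rw [LinearMap.mem_ker]
    ext1 a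
    ext1
    exact congrFun this a

/-- Minimality makes the degrees grow at every step: a generator with zero differential would be the
image of something, yet the entries of the matrices have no constant term. So only finitely many
steps matter in a given degree. -/
theorem le_deg (i : ℕ) (k : Fin (res.rank i)) : i ≤ res.deg i k := by
  induction i with
  | zero => exact Nat.zero_le _
  | succ i ih =>
    obtain ⟨a, ha⟩ : ∃ a, res.d i a k ≠ 0 := by
      by_contra hcon
      push Not at hcon
      have h1 : (res.d i).mulVec (Pi.single k 1) = 0 := by
        ext1 a
        rw [Matrix.mulVec_single_one]
        exact hcon a
      obtain ⟨w, hw⟩ := (res.exact_succ i _).1 h1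
      have h2 := congrArg constantCoeff (congrFun hw k)
      rw [Pi.single_eq_same, Matrix.mulVec, dotProduct, map_sum] at h2
      simp only [map_mul, res.minimal, zero_mul, Finset.sum_const_zero, map_one] at h2
      exact zero_ne_one h2
    rcases res.d_homogeneous i a k with h | ⟨e, he, hhom⟩
    · exact (ha h).elim
    · have h1 := ih a
      rcases Nat.eq_zero_or_pos e with rfl | hpos
      · obtain ⟨c, hc⟩ := isHomogeneous_zero_exists hhom
        have h2 := res.minimal i a k
        rw [hc, constantCoeff_C] at h2
        rw [hc, h2, C_0] at ha
        exact (ha rfl).elim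
      · omega

/-- The dimension of the degree `t` part of the `i`-th syzygy module. -/
def syzDim (t : ℕ) : ℕ → ℕ
  | 0 => Module.finrank ℂ (degPart I t)
  | i + 1 => Module.finrank ℂ (LinearMap.range (res.diffPiece i t))

theorem finrank_piece (i t : ℕ) :
    Module.finrank ℂ (res.Piece i t) = res.syzDim t i + res.syzDim t (i + 1) := by
  match i with
  | 0 =>
    rw [← LinearMap.finrank_range_add_finrank_ker (res.augPiece t), range_augPiece, ker_augPiece]
    rfl
  | i + 1 =>
    rw [← LinearMap.finrank_range_add_finrank_ker (res.diffPiece i t), ker_diffPiece]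
    rfl

theorem finrank_piece_eq_sum (i t : ℕ) : Module.finrank ℂ (res.Piece i t) =
    ∑ k, Module.finrank ℂ (shiftForm n (res.deg i k) t) :=
  Module.finrank_pi_fintype ℂ

theorem syzDim_eq_zero {i t : ℕ} (h : t < i) : res.syzDim t i = 0 := by
  have h1 := res.finrank_piece i t
  have h2 : Module.finrank ℂ (res.Piece i t) = 0 := by
    rw [finrank_piece_eq_sum]
    refine Finset.sum_eq_zero fun k _ => ?_
    rw [shiftForm_of_lt (h.trans_le (res.le_deg i k)), finrank_bot]
  omega

end MinimalResolution

theorem sum_eq_of_card_fiber_eq {r r' : ℕ} {f : Fin r → ℕ} {f' : Fin r' → ℕ}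
    (h : ∀ j, Nat.card {k // f k = j} = Nat.card {k // f' k = j}) (g : ℕ → ℕ) :
    ∑ k, g (f k) = ∑ k, g (f' k) := by
  have e : ∀ j, Nonempty ({k // f k = j} ≃ {k // f' k = j}) := fun j => Finite.card_eq.1 (h j)
  let E : Fin r ≃ Fin r' := (Equiv.sigmaFiberEquiv f).symm.trans
    ((Equiv.sigmaCongrRight fun j => (e j).some).trans (Equiv.sigmaFiberEquiv f'))
  have hE : ∀ k, f' (E k) = f k := fun k => ((e (f k)).some ⟨k, rfl⟩).2
  rw [← E.sum_comp fun k => g (f' k)]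
  simp only [hE]

/-- Betti numbers fix the dimension of every module of the resolution in degree t. The syzygy
modules vanish in this degree beyond step t, and descending induction along the exact sequence
reaches the ideal. -/
theorem finrank_degPart_eq_of_hasBettiNumbers {I I' : Ideal (Poly n)} {β : ℕ → ℕ → ℕ}
    (h : HasBettiNumbers I β) (h' : HasBettiNumbers I' β) (t : ℕ) :
    Module.finrank ℂ (degPart I t) = Module.finrank ℂ (degPart I' t) := by
  obtain ⟨res, hres⟩ := h
  obtain ⟨res', hres'⟩ := h'
  have hpiece : ∀ i, Module.finrank ℂ (res.Piece i t) = Module.finrank ℂ (res'.Piece i t) := by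
    intro i
    rw [res.finrank_piece_eq_sum, res'.finrank_piece_eq_sum]
    exact sum_eq_of_card_fiber_eq (fun j => (hres i j).trans (hres' i j).symm)
      fun d => Module.finrank ℂ (shiftForm n d t)
  have key : ∀ m i, i + m = t + 1 → res.syzDim t i = res'.syzDim t i := by
    intro m
    induction m with
    | zero =>
      intro i hi
      rw [res.syzDim_eq_zero (by omega), res'.syzDim_eq_zero (by omega)]
    | succ m ih =>
      intro i hi
      have h1 := ih (i + 1) (by omega)
      have h2 := hpiece i
      rw [res.finrank_piece, res'.finrank_piece] at h2
      omega
  exact key (t + 1) 0 (by omega)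

end Betti

/-! ### Recognising Hilbert–Burch ideals through their dimensions -/

section Recognition

open MvPolynomial

/-- Two cubics have only 3 · 2 = 6 independent products with variables, so a seven-dimensional space
of quartics contains one that the cubics do not generate. -/
theorem cubic_pair_finrank_le {C₁ C₂ : Poly 2} (h₁ : C₁.IsHomogeneous 3)
    (h₂ : C₂.IsHomogeneous 3) {V : Submodule ℂ (Poly 2)} (hV : V ≤ Form 2 4)
    (hVJ : ∀ f ∈ V, f ∈ Ideal.span {C₁, C₂}) : Module.finrank ℂ V ≤ 6 := by
  have hle : V ≤ Submodule.span ℂ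
      (Set.range fun q : Fin 3 × Fin 2 => X q.1 * (![C₁, C₂] : Fin 2 → Poly 2) q.2) := by
    intro f hf
    obtain ⟨x, y, hxy⟩ := Ideal.mem_span_pair.1 (hVJ f hf)
    have h4 : homogeneousComponent 1 x * C₁ + homogeneousComponent 1 y * C₂ = f := by
      rw [← homogeneousComponent_mul_right h₁ x 1, ← homogeneousComponent_mul_right h₂ y 1,
        ← map_add, hxy]
      exact homogeneousComponent_eq_self (hV hf)
    obtain ⟨a, ha⟩ := eq_sum_X_of_isHomogeneous_one (homogeneousComponent_isHomogeneous 1 x)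
    obtain ⟨b, hb⟩ := eq_sum_X_of_isHomogeneous_one (homogeneousComponent_isHomogeneous 1 y)
    rw [← h4, ha, hb, Finset.sum_mul, Finset.sum_mul]
    refine add_mem (Submodule.sum_mem _ fun i _ => ?_) (Submodule.sum_mem _ fun i _ => ?_)
    · rw [smul_mul_assoc]
      exact Submodule.smul_mem _ _ (Submodule.subset_span ⟨(i, 0), rfl⟩)
    · rw [smul_mul_assoc]
      exact Submodule.smul_mem _ _ (Submodule.subset_span ⟨(i, 1), rfl⟩)
  have : FiniteDimensional ℂ (Submodule.span ℂ
      (Set.range fun q : Fin 3 × Fin 2 => X q.1 * (![C₁, C₂] : Fin 2 → Poly 2) q.2)) :=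
    FiniteDimensional.span_of_finite ℂ (Set.finite_range _)
  refine (Submodule.finrank_mono hle).trans ?_
  refine (finrank_range_le_card _).trans ?_
  simp

/-- Stated for spaces of forms, not for graded pieces of an ideal. It thus also applies to spaces
read off from a point of the Grassmannian that is not yet known to come from a scheme, which gives
local closedness of the family. -/
theorem exists_hilbertBurch_of_submodules {V₃ V₄ V₅ : Submodule ℂ (Poly 2)} (h₃ : V₃ ≤ Form 2 3)
    (h₄ : V₄ ≤ Form 2 4) (h₅ : V₅ ≤ Form 2 5) (d₃ : 2 ≤ Module.finrank ℂ V₃)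
    (d₄ : 7 ≤ Module.finrank ℂ V₄) (d₅ : Module.finrank ℂ V₅ ≤ 13)
    (m₃ : ∀ f ∈ V₃, ∀ g : Poly 2, g.IsHomogeneous 2 → g * f ∈ V₅)
    (m₄ : ∀ f ∈ V₄, ∀ g : Poly 2, g.IsHomogeneous 1 → g * f ∈ V₅)
    (hcop : ∀ b : Fin 2 → Poly 2, (∀ i, b i ∈ V₃) → LinearIndependent ℂ b →
      IsRelPrime (b 0) (b 1)) :
    ∃ D : HilbertBurch, D.cub₁ ∈ V₃ ∧ D.cub₂ ∈ V₃ ∧ D.quart ∈ V₄ := by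
  have : FiniteDimensional ℂ V₃ := Submodule.finiteDimensional_of_le h₃
  have : FiniteDimensional ℂ V₅ := Submodule.finiteDimensional_of_le h₅
  obtain ⟨v, hv⟩ := exists_linearIndependent_of_le_finrank d₃
  obtain ⟨C, hC, hCV⟩ : ∃ C : Fin 2 → Poly 2, LinearIndependent ℂ C ∧ ∀ i, C i ∈ V₃ :=
    ⟨_, hv.map' V₃.subtype (Submodule.ker_subtype _), fun i => (v i).2⟩
  obtain ⟨Q, hQ, hQJ⟩ : ∃ Q ∈ V₄, Q ∉ Ideal.span {C 0, C 1} := by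
    by_contra hcon
    push Not at hcon
    have := cubic_pair_finrank_le (h₃ (hCV 0)) (h₃ (hCV 1)) h₄ hcon
    omega
  obtain ⟨D, c, hc, h1, h2, h3⟩ := exists_hilbertBurch (h₃ (hCV 0)) (h₃ (hCV 1))
    (hcop C hCV hC) hQJ d₅ fun x y z hx hy hz =>
      sub_mem (sub_mem (m₄ Q hQ z hz) (m₃ _ (hCV 0) x hx)) (m₃ _ (hCV 1) y hy)
  refine ⟨D, h1 ▸ hCV 0, h2 ▸ hCV 1, ?_⟩
  have : D.quart = c⁻¹ • Q := by rw [h3, inv_smul_smul₀ hc]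
  rw [this]
  exact Submodule.smul_mem _ _ hQ

theorem le_of_degPart_le {n : ℕ} {I J : Ideal (Poly n)}
    (hI : ∀ f ∈ I, ∀ t, homogeneousComponent t f ∈ I)
    (hJ : ∀ f : Poly n, (∀ i, X i * f ∈ J) → f ∈ J) {s : ℕ}
    (h : ∀ t, s ≤ t → degPart I t ≤ degPart J t) : I ≤ J := by
  have key : ∀ m t, s ≤ t + m → degPart I t ≤ degPart J t := by
    intro m
    induction m with
    | zero => exact fun t ht => h t ht
    | succ m ih =>
      intro t ht f hf
      refine ⟨hJ f fun i => ?_, hf.2⟩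
      refine (ih (t + 1) (by omega) (⟨Ideal.mul_mem_left _ _ hf.1, ?_⟩ : X i * f ∈ degPart I _)).1
      exact mul_comm f (X i) ▸ IsHomogeneous.mul hf.2 (isHomogeneous_X ℂ i)
  intro f hf
  rw [← sum_homogeneousComponent f]
  exact Ideal.sum_mem _ fun t _ =>
    (key s t (by omega) ⟨hI f hf t, homogeneousComponent_isHomogeneous _ _⟩).1

theorem HilbertBurch.ideal_le {D : HilbertBurch} {I : Ideal (Poly 2)} (h₁ : D.cub₁ ∈ I)
    (h₂ : D.cub₂ ∈ I) (h₃ : D.quart ∈ I) : D.ideal ≤ I := by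
  rw [HilbertBurch.ideal, Ideal.span_le]
  rintro _ ⟨k, rfl⟩
  fin_cases k
  · exact h₁
  · exact h₂
  · exact h₃

/-- The ideals have the same dimension in large degrees, so they agree there, and saturation carries
the equality down. -/
theorem HilbertBurch.ideal_eq_of_le {D : HilbertBurch} {I : Ideal (Poly 2)}
    (hI : IsSchemeIdeal 8 I) (hle : D.ideal ≤ I) : D.ideal = I := by
  obtain ⟨s, hs⟩ := Filter.eventually_atTop.1 hI.length
  refine le_antisymm hle (le_of_degPart_le hI.homogeneous D.saturated (s := s + 5) fun t ht => ?_)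
  obtain ⟨u, rfl⟩ := Nat.exists_eq_add_of_le' (show 5 ≤ t by omega)
  have h1 : Module.finrank ℂ (Form 2 (u + 5)) = Module.finrank ℂ (degPart I (u + 5)) + 8 :=
    hs (u + 5) (by omega)
  have h2 := D.finrank_degPart u
  have h3 : degPart D.ideal (u + 5) ≤ degPart I (u + 5) := fun f hf => ⟨hle hf.1, hf.2⟩
  exact (Submodule.eq_of_le_of_finrank_le h3 (by omega)).ge

theorem exists_hilbertBurch_of_isSchemeIdeal {I : Ideal (Poly 2)} (hI : IsSchemeIdeal 8 I)
    (d₃ : 2 ≤ Module.finrank ℂ (degPart I 3)) (d₄ : 7 ≤ Module.finrank ℂ (degPart I 4))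
    (d₅ : Module.finrank ℂ (degPart I 5) ≤ 13)
    (hcop : ∀ b : Fin 2 → Poly 2, (∀ i, b i ∈ degPart I 3) → LinearIndependent ℂ b →
      IsRelPrime (b 0) (b 1)) :
    ∃ D : HilbertBurch, D.ideal = I := by
  obtain ⟨D, h1, h2, h3⟩ := exists_hilbertBurch_of_submodules inf_le_right inf_le_right
    inf_le_right d₃ d₄ d₅ (fun f hf g hg => ⟨Ideal.mul_mem_left _ _ hf.1, hg.mul hf.2⟩)
    (fun f hf g hg => ⟨Ideal.mul_mem_left _ _ hf.1, hg.mul hf.2⟩) hcop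
  exact ⟨D, HilbertBurch.ideal_eq_of_le hI (HilbertBurch.ideal_le h1.1 h2.1 h3.1)⟩

end Recognition

/-! ### Interpolation at general points -/

section Interpolation

open MvPolynomial

/-- Evaluations at points span the dual of the space of forms, since a form that vanishes everywhere
is zero; a basis chosen among them gives the points. -/
theorem exists_interpolation_points (n d : ℕ) {k : ℕ} (e : Fin k ≃ Mon n d) :
    ∃ w : Fin k → Fin (n + 1) → ℂ, (Matrix.of fun i j => ∏ a, w i a ^ (e j).1 a).det ≠ 0 := by
  set s : Set (Mon n d → ℂ) := Set.range fun (p : Fin (n + 1) → ℂ) (m : Mon n d) =>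
    ∏ a, p a ^ m.1 a with hs
  have htop : Submodule.span ℂ s = ⊤ := by
    by_contra hne
    obtain ⟨φ, hφ, hle⟩ := Submodule.exists_le_ker_of_lt_top _ (lt_top_iff_ne_top.2 hne)
    refine hφ ?_
    have hf : (∑ m : Mon n d, monomial m.1 (φ (Pi.single m 1)) : Poly n) = 0 := by
      refine MvPolynomial.funext fun p => ?_
      have h1 : φ (fun m => ∏ a, p a ^ m.1 a) = 0 :=
        LinearMap.mem_ker.1 (hle (Submodule.subset_span ⟨p, rfl⟩))
      rw [LinearMap.pi_apply_eq_sum_univ φ] at h1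
      rw [map_zero, ← h1, map_sum]
      refine Finset.sum_congr rfl fun m _ => ?_
      rw [eval_monomial, Finsupp.prod_fintype _ _ (fun _ => pow_zero _), smul_eq_mul, mul_comm]
      congr 2
      ext j
      rw [Pi.single_apply]
      simp only [eq_comm]
    refine LinearMap.pi_ext' fun m => LinearMap.ext_ring ?_
    have h2 := congrArg (coeff m.1) hf
    rw [coeff_sum, Finset.sum_eq_single m] at h2
    · simpa using h2
    · intro b _ hb
      rw [coeff_monomial, if_neg fun h => hb (Subtype.ext h)]
    · simp
  have hk : k = Module.finrank ℂ (Submodule.span ℂ s) := by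
    rw [htop, finrank_top, Module.finrank_fintype_fun_eq_card, ← Fintype.card_congr e,
      Fintype.card_fin]
  obtain ⟨f, hfs, -, hli⟩ := Submodule.exists_fun_fin_finrank_span_eq ℂ s
  choose p hp using fun i => hfs i
  refine ⟨fun i => p (Fin.cast hk i), ?_⟩
  have hli2 : LinearIndependent ℂ fun i : Fin k => f (Fin.cast hk i) :=
    hli.comp _ (Fin.cast_injective hk)
  have hli3 : LinearIndependent ℂ
      (Matrix.of fun i j => ∏ a, p (Fin.cast hk i) a ^ (e j).1 a : Matrix (Fin k) (Fin k) ℂ).row := by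
    have := hli2.map' (LinearMap.funLeft ℂ ℂ e)
      (LinearMap.ker_eq_bot.2 (LinearMap.funLeft_injective_of_surjective ℂ ℂ _ e.surjective))
    have hrow : (LinearMap.funLeft ℂ ℂ e) ∘ (fun i : Fin k => f (Fin.cast hk i)) =
        (Matrix.of fun i j => ∏ a, p (Fin.cast hk i) a ^ (e j).1 a :
          Matrix (Fin k) (Fin k) ℂ).row := by
      ext i j
      simp [Matrix.row, LinearMap.funLeft_apply, ← hp]
    exact hrow ▸ this
  exact ((Matrix.isUnit_iff_isUnit_det _).1 (Matrix.linearIndependent_rows_iff_isUnit.1 hli3)).ne_zero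

/-- Forms of degree `d` take arbitrary values, and are determined by their values, at any `k` of
`s` general points, if `k` is the dimension of the space of forms of degree `d`. -/
theorem exists_interpolation (n d s : ℕ) {k : ℕ} (hk : Fintype.card (Mon n d) = k) :
    ∃ G : MvPolynomial (Fin s × Fin (n + 1)) ℂ, G ≠ 0 ∧ ∀ v : Fin s → Fin (n + 1) → ℂ,
      eval (fun q => v q.1 q.2) G ≠ 0 → ∀ t : Fin k ↪ Fin s,
        (∀ c : Fin k → ℂ, ∃ f : Poly n, f.IsHomogeneous d ∧ ∀ i, eval (v (t i)) f = c i) ∧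
        ∀ f : Poly n, f.IsHomogeneous d → (∀ i, eval (v (t i)) f = 0) → f = 0 := by
  classical
  have e : Fin k ≃ Mon n d := (Fintype.equivFinOfCardEq hk).symm
  -- One determinant for every choice of k of the s points; their product controls all choices at
  -- once.
  set H : (Fin k ↪ Fin s) → MvPolynomial (Fin s × Fin (n + 1)) ℂ := fun t =>
    (Matrix.of fun i j => ∏ a, X (t i, a) ^ (e j).1 a).det with hH
  have heval : ∀ (v : Fin s → Fin (n + 1) → ℂ) t, eval (fun q => v q.1 q.2) (H t) =
      (Matrix.of fun i j => ∏ a, v (t i) a ^ (e j).1 a).det := by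
    intro v t
    rw [hH, RingHom.map_det]
    congr 1
    ext i j
    simp
  refine ⟨∏ t, H t, Finset.prod_ne_zero_iff.2 fun t _ => ?_, fun v hv t => ?_⟩
  · obtain ⟨w, hw⟩ := exists_interpolation_points n d e
    intro h0
    refine hw ?_
    have := heval (Function.extend t w 0) t
    rw [h0, map_zero] at this
    simp only [t.injective.extend_apply] at this
    exact this.symm
  · rw [map_prod] at hv
    have hdet := Finset.prod_ne_zero_iff.1 hv t (Finset.mem_univ _)
    rw [heval] at hdet
    set M : Matrix (Fin k) (Fin k) ℂ := Matrix.of fun i j => ∏ a, v (t i) a ^ (e j).1 a with hM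
    have hsum : ∀ c : Fin k → ℂ, ∀ i,
        eval (v (t i)) (∑ j, monomial (e j).1 (c j) : Poly n) = M.mulVec c i := by
      intro c i
      rw [map_sum, Matrix.mulVec, dotProduct]
      refine Finset.sum_congr rfl fun j _ => ?_
      rw [eval_monomial, Finsupp.prod_fintype _ _ (fun _ => pow_zero _), mul_comm]
      rfl
    constructor
    · intro c
      refine ⟨∑ j, monomial (e j).1 ((M⁻¹.mulVec c) j),
        Submodule.sum_mem (Form n d) fun j _ => isHomogeneous_mon _ _, fun i => ?_⟩
      rw [hsum, Matrix.mulVec_mulVec, Matrix.mul_nonsing_inv _ (isUnit_iff_ne_zero.2 hdet),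
        Matrix.one_mulVec]
    · intro f hf h0
      have hfe : f = ∑ j, monomial (e j).1 (coeff (e j).1 f) := by
        conv_lhs => rw [form_eq_sum hf]
        exact (e.sum_comp fun m : Mon n d => monomial m.1 (coeff m.1 f)).symm
      have h1 : M.mulVec (fun j => coeff (e j).1 f) = 0 := by
        ext i
        rw [← hsum, ← hfe]
        exact h0 i
      have h2 := Matrix.eq_zero_of_mulVec_eq_zero hdet h1
      rw [hfe]
      exact Finset.sum_eq_zero fun j _ => by rw [congrFun h2 j, Pi.zero_apply, map_zero]

end Interpolation

/-! ### The ideal of eight general points -/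

section EightPoints

open MvPolynomial

theorem mem_pointIdeal_iff {n d : ℕ} {v : Fin (n + 1) → ℂ} (hv : v ≠ 0) {f : Poly n}
    (hf : f.IsHomogeneous d) : f ∈ pointIdeal (Projectivization.mk ℂ v hv) ↔ eval v f = 0 := by
  have h1 : eval (Projectivization.mk ℂ v hv).rep f = 0 ↔ eval v f = 0 :=
    not_iff_not.1 (HomFun.ne_zero_congr ⟨f, hf, fun _ => rfl⟩ hv)
  rw [← h1, pointIdeal, Ideal.mem_iInf]
  simp only [RingHom.mem_ker, eval_smul_of_isHomogeneous hf]
  exact ⟨fun h => by simpa using h 1, fun h c => by rw [h, mul_zero]⟩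

theorem eval_smul_eq_sum {n : ℕ} (f : Poly n) (c : ℂ) (x : Fin (n + 1) → ℂ) :
    eval (c • x) f = ∑ t ∈ Finset.range (f.totalDegree + 1),
      c ^ t * eval x (homogeneousComponent t f) := by
  conv_lhs => rw [← sum_homogeneousComponent f]
  rw [map_sum]
  exact Finset.sum_congr rfl fun t _ =>
    eval_smul_of_isHomogeneous (homogeneousComponent_isHomogeneous _ _) _ _

/-- On the line of p, f becomes a polynomial in the scalar c whose coefficients are the values of
its components; if it vanishes for all c, so do they. -/
theorem homogeneousComponent_mem_pointIdeal {n : ℕ} {p : ProjSp (Fin (n + 1))} {f : Poly n}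
    (hf : f ∈ pointIdeal p) (t : ℕ) : homogeneousComponent t f ∈ pointIdeal p := by
  have hcomp : eval p.rep (homogeneousComponent t f) = 0 := by
    set P : Polynomial ℂ := ∑ t ∈ Finset.range (f.totalDegree + 1),
      Polynomial.monomial t (eval p.rep (homogeneousComponent t f)) with hP
    have h0 : P = 0 := by
      refine Polynomial.funext fun c => ?_
      have h1 : eval (c • p.rep) f = 0 := (Ideal.mem_iInf.1 hf) c
      rw [eval_smul_eq_sum] at h1
      rw [Polynomial.eval_zero, ← h1, hP, Polynomial.eval_finsetSum]
      exact Finset.sum_congr rfl fun t _ => by rw [Polynomial.eval_monomial, mul_comm]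
    by_cases ht : t ≤ f.totalDegree
    · have h2 := congrArg (Polynomial.coeff · t) h0
      simp only [hP, Polynomial.finsetSum_coeff, Polynomial.coeff_monomial,
        Finset.sum_ite_eq', Finset.mem_range, Polynomial.coeff_zero] at h2
      rwa [if_pos (by omega)] at h2
    · rw [homogeneousComponent_eq_zero _ _ (by omega), map_zero]
  rw [← p.mk_rep]
  exact (mem_pointIdeal_iff p.rep_nonzero (homogeneousComponent_isHomogeneous _ _)).2 hcomp

theorem mem_pointIdeal_of_X_mul_mem {n : ℕ} {p : ProjSp (Fin (n + 1))} {f : Poly n}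
    (h : ∀ i, X i * f ∈ pointIdeal p) : f ∈ pointIdeal p := by
  rw [← sum_homogeneousComponent f]
  refine Ideal.sum_mem _ fun t _ => ?_
  have hc := homogeneousComponent_isHomogeneous t f
  rw [← p.mk_rep]
  rw [mem_pointIdeal_iff p.rep_nonzero hc]
  obtain ⟨i, hi⟩ := Function.ne_iff.1 p.rep_nonzero
  have h1 := homogeneousComponent_mem_pointIdeal (h i) (t + 1)
  rw [mul_comm, homogeneousComponent_mul_right (isHomogeneous_X ℂ i), ← p.mk_rep,
    mem_pointIdeal_iff p.rep_nonzero (hc.mul (isHomogeneous_X ℂ i)), map_mul, eval_X] at h1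
  exact (mul_eq_zero.1 h1).resolve_right hi

variable {v : Fin 8 → Fin 3 → ℂ} (hv : ∀ i, v i ≠ 0)

/-- The ideal of eight points. -/
def eightIdeal : Ideal (Poly 2) := ⨅ i, pointIdeal (Projectivization.mk ℂ (v i) (hv i))

theorem mem_eightIdeal_iff {d : ℕ} {f : Poly 2} (hf : f.IsHomogeneous d) :
    f ∈ eightIdeal hv ↔ ∀ i, eval (v i) f = 0 := by
  rw [eightIdeal, Ideal.mem_iInf]
  exact forall_congr' fun i => mem_pointIdeal_iff (hv i) hf

/-- No three of the points lie on a line, and no six on a conic. -/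
structure IsGeneralEight (v : Fin 8 → Fin 3 → ℂ) : Prop where
  line : ∀ t : Fin 3 ↪ Fin 8,
    (∀ c : Fin 3 → ℂ, ∃ f : Poly 2, f.IsHomogeneous 1 ∧ ∀ i, eval (v (t i)) f = c i) ∧
    ∀ f : Poly 2, f.IsHomogeneous 1 → (∀ i, eval (v (t i)) f = 0) → f = 0
  conic : ∀ t : Fin 6 ↪ Fin 8,
    (∀ c : Fin 6 → ℂ, ∃ f : Poly 2, f.IsHomogeneous 2 ∧ ∀ i, eval (v (t i)) f = c i) ∧
    ∀ f : Poly 2, f.IsHomogeneous 2 → (∀ i, eval (v (t i)) f = 0) → f = 0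

theorem exists_embedding_of_card_le {k : ℕ} {S : Finset (Fin 8)} (h : k ≤ S.card) :
    ∃ t : Fin k ↪ Fin 8, ∀ i, t i ∈ S := by
  obtain ⟨e⟩ := Function.Embedding.nonempty_of_card_le (α := Fin k) (β := S) (by simpa using h)
  exact ⟨e.trans (Function.Embedding.subtype _), fun i => (e i).2⟩

variable {hv}

namespace IsGeneralEight

variable (hg : IsGeneralEight v)
include hg

/-- Of the eight points, at least three lie on the line or at least six lie on the conic, and both
are excluded. Hence no reducible cubic passes through all of them. -/
theorem eq_zero_of_mul {l q : Poly 2} (hl : l.IsHomogeneous 1) (hq : q.IsHomogeneous 2)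
    (h : ∀ i, eval (v i) (l * q) = 0) : l = 0 ∨ q = 0 := by
  classical
  set S : Finset (Fin 8) := Finset.univ.filter fun i => eval (v i) l = 0 with hS
  by_cases hc : 3 ≤ S.card
  · obtain ⟨t, ht⟩ := exists_embedding_of_card_le hc
    exact Or.inl ((hg.line t).2 l hl fun i => (Finset.mem_filter.1 (ht i)).2)
  · have h1 : 6 ≤ Sᶜ.card := by
      rw [Finset.card_compl, Fintype.card_fin]
      omega
    obtain ⟨t, ht⟩ := exists_embedding_of_card_le h1
    refine Or.inr ((hg.conic t).2 q hq fun i => ?_)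
    have h2 := h (t i)
    rw [map_mul] at h2
    refine (mul_eq_zero.1 h2).resolve_left fun h3 => ?_
    exact Finset.mem_compl.1 (ht i) (Finset.mem_filter.2 ⟨Finset.mem_univ _, h3⟩)

/-- Of the other seven points, five lie on a conic and two on a line that both avoid the i-th point.
Powers of the line raise the degree; the transposition moves the chosen point to index 0. -/
theorem exists_separating (i : Fin 8) (t : ℕ) :
    ∃ f : Poly 2, f.IsHomogeneous (t + 3) ∧ ∀ j, eval (v j) f = if j = i then 1 else 0 := by
  set σ : Equiv.Perm (Fin 8) := Equiv.swap 0 i with hσ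
  have h68 : 6 ≤ 8 := by norm_num
  set t6 : Fin 6 ↪ Fin 8 := ⟨fun j => σ (Fin.castLE h68 j),
    σ.injective.comp (Fin.castLE_injective h68)⟩ with ht6
  set t3 : Fin 3 ↪ Fin 8 := ⟨fun j => σ (![0, 6, 7] j), σ.injective.comp (by decide)⟩ with ht3
  obtain ⟨q, hq, hqv⟩ := (hg.conic t6).1 (Pi.single 0 1)
  obtain ⟨l, hl, hlv⟩ := (hg.line t3).1 (Pi.single 0 1)
  refine ⟨l ^ (t + 1) * q, ?_, fun j => ?_⟩
  · have := (hl.pow (t + 1)).mul hq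
    rwa [show 1 * (t + 1) + 2 = t + 3 by ring] at this
  · obtain ⟨k, rfl⟩ := σ.surjective j
    have hi : i = σ 0 := (Equiv.swap_apply_left 0 i).symm
    rw [map_mul, map_pow]
    have hq' : ∀ m : Fin 6, eval (v (σ (Fin.castLE h68 m))) q =
        (Pi.single 0 1 : Fin 6 → ℂ) m := hqv
    have hl' : ∀ m : Fin 3, eval (v (σ (![0, 6, 7] m))) l = (Pi.single 0 1 : Fin 3 → ℂ) m := hlv
    have h60 := hq' 0
    have h30 := hl' 0
    have h31 := hl' 1
    have h32 := hl' 2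
    simp only [Matrix.cons_val_zero, Matrix.cons_val_one, Matrix.cons_val, Pi.single_apply] at h30 h31 h32
    simp only [hi, σ.injective.eq_iff]
    by_cases hk : k.1 < 6
    · have h6 := hq' ⟨k, hk⟩
      rw [show Fin.castLE h68 (⟨k, hk⟩ : Fin 6) = k from rfl, Pi.single_apply] at h6
      rw [h6]
      by_cases hk0 : k = 0
      · subst hk0
        simp [h30]
      · have : (⟨k, hk⟩ : Fin 6) ≠ 0 := fun h => hk0 (Fin.ext (congrArg (Fin.val (n := 6)) h))
        simp [hk0, this]
    · have hk' : k = 6 ∨ k = 7 := by omega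
      rcases hk' with rfl | rfl
      · simp [h31]
      · simp [h32]

theorem finrank_degPart (t : ℕ) :
    Module.finrank ℂ (Form 2 (t + 3)) = Module.finrank ℂ (degPart (eightIdeal hv) (t + 3)) + 8 := by
  set E : Form 2 (t + 3) →ₗ[ℂ] (Fin 8 → ℂ) :=
    LinearMap.pi fun i => (aeval (v i)).toLinearMap ∘ₗ (Form 2 (t + 3)).subtype with hE
  have hEa : ∀ f i, E f i = eval (v i) (f : Poly 2) := fun f i => by
    simp [hE, aeval_eq_eval]
  have hsurj : LinearMap.range E = ⊤ := by
    refine LinearMap.range_eq_top.2 fun c => ?_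
    choose f hf hfv using fun i => hg.exists_separating i t
    refine ⟨∑ i, c i • ⟨f i, hf i⟩, ?_⟩
    ext j
    simp [map_sum, hEa, hfv]
  have hker : (LinearMap.ker E).map (Form 2 (t + 3)).subtype = degPart (eightIdeal hv) (t + 3) := by
    ext f
    constructor
    · rintro ⟨g, hg, rfl⟩
      refine ⟨(mem_eightIdeal_iff hv g.2).2 fun i => ?_, g.2⟩
      rw [← hEa]
      exact congrFun hg i
    · rintro ⟨hf, hhom⟩
      refine ⟨⟨f, hhom⟩, ?_, rfl⟩
      ext i
      rw [hEa]
      exact (mem_eightIdeal_iff hv hhom).1 hf i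
  have h1 := LinearMap.finrank_range_add_finrank_ker E
  have h2 := Submodule.finrank_map_subtype_eq (Form 2 (t + 3)) (LinearMap.ker E)
  rw [hsurj, finrank_top, Module.finrank_fin_fun] at h1
  rw [hker] at h2
  omega

theorem isSchemeIdeal : IsSchemeIdeal 8 (eightIdeal hv) where
  homogeneous f hf t := by
    rw [eightIdeal, Ideal.mem_iInf] at hf ⊢
    exact fun i => homogeneousComponent_mem_pointIdeal (hf i) t
  saturated f hf := by
    simp only [eightIdeal, Ideal.mem_iInf] at hf ⊢
    exact fun i => mem_pointIdeal_of_X_mul_mem fun j => hf j i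
  length := by
    refine Filter.eventually_atTop.2 ⟨3, fun t ht => ?_⟩
    obtain ⟨u, rfl⟩ := Nat.exists_eq_add_of_le' ht
    exact hg.finrank_degPart u

end IsGeneralEight

/-- Two independent cubics are relatively prime if the space they come from contains no
reducible cubic. -/
theorem isRelPrime_of_not_reducible {C : Fin 2 → Poly 2} (hC : ∀ i, (C i).IsHomogeneous 3)
    (hli : LinearIndependent ℂ C)
    (h₁ : ∀ l q q' : Poly 2, l.IsHomogeneous 1 → q.IsHomogeneous 2 → q'.IsHomogeneous 2 →
      l ≠ 0 → C 0 = l * q → C 1 = l * q' → False)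
    (h₂ : ∀ q l l' : Poly 2, q.IsHomogeneous 2 → l.IsHomogeneous 1 → l'.IsHomogeneous 1 →
      q ≠ 0 → C 0 = q * l → C 1 = q * l' → False) : IsRelPrime (C 0) (C 1) := by
  intro h hd0 hd1
  have hne0 := hli.ne_zero 0
  obtain ⟨e, he⟩ := isHomogeneous_of_dvd (hC 0) hne0 hd0
  obtain ⟨x, hx⟩ := hd0
  obtain ⟨y, hy⟩ := hd1
  have hh : h ≠ 0 := by
    rintro rfl
    exact hne0 (by rw [hx, zero_mul])
  have hx0 : x ≠ 0 := by
    rintro rfl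
    exact hne0 (by rw [hx, mul_zero])
  have hle : e ≤ 3 := by
    obtain ⟨f, hf⟩ := isHomogeneous_of_dvd (hC 0) hne0 ⟨h, by rw [hx, mul_comm]⟩
    have h1 := (he.mul hf).totalDegree (mul_ne_zero hh hx0)
    rw [← hx, (hC 0).totalDegree hne0] at h1
    omega
  have hquot : ∀ z i, C i = h * z → ∀ d, d + e = 3 → z.IsHomogeneous d := by
    intro z i hz d hd
    refine isHomogeneous_of_mul_eq he hh ?_
    rw [mul_comm, ← hz, hd]
    exact hC i
  -- The common factor is a form of degree e ≤ 3. Degree 0 is the claim, degrees 1 and 2 are the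
  -- excluded factorisations, and degree 3 would make the cubics proportional.
  rcases Nat.lt_or_ge e 1 with h0 | h1
  · obtain rfl : e = 0 := by omega
    exact isUnit_of_isHomogeneous_zero he hh
  exfalso
  rcases Nat.lt_or_ge e 2 with h2 | h2
  · obtain rfl : e = 1 := by omega
    exact h₁ h x y he (hquot x 0 hx 2 rfl) (hquot y 1 hy 2 rfl) hh hx hy
  rcases Nat.lt_or_ge e 3 with h3 | h3
  · obtain rfl : e = 2 := by omega
    exact h₂ h x y he (hquot x 0 hx 1 rfl) (hquot y 1 hy 1 rfl) hh hx hy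
  · obtain rfl : e = 3 := by omega
    obtain ⟨a, rfl⟩ := isHomogeneous_zero_exists (hquot x 0 hx 0 rfl)
    obtain ⟨b, rfl⟩ := isHomogeneous_zero_exists (hquot y 1 hy 0 rfl)
    have h4 := Fintype.linearIndependent_iff.1 hli ![b, -a] (by
      rw [Fin.sum_univ_two, hx, hy]
      simp only [Matrix.cons_val_zero, Matrix.cons_val_one, smul_eq_C_mul, C_neg]
      ring)
    have h5 := h4 1
    simp only [Matrix.cons_val_one] at h5
    exact hx0 (by simpa using h5)

/-- The Hilbert function gives 2 cubics, 7 quartics and 13 quintics, and the absence of reducible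
cubics gives coprimality. -/
theorem IsGeneralEight.exists_hilbertBurch (hg : IsGeneralEight v) :
    ∃ D : HilbertBurch, D.ideal = eightIdeal hv := by
  have f3 := two_mul_finrank_form_two 3
  have f4 := two_mul_finrank_form_two 4
  have f5 := two_mul_finrank_form_two 5
  have d3 := hg.finrank_degPart (hv := hv) 0
  have d4 := hg.finrank_degPart (hv := hv) 1
  have d5 := hg.finrank_degPart (hv := hv) 2
  simp only [Nat.reduceAdd] at d3 d4 d5
  refine exists_hilbertBurch_of_isSchemeIdeal hg.isSchemeIdeal (by omega) (by omega) (by omega)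
    fun b hb hli => ?_
  have hz : ∀ i, eval (v i) (b 0) = 0 := (mem_eightIdeal_iff hv (hb 0).2).1 (hb 0).1
  refine isRelPrime_of_not_reducible (fun i => (hb i).2) hli ?_ ?_
  · intro l q q' hl hq _ _ h0 _
    rcases hg.eq_zero_of_mul hl hq (fun i => h0 ▸ hz i) with rfl | rfl
    · exact hli.ne_zero 0 (by rw [h0, zero_mul])
    · exact hli.ne_zero 0 (by rw [h0, mul_zero])
  · intro q l l' hq hl _ _ h0 _
    rcases hg.eq_zero_of_mul hl hq (fun i => by rw [mul_comm, ← h0]; exact hz i) with rfl | rfl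
    · exact hli.ne_zero 0 (by rw [h0, mul_zero])
    · exact hli.ne_zero 0 (by rw [h0, zero_mul])

theorem exists_general_eight :
    ∃ G : MvPolynomial (Fin 8 × Fin (2 + 1)) ℂ, G ≠ 0 ∧ ∀ v : Fin 8 → Fin 3 → ℂ,
      eval (fun q => v q.1 q.2) G ≠ 0 → IsGeneralEight v := by
  obtain ⟨G, hG, h⟩ := exists_interpolation 2 1 8 (k := 3) (card_mon 2 1)
  obtain ⟨G', hG', h'⟩ := exists_interpolation 2 2 8 (k := 6) (card_mon 2 2)
  refine ⟨G * G', mul_ne_zero hG hG', fun v hv => ?_⟩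
  rw [map_mul] at hv
  exact ⟨h v (left_ne_zero_of_mul hv), h' v (right_ne_zero_of_mul hv)⟩

theorem generalPointsHaveBettiNumbers : GeneralPointsHaveBettiNumbers 2 8 hbBetti := by
  obtain ⟨G, hG, h⟩ := exists_general_eight
  refine ⟨G, hG, fun v hv hvG => ?_⟩
  obtain ⟨D, hD⟩ := (h v hvG).exists_hilbertBurch (hv := hv)
  change HasBettiNumbers (eightIdeal hv) hbBetti
  rw [← hD]
  exact D.hasBettiNumbers

theorem HilbertBurch.isResolutionGeneral (D : HilbertBurch) : IsResolutionGeneral 8 D.ideal :=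
  ⟨hbBetti, D.hasBettiNumbers, generalPointsHaveBettiNumbers⟩

/-- A resolution-general ideal has the Hilbert function of eight general points. -/
theorem IsResolutionGeneral.finrank_degPart {I : Ideal (Poly 2)} (hI : IsResolutionGeneral 8 I)
    (t : ℕ) :
    Module.finrank ℂ (Form 2 (t + 3)) = Module.finrank ℂ (degPart I (t + 3)) + 8 := by
  obtain ⟨β, hβ, G, hG, h⟩ := hI
  obtain ⟨G', hG', h'⟩ := exists_general_eight
  -- One configuration is to be general both for the given Betti numbers and for the known Hilbert
  -- function. The product of the first coordinates keeps all eight vectors nonzero.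
  obtain ⟨a, ha⟩ : ∃ a : Fin 8 × Fin (2 + 1) → ℂ,
      eval a (G * G' * ∏ i, X (i, 0)) ≠ 0 := by
    by_contra hcon
    push Not at hcon
    have h0 : G * G' * ∏ i, X (i, 0) = 0 :=
      MvPolynomial.funext fun x => by rw [hcon x, map_zero]
    exact mul_ne_zero (mul_ne_zero hG hG')
      (Finset.prod_ne_zero_iff.2 fun i _ => X_ne_zero (i, (0 : Fin (2 + 1)))) h0
  rw [map_mul, map_mul, map_prod] at ha
  simp only [eval_X] at ha
  set v : Fin 8 → Fin 3 → ℂ := fun i j => a (i, j) with hv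
  have hv0 : ∀ i, v i ≠ 0 := fun i h0 =>
    Finset.prod_ne_zero_iff.1 (right_ne_zero_of_mul ha) i (Finset.mem_univ i) (congrFun h0 0)
  have hβ' := h v hv0 (left_ne_zero_of_mul (left_ne_zero_of_mul ha))
  rw [finrank_degPart_eq_of_hasBettiNumbers hβ hβ']
  exact (h' v (right_ne_zero_of_mul (left_ne_zero_of_mul ha))).finrank_degPart (hv := hv0) t

end EightPoints

/-! ### Apolarity through linear functionals -/

section Apolarity

open MvPolynomial

variable {n : ℕ}

/-- The product of the factorials of the exponents. -/
def expFactorial (m : Fin (n + 1) →₀ ℕ) : ℂ := ∏ i, ((m i).factorial : ℂ)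

theorem expFactorial_ne_zero (m : Fin (n + 1) →₀ ℕ) : expFactorial m ≠ 0 :=
  Finset.prod_ne_zero_iff.2 fun _ _ => Nat.cast_ne_zero.2 (Nat.factorial_ne_zero _)

theorem expFactorial_add_single (m : Fin (n + 1) →₀ ℕ) (i : Fin (n + 1)) :
    expFactorial (m + Finsupp.single i 1) = expFactorial m * (m i + 1) := by
  unfold expFactorial
  rw [← Finset.mul_prod_erase _ _ (Finset.mem_univ i),
    ← Finset.mul_prod_erase _ (fun j => ((m j).factorial : ℂ)) (Finset.mem_univ i)]
  have h1 : ∀ j ∈ Finset.univ.erase i, (((m + Finsupp.single i 1 : Fin (n + 1) →₀ ℕ) j).factorial : ℂ) =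
      ((m j).factorial : ℂ) := by
    intro j hj
    rw [Finsupp.add_apply, Finsupp.single_eq_of_ne (Finset.ne_of_mem_erase hj), add_zero]
  rw [Finset.prod_congr rfl h1, Finsupp.add_apply, Finsupp.single_eq_same, Nat.factorial_succ]
  push_cast
  ring

/-- The value of a derivative of `F` at the origin. -/
def divCoeff (F : Poly n) (m : Fin (n + 1) →₀ ℕ) : ℂ := expFactorial m * coeff m F

theorem divCoeff_pderiv (F : Poly n) (i : Fin (n + 1)) (m : Fin (n + 1) →₀ ℕ) :
    divCoeff (pderiv i F) m = divCoeff F (m + Finsupp.single i 1) := by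
  rw [divCoeff, divCoeff, coeff_pderiv, expFactorial_add_single]
  ring

theorem divCoeff_pderiv_pow (F : Poly n) (i : Fin (n + 1)) (k : ℕ) (m : Fin (n + 1) →₀ ℕ) :
    divCoeff ((((pderiv i).toLinearMap : Module.End ℂ (Poly n)) ^ k) F) m =
      divCoeff F (m + Finsupp.single i k) := by
  induction k generalizing m with
  | zero => simp
  | succ k ih =>
    rw [pow_succ', Module.End.mul_apply]
    change divCoeff (pderiv i _) m = _
    rw [divCoeff_pderiv, ih, add_assoc, ← Finsupp.single_add, add_comm 1 k]

theorem divCoeff_partialOp (F : Poly n) (m e : Fin (n + 1) →₀ ℕ) :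
    divCoeff (partialOp m F) e = divCoeff F (e + m) := by
  have key : ∀ (L : List (Fin (n + 1))) (e : Fin (n + 1) →₀ ℕ),
      divCoeff ((L.map fun i =>
        ((pderiv i).toLinearMap : Module.End ℂ (Poly n)) ^ m i).prod F) e =
      divCoeff F (e + (L.map fun i => Finsupp.single i (m i)).sum) := by
    intro L
    induction L with
    | nil => intro e; simp
    | cons i L ih =>
      intro e
      rw [List.map_cons, List.prod_cons, Module.End.mul_apply, divCoeff_pderiv_pow, ih,
        List.map_cons, List.sum_cons, add_assoc]
  rw [partialOp, key]
  congr 2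
  rw [← List.ofFn_eq_map, List.sum_ofFn]
  exact Finsupp.univ_sum_single m

/-- The functional `f ↦ (f ∘ F)(0)`. -/
def apolarPairing (F : Poly n) : Poly n →ₗ[ℂ] ℂ := (basisMonomials _ ℂ).constr ℂ (divCoeff F)

theorem apolarPairing_monomial (F : Poly n) (m : Fin (n + 1) →₀ ℕ) (a : ℂ) :
    apolarPairing F (monomial m a) = a * divCoeff F m := by
  have h1 : (monomial m a : Poly n) = a • basisMonomials _ ℂ m := by
    rw [coe_basisMonomials, smul_monomial, smul_eq_mul, mul_one]
  rw [h1, map_smul, apolarPairing, Module.Basis.constr_basis, smul_eq_mul]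

/-- Taylor coefficients at the origin: differentiating f ∘ F by ∂^e and evaluating at 0 is the same
as pairing the product of f and the monomial e with F. -/
theorem divCoeff_contract (f F : Poly n) (e : Fin (n + 1) →₀ ℕ) :
    divCoeff (contract f F) e = apolarPairing F (monomial e 1 * f) := by
  conv_rhs => rw [f.as_sum]
  rw [Finset.mul_sum, map_sum, divCoeff, contract, coeff_sum, Finset.mul_sum]
  refine Finset.sum_congr rfl fun m _ => ?_
  rw [monomial_mul, one_mul, apolarPairing_monomial, ← divCoeff_partialOp, coeff_smul, divCoeff,
    smul_eq_mul]
  ring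

theorem contract_eq_zero_iff (f F : Poly n) :
    contract f F = 0 ↔ ∀ e, apolarPairing F (monomial e 1 * f) = 0 := by
  simp only [← divCoeff_contract, divCoeff, mul_eq_zero, expFactorial_ne_zero, false_or]
  exact ⟨fun h e => by rw [h, coeff_zero], fun h => by ext e; rw [h, coeff_zero]⟩

/-- The functional on forms of degree `d` with the given coefficients. -/
def formFunctional {d : ℕ} (c : Mon n d → ℂ) : Poly n →ₗ[ℂ] ℂ :=
  ∑ m : Mon n d, (expFactorial m.1 * c m) • lcoeff ℂ m.1

theorem formFunctional_apply {d : ℕ} (c : Mon n d → ℂ) (f : Poly n) :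
    formFunctional c f = ∑ m : Mon n d, expFactorial m.1 * c m * coeff m.1 f := by
  simp [formFunctional]

theorem apolarPairing_eq {d : ℕ} {F : Poly n} (hF : F.IsHomogeneous d) (f : Poly n) :
    apolarPairing F f = formFunctional (fun m : Mon n d => coeff m.1 F) f := by
  have h : apolarPairing F = formFunctional (fun m : Mon n d => coeff m.1 F) := by
    refine (basisMonomials _ ℂ).ext fun m => ?_
    rw [coe_basisMonomials, apolarPairing_monomial, one_mul, formFunctional_apply, divCoeff]
    by_cases hm : m.degree = d
    · rw [Finset.sum_eq_single ⟨m, mem_mon hm⟩]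
      · simp
      · intro b _ hb
        rw [coeff_monomial, if_neg fun h => hb (Subtype.ext h.symm), mul_zero]
      · simp
    · rw [hF.coeff_eq_zero hm, mul_zero]
      refine (Finset.sum_eq_zero fun b _ => ?_).symm
      rw [coeff_monomial, if_neg, mul_zero]
      rintro rfl
      exact hm (mon_degree b)
  rw [h]

theorem formFunctional_homogeneousComponent {d : ℕ} (c : Mon n d → ℂ) (f : Poly n) :
    formFunctional c (homogeneousComponent d f) = formFunctional c f := by
  rw [formFunctional_apply, formFunctional_apply]
  exact Finset.sum_congr rfl fun m _ => by rw [coeff_homogeneousComponent, if_pos (mon_degree m)]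

/-- The pairing with a form of degree d sees only components of degree d, and an ideal is closed
under multiplication by monomials, so apolarity is tested on its degree d part alone. -/
theorem isApolar_span_iff {d k : ℕ} {I : Ideal (Poly n)}
    (hI : ∀ f ∈ I, ∀ t, homogeneousComponent t f ∈ I) {F : Fin k → Poly n}
    (hF : ∀ i, (F i).IsHomogeneous d) :
    IsApolar I (Submodule.span ℂ (Set.range F)) ↔
      ∀ f ∈ degPart I d, ∀ i, formFunctional (fun m : Mon n d => coeff m.1 (F i)) f = 0 := by
  constructor
  · intro h f hf i
    have h1 := (contract_eq_zero_iff f (F i)).1 (h f hf.1 _ (Submodule.subset_span ⟨i, rfl⟩)) 0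
    rw [← apolarPairing_eq (hF i)]
    rwa [← one_def, one_mul] at h1
  · intro h f hf G hG
    induction hG using Submodule.span_induction with
    | mem G hG =>
      obtain ⟨i, rfl⟩ := hG
      rw [contract_eq_zero_iff]
      intro e
      rw [apolarPairing_eq (hF i), ← formFunctional_homogeneousComponent]
      exact h _ ⟨hI _ (Ideal.mul_mem_left _ _ hf) _, homogeneousComponent_isHomogeneous _ _⟩ i
    | zero => simp [contract]
    | add G G' _ _ h1 h2 =>
      have h3 : contract f (G + G') = contract f G + contract f G' := by
        simp only [contract, map_add, smul_add, Finset.sum_add_distrib]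
      rw [h3, h1, h2, add_zero]
    | smul a G _ h1 =>
      have h3 : contract f (a • G) = a • contract f G := by
        simp only [contract, map_smul, Finset.smul_sum]
        exact Finset.sum_congr rfl fun m _ => smul_comm _ _ _
      rw [h3, h1, smul_zero]

end Apolarity

/-! ### The cubics apolar to a pencil of functionals -/

section Pencil

open MvPolynomial

/-- The linear form with the given coefficients. -/
def linForm (c : Fin 3 → ℂ) : Poly 2 := C (c 0) * X 0 + C (c 1) * X 1 + C (c 2) * X 2

theorem linForm_hom (c : Fin 3 → ℂ) : (linForm c).IsHomogeneous 1 :=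
  ((isHomogeneous_C_mul_X _ _).add (isHomogeneous_C_mul_X _ _)).add (isHomogeneous_C_mul_X _ _)

theorem exists_linForm {l : Poly 2} (hl : l.IsHomogeneous 1) : ∃ c, l = linForm c := by
  obtain ⟨c, hc⟩ := eq_sum_X_of_isHomogeneous_one hl
  exact ⟨c, by rw [hc, Fin.sum_univ_three, linForm]; simp only [smul_eq_C_mul]⟩

theorem eval_linForm (c p : Fin 3 → ℂ) :
    eval p (linForm c) = c 0 * p 0 + c 1 * p 1 + c 2 * p 2 := by
  simp [linForm]

theorem linForm_smul (a : ℂ) (c : Fin 3 → ℂ) : linForm (a • c) = C a * linForm c := by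
  simp only [linForm, Pi.smul_apply, smul_eq_mul, C_mul]
  ring

theorem linForm_eq_zero_iff {c : Fin 3 → ℂ} : linForm c = 0 ↔ c = 0 := by
  constructor
  · intro h
    ext i
    have := congrArg (eval (Pi.single i 1)) h
    rw [eval_linForm, map_zero] at this
    fin_cases i <;> simpa using this
  · rintro rfl
    simp [linForm]

theorem map_C_mul {M : Type*} [AddCommGroup M] [Module ℂ M] (φ : Poly 2 →ₗ[ℂ] M) (c : ℂ)
    (f : Poly 2) : φ (C c * f) = c • φ f := by
  rw [← smul_eq_C_mul, map_smul]

variable (lam mu : Poly 2 →ₗ[ℂ] ℂ)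

/-- The cubics whose multiples are annihilated by both functionals. -/
def apolarCubics : Submodule ℂ (Poly 2) where
  carrier := {f | f.IsHomogeneous 3 ∧ ∀ i, lam (X i * f) = 0 ∧ mu (X i * f) = 0}
  add_mem' hf hg := ⟨hf.1.add hg.1, fun i => by
    rw [mul_add, map_add, map_add, (hf.2 i).1, (hf.2 i).2, (hg.2 i).1, (hg.2 i).2]
    simp⟩
  zero_mem' := ⟨isHomogeneous_zero _ _ _, fun i => by simp⟩
  smul_mem' c f hf := ⟨(Form 2 3).smul_mem c hf.1, fun i => by
    rw [mul_smul_comm, map_smul, map_smul, (hf.2 i).1, (hf.2 i).2]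
    simp⟩

/-- The apolar cubics through a point. -/
def apolarCubicsAt (p : Fin 3 → ℂ) : Submodule ℂ (Poly 2) :=
  apolarCubics lam mu ⊓ LinearMap.ker (aeval p : Poly 2 →ₐ[ℂ] ℂ).toLinearMap

variable {lam mu}

theorem mem_apolarCubicsAt {p : Fin 3 → ℂ} {f : Poly 2} :
    f ∈ apolarCubicsAt lam mu p ↔ f ∈ apolarCubics lam mu ∧ eval p f = 0 := by
  rw [apolarCubicsAt, Submodule.mem_inf, LinearMap.mem_ker, AlgHom.toLinearMap_apply,
    aeval_eq_eval]

theorem apolarCubics_swap : apolarCubics lam mu = apolarCubics mu lam := by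
  ext f
  exact and_congr_right fun _ => forall_congr' fun i => and_comm

theorem apolarCubicsAt_swap (p : Fin 3 → ℂ) :
    apolarCubicsAt lam mu p = apolarCubicsAt mu lam p := by
  rw [apolarCubicsAt, apolarCubics_swap, apolarCubicsAt]

theorem apolar_mul_eq_zero {f m : Poly 2} (hf : f ∈ apolarCubics lam mu) (hm : m.IsHomogeneous 1) :
    lam (m * f) = 0 ∧ mu (m * f) = 0 := by
  obtain ⟨c, rfl⟩ := exists_linForm hm
  have e : linForm c * f = C (c 0) * (X 0 * f) + C (c 1) * (X 1 * f) + C (c 2) * (X 2 * f) := by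
    rw [linForm]
    ring
  simp only [e, map_add, map_C_mul, (hf.2 _).1, (hf.2 _).2]
  simp

theorem mem_apolarCubics {f : Poly 2} (hf : f.IsHomogeneous 3)
    (h : ∀ m : Poly 2, m.IsHomogeneous 1 → lam (m * f) = 0 ∧ mu (m * f) = 0) :
    f ∈ apolarCubics lam mu :=
  ⟨hf, fun i => h _ (isHomogeneous_X ℂ i)⟩

/-- The determinant with rows `p`, `x`, `y`. -/
def triple (p : Fin 3 → ℂ) (x y : Fin 3 → Poly 2) : Poly 2 :=
  C (p 0) * (x 1 * y 2 - x 2 * y 1) + C (p 1) * (x 2 * y 0 - x 0 * y 2) +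
    C (p 2) * (x 0 * y 1 - x 1 * y 0)

theorem map_triple (φ : Poly 2 →ₗ[ℂ] ℂ) (p : Fin 3 → ℂ) (x y : Fin 3 → Poly 2) :
    φ (triple p x y) = p 0 * (φ (x 1 * y 2) - φ (x 2 * y 1)) +
      p 1 * (φ (x 2 * y 0) - φ (x 0 * y 2)) + p 2 * (φ (x 0 * y 1) - φ (x 1 * y 0)) := by
  simp only [triple, map_add, map_C_mul, map_sub, smul_eq_mul]

/-- The operator on quadratic forms that carries the form `q, q' ↦ lam (q * q')` to a multiple of
`q, q' ↦ mu (q * q')`. -/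
structure Transfer (lam mu : Poly 2 →ₗ[ℂ] ℂ) where
  T : Poly 2 →ₗ[ℂ] Poly 2
  δ : ℂ
  δ_ne : δ ≠ 0
  hom : ∀ q, (T q).IsHomogeneous 2
  apply : ∀ q q' : Poly 2, q.IsHomogeneous 2 → q'.IsHomogeneous 2 →
    lam (T q * q') = δ * mu (q * q')
  nondeg : ∀ q : Poly 2, q.IsHomogeneous 2 →
    (∀ q' : Poly 2, q'.IsHomogeneous 2 → lam (q * q') = 0) → q = 0

namespace Transfer

variable (t : Transfer lam mu)

/-- The alternating form on linear forms whose radical gives the distinguished cubic. -/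
def alt (p : Fin 3 → ℂ) (m m' : Poly 2) : ℂ :=
  lam (triple p (fun i => t.T (m * X i)) fun i => t.T (m' * X i))

/-- The coefficients of the linear form in the radical of `alt`. -/
def radical (p : Fin 3 → ℂ) : Fin 3 → ℂ :=
  ![t.alt p (X 1) (X 2), t.alt p (X 2) (X 0), t.alt p (X 0) (X 1)]

/-- The cubic attached to a linear form. -/
def cubicOf (p : Fin 3 → ℂ) (m : Poly 2) : Poly 2 := triple p (fun i => t.T (m * X i)) X

/-- The distinguished cubic at a point. -/
def cubic (p : Fin 3 → ℂ) : Poly 2 := t.cubicOf p (linForm (t.radical p))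

theorem T_linForm_mul (c : Fin 3 → ℂ) (q : Poly 2) : t.T (linForm c * q) =
    C (c 0) * t.T (X 0 * q) + C (c 1) * t.T (X 1 * q) + C (c 2) * t.T (X 2 * q) := by
  have e : linForm c * q = C (c 0) * (X 0 * q) + C (c 1) * (X 1 * q) + C (c 2) * (X 2 * q) := by
    rw [linForm]
    ring
  simp only [e, map_add, map_C_mul, smul_eq_C_mul]

/-- In three variables an alternating form depends only on the 2 × 2 minors of its arguments, so it
is a determinant whose first row is the vector `radical`; this vector spans its radical when it is
nonzero. -/
theorem alt_linForm (p a b : Fin 3 → ℂ) : t.alt p (linForm a) (linForm b) =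
    t.radical p 0 * (a 1 * b 2 - a 2 * b 1) + t.radical p 1 * (a 2 * b 0 - a 0 * b 2) +
      t.radical p 2 * (a 0 * b 1 - a 1 * b 0) := by
  have e : triple p (fun i => t.T (linForm a * X i)) (fun i => t.T (linForm b * X i)) =
      C (a 1 * b 2 - a 2 * b 1) *
        triple p (fun i => t.T (X 1 * X i)) (fun i => t.T (X 2 * X i)) +
      C (a 2 * b 0 - a 0 * b 2) *
        triple p (fun i => t.T (X 2 * X i)) (fun i => t.T (X 0 * X i)) +
      C (a 0 * b 1 - a 1 * b 0) *
        triple p (fun i => t.T (X 0 * X i)) (fun i => t.T (X 1 * X i)) := by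
    simp only [T_linForm_mul, triple, C_sub, C_mul]
    ring
  rw [alt, e, map_add, map_add, map_C_mul, map_C_mul, map_C_mul]
  simp only [radical, Matrix.cons_val_zero, Matrix.cons_val_one, Matrix.cons_val, smul_eq_mul]
  unfold alt
  ring

theorem cubicOf_hom (p : Fin 3 → ℂ) (m : Poly 2) : (t.cubicOf p m).IsHomogeneous 3 := by
  have h : ∀ c : ℂ, ∀ i j k l : Fin 3, (C c * (t.T (m * X i) * X j -
      t.T (m * X k) * X l) : Poly 2).IsHomogeneous 3 := fun c i j k l =>
    (((t.hom _).mul (isHomogeneous_X ℂ j)).sub ((t.hom _).mul (isHomogeneous_X ℂ l))).C_mul c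
  exact ((h _ _ _ _ _).add (h _ _ _ _ _)).add (h _ _ _ _ _)

theorem eval_cubicOf (p : Fin 3 → ℂ) (m : Poly 2) : eval p (t.cubicOf p m) = 0 := by
  simp only [cubicOf, triple, map_add, map_mul, map_sub, eval_C, eval_X]
  ring

theorem mul_cubicOf (p : Fin 3 → ℂ) (m m' : Poly 2) : m' * t.cubicOf p m =
    triple p (fun i => t.T (m * X i)) (fun i => m' * X i) := by
  simp only [cubicOf, triple]
  ring

/-- The transfer makes lam(T(m X_i) · m' X_j) equal to δ mu(m m' X_i X_j), which is symmetric in i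
and j, while the determinant with row p antisymmetrises in i and j. -/
theorem lam_mul_cubicOf (p : Fin 3 → ℂ) {m m' : Poly 2} (hm : m.IsHomogeneous 1)
    (hm' : m'.IsHomogeneous 1) : lam (m' * t.cubicOf p m) = 0 := by
  have h : ∀ i j, lam (t.T (m * X i) * (m' * X j)) = lam (t.T (m * X j) * (m' * X i)) := by
    intro i j
    rw [t.apply _ _ (hm.mul (isHomogeneous_X ℂ i)) (hm'.mul (isHomogeneous_X ℂ j)),
      t.apply _ _ (hm.mul (isHomogeneous_X ℂ j)) (hm'.mul (isHomogeneous_X ℂ i))]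
    congr 2
    ring
  rw [mul_cubicOf, map_triple, h 1 2, h 2 0, h 0 1]
  ring

/-- Transferring once more turns `mu` into `lam` of a product of two images of T. Thus apolarity of
the cubic to `mu` says that m lies in the radical of `alt`. -/
theorem mu_mul_cubicOf (p : Fin 3 → ℂ) {m m' : Poly 2}
    (hm' : m'.IsHomogeneous 1) : t.δ * mu (m' * t.cubicOf p m) = -t.alt p m' m := by
  have h : ∀ i j, t.δ * mu (t.T (m * X i) * (m' * X j)) =
      lam (t.T (m' * X j) * t.T (m * X i)) := by
    intro i j
    rw [t.apply _ _ (hm'.mul (isHomogeneous_X ℂ j)) (t.hom _), mul_comm (t.T _)]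
  rw [mul_cubicOf, map_triple, alt, map_triple, ← h, ← h, ← h, ← h, ← h, ← h]
  ring

theorem alt_radical (p : Fin 3 → ℂ) {m : Poly 2} (hm : m.IsHomogeneous 1) :
    t.alt p m (linForm (t.radical p)) = 0 := by
  obtain ⟨c, rfl⟩ := exists_linForm hm
  rw [alt_linForm]
  ring

theorem cubic_mem (p : Fin 3 → ℂ) : t.cubic p ∈ apolarCubicsAt lam mu p := by
  refine mem_apolarCubicsAt.2 ⟨mem_apolarCubics (t.cubicOf_hom _ _) fun m hm =>
    ⟨t.lam_mul_cubicOf p (linForm_hom _) hm, ?_⟩, t.eval_cubicOf _ _⟩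
  refine (mul_eq_zero.1 ?_).resolve_left t.δ_ne
  rw [cubic, mu_mul_cubicOf _ _ hm, alt_radical _ _ hm, neg_zero]

theorem cubicOf_C_mul (p : Fin 3 → ℂ) (c : ℂ) (m : Poly 2) :
    t.cubicOf p (C c * m) = C c * t.cubicOf p m := by
  simp only [cubicOf, triple, mul_assoc, map_C_mul, smul_eq_C_mul]
  ring

/-- A linear form whose cubic is apolar lies in the radical. -/
theorem exists_smul_radical {p : Fin 3 → ℂ} (hr : t.radical p ≠ 0) {m : Poly 2}
    (hm : m.IsHomogeneous 1) (h : t.cubicOf p m ∈ apolarCubics lam mu) :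
    ∃ c : ℂ, t.cubicOf p m = c • t.cubic p := by
  obtain ⟨a, rfl⟩ := exists_linForm hm
  have halt : ∀ b, t.alt p (linForm b) (linForm a) = 0 := by
    intro b
    rw [← neg_eq_zero, ← t.mu_mul_cubicOf p (linForm_hom b),
      (apolar_mul_eq_zero h (linForm_hom b)).2, mul_zero]
  have h0 := halt (Pi.single 0 1)
  have h1 := halt (Pi.single 1 1)
  have h2 := halt (Pi.single 2 1)
  rw [alt_linForm] at h0 h1 h2
  simp at h0 h1 h2
  obtain ⟨k, hk⟩ := Function.ne_iff.1 hr
  have hc : a = (a k / t.radical p k) • t.radical p := by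
    rw [Pi.zero_apply] at hk
    ext i
    rw [Pi.smul_apply, smul_eq_mul, div_mul_eq_mul_div, eq_div_iff hk]
    fin_cases k <;> fin_cases i <;> simp only [Fin.zero_eta, Fin.mk_one, Fin.reduceFinMk] <;>
      first
        | rfl
        | linear_combination h0
        | linear_combination h1
        | linear_combination h2
        | linear_combination -h0
        | linear_combination -h1
        | linear_combination -h2
  refine ⟨a k / t.radical p k, ?_⟩
  conv_lhs => rw [hc, linForm_smul, cubicOf_C_mul]
  rw [smul_eq_C_mul, cubic]

end Transfer

/-! ### Linear forms through a point -/

/-- Two independent linear forms through the point `p`. -/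
structure IsFrame (p : Fin 3 → ℂ) (l : Fin 2 → Poly 2) : Prop where
  hom : ∀ i, (l i).IsHomogeneous 1
  indep : LinearIndependent ℂ l
  eval : ∀ i, eval p (l i) = 0

theorem linearIndependent_pair {l : Fin 2 → Poly 2} (h : LinearIndependent ℂ l) :
    LinearIndependent ℂ ![l 0, l 1] := by
  convert h using 1
  ext i
  fin_cases i <;> rfl

namespace IsFrame

variable {p : Fin 3 → ℂ} {l : Fin 2 → Poly 2} (hl : IsFrame p l)
include hl

theorem isRelPrime : IsRelPrime (l 0) (l 1) :=
  isRelPrime_linear (hl.hom 0) (hl.hom 1) (linearIndependent_pair hl.indep)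

theorem exists_eq {d : ℕ} (hp : p ≠ 0) {f : Poly 2} (hf : f.IsHomogeneous (d + 1))
    (hfp : MvPolynomial.eval p f = 0) :
    ∃ x y : Poly 2, x.IsHomogeneous d ∧ y.IsHomogeneous d ∧ f = x * l 1 - y * l 0 := by
  have h0 : ∀ i, MvPolynomial.eval (Projectivization.mk ℂ p hp).rep (l i) = 0 := fun i =>
    not_not.1 fun h => (HomFun.ne_zero_congr ⟨l i, hl.hom i, fun _ => rfl⟩ hp).1 h (hl.eval i)
  have h1 := (mem_pointIdeal_iff hp hf).2 hfp
  rw [pointIdeal_eq hl.hom hl.indep h0] at h1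
  obtain ⟨x, y, hxy⟩ := Ideal.mem_span_pair.1 h1
  refine ⟨homogeneousComponent d y, -homogeneousComponent d x,
    homogeneousComponent_isHomogeneous _ _, (homogeneousComponent_isHomogeneous _ _).neg, ?_⟩
  have h2 := congrArg (homogeneousComponent (d + 1)) hxy
  rw [map_add, homogeneousComponent_mul_right (hl.hom 0), homogeneousComponent_mul_right (hl.hom 1),
    homogeneousComponent_eq_self hf] at h2
  linear_combination -h2

/-- The coefficient vectors of both linear forms are orthogonal to p, so their cross product is a
multiple of p, and a nonzero one because they are independent. -/
theorem exists_cross (hp : p ≠ 0) : ∃ (c d : Fin 3 → ℂ) (s : ℂ), s ≠ 0 ∧ l 0 = linForm c ∧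
    l 1 = linForm d ∧ c 1 * d 2 - c 2 * d 1 = s * p 0 ∧ c 2 * d 0 - c 0 * d 2 = s * p 1 ∧
      c 0 * d 1 - c 1 * d 0 = s * p 2 := by
  obtain ⟨c, hc⟩ := exists_linForm (hl.hom 0)
  obtain ⟨d, hd⟩ := exists_linForm (hl.hom 1)
  have e0 := hl.eval 0
  have e1 := hl.eval 1
  rw [hc, eval_linForm] at e0
  rw [hd, eval_linForm] at e1
  have hli := Fintype.linearIndependent_iff.1 hl.indep
  have hne : ¬(c 1 * d 2 - c 2 * d 1 = 0 ∧ c 2 * d 0 - c 0 * d 2 = 0 ∧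
      c 0 * d 1 - c 1 * d 0 = 0) := by
    rintro ⟨h0, h1, h2⟩
    have key : ∀ i, d i = 0 := by
      intro i
      have h3 := hli ![d i, -c i] (by
        rw [Fin.sum_univ_two, hc, hd]
        simp only [Matrix.cons_val_zero, Matrix.cons_val_one, smul_eq_C_mul, linForm]
        have H : ∀ j, C (d i) * C (c j) - C (c i) * C (d j) = (0 : Poly 2) := by
          intro j
          rw [← C_mul, ← C_mul, ← C_sub, ← C_0]
          congr 1
          fin_cases i <;> fin_cases j <;>
            simp only [Fin.zero_eta, Fin.mk_one, Fin.reduceFinMk] <;>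
            first
              | ring1
              | linear_combination h0
              | linear_combination h1
              | linear_combination h2
              | linear_combination -h0
              | linear_combination -h1
              | linear_combination -h2
        rw [C_neg]
        linear_combination X 0 * H 0 + X 1 * H 1 + X 2 * H 2)
      exact h3 0
    have : l 1 = 0 := by rw [hd, linForm, key, key, key]; simp
    exact hl.indep.ne_zero 1 this
  obtain ⟨k, hk⟩ := Function.ne_iff.1 hp
  rw [Pi.zero_apply] at hk
  have hs : ∃ s : ℂ, c 1 * d 2 - c 2 * d 1 = s * p 0 ∧ c 2 * d 0 - c 0 * d 2 = s * p 1 ∧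
      c 0 * d 1 - c 1 * d 0 = s * p 2 := by
    fin_cases k
    · refine ⟨(c 1 * d 2 - c 2 * d 1) / p 0, ?_, ?_, ?_⟩ <;>
        simp only [Fin.zero_eta] at hk <;> field_simp
      · linear_combination c 2 * e1 - d 2 * e0
      · linear_combination d 1 * e0 - c 1 * e1
    · refine ⟨(c 2 * d 0 - c 0 * d 2) / p 1, ?_, ?_, ?_⟩ <;>
        simp only [Fin.mk_one] at hk <;> field_simp
      · linear_combination d 2 * e0 - c 2 * e1
      · linear_combination c 0 * e1 - d 0 * e0
    · refine ⟨(c 0 * d 1 - c 1 * d 0) / p 2, ?_, ?_, ?_⟩ <;>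
        simp only [Fin.reduceFinMk] at hk <;> field_simp
      · linear_combination c 1 * e1 - d 1 * e0
      · linear_combination d 0 * e0 - c 0 * e1
  obtain ⟨s, h0, h1, h2⟩ := hs
  refine ⟨c, d, s, ?_, hc, hd, h0, h1, h2⟩
  rintro rfl
  exact hne ⟨by rw [h0, zero_mul], by rw [h1, zero_mul], by rw [h2, zero_mul]⟩

end IsFrame

theorem exists_isFrame {p : Fin 3 → ℂ} (hp : p ≠ 0) : ∃ l, IsFrame p l := by
  obtain ⟨k, hk⟩ := Function.ne_iff.1 hp
  rw [Pi.zero_apply] at hk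
  have hi : ∀ j : Fin 3, (C (p k) * X j - C (p j) * X k : Poly 2).IsHomogeneous 1 := fun j =>
    (isHomogeneous_C_mul_X _ _).sub (isHomogeneous_C_mul_X _ _)
  refine ⟨fun i => C (p k) * X (k.succAbove i) - C (p (k.succAbove i)) * X k, fun i => hi _, ?_,
    fun i => by simp; ring⟩
  rw [Fintype.linearIndependent_iff]
  intro g hg i
  have h1 := congrArg (eval (Pi.single (k.succAbove i) 1)) hg
  rw [map_sum, Finset.sum_eq_single i] at h1
  · simpa [smul_eq_C_mul, Fin.succAbove_ne, hk, (Fin.succAbove_ne _ _).symm] using h1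
  · intro j _ hj
    have : k.succAbove j ≠ k.succAbove i := fun h => hj (Fin.succAbove_right_injective h)
    simp [smul_eq_C_mul, this, (Fin.succAbove_ne _ _).symm]
  · simp

/-- The identity (c × d) · (u × X) = (c · u)(d · X) - (d · u)(c · X) with u_i = T(m X_i). The
formula with p is polynomial in p; the one with a frame shows the cubic as an element x l₁ - y l₀.
-/
theorem Transfer.exists_smul_cubicOf (t : Transfer lam mu) {p : Fin 3 → ℂ} {l : Fin 2 → Poly 2}
    (hl : IsFrame p l) (hp : p ≠ 0) : ∃ s : ℂ, s ≠ 0 ∧ ∀ m,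
      C s * t.cubicOf p m = t.T (m * l 0) * l 1 - t.T (m * l 1) * l 0 := by
  obtain ⟨c, d, s, hs, hc, hd, h0, h1, h2⟩ := hl.exists_cross hp
  refine ⟨s, hs, fun m => ?_⟩
  have H0 := congrArg (C : ℂ → Poly 2) h0
  have H1 := congrArg (C : ℂ → Poly 2) h1
  have H2 := congrArg (C : ℂ → Poly 2) h2
  simp only [C_sub, C_mul] at H0 H1 H2
  rw [hc, hd, mul_comm m, mul_comm m, T_linForm_mul, T_linForm_mul]
  simp only [cubicOf, triple, linForm, mul_comm m]
  linear_combination -(t.T (X 1 * m) * X 2 - t.T (X 2 * m) * X 1) * H0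
    - (t.T (X 2 * m) * X 0 - t.T (X 0 * m) * X 2) * H1
    - (t.T (X 0 * m) * X 1 - t.T (X 1 * m) * X 0) * H2

end Pencil

/-! ### Isotropic pencils of apolar cubics -/

section Isotropic

open MvPolynomial

variable {lam mu : Poly 2 →ₗ[ℂ] ℂ}

/-- The multiples of the two functionals do not interpolate the value at `p` on cubics. -/
def IsUnrelatedAt (lam mu : Poly 2 →ₗ[ℂ] ℂ) (p : Fin 3 → ℂ) : Prop :=
  ∀ (g h : Poly 2) (c : ℂ), g.IsHomogeneous 1 → h.IsHomogeneous 1 →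
    (∀ f : Poly 2, f.IsHomogeneous 3 → lam (g * f) + mu (h * f) = c * eval p f) → g = 0 ∧ h = 0

theorem IsUnrelatedAt.swap {p : Fin 3 → ℂ} (h : IsUnrelatedAt lam mu p) :
    IsUnrelatedAt mu lam p := fun g g' c hg hg' hf =>
  (h g' g c hg' hg fun f hf' => by rw [add_comm]; exact hf f hf').symm

theorem exists_isHomogeneous_eval_eq_one {p : Fin 3 → ℂ} (hp : p ≠ 0) (d : ℕ) :
    ∃ f : Poly 2, f.IsHomogeneous d ∧ eval p f = 1 := by
  obtain ⟨k, hk⟩ := Function.ne_iff.1 hp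
  rw [Pi.zero_apply] at hk
  refine ⟨C (p k ^ d)⁻¹ * X k ^ d, (isHomogeneous_X_pow k d).C_mul _, ?_⟩
  simp [hk]

/-- Forms that vanish at p are combinations of the frame, so a functional that kills those
combinations factors through evaluation at p. -/
theorem exists_eq_of_functional {p : Fin 3 → ℂ} (hp : p ≠ 0) {l : Fin 2 → Poly 2}
    (hl : IsFrame p l) {d : ℕ} (φ : Poly 2 →ₗ[ℂ] ℂ)
    (h : ∀ i, ∀ q : Poly 2, q.IsHomogeneous d → φ (q * l i) = 0) :
    ∃ c, ∀ f : Poly 2, f.IsHomogeneous (d + 1) → φ f = c * eval p f := by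
  obtain ⟨f₀, hf₀, h1⟩ := exists_isHomogeneous_eval_eq_one hp (d + 1)
  refine ⟨φ f₀, fun f hf => ?_⟩
  have h2 : (f - C (eval p f) * f₀).IsHomogeneous (d + 1) := hf.sub (hf₀.C_mul _)
  obtain ⟨x, y, hx, hy, hxy⟩ := hl.exists_eq hp h2 (by simp [h1])
  have h3 := congrArg φ hxy
  rw [map_sub, map_sub, h 1 x hx, h 0 y hy, map_C_mul, smul_eq_mul, sub_zero] at h3
  linear_combination h3

namespace Transfer

variable (t : Transfer lam mu)

/-- If the cubic vanishes, coprimality of the frame gives T(m l_i) = -h l_i for one linear form h.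
Then f ↦ lam(h f) + δ mu(m f) kills all cubics through p, so it is a multiple of evaluation there,
against `IsUnrelatedAt`. -/
theorem cubicOf_ne_zero {p : Fin 3 → ℂ} (hp : p ≠ 0) (hu : IsUnrelatedAt lam mu p) {m : Poly 2}
    (hm : m.IsHomogeneous 1) (hm0 : m ≠ 0) : t.cubicOf p m ≠ 0 := by
  intro h0
  obtain ⟨l, hl⟩ := exists_isFrame hp
  obtain ⟨s, hs, hst⟩ := t.exists_smul_cubicOf hl hp
  have h1 := hst m
  rw [h0, mul_zero] at h1
  obtain ⟨h, hx, hy⟩ := syzygy_of_isRelPrime hl.isRelPrime (hl.indep.ne_zero 1)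
    (x := -t.T (m * l 1)) (y := t.T (m * l 0)) (by linear_combination -h1)
  have hh : h.IsHomogeneous 1 := by
    refine isHomogeneous_of_mul_eq (hl.hom 1) (hl.indep.ne_zero 1) ?_
    rw [← hx]
    exact (t.hom _).neg
  have hx' : t.T (m * l 1) = -(h * l 1) := by linear_combination -hx
  obtain ⟨c, hc⟩ := exists_eq_of_functional hp hl (d := 2)
    (lam ∘ₗ LinearMap.mulLeft ℂ h + t.δ • mu ∘ₗ LinearMap.mulLeft ℂ m) fun i q hq => by
      have e1 : t.T (m * l i) * q = -(h * (q * l i)) := by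
        fin_cases i
        · change t.T (m * l 0) * q = -(h * (q * l 0))
          rw [hy]
          ring
        · change t.T (m * l 1) * q = -(h * (q * l 1))
          rw [hx']
          ring
      have e2 := t.apply _ q (hm.mul (hl.hom i)) hq
      rw [e1, map_neg] at e2
      have e3 : m * l i * q = m * (q * l i) := by ring
      rw [e3] at e2
      simp only [LinearMap.add_apply, LinearMap.comp_apply, LinearMap.smul_apply,
        LinearMap.mulLeft_apply, smul_eq_mul]
      linear_combination -e2
  have h2 := (hu h (C t.δ * m) c hh (hm.C_mul _) fun f hf => by
    have := hc f hf
    simp only [LinearMap.add_apply, LinearMap.comp_apply, LinearMap.smul_apply,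
      LinearMap.mulLeft_apply, smul_eq_mul] at this
    rw [mul_assoc (C t.δ), map_C_mul, smul_eq_mul]
    exact this).2
  exact mul_ne_zero (by simpa using t.δ_ne) hm0 h2

theorem cubic_ne_zero {p : Fin 3 → ℂ} (hp : p ≠ 0) (hu : IsUnrelatedAt lam mu p)
    (hr : t.radical p ≠ 0) : t.cubic p ≠ 0 :=
  t.cubicOf_ne_zero hp hu (linForm_hom _) fun h => hr (linForm_eq_zero_iff.1 h)

/-- The cubics made from linear forms are orthogonal, for the alternating form given by `lam`, to
all apolar cubics: transferring T turns the pairing into δ mu of a linear multiple of the second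
cubic. -/
theorem lam_pairing_cubicOf {l : Fin 2 → Poly 2}
    (hl : ∀ i, (l i).IsHomogeneous 1) {m x y : Poly 2} (hm : m.IsHomogeneous 1)
    (hx : x.IsHomogeneous 2) (hy : y.IsHomogeneous 2)
    (hC : x * l 1 - y * l 0 ∈ apolarCubics lam mu) :
    lam (t.T (m * l 0) * y - x * t.T (m * l 1)) = 0 := by
  rw [mul_comm x, map_sub, t.apply _ _ (hm.mul (hl 0)) hy, t.apply _ _ (hm.mul (hl 1)) hx, ← mul_sub,
    ← map_sub]
  have : m * l 0 * y - m * l 1 * x = -(m * (x * l 1 - y * l 0)) := by ring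
  rw [this, map_neg, (apolar_mul_eq_zero hC hm).2, neg_zero, mul_zero]

/-- A pair of quadratic forms that is orthogonal to all pairs that define apolar cubics comes
from a linear form. -/
theorem exists_cubicOf_eq {p : Fin 3 → ℂ} (hp : p ≠ 0) {l : Fin 2 → Poly 2} (hl : IsFrame p l)
    {x y : Poly 2} (hx : x.IsHomogeneous 2) (hy : y.IsHomogeneous 2)
    (h : ∀ x' y' : Poly 2, x'.IsHomogeneous 2 → y'.IsHomogeneous 2 →
      x' * l 1 - y' * l 0 ∈ apolarCubics lam mu → lam (x * y' - x' * y) = 0) :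
    ∃ m : Poly 2, m.IsHomogeneous 1 ∧ x * l 1 - y * l 0 = t.cubicOf p m := by
  set cub : (Form 2 2 × Form 2 2) →ₗ[ℂ] Poly 2 :=
    LinearMap.mulRight ℂ (l 1) ∘ₗ (Form 2 2).subtype ∘ₗ LinearMap.fst ℂ _ _ -
      LinearMap.mulRight ℂ (l 0) ∘ₗ (Form 2 2).subtype ∘ₗ LinearMap.snd ℂ _ _ with hcub
  have hcub_apply : ∀ v, cub v = v.1 * l 1 - v.2 * l 0 := fun v => by simp [hcub]
  set φ : (Form 2 2 × Form 2 2) →ₗ[ℂ] ℂ :=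
    lam ∘ₗ (LinearMap.mulLeft ℂ x ∘ₗ (Form 2 2).subtype ∘ₗ LinearMap.snd ℂ _ _ -
      LinearMap.mulRight ℂ y ∘ₗ (Form 2 2).subtype ∘ₗ LinearMap.fst ℂ _ _) with hφ
  have hφ_apply : ∀ v, φ v = lam (x * v.2 - v.1 * y) := fun v => by simp [hφ]
  set L : Fin 3 ⊕ Fin 3 → (Form 2 2 × Form 2 2) →ₗ[ℂ] ℂ :=
    Sum.elim (fun i => lam ∘ₗ LinearMap.mulLeft ℂ (X i) ∘ₗ cub)
      (fun i => mu ∘ₗ LinearMap.mulLeft ℂ (X i) ∘ₗ cub) with hL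
  -- Duality: φ vanishes on the common kernel of the six apolarity conditions, so it is a
  -- combination of them. The coefficients are collected in two linear forms, `g` for `lam` and `k`
  -- for `mu`.
  have hspan : φ ∈ Submodule.span ℂ (Set.range L) := by
    refine FiniteDimensional.mem_span_of_iInf_ker_le_ker fun v hv => ?_
    rw [Submodule.mem_iInf] at hv
    rw [LinearMap.mem_ker, hφ_apply]
    refine h _ _ v.1.2 v.2.2 ⟨?_, fun i => ?_⟩
    · exact (v.1.2.mul (hl.hom 1)).sub (v.2.2.mul (hl.hom 0))
    · have h1 := LinearMap.mem_ker.1 (hv (Sum.inl i))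
      have h2 := LinearMap.mem_ker.1 (hv (Sum.inr i))
      simp only [hL, Sum.elim_inl, Sum.elim_inr, LinearMap.comp_apply, LinearMap.mulLeft_apply,
        hcub_apply] at h1 h2
      exact ⟨h1, h2⟩
  obtain ⟨c, hc⟩ := (Submodule.mem_span_range_iff_exists_fun ℂ).1 hspan
  obtain ⟨g, hg⟩ : ∃ g, g = linForm fun i => c (Sum.inl i) := ⟨_, rfl⟩
  obtain ⟨k, hk⟩ : ∃ k, k = linForm fun i => c (Sum.inr i) := ⟨_, rfl⟩
  have key : ∀ x' y' : Poly 2, x'.IsHomogeneous 2 → y'.IsHomogeneous 2 →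
      lam (x * y' - x' * y) = lam (g * (x' * l 1 - y' * l 0)) + mu (k * (x' * l 1 - y' * l 0)) := by
    intro x' y' hx' hy'
    have h1 := LinearMap.congr_fun hc (⟨x', hx'⟩, ⟨y', hy'⟩)
    rw [hφ_apply] at h1
    rw [← h1, Fintype.sum_sum_type]
    simp only [LinearMap.add_apply, LinearMap.smul_apply, hL, Sum.elim_inl,
      Sum.elim_inr, LinearMap.comp_apply, LinearMap.mulLeft_apply, hcub_apply, Fin.sum_univ_three,
      smul_eq_mul, hg, hk]
    have e : ∀ (a : Fin 3 → ℂ) (f : Poly 2),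
        linForm a * f = C (a 0) * (X 0 * f) + C (a 1) * (X 1 * f) + C (a 2) * (X 2 * f) := by
      intro a f
      rw [linForm]
      ring
    simp only [e, map_add, map_C_mul, smul_eq_mul]
  have hgh : g.IsHomogeneous 1 := hg ▸ linForm_hom _
  have hkh : k.IsHomogeneous 1 := hk ▸ linForm_hom _
  have hkT : ∀ i, ∀ q : Poly 2, q.IsHomogeneous 2 →
      mu (k * l i * q) = lam (C t.δ⁻¹ * t.T (k * l i) * q) := by
    intro i q hq
    rw [mul_assoc (C t.δ⁻¹), map_C_mul, t.apply _ _ (hkh.mul (hl.hom i)) hq, smul_eq_mul,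
      inv_mul_cancel_left₀ t.δ_ne]
  -- Test on pairs (q, 0), after rewriting `mu` through T so that only `lam` occurs; nondegeneracy
  -- then determines y. The pairs (0, q) determine x.
  have hyeq : y + (g * l 1 + C t.δ⁻¹ * t.T (k * l 1)) = 0 := by
    refine t.nondeg _ (hy.add ((hgh.mul (hl.hom 1)).add ((t.hom _).C_mul _))) fun q hq => ?_
    have h1 := key q 0 hq (isHomogeneous_zero _ _ _)
    have e1 : x * 0 - q * y = -(y * q) := by ring
    have e2 : g * (q * l 1 - 0 * l 0) = g * l 1 * q := by ring
    have e3 : k * (q * l 1 - 0 * l 0) = k * l 1 * q := by ring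
    rw [e1, e2, e3, hkT 1 q hq, map_neg] at h1
    rw [add_mul, add_mul, map_add, map_add]
    linear_combination -h1
  have hxeq : x + (g * l 0 + C t.δ⁻¹ * t.T (k * l 0)) = 0 := by
    refine t.nondeg _ (hx.add ((hgh.mul (hl.hom 0)).add ((t.hom _).C_mul _))) fun q hq => ?_
    have h1 := key 0 q (isHomogeneous_zero _ _ _) hq
    have e1 : x * q - 0 * y = x * q := by ring
    have e2 : g * (0 * l 1 - q * l 0) = -(g * l 0 * q) := by ring
    have e3 : k * (0 * l 1 - q * l 0) = -(k * l 0 * q) := by ring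
    rw [e1, e2, e3, map_neg, map_neg, hkT 0 q hq] at h1
    rw [add_mul, add_mul, map_add, map_add]
    linear_combination h1
  obtain ⟨s, hs, hst⟩ := t.exists_smul_cubicOf hl hp
  refine ⟨C (-(t.δ⁻¹ * s)) * k, hkh.C_mul _, ?_⟩
  rw [cubicOf_C_mul, C_neg, C_mul]
  linear_combination l 1 * hxeq - l 0 * hyeq + C t.δ⁻¹ * hst k

/-- The quartic minor of a pair of apolar cubics through `p` is annihilated by `lam` if and only
if the pencil of cubics contains the distinguished cubic. -/
theorem cubic_mem_span_iff {p : Fin 3 → ℂ} (hp : p ≠ 0) (hu : IsUnrelatedAt lam mu p)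
    (hr : t.radical p ≠ 0) (hdim : Module.finrank ℂ (apolarCubicsAt lam mu p) ≤ 3)
    {l : Fin 2 → Poly 2} (hl : IsFrame p l) {x y : Fin 2 → Poly 2}
    (hx : ∀ i, (x i).IsHomogeneous 2) (hy : ∀ i, (y i).IsHomogeneous 2) {K : Fin 2 → Poly 2}
    (hK : ∀ i, K i = x i * l 1 - y i * l 0) (hKN : ∀ i, K i ∈ apolarCubics lam mu)
    (hli : LinearIndependent ℂ K) :
    lam (x 0 * y 1 - x 1 * y 0) = 0 ↔ t.cubic p ∈ Submodule.span ℂ (Set.range K) := by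
  have hN : ∀ i, x i * l 1 - y i * l 0 ∈ apolarCubics lam mu := fun i => hK i ▸ hKN i
  have hlh := linForm_hom (t.radical p)
  obtain ⟨s, hs, hst⟩ := t.exists_smul_cubicOf hl hp
  have hsC := hst (linForm (t.radical p))
  change C s * t.cubic p = _ at hsC
  have hsyz : ∀ a b : Poly 2, a * l 1 - b * l 0 = 0 → ∃ n, a = n * l 0 ∧ b = n * l 1 := by
    intro a b hab
    obtain ⟨n, h1, h2⟩ := syzygy_of_isRelPrime hl.isRelPrime (hl.indep.ne_zero 1)
      (x := -b) (y := a) (by linear_combination hab)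
    exact ⟨-n, by linear_combination h2, by linear_combination -h1⟩
  -- A cubic determines its pair only up to n · (l₀, l₁). This changes the minor by a linear
  -- multiple of the other cubic, which `lam` kills.
  have hlin : ∀ a b a' b' n : Poly 2, n.IsHomogeneous 1 → a' * l 1 - b' * l 0 ∈ apolarCubics lam mu →
      lam ((a + n * l 0) * b' - a' * (b + n * l 1)) = lam (a * b' - a' * b) := by
    intro a b a' b' n hn h
    have e : (a + n * l 0) * b' - a' * (b + n * l 1) =
        (a * b' - a' * b) - n * (a' * l 1 - b' * l 0) := by ring
    rw [e, map_sub, (apolar_mul_eq_zero h hn).1, sub_zero]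
  have hdeg : ∀ n a : Poly 2, a.IsHomogeneous 2 → a = n * l 0 → n.IsHomogeneous 1 := by
    intro n a ha h
    refine isHomogeneous_of_mul_eq (hl.hom 0) (hl.indep.ne_zero 0) ?_
    rw [← h]
    exact ha
  set a₀ := t.T (linForm (t.radical p) * l 0) with ha₀
  set b₀ := t.T (linForm (t.radical p) * l 1) with hb₀
  have hiso : ∀ a b : Poly 2, a.IsHomogeneous 2 → b.IsHomogeneous 2 →
      a * l 1 - b * l 0 ∈ apolarCubics lam mu → lam (a₀ * b - a * b₀) = 0 := fun a b ha hb h =>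
    t.lam_pairing_cubicOf hl.hom hlh ha hb h
  constructor
  · intro h0
    by_contra hnot
    -- If the distinguished cubic were outside the pencil, it would span the apolar cubics through p
    -- together with K₀ and K₁. Then K₀ is orthogonal to all of them, so it comes from a linear
    -- form, which lies in the radical of `alt`; hence K₀ is a multiple of the distinguished cubic
    -- after all.
    have hli3 : LinearIndependent ℂ (Fin.cons (t.cubic p) K : Fin 3 → Poly 2) :=
      linearIndependent_finCons.2 ⟨hli, hnot⟩
    have hmem3 : ∀ i, (Fin.cons (t.cubic p) K : Fin 3 → Poly 2) i ∈ apolarCubicsAt lam mu p := by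
      refine Fin.cases (t.cubic_mem p) fun i => ?_
      refine mem_apolarCubicsAt.2 ⟨hKN i, ?_⟩
      rw [Fin.cons_succ, hK, map_sub, map_mul, map_mul, hl.eval, hl.eval]
      ring
    have hfin : FiniteDimensional ℂ (apolarCubicsAt lam mu p) :=
      Submodule.finiteDimensional_of_le (S₂ := Form 2 3) fun f hf =>
        (mem_apolarCubicsAt.1 hf).1.1
    have hspan : Submodule.span ℂ (Set.range (Fin.cons (t.cubic p) K : Fin 3 → Poly 2)) =
        apolarCubicsAt lam mu p := by
      refine Submodule.eq_of_le_of_finrank_le (Submodule.span_le.2 ?_) ?_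
      · rintro _ ⟨i, rfl⟩
        exact hmem3 i
      · rw [finrank_span_eq_card hli3, Fintype.card_fin]
        exact hdim
    obtain ⟨m, hm, hmeq⟩ := t.exists_cubicOf_eq hp hl (hx 0) (hy 0) fun x' y' hx' hy' h' => by
      have h1 : x' * l 1 - y' * l 0 ∈ apolarCubicsAt lam mu p := by
        refine mem_apolarCubicsAt.2 ⟨h', ?_⟩
        rw [map_sub, map_mul, map_mul, hl.eval, hl.eval]
        ring
      rw [← hspan] at h1
      obtain ⟨c, hc⟩ := (Submodule.mem_span_range_iff_exists_fun ℂ).1 h1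
      rw [Fin.sum_univ_three] at hc
      change c 0 • t.cubic p + c 1 • K 0 + c 2 • K 1 = _ at hc
      simp only [smul_eq_C_mul] at hc
      have hss : (C s⁻¹ * C s : Poly 2) = 1 := by rw [← C_mul, inv_mul_cancel₀ hs, C_1]
      obtain ⟨n, hn1, hn2⟩ := hsyz
        (C (c 0) * (C s⁻¹ * a₀) + C (c 1) * x 0 + C (c 2) * x 1 - x')
        (C (c 0) * (C s⁻¹ * b₀) + C (c 1) * y 0 + C (c 2) * y 1 - y')
        (by linear_combination hc - C (c 0) * C s⁻¹ * hsC + C (c 0) * t.cubic p * hss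
              - C (c 1) * hK 0 - C (c 2) * hK 1)
      have hn : n.IsHomogeneous 1 := by
        refine hdeg n _ ?_ hn1
        exact (((((t.hom _).C_mul _).C_mul _).add ((hx 0).C_mul _)).add ((hx 1).C_mul _)).sub hx'
      have e : x 0 * y' - x' * y 0 = n * (x 0 * l 1 - y 0 * l 0) * (-1) +
          (C (c 0 * s⁻¹) * (-(a₀ * y 0 - x 0 * b₀)) + C (c 2) * (x 0 * y 1 - x 1 * y 0)) := by
        rw [C_mul]
        linear_combination y 0 * hn1 - x 0 * hn2
      rw [e, mul_neg_one, map_add, map_neg, (apolar_mul_eq_zero (hN 0) hn).1, map_add, map_C_mul,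
        map_C_mul, h0, map_neg, hiso _ _ (hx 0) (hy 0) (hN 0)]
      simp
    obtain ⟨c, hc⟩ := t.exists_smul_radical hr hm (hmeq ▸ hN 0)
    rw [← hmeq, ← hK] at hc
    have hc0 : c ≠ 0 := by
      rintro rfl
      exact hli.ne_zero 0 (by rw [hc, zero_smul])
    refine hnot ?_
    have : t.cubic p = c⁻¹ • K 0 := by rw [hc, inv_smul_smul₀ hc0]
    rw [this]
    exact Submodule.smul_mem _ _ (Submodule.subset_span ⟨0, rfl⟩)
  · intro hmem
    obtain ⟨c, hc⟩ := (Submodule.mem_span_range_iff_exists_fun ℂ).1 hmem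
    rw [Fin.sum_univ_two, smul_eq_C_mul, smul_eq_C_mul] at hc
    obtain ⟨n, hn1, hn2⟩ := hsyz (C s * (C (c 0) * x 0 + C (c 1) * x 1) - a₀)
      (C s * (C (c 0) * y 0 + C (c 1) * y 1) - b₀)
      (by linear_combination C s * hc + hsC - C s * C (c 0) * hK 0 - C s * C (c 1) * hK 1)
    have hn : n.IsHomogeneous 1 := by
      refine hdeg n _ ?_ hn1
      exact ((((hx 0).C_mul _).add ((hx 1).C_mul _)).C_mul _).sub (t.hom _)
    -- The distinguished cubic c₀K₀ + c₁K₁ is orthogonal to K₀ and to K₁; by alternation each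
    -- pairing is a multiple of lam(x₀y₁ - x₁y₀), and one of the factors c₀, c₁ is nonzero.
    have hpair : ∀ j, lam (C s * (C (c 0) * x 0 + C (c 1) * x 1) * y j -
        x j * (C s * (C (c 0) * y 0 + C (c 1) * y 1))) = 0 := by
      intro j
      have e1 : C s * (C (c 0) * x 0 + C (c 1) * x 1) = a₀ + n * l 0 := by
        linear_combination hn1
      have e2 : C s * (C (c 0) * y 0 + C (c 1) * y 1) = b₀ + n * l 1 := by
        linear_combination hn2
      rw [e1, e2, hlin _ _ _ _ _ hn (hN j), hiso _ _ (hx j) (hy j) (hN j)]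
    have hne : c 0 ≠ 0 ∨ c 1 ≠ 0 := by
      by_contra hcon
      push Not at hcon
      refine t.cubic_ne_zero hp hu hr ?_
      rw [← hc, hcon.1, hcon.2]
      simp
    rcases hne with h | h
    · have h1 := hpair 1
      have e : C s * (C (c 0) * x 0 + C (c 1) * x 1) * y 1 -
          x 1 * (C s * (C (c 0) * y 0 + C (c 1) * y 1)) =
          C (s * c 0) * (x 0 * y 1 - x 1 * y 0) := by
        rw [C_mul]
        ring
      rw [e, map_C_mul, smul_eq_mul] at h1
      exact (mul_eq_zero.1 h1).resolve_left (mul_ne_zero hs h)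
    · have h1 := hpair 0
      have e : C s * (C (c 0) * x 0 + C (c 1) * x 1) * y 0 -
          x 0 * (C s * (C (c 0) * y 0 + C (c 1) * y 1)) =
          C (-(s * c 1)) * (x 0 * y 1 - x 1 * y 0) := by
        rw [C_neg, C_mul]
        ring
      rw [e, map_C_mul, smul_eq_mul] at h1
      exact (mul_eq_zero.1 h1).resolve_left (neg_ne_zero.2 (mul_ne_zero hs h))

end Transfer

end Isotropic

/-! ### Families of forms -/

section Families

open MvPolynomial

variable {κ σ : Type*} {n : ℕ}

/-- The coefficients of `Φ a y` are polynomial in `a` and homogeneous of degree `d` in `y`. -/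
def BiForm (d : ℕ) (Φ : (κ → ℂ) → (σ → ℂ) → Poly n) : Prop :=
  ∀ m, BiHom d fun a y => coeff m (Φ a y)

/-- The coefficients of `Φ y` are homogeneous of degree `d` in `y`. -/
def HomForm (d : ℕ) (Φ : (σ → ℂ) → Poly n) : Prop := ∀ m, HomFun d fun y => coeff m (Φ y)

theorem HomForm.biForm {d : ℕ} {Φ : (σ → ℂ) → Poly n} (h : HomForm d Φ) :
    BiForm d fun (_ : κ → ℂ) y => Φ y := fun m => (h m).biHom

theorem BiForm.homForm {d : ℕ} {Φ : (κ → ℂ) → (σ → ℂ) → Poly n} (h : BiForm d Φ) (a : κ → ℂ) :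
    HomForm d (Φ a) := fun m => (h m).homFun a

namespace BiForm

variable {d e : ℕ} {Φ Ψ : (κ → ℂ) → (σ → ℂ) → Poly n}

theorem const (f : Poly n) : BiForm 0 fun (_ : κ → ℂ) (_ : σ → ℂ) => f := fun _ => biHom_const _

theorem zero (d : ℕ) : BiForm d fun (_ : κ → ℂ) (_ : σ → ℂ) => (0 : Poly n) := fun m => by
  simpa using biHom_zero d

theorem cast (h : BiForm d Φ) (hd : d = e) : BiForm e Φ := hd ▸ h

theorem add (h : BiForm d Φ) (h' : BiForm d Ψ) : BiForm d fun a y => Φ a y + Ψ a y := fun m => by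
  simpa only [coeff_add] using (h m).add (h' m)

theorem sub (h : BiForm d Φ) (h' : BiForm d Ψ) : BiForm d fun a y => Φ a y - Ψ a y := fun m => by
  simpa only [coeff_sub] using (h m).sub (h' m)

theorem mul (h : BiForm d Φ) (h' : BiForm e Ψ) : BiForm (d + e) fun a y => Φ a y * Ψ a y :=
  fun m => by
    simpa only [coeff_mul] using BiHom.sum _ fun x _ => (h x.1).mul (h' x.2)

theorem C_mul {φ : (κ → ℂ) → (σ → ℂ) → ℂ} (h : BiHom d φ) (h' : BiForm e Ψ) :
    BiForm (d + e) fun a y => C (φ a y) * Ψ a y := fun m => by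
  simpa only [coeff_C_mul] using h.mul (h' m)

theorem sum {ι : Type*} (s : Finset ι) {f : ι → (κ → ℂ) → (σ → ℂ) → Poly n}
    (h : ∀ i ∈ s, BiForm d (f i)) : BiForm d fun a y => ∑ i ∈ s, f i a y := fun m => by
  simpa only [coeff_sum] using BiHom.sum s fun i hi => h i hi m

end BiForm

namespace HomForm

variable {d e : ℕ} {Φ Ψ : (σ → ℂ) → Poly n}

theorem const (f : Poly n) : HomForm 0 fun (_ : σ → ℂ) => f :=
  (BiForm.const (κ := Empty) f).homForm Empty.elim

theorem zero (d : ℕ) : HomForm d fun (_ : σ → ℂ) => (0 : Poly n) :=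
  (BiForm.zero (κ := Empty) d).homForm Empty.elim

theorem cast (h : HomForm d Φ) (hd : d = e) : HomForm e Φ := hd ▸ h

theorem add (h : HomForm d Φ) (h' : HomForm d Ψ) : HomForm d fun y => Φ y + Ψ y :=
  (h.biForm.add (κ := Empty) h'.biForm).homForm Empty.elim

theorem sub (h : HomForm d Φ) (h' : HomForm d Ψ) : HomForm d fun y => Φ y - Ψ y :=
  (h.biForm.sub (κ := Empty) h'.biForm).homForm Empty.elim

theorem mul (h : HomForm d Φ) (h' : HomForm e Ψ) : HomForm (d + e) fun y => Φ y * Ψ y :=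
  (h.biForm.mul (κ := Empty) h'.biForm).homForm Empty.elim

theorem C_mul {φ : (σ → ℂ) → ℂ} (h : HomFun d φ) (h' : HomForm e Ψ) :
    HomForm (d + e) fun y => C (φ y) * Ψ y :=
  (BiForm.C_mul (κ := Empty) h.biHom h'.biForm).homForm Empty.elim

theorem sum {ι : Type*} (s : Finset ι) {f : ι → (σ → ℂ) → Poly n}
    (h : ∀ i ∈ s, HomForm d (f i)) : HomForm d fun y => ∑ i ∈ s, f i y :=
  (BiForm.sum (κ := Empty) s fun i hi => (h i hi).biForm).homForm Empty.elim

end HomForm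

/-! ### Dividing a family of cubics by the linear forms through a point -/

theorem exists_eq_add_single {d : ℕ} {m : Fin (n + 1) →₀ ℕ} (h : m.degree = d + 1) :
    ∃ (m' : Fin (n + 1) →₀ ℕ) (i : Fin (n + 1)), m'.degree = d ∧ m = m' + Finsupp.single i 1 := by
  obtain ⟨i, hi⟩ : ∃ i, m i ≠ 0 := by
    by_contra hcon
    push Not at hcon
    have : m = 0 := Finsupp.ext hcon
    rw [this, map_zero] at h
    omega
  have h1 : m = (m - Finsupp.single i 1) + Finsupp.single i 1 := by
    refine (tsub_add_cancel_of_le ?_).symm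
    rw [Finsupp.single_le_iff]
    omega
  refine ⟨m - Finsupp.single i 1, i, ?_, h1⟩
  have h2 := congrArg Finsupp.degree h1
  rw [map_add, Finsupp.degree_single, h] at h2
  omega

theorem exists_monomial_three (m : Mon 2 3) :
    ∃ i j k : Fin 3, (monomial m.1 1 : Poly 2) = X i * X j * X k := by
  obtain ⟨m₂, k, h₂, e₂⟩ := exists_eq_add_single (mon_degree m)
  obtain ⟨m₁, j, h₁, e₁⟩ := exists_eq_add_single h₂
  obtain ⟨m₀, i, h₀, e₀⟩ := exists_eq_add_single h₁
  have hm₀ : m₀ = 0 := (Finsupp.degree_eq_zero_iff _).1 h₀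
  refine ⟨i, j, k, ?_⟩
  rw [e₂, e₁, e₀, hm₀, zero_add]
  simp only [X, monomial_mul, one_mul]

/-- The linear forms through `p` in the chart of the coordinate `k`. -/
def chartForm (k : Fin 3) (p : Fin 3 → ℂ) (v : Fin 3) : Poly 2 := C (p k) * X v - C (p v) * X k

theorem chartForm_self (k : Fin 3) (p : Fin 3 → ℂ) : chartForm k p k = 0 := sub_self _

theorem isFrame_chartForm {k : Fin 3} {p : Fin 3 → ℂ} (hk : p k ≠ 0) :
    IsFrame p fun i => chartForm k p (k.succAbove i) := by
  refine ⟨fun i => (isHomogeneous_C_mul_X _ _).sub (isHomogeneous_C_mul_X _ _), ?_,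
    fun i => by simp [chartForm]; ring⟩
  rw [Fintype.linearIndependent_iff]
  intro g hg i
  have h1 := congrArg (eval (Pi.single (k.succAbove i) 1)) hg
  rw [map_sum, Finset.sum_eq_single i] at h1
  · simpa [chartForm, smul_eq_C_mul, hk, (Fin.succAbove_ne _ _).symm] using h1
  · intro j _ hj
    have : k.succAbove j ≠ k.succAbove i := fun h => hj (Fin.succAbove_right_injective h)
    simp [chartForm, smul_eq_C_mul, this, (Fin.succAbove_ne _ _).symm]
  · simp

/-- A cubic form minus its value at `p` is, after clearing denominators, a combination of the
linear forms through `p`. -/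
theorem exists_chart_division (k : Fin 3) :
    ∃ A : Fin 3 → Mon 2 3 → (Fin 3 → ℂ) → Poly 2, (∀ v m, HomForm 2 (A v m)) ∧
      (∀ v m p, (A v m p).IsHomogeneous 2) ∧ ∀ (f : Poly 2), f.IsHomogeneous 3 → ∀ p,
        C (p k ^ 3) * f - C (eval p f) * X k ^ 3 =
          ∑ v, (∑ m : Mon 2 3, C (coeff m.1 f) * A v m p) * chartForm k p v := by
  classical
  choose i₁ i₂ i₃ hi using exists_monomial_three
  -- For a monomial X_a X_b X_c, replace one variable after the other by its value at p times X_k.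
  -- Each replacement contributes one chart form, and the sum telescopes.
  refine ⟨fun v m p =>
    (if i₃ m = v then C (p k * p k) * (X (i₁ m) * X (i₂ m)) else 0) +
    (if i₂ m = v then C (p k * p (i₃ m)) * (X (i₁ m) * X k) else 0) +
    (if i₁ m = v then C (p (i₂ m) * p (i₃ m)) * (X k * X k) else 0), ?_, ?_, ?_⟩
  · intro v m
    have h : ∀ (P : Prop) [Decidable P] (a b c d : Fin 3),
        HomForm 2 fun p : Fin 3 → ℂ =>
          if P then (C (p a * p b) * (X c * X d) : Poly 2) else 0 := by
      intro P _ a b c d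
      split_ifs
      · exact HomForm.C_mul ((homFun_coord a).mul (homFun_coord b)) (HomForm.const (X c * X d))
      · exact HomForm.zero 2
    exact ((h _ _ _ _ _).add (h _ _ _ _ _)).add (h _ _ _ _ _)
  · intro v m p
    have h : ∀ (P : Prop) [Decidable P] (z : ℂ) (c d : Fin 3),
        (if P then (C z * (X c * X d) : Poly 2) else 0).IsHomogeneous 2 := by
      intro P _ z c d
      split_ifs
      · exact ((isHomogeneous_X ℂ c).mul (isHomogeneous_X ℂ d)).C_mul z
      · exact isHomogeneous_zero _ _ _
    exact ((h _ _ _ _).add (h _ _ _ _)).add (h _ _ _ _)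
  · intro f hf p
    have hmon : ∀ m : Mon 2 3, C (p k ^ 3) * monomial m.1 1 -
        C (eval p (monomial m.1 1)) * X k ^ 3 = ∑ v,
          ((if i₃ m = v then C (p k * p k) * (X (i₁ m) * X (i₂ m)) else 0) +
          (if i₂ m = v then C (p k * p (i₃ m)) * (X (i₁ m) * X k) else 0) +
          (if i₁ m = v then C (p (i₂ m) * p (i₃ m)) * (X k * X k) else 0)) *
            chartForm k p v := by
      intro m
      simp only [add_mul, Finset.sum_add_distrib, ite_mul, zero_mul, Finset.sum_ite_eq,
        Finset.mem_univ, if_true]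
      rw [hi m]
      simp only [chartForm, map_mul, eval_X, map_pow]
      ring
    have hfe : f = ∑ m : Mon 2 3, C (coeff m.1 f) * monomial m.1 1 := by
      conv_lhs => rw [form_eq_sum hf]
      exact Finset.sum_congr rfl fun m _ => by rw [C_mul_monomial, mul_one]
    simp only [Finset.sum_mul]
    rw [Finset.sum_comm]
    simp only [mul_assoc, ← Finset.mul_sum]
    simp only [← hmon]
    conv_lhs => rw [hfe]
    rw [map_sum, map_sum, Finset.mul_sum, Finset.sum_mul, ← Finset.sum_sub_distrib]
    refine Finset.sum_congr rfl fun m _ => ?_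
    rw [map_mul, eval_C, C_mul]
    ring

end Families

/-! ### Linkage: the ideal is determined by its cubics and the associated point -/

section Linkage

open MvPolynomial

namespace HilbertBurch

variable (D : HilbertBurch)

theorem exists_of_mem_degPart {t : ℕ} {f : Poly 2} (hf : f ∈ degPart D.ideal t) :
    ∃ x y z : Poly 2, f = shiftComponent t 3 x * D.cub₁ + shiftComponent t 3 y * D.cub₂ +
      shiftComponent t 4 z * D.quart := by
  obtain ⟨x, y, z, hxyz⟩ := D.mem_ideal.1 hf.1
  refine ⟨x, y, z, ?_⟩
  rw [← homogeneousComponent_mul D.cub₁_hom, ← homogeneousComponent_mul D.cub₂_hom,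
    ← homogeneousComponent_mul D.quart_hom, ← map_add, ← map_add, hxyz]
  exact (homogeneousComponent_eq_self hf.2).symm

theorem exists_of_mem_degPart_four {f : Poly 2} (hf : f ∈ degPart D.ideal 4) :
    ∃ (x y : Poly 2) (c : ℂ), x.IsHomogeneous 1 ∧ y.IsHomogeneous 1 ∧
      f = x * D.cub₁ + y * D.cub₂ + C c * D.quart := by
  obtain ⟨x, y, z, h⟩ := D.exists_of_mem_degPart hf
  obtain ⟨c, hc⟩ := isHomogeneous_zero_exists (homogeneousComponent_isHomogeneous 0 z)
  refine ⟨homogeneousComponent 1 x, homogeneousComponent 1 y, c,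
    homogeneousComponent_isHomogeneous _ _, homogeneousComponent_isHomogeneous _ _, ?_⟩
  rw [← hc]
  exact h

theorem mem_degPart_three {f : Poly 2} :
    f ∈ degPart D.ideal 3 ↔ ∃ a b : ℂ, f = C a * D.cub₁ + C b * D.cub₂ := by
  constructor
  · intro hf
    obtain ⟨x, y, z, h⟩ := D.exists_of_mem_degPart hf
    obtain ⟨a, ha⟩ := isHomogeneous_zero_exists (homogeneousComponent_isHomogeneous 0 x)
    obtain ⟨b, hb⟩ := isHomogeneous_zero_exists (homogeneousComponent_isHomogeneous 0 y)
    refine ⟨a, b, ?_⟩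
    rw [← ha, ← hb]
    refine h.trans ?_
    change homogeneousComponent 0 x * _ + homogeneousComponent 0 y * _ + 0 * _ = _
    ring
  · rintro ⟨a, b, rfl⟩
    exact ⟨add_mem (Ideal.mul_mem_left _ _ D.cub₁_mem) (Ideal.mul_mem_left _ _ D.cub₂_mem),
      (D.cub₁_hom.C_mul a).add (D.cub₂_hom.C_mul b)⟩

theorem degPart_three : degPart D.ideal 3 = Submodule.span ℂ {D.cub₁, D.cub₂} := by
  ext f
  rw [mem_degPart_three, Submodule.mem_span_pair]
  simp only [smul_eq_C_mul, eq_comm]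

theorem cub_independent : LinearIndependent ℂ ![D.cub₁, D.cub₂] := by
  rw [LinearIndependent.pair_iff]
  intro a b hab
  rw [smul_eq_C_mul, smul_eq_C_mul] at hab
  have key : ∀ {c d : ℂ} {f g : Poly 2}, IsRelPrime f g → ¬IsUnit g → C c * f + C d * g = 0 →
      c = 0 := by
    intro c d f g hfg hg h
    by_contra hc
    refine hg (hfg ?_ dvd_rfl)
    have hcc : (C c⁻¹ * C c : Poly 2) = 1 := by rw [← C_mul, inv_mul_cancel₀ hc, C_1]
    exact ⟨-(C c⁻¹ * C d), by linear_combination -f * hcc + C c⁻¹ * h⟩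
  exact ⟨key D.isRelPrime (not_isUnit_of_isHomogeneous D.cub₂_hom (by norm_num)) hab,
    key D.isRelPrime.symm (not_isUnit_of_isHomogeneous D.cub₁_hom (by norm_num))
      ((add_comm _ _).trans hab)⟩

theorem span_degPart_three :
    Ideal.span (degPart D.ideal 3 : Set (Poly 2)) = D.cubicIdeal := by
  refine le_antisymm (Ideal.span_le.2 fun f hf => ?_) (Ideal.span_le.2 ?_)
  · obtain ⟨a, b, rfl⟩ := D.mem_degPart_three.1 hf
    exact D.mem_cubicIdeal.2 ⟨_, _, rfl⟩
  · rintro f (rfl | rfl)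
    · exact Ideal.subset_span ⟨D.cub₁_mem, D.cub₁_hom⟩
    · exact Ideal.subset_span ⟨D.cub₂_mem, D.cub₂_hom⟩

theorem isAssociatedPoint_iff {p : ProjSp (Fin 3)} :
    IsAssociatedPoint D.ideal p ↔ IsFrame p.rep D.l := by
  have h1 : IsAssociatedPoint D.ideal p ↔ Ideal.span {D.l 0, D.l 1} = pointIdeal p := by
    rw [IsAssociatedPoint, span_degPart_three, colon_eq]
  rw [h1]
  constructor
  · intro h
    refine ⟨D.hl, D.indep, fun i => ?_⟩
    have h2 : D.l i ∈ pointIdeal p := by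
      rw [← h]
      refine Ideal.subset_span ?_
      fin_cases i <;> simp
    rw [← p.mk_rep] at h2
    exact (mem_pointIdeal_iff p.rep_nonzero (D.hl i)).1 h2
  · intro h
    exact (pointIdeal_eq D.hl D.indep h.eval).symm

theorem exists_isAssociatedPoint : ∃ p, IsAssociatedPoint D.ideal p := by
  obtain ⟨v, hv, hvl⟩ := exists_common_zero D.hl
  refine ⟨Projectivization.mk ℂ v hv, D.isAssociatedPoint_iff.2 ⟨D.hl, D.indep, fun i => ?_⟩⟩
  exact not_not.1 fun h =>
    (HomFun.ne_zero_congr ⟨D.l i, D.hl i, fun _ => rfl⟩ hv).1 h (hvl i)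

/-- The second half of linkage, I = J : (l₀, l₁). Comparing the representations of f l₀ and f l₁ by
the cubics gives a Koszul syzygy with multiplier k; after subtracting k times the columns, the
coefficients become divisible by `l 0`. -/
theorem mem_ideal_iff_mul_mem {f : Poly 2} :
    f ∈ D.ideal ↔ ∀ g ∈ Ideal.span {D.l 0, D.l 1}, f * g ∈ D.cubicIdeal := by
  constructor
  · intro hf g hg
    rw [← D.colon_eq, Submodule.mem_colon] at hg
    rw [mul_comm]
    exact hg f hf
  · intro h
    obtain ⟨x₀, y₀, h₀⟩ := D.mem_cubicIdeal.1 (h (D.l 0) (Ideal.subset_span (by simp)))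
    obtain ⟨x₁, y₁, h₁⟩ := D.mem_cubicIdeal.1 (h (D.l 1) (Ideal.subset_span (by simp)))
    obtain ⟨k, hx, hy⟩ := syzygy_of_isRelPrime D.isRelPrime D.cub₂_ne_zero
      (x := x₀ * D.l 1 - x₁ * D.l 0) (y := y₀ * D.l 1 - y₁ * D.l 0)
      (by linear_combination D.l 1 * h₀ - D.l 0 * h₁)
    have hrl : IsRelPrime (D.l 1) (D.l 0) :=
      (isRelPrime_linear (D.hl 0) (D.hl 1) (linearIndependent_pair D.indep)).symm
    obtain ⟨g, hg, -⟩ := syzygy_of_isRelPrime hrl (D.l_ne_zero 0)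
      (x := x₀ - k * D.a 0) (y := -(x₁ - k * D.a 1)) (by
        have : k * D.cub₂ = k * (D.a 0 * D.l 1 - D.a 1 * D.l 0) := rfl
        linear_combination hx + this)
    obtain ⟨g', hg', -⟩ := syzygy_of_isRelPrime hrl (D.l_ne_zero 0)
      (x := y₀ - k * D.b 0) (y := -(y₁ - k * D.b 1)) (by
        have : k * D.cub₁ = k * (D.b 1 * D.l 0 - D.b 0 * D.l 1) := rfl
        linear_combination hy - this)
    refine D.mem_ideal.2 ⟨g, g', k, mul_left_cancel₀ (D.l_ne_zero 0) ?_⟩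
    linear_combination h₀ - D.cub₁ * hg - D.cub₂ * hg' - k * D.relation 0

theorem ideal_eq_of_degPart_three_eq {D D' : HilbertBurch} {p : ProjSp (Fin 3)}
    (h : IsFrame p.rep D.l) (h' : IsFrame p.rep D'.l)
    (hE : degPart D.ideal 3 = degPart D'.ideal 3) : D.ideal = D'.ideal := by
  have hJ : D.cubicIdeal = D'.cubicIdeal := by
    rw [← span_degPart_three, ← span_degPart_three, hE]
  have hP : Ideal.span {D.l 0, D.l 1} = Ideal.span {D'.l 0, D'.l 1} := by
    rw [← pointIdeal_eq D.hl D.indep h.eval, ← pointIdeal_eq D'.hl D'.indep h'.eval]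
  ext f
  rw [mem_ideal_iff_mul_mem, mem_ideal_iff_mul_mem, hJ, hP]

end HilbertBurch

theorem isRelPrime_of_span_le {f g f' g' : Poly 2} (h : IsRelPrime f g)
    (hle : Submodule.span ℂ {f, g} ≤ Submodule.span ℂ {f', g'}) : IsRelPrime f' g' := by
  intro d hf hg
  have key : ∀ x ∈ Submodule.span ℂ {f', g'}, d ∣ x := by
    intro x hx
    obtain ⟨a, b, rfl⟩ := Submodule.mem_span_pair.1 hx
    rw [smul_eq_C_mul, smul_eq_C_mul]
    exact dvd_add (hf.mul_left _) (hg.mul_left _)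
  exact h (key f (hle (Submodule.subset_span (by simp))))
    (key g (hle (Submodule.subset_span (by simp))))

/-- Two coprime cubics through a point come from a Hilbert–Burch matrix. -/
theorem exists_hilbertBurch_of_isFrame {p : Fin 3 → ℂ} {l : Fin 2 → Poly 2} (hl : IsFrame p l)
    {x y : Fin 2 → Poly 2} (hx : ∀ i, (x i).IsHomogeneous 2) (hy : ∀ i, (y i).IsHomogeneous 2)
    (h : IsRelPrime (x 0 * l 1 - y 0 * l 0) (x 1 * l 1 - y 1 * l 0)) :
    ∃ D : HilbertBurch, D.l = l ∧ D.cub₁ = x 0 * l 1 - y 0 * l 0 ∧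
      D.cub₂ = x 1 * l 1 - y 1 * l 0 ∧ D.quart = x 0 * y 1 - x 1 * y 0 := by
  have e1 : -y 0 * l 0 - -x 0 * l 1 = x 0 * l 1 - y 0 * l 0 := by ring
  refine ⟨⟨l, ![x 1, y 1], ![-x 0, -y 0], hl.hom, ?_, ?_, hl.indep, ?_⟩, rfl, e1, rfl, ?_⟩
  · intro i
    fin_cases i
    · exact hx 1
    · exact hy 1
  · intro i
    fin_cases i
    · exact (hx 0).neg
    · exact (hy 0).neg
  · change IsRelPrime (-y 0 * l 0 - -x 0 * l 1) _
    rw [e1]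
    exact h
  · change x 1 * -y 0 - y 1 * -x 0 = _
    ring

end Linkage

/-! ### Plücker coordinates of families of ideals -/

section Section

open MvPolynomial

/-- The multiples of degree `8` of the generators. -/
def octicGen (g : Fin 3 → Poly 2) : (Mon 2 5 ⊕ Mon 2 5) ⊕ Mon 2 4 → Poly 2 :=
  Sum.elim (Sum.elim (fun m => monomial m.1 1 * g 0) fun m => monomial m.1 1 * g 1)
    fun m => monomial m.1 1 * g 2

theorem mul_mem_span_of_isHomogeneous {d : ℕ} {f g : Poly 2} {S : Submodule ℂ (Poly 2)}
    (hf : f.IsHomogeneous d) (h : ∀ m : Mon 2 d, monomial m.1 1 * g ∈ S) : f * g ∈ S := by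
  rw [form_eq_sum hf, Finset.sum_mul]
  refine Submodule.sum_mem _ fun m _ => ?_
  have e : monomial m.1 (coeff m.1 f) * g = coeff m.1 f • (monomial m.1 1 * g) := by
    rw [← smul_mul_assoc, smul_monomial, smul_eq_mul, mul_one]
  rw [e]
  exact S.smul_mem _ (h m)

theorem HilbertBurch.span_octicGen (D : HilbertBurch) :
    Submodule.span ℂ (Set.range (octicGen D.gen)) = degPart D.ideal 8 := by
  refine le_antisymm (Submodule.span_le.2 ?_) fun f hf => ?_
  · rintro _ ⟨(m | m) | m, rfl⟩
    · exact ⟨Ideal.mul_mem_left _ _ D.cub₁_mem, (isHomogeneous_mon m 1).mul D.cub₁_hom⟩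
    · exact ⟨Ideal.mul_mem_left _ _ D.cub₂_mem, (isHomogeneous_mon m 1).mul D.cub₂_hom⟩
    · exact ⟨Ideal.mul_mem_left _ _ D.quart_mem, (isHomogeneous_mon m 1).mul D.quart_hom⟩
  · obtain ⟨x, y, z, rfl⟩ := D.exists_of_mem_degPart hf
    refine add_mem (add_mem ?_ ?_) ?_
    · exact mul_mem_span_of_isHomogeneous (homogeneousComponent_isHomogeneous 5 x) fun m =>
        Submodule.subset_span ⟨Sum.inl (Sum.inl m), rfl⟩
    · exact mul_mem_span_of_isHomogeneous (homogeneousComponent_isHomogeneous 5 y) fun m =>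
        Submodule.subset_span ⟨Sum.inl (Sum.inr m), rfl⟩
    · exact mul_mem_span_of_isHomogeneous (homogeneousComponent_isHomogeneous 4 z) fun m =>
        Submodule.subset_span ⟨Sum.inr m, rfl⟩

theorem HilbertBurch.finrank_degPart_eight (D : HilbertBurch) :
    Module.finrank ℂ (degPart D.ideal 8) = (2 + 8).choose 2 - 8 := by
  have h1 := D.finrank_degPart 3
  have h2 := finrank_form 2 8
  simp only [Nat.reduceAdd] at h1 h2 ⊢
  omega

/-- A family of pairs of cubics through the points of the plane gives the Plücker coordinates of
the corresponding ideals of eight points. -/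
theorem exists_plucker_section {e : Fin 2 → ℕ} {K : Fin 2 → (Fin 3 → ℂ) → Poly 2}
    (hK : ∀ i, HomForm (e i) (K i)) (hK3 : ∀ i p, (K i p).IsHomogeneous 3) {p₀ : ProjSp (Fin 3)}
    {D₀ : HilbertBurch} (h₀ : IsFrame p₀.rep D₀.l)
    (hE₀ : degPart D₀.ideal 3 = Submodule.span ℂ {K 0 p₀.rep, K 1 p₀.rep}) :
    ∃ (d : ℕ) (g : (Fin 3 → ℂ) → (Fin ((2 + 8).choose 2 - 8) → Mon 2 8) → ℂ),
      (∀ c, HomFun d fun p => g p c) ∧ g p₀.rep ≠ 0 ∧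
      ∀ (p : ProjSp (Fin 3)) (D : HilbertBurch), IsFrame p.rep D.l →
        degPart D.ideal 3 = Submodule.span ℂ {K 0 p.rep, K 1 p.rep} →
          ∀ h : g p.rep ≠ 0, IsPluckerPoint (degPart D.ideal 8) (Projectivization.mk ℂ _ h) := by
  obtain ⟨k, hk⟩ := Function.ne_iff.1 p₀.rep_nonzero
  rw [Pi.zero_apply] at hk
  obtain ⟨A, hA, hA2, hAdiv⟩ := exists_chart_division k
  -- Quadratic coefficients of K_i with respect to the chart forms at p, scaled by p_k³ so as to be
  -- polynomial in p. The chart form of index k itself is zero, so two coefficients matter.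
  set B : Fin 2 → Fin 3 → (Fin 3 → ℂ) → Poly 2 := fun i v p =>
    ∑ m : Mon 2 3, C (coeff m.1 (K i p)) * A v m p with hB
  have hBf : ∀ i v, HomForm (e i + 2) (B i v) := fun i v =>
    HomForm.sum _ fun m _ => HomForm.C_mul (hK i m.1) (hA v m)
  have hBh : ∀ i v p, (B i v p).IsHomogeneous 2 := fun i v p =>
    Submodule.sum_mem (Form 2 2) fun m _ => (hA2 v m p).C_mul _
  -- The quartic minor of these coefficients; with the two cubics it generates the ideal at every p
  -- in the chart.
  set Q : (Fin 3 → ℂ) → Poly 2 := fun p =>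
    B 0 (k.succAbove 1) p * -B 1 (k.succAbove 0) p -
      B 1 (k.succAbove 1) p * -B 0 (k.succAbove 0) p with hQ
  have hQf : HomForm (e 0 + e 1 + 4) Q := by
    have h1 := ((hBf 1 (k.succAbove 1)).mul (hBf 0 (k.succAbove 0))).cast
      (show e 1 + 2 + (e 0 + 2) = e 0 + e 1 + 4 by omega)
    have h2 := ((hBf 0 (k.succAbove 1)).mul (hBf 1 (k.succAbove 0))).cast
      (show e 0 + 2 + (e 1 + 2) = e 0 + e 1 + 4 by omega)
    have h3 : Q = fun p => B 1 (k.succAbove 1) p * B 0 (k.succAbove 0) p -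
        B 0 (k.succAbove 1) p * B 1 (k.succAbove 0) p := by
      funext p
      rw [hQ]
      ring
    rw [h3]
    exact h1.sub h2
  set gen : (Fin 3 → ℂ) → Fin 3 → Poly 2 := fun p => ![K 0 p, K 1 p, Q p] with hgen
  have hdata : ∀ (p : ProjSp (Fin 3)) (D : HilbertBurch), IsFrame p.rep D.l → p.rep k ≠ 0 →
      degPart D.ideal 3 = Submodule.span ℂ {K 0 p.rep, K 1 p.rep} →
      Submodule.span ℂ (Set.range (octicGen (gen p.rep))) = degPart D.ideal 8 := by
    intro p D hD hpk hE
    have hfr := isFrame_chartForm hpk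
    have hKD : ∀ i, K i p.rep ∈ degPart D.ideal 3 := by
      intro i
      rw [hE]
      refine Submodule.subset_span ?_
      fin_cases i <;> simp
    have hKp : ∀ i, eval p.rep (K i p.rep) = 0 := by
      intro i
      obtain ⟨a, b, hab⟩ := D.mem_degPart_three.1 (hKD i)
      rw [hab, HilbertBurch.cub₁, HilbertBurch.cub₂]
      simp [hD.eval]
    have hdiv : ∀ i, C (p.rep k ^ 3) * K i p.rep =
        B i (k.succAbove 1) p.rep * chartForm k p.rep (k.succAbove 1) -
          -B i (k.succAbove 0) p.rep * chartForm k p.rep (k.succAbove 0) := by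
      intro i
      have h1 := hAdiv (K i p.rep) (hK3 i p.rep) p.rep
      rw [hKp, C_0, zero_mul, sub_zero, Fin.sum_univ_succAbove _ k, chartForm_self, mul_zero,
        zero_add, Fin.sum_univ_two] at h1
      rw [h1]
      ring
    have hk3 : p.rep k ^ 3 ≠ 0 := pow_ne_zero _ hpk
    have hspan : Submodule.span ℂ {C (p.rep k ^ 3) * K 0 p.rep, C (p.rep k ^ 3) * K 1 p.rep} =
        Submodule.span ℂ {K 0 p.rep, K 1 p.rep} := by
      ext f
      simp only [Submodule.mem_span_pair, ← smul_eq_C_mul, smul_smul]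
      constructor
      · rintro ⟨a, b, rfl⟩
        exact ⟨_, _, rfl⟩
      · rintro ⟨a, b, rfl⟩
        exact ⟨a / p.rep k ^ 3, b / p.rep k ^ 3, by
          rw [div_mul_cancel₀ _ hk3, div_mul_cancel₀ _ hk3]⟩
    have hrel : IsRelPrime (C (p.rep k ^ 3) * K 0 p.rep) (C (p.rep k ^ 3) * K 1 p.rep) := by
      refine isRelPrime_of_span_le D.isRelPrime ?_
      rw [hspan, ← hE, D.degPart_three]
    obtain ⟨D', hl', h1', h2', h3'⟩ := exists_hilbertBurch_of_isFrame hfr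
      (x := fun i => B i (k.succAbove 1) p.rep) (y := fun i => -B i (k.succAbove 0) p.rep)
      (fun i => hBh i _ _) (fun i => (hBh i _ _).neg) (by rw [← hdiv, ← hdiv]; exact hrel)
    rw [← hdiv] at h1' h2'
    -- Both matrices have the same cubics and the same associated point, so linkage identifies their
    -- ideals.
    have hDD : D'.ideal = D.ideal := by
      refine HilbertBurch.ideal_eq_of_degPart_three_eq (p := p) (hl' ▸ hfr) hD ?_
      rw [hE, ← hspan, D'.degPart_three, h1', h2']
    rw [← hDD, ← D'.span_octicGen]
    have hunit : ∀ f : Poly 2, f ∈ Submodule.span ℂ {C (p.rep k ^ 3) * f} := by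
      intro f
      refine Submodule.mem_span_singleton.2 ⟨(p.rep k ^ 3)⁻¹, ?_⟩
      rw [← smul_eq_C_mul, inv_smul_smul₀ hk3]
    refine le_antisymm (Submodule.span_le.2 ?_) (Submodule.span_le.2 ?_)
    · rintro _ ⟨(m | m) | m, rfl⟩
      · obtain ⟨c, hc⟩ := Submodule.mem_span_singleton.1 (hunit (monomial m.1 1 * K 0 p.rep))
        change monomial m.1 1 * K 0 p.rep ∈ _
        rw [← hc]
        refine Submodule.smul_mem _ _ (Submodule.subset_span ⟨Sum.inl (Sum.inl m), ?_⟩)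
        change monomial m.1 1 * D'.cub₁ = _
        rw [h1']
        ring
      · obtain ⟨c, hc⟩ := Submodule.mem_span_singleton.1 (hunit (monomial m.1 1 * K 1 p.rep))
        change monomial m.1 1 * K 1 p.rep ∈ _
        rw [← hc]
        refine Submodule.smul_mem _ _ (Submodule.subset_span ⟨Sum.inl (Sum.inr m), ?_⟩)
        change monomial m.1 1 * D'.cub₂ = _
        rw [h2']
        ring
      · refine Submodule.subset_span ⟨Sum.inr m, ?_⟩
        change monomial m.1 1 * D'.quart = monomial m.1 1 * Q p.rep
        rw [h3']
    · rintro _ ⟨(m | m) | m, rfl⟩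
      · change monomial m.1 1 * D'.cub₁ ∈ _
        rw [h1', mul_left_comm, ← smul_eq_C_mul]
        exact Submodule.smul_mem _ _ (Submodule.subset_span ⟨Sum.inl (Sum.inl m), rfl⟩)
      · change monomial m.1 1 * D'.cub₂ ∈ _
        rw [h2', mul_left_comm, ← smul_eq_C_mul]
        exact Submodule.smul_mem _ _ (Submodule.subset_span ⟨Sum.inl (Sum.inr m), rfl⟩)
      · refine Submodule.subset_span ⟨Sum.inr m, ?_⟩
        change monomial m.1 1 * Q p.rep = monomial m.1 1 * D'.quart
        rw [h3']
  have h8 := hdata p₀ D₀ h₀ hk hE₀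
  have hcard : (2 + 8).choose 2 - 8 =
      Module.finrank ℂ (Submodule.span ℂ (Set.range (octicGen (gen p₀.rep)))) := by
    rw [h8, D₀.finrank_degPart_eight]
  have hfin : FiniteDimensional ℂ (Submodule.span ℂ (Set.range (octicGen (gen p₀.rep)))) :=
    FiniteDimensional.span_of_finite ℂ (Set.finite_range _)
  -- Fix 37 = 45 - 8 of the octic multiples that form a basis at `p₀`. The same multiples remain a
  -- basis wherever their Plücker vector is nonzero.
  obtain ⟨f, hf, -, hli⟩ :=
    Submodule.exists_fun_fin_finrank_span_eq ℂ (Set.range (octicGen (gen p₀.rep)))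
  choose ι hι using hf
  set b : (Fin 3 → ℂ) → Fin ((2 + 8).choose 2 - 8) → Poly 2 := fun p i =>
    octicGen (gen p) (ι (Fin.cast hcard i)) with hb
  have hb₀ : pluckerVec (d := 8) (b p₀.rep) ≠ 0 := by
    have hbf : b p₀.rep = fun i => f (Fin.cast hcard i) := funext fun i => hι _
    refine exists_det_ne_zero_of_linearIndependent (fun i => ?_) ?_
    · have : b p₀.rep i ∈ degPart D₀.ideal 8 := h8 ▸ Submodule.subset_span ⟨_, rfl⟩
      exact this.2
    · rw [hbf]
      exact hli.comp _ (Fin.cast_injective hcard)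
  have hrow : ∀ j, ∃ r, HomForm r fun p => octicGen (gen p) j := by
    rintro ((m | m) | m)
    · exact ⟨_, (HomForm.const (monomial m.1 1)).mul (hK 0)⟩
    · exact ⟨_, (HomForm.const (monomial m.1 1)).mul (hK 1)⟩
    · exact ⟨_, (HomForm.const (monomial m.1 1)).mul hQf⟩
  choose r hr using hrow
  -- The factor p_k makes a nonzero value of the section place p in the chart.
  refine ⟨1 + ∑ i, r (ι (Fin.cast hcard i)), fun p c => p k * pluckerVec (d := 8) (b p) c, ?_, ?_, ?_⟩
  · intro c
    refine (homFun_coord k).mul (HomFun.det (r := fun i => r (ι (Fin.cast hcard i))) ?_)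
    intro i j
    exact hr _ _
  · obtain ⟨c, hc⟩ := Function.ne_iff.1 hb₀
    exact Function.ne_iff.2 ⟨c, mul_ne_zero hk hc⟩
  · intro p D hD hE h
    obtain ⟨c, hc⟩ := Function.ne_iff.1 h
    have hpk : p.rep k ≠ 0 := left_ne_zero_of_mul hc
    have hbp : pluckerVec (d := 8) (b p.rep) ≠ 0 :=
      Function.ne_iff.2 ⟨c, right_ne_zero_of_mul hc⟩
    have hmk : Projectivization.mk ℂ _ h = Projectivization.mk ℂ _ hbp := by
      rw [Projectivization.mk_eq_mk_iff']
      exact ⟨p.rep k, rfl⟩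
    rw [hmk]
    refine isPluckerPoint_mk D.finrank_degPart_eight (fun i => ?_) hbp
    rw [← hdata p D hD hpk hE]
    exact Submodule.subset_span ⟨_, rfl⟩

end Section

/-! ### General pencils and their polar octahedra -/

section Distinguished

open MvPolynomial

variable {κ : Type*} (lam : Poly 2 →ₗ[ℂ] ℂ) (T : Poly 2 →ₗ[ℂ] Poly 2)

/-- The radical of the alternating form given by `lam` and `T`. -/
def radicalOf (p : Fin 3 → ℂ) : Fin 3 → ℂ :=
  ![lam (triple p (fun i => T (X 1 * X i)) fun i => T (X 2 * X i)),
    lam (triple p (fun i => T (X 2 * X i)) fun i => T (X 0 * X i)),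
    lam (triple p (fun i => T (X 0 * X i)) fun i => T (X 1 * X i))]

/-- The distinguished cubic given by `lam` and `T`. -/
def cubicAt (p : Fin 3 → ℂ) : Poly 2 :=
  triple p (fun i => C (radicalOf lam T p 0) * T (X 0 * X i) +
    C (radicalOf lam T p 1) * T (X 1 * X i) + C (radicalOf lam T p 2) * T (X 2 * X i)) X

variable {lam T}

theorem Transfer.radical_eq {mu : Poly 2 →ₗ[ℂ] ℂ} (t : Transfer lam mu) (p : Fin 3 → ℂ) :
    t.radical p = radicalOf lam t.T p := rfl

theorem Transfer.cubic_eq {mu : Poly 2 →ₗ[ℂ] ℂ} (t : Transfer lam mu) (p : Fin 3 → ℂ) :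
    t.cubic p = cubicAt lam t.T p := by
  rw [Transfer.cubic, Transfer.cubicOf, cubicAt]
  simp only [T_linForm_mul, radical_eq]

section Bi

variable {lam : (κ → ℂ) → Poly 2 →ₗ[ℂ] ℂ} {T : (κ → ℂ) → Poly 2 →ₗ[ℂ] Poly 2}
  (hlam : ∀ i j i' j', BiHom 0 fun a (_ : Fin 3 → ℂ) =>
    lam a (T a (X i * X j) * T a (X i' * X j')))
  (hT : ∀ i j, BiForm 0 fun a (_ : Fin 3 → ℂ) => T a (X i * X j))

include hlam in
theorem biHom_radicalOf (i : Fin 3) : BiHom 1 fun a p => radicalOf (lam a) (T a) p i := by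
  have h : ∀ j k, BiHom 1 fun a (p : Fin 3 → ℂ) =>
      lam a (triple p (fun i => T a (X j * X i)) fun i => T a (X k * X i)) := by
    intro j k
    simp only [map_triple]
    exact (((biHom_coord 0).mul ((hlam _ _ _ _).sub (hlam _ _ _ _))).add
      ((biHom_coord 1).mul ((hlam _ _ _ _).sub (hlam _ _ _ _)))).add
      ((biHom_coord 2).mul ((hlam _ _ _ _).sub (hlam _ _ _ _)))
  fin_cases i
  · exact h 1 2
  · exact h 2 0
  · exact h 0 1

include hlam hT in
theorem biForm_cubicAt : BiForm 2 fun a p => cubicAt (lam a) (T a) p := by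
  have h : ∀ i, BiForm 1 fun a (p : Fin 3 → ℂ) =>
      C (radicalOf (lam a) (T a) p 0) * T a (X 0 * X i) +
      C (radicalOf (lam a) (T a) p 1) * T a (X 1 * X i) +
      C (radicalOf (lam a) (T a) p 2) * T a (X 2 * X i) := fun i =>
    ((BiForm.C_mul (biHom_radicalOf hlam 0) (hT 0 i)).add
      (BiForm.C_mul (biHom_radicalOf hlam 1) (hT 1 i))).add
      (BiForm.C_mul (biHom_radicalOf hlam 2) (hT 2 i))
  have h' : ∀ k i j, BiForm 2 fun a (p : Fin 3 → ℂ) =>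
      C (p k) * ((C (radicalOf (lam a) (T a) p 0) * T a (X 0 * X i) +
        C (radicalOf (lam a) (T a) p 1) * T a (X 1 * X i) +
        C (radicalOf (lam a) (T a) p 2) * T a (X 2 * X i)) * X j -
        (C (radicalOf (lam a) (T a) p 0) * T a (X 0 * X j) +
        C (radicalOf (lam a) (T a) p 1) * T a (X 1 * X j) +
        C (radicalOf (lam a) (T a) p 2) * T a (X 2 * X j)) * X i) := fun k i j =>
    BiForm.C_mul (biHom_coord k) (((h i).mul (BiForm.const (X j))).sub
      ((h j).mul (BiForm.const (X i))))
  exact ((h' 0 1 2).add (h' 1 2 0)).add (h' 2 0 1)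

end Bi

theorem Transfer.homForm_cubic {lam mu : Poly 2 →ₗ[ℂ] ℂ} (t : Transfer lam mu) :
    HomForm 2 t.cubic := by
  have h := (biForm_cubicAt (κ := Empty) (lam := fun _ => lam) (T := fun _ => t.T)
    (fun _ _ _ _ => biHom_const _) fun _ _ => BiForm.const _).homForm Empty.elim
  have e : t.cubic = fun p => cubicAt lam t.T p := funext t.cubic_eq
  rw [e]
  exact h

end Distinguished

/-! ### Genericity conditions, and the apolar pencil of cubics at a good point -/

section General

open MvPolynomial

/-- The genericity conditions on a pencil of functionals on quartics. -/
structure GeneralPencil (lam mu : Poly 2 →ₗ[ℂ] ℂ) where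
  s : Transfer lam mu
  t : Transfer mu lam
  finrank_le : ∀ p : Fin 3 → ℂ, p ≠ 0 → Module.finrank ℂ (apolarCubicsAt lam mu p) ≤ 3
  unrelated : ∀ p : Fin 3 → ℂ, p ≠ 0 → IsUnrelatedAt lam mu p
  radical_s : ∀ p : Fin 3 → ℂ, p ≠ 0 → s.radical p ≠ 0
  radical_t : ∀ p : Fin 3 → ℂ, p ≠ 0 → t.radical p ≠ 0
  line_mul : ∀ l q q' : Poly 2, l.IsHomogeneous 1 → q.IsHomogeneous 2 → q'.IsHomogeneous 2 →
    l ≠ 0 → l * q ∈ apolarCubics lam mu → l * q' ∈ apolarCubics lam mu →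
      ¬LinearIndependent ℂ ![q, q']
  conic_mul : ∀ q l l' : Poly 2, q.IsHomogeneous 2 → l.IsHomogeneous 1 → l'.IsHomogeneous 1 →
    q ≠ 0 → q * l ∈ apolarCubics lam mu → q * l' ∈ apolarCubics lam mu →
      ¬LinearIndependent ℂ ![l, l']
  line : ∀ p : Fin 3 → ℂ, p ≠ 0 → p 0 + p 1 + p 2 = 0 →
    LinearIndependent ℂ ![s.cubic p, t.cubic p]

theorem linearIndependent_of_mul {f g h : Poly 2} (hli : LinearIndependent ℂ ![h * f, h * g]) :
    LinearIndependent ℂ ![f, g] := by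
  rw [LinearIndependent.pair_iff] at hli ⊢
  intro a b hab
  refine hli a b ?_
  rw [← mul_smul_comm, ← mul_smul_comm, ← mul_add, hab, mul_zero]

namespace GeneralPencil

variable {lam mu : Poly 2 →ₗ[ℂ] ℂ} (G : GeneralPencil lam mu)

include G in
theorem isRelPrime {K : Fin 2 → Poly 2} (hK : ∀ i, K i ∈ apolarCubics lam mu)
    (hli : LinearIndependent ℂ K) : IsRelPrime (K 0) (K 1) := by
  have hli' := linearIndependent_pair hli
  refine isRelPrime_of_not_reducible (fun i => (hK i).1) hli ?_ ?_
  · intro l q q' hl hq hq' hl0 h0 h1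
    rw [h0, h1] at hli'
    exact G.line_mul l q q' hl hq hq' hl0 (h0 ▸ hK 0) (h1 ▸ hK 1) (linearIndependent_of_mul hli')
  · intro q l l' hq hl hl' hq0 h0 h1
    rw [h0, h1] at hli'
    exact G.conic_mul q l l' hq hl hl' hq0 (h0 ▸ hK 0) (h1 ▸ hK 1) (linearIndependent_of_mul hli')

/-- The ideal of a Hilbert–Burch matrix is apolar to the pencil. -/
structure IsApolarTo (lam mu : Poly 2 →ₗ[ℂ] ℂ) (D : HilbertBurch) : Prop where
  cub₁ : D.cub₁ ∈ apolarCubics lam mu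
  cub₂ : D.cub₂ ∈ apolarCubics lam mu
  lam : lam D.quart = 0
  mu : mu D.quart = 0

theorem range_pair (f g : Poly 2) : Set.range ![f, g] = {f, g} := by
  simp [Set.pair_comm]

include G in
theorem exists_hilbertBurch {p : Fin 3 → ℂ} (hp : p ≠ 0) {K : Fin 2 → Poly 2}
    (hK : ∀ i, K i ∈ apolarCubicsAt lam mu p) (hli : LinearIndependent ℂ K) :
    ∃ D : HilbertBurch, IsFrame p D.l ∧ D.cub₁ = K 0 ∧ D.cub₂ = K 1 := by
  obtain ⟨l, hl⟩ := exists_isFrame hp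
  have hK' := fun i => mem_apolarCubicsAt.1 (hK i)
  choose x y hx hy hxy using fun i => hl.exists_eq hp (hK' i).1.1 (hK' i).2
  obtain ⟨D, h1, h2, h3, -⟩ := exists_hilbertBurch_of_isFrame hl hx hy (by
    rw [← hxy, ← hxy]
    exact G.isRelPrime (fun i => (hK' i).1) hli)
  exact ⟨D, h1 ▸ hl, by rw [h2, hxy], by rw [h3, hxy]⟩

/-- `cubic_mem_span_iff` applied twice, the second time with `lam` and `mu` exchanged. The cubic
minors are written as x_i l₁ - y_i l₀ with x = (-b₀, a₀) and y = (-b₁, a₁), whose minor is `quart`.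
-/
theorem quart_eq_zero_iff {p : Fin 3 → ℂ} (hp : p ≠ 0) {D : HilbertBurch} (hD : IsFrame p D.l)
    (h₁ : D.cub₁ ∈ apolarCubics lam mu) (h₂ : D.cub₂ ∈ apolarCubics lam mu) :
    (lam D.quart = 0 ↔ G.s.cubic p ∈ degPart D.ideal 3) ∧
      (mu D.quart = 0 ↔ G.t.cubic p ∈ degPart D.ideal 3) := by
  have e : ![-D.b 0, D.a 0] 0 * ![-D.b 1, D.a 1] 1 - ![-D.b 0, D.a 0] 1 * ![-D.b 1, D.a 1] 0 =
      D.quart := by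
    simp [HilbertBurch.quart]
    ring
  have hx : ∀ i, ((![-D.b 0, D.a 0] : Fin 2 → Poly 2) i).IsHomogeneous 2 := by
    intro i
    fin_cases i
    · exact (D.hb 0).neg
    · exact D.ha 0
  have hy : ∀ i, ((![-D.b 1, D.a 1] : Fin 2 → Poly 2) i).IsHomogeneous 2 := by
    intro i
    fin_cases i
    · exact (D.hb 1).neg
    · exact D.ha 1
  have hK : ∀ i, (![D.cub₁, D.cub₂] : Fin 2 → Poly 2) i =
      ![-D.b 0, D.a 0] i * D.l 1 - ![-D.b 1, D.a 1] i * D.l 0 := by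
    intro i
    fin_cases i
    · simp [HilbertBurch.cub₁]
      ring
    · simp [HilbertBurch.cub₂]
  have hKN : ∀ i, (![D.cub₁, D.cub₂] : Fin 2 → Poly 2) i ∈ apolarCubics lam mu := by
    intro i
    fin_cases i
    · exact h₁
    · exact h₂
  have h3 : degPart D.ideal 3 = Submodule.span ℂ (Set.range ![D.cub₁, D.cub₂]) := by
    rw [range_pair, D.degPart_three]
  rw [h3, ← e]
  refine ⟨G.s.cubic_mem_span_iff hp (G.unrelated p hp) (G.radical_s p hp) (G.finrank_le p hp) hD
    hx hy hK hKN D.cub_independent, ?_⟩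
  refine G.t.cubic_mem_span_iff hp (G.unrelated p hp).swap (G.radical_t p hp) ?_ hD
    hx hy hK (fun i => apolarCubics_swap ▸ hKN i) D.cub_independent
  rw [← apolarCubicsAt_swap]
  exact G.finrank_le p hp

/-- The points at which the two distinguished cubics span a pencil. -/
def goodSet : Set (ProjSp (Fin 3)) :=
  {p | LinearIndependent ℂ ![G.s.cubic p.rep, G.t.cubic p.rep]}

theorem s_cubic_mem (p : Fin 3 → ℂ) : G.s.cubic p ∈ apolarCubicsAt lam mu p := G.s.cubic_mem p

theorem t_cubic_mem (p : Fin 3 → ℂ) : G.t.cubic p ∈ apolarCubicsAt lam mu p := by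
  rw [apolarCubicsAt_swap]
  exact G.t.cubic_mem p

/-- The pencil contains both radicals, and these already span a plane. This is the uniqueness of the
octahedron over a good point. -/
theorem degPart_three_eq {p : ProjSp (Fin 3)} {D : HilbertBurch} (hD : IsFrame p.rep D.l)
    (hA : IsApolarTo lam mu D) (hp : p ∈ G.goodSet) :
    degPart D.ideal 3 = Submodule.span ℂ {G.s.cubic p.rep, G.t.cubic p.rep} := by
  obtain ⟨h1, h2⟩ := G.quart_eq_zero_iff p.rep_nonzero hD hA.cub₁ hA.cub₂
  refine (Submodule.eq_of_le_of_finrank_le (Submodule.span_le.2 ?_) ?_).symm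
  · rintro f (rfl | rfl)
    · exact h1.1 hA.lam
    · exact h2.1 hA.mu
  · rw [D.degPart_three, ← range_pair, ← range_pair, finrank_span_eq_card D.cub_independent,
      finrank_span_eq_card hp]

theorem exists_of_mem_goodSet {p : ProjSp (Fin 3)} (hp : p ∈ G.goodSet) :
    ∃ D : HilbertBurch, IsFrame p.rep D.l ∧ IsApolarTo lam mu D := by
  have hmem : ∀ i, (![G.s.cubic p.rep, G.t.cubic p.rep] : Fin 2 → Poly 2) i ∈
      apolarCubicsAt lam mu p.rep := by
    intro i
    fin_cases i
    · exact G.s_cubic_mem _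
    · exact G.t_cubic_mem _
  obtain ⟨D, hD, h1, h2⟩ := G.exists_hilbertBurch p.rep_nonzero hmem hp
  have h1' : D.cub₁ ∈ apolarCubics lam mu := h1 ▸ (mem_apolarCubicsAt.1 (hmem 0)).1
  have h2' : D.cub₂ ∈ apolarCubics lam mu := h2 ▸ (mem_apolarCubicsAt.1 (hmem 1)).1
  obtain ⟨e1, e2⟩ := G.quart_eq_zero_iff p.rep_nonzero hD h1' h2'
  refine ⟨D, hD, h1', h2', e1.2 ?_, e2.2 ?_⟩
  · rw [D.degPart_three, h1]
    exact Submodule.subset_span (by simp)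
  · rw [D.degPart_three, h2]
    exact Submodule.subset_span (by simp)

end GeneralPencil

/-! ### Ideals from their octics -/

theorem degPart_le_of_le {n : ℕ} {I J : Ideal (Poly n)}
    (hJ : ∀ f : Poly n, (∀ i, X i * f ∈ J) → f ∈ J) {s : ℕ} (h : degPart I s ≤ degPart J s) :
    ∀ t, t ≤ s → degPart I t ≤ degPart J t := by
  have key : ∀ m t, t + m = s → degPart I t ≤ degPart J t := by
    intro m
    induction m with
    | zero =>
      intro t ht
      obtain rfl : t = s := ht
      exact h
    | succ m ih =>
      intro t ht f hf
      refine ⟨hJ f fun i => ?_, hf.2⟩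
      refine (ih (t + 1) (by omega) (⟨Ideal.mul_mem_left _ _ hf.1, ?_⟩ : X i * f ∈ degPart I _)).1
      exact mul_comm f (X i) ▸ IsHomogeneous.mul hf.2 (isHomogeneous_X ℂ i)
  exact fun t ht => key (s - t) t (by omega)

/-- The generators have degrees 3 and 4, and saturation recovers these pieces from degree 8. So the
Plücker point determines the ideal. -/
theorem HilbertBurch.ideal_eq_of_degPart_eight_eq {D D' : HilbertBurch}
    (h : degPart D.ideal 8 = degPart D'.ideal 8) : D.ideal = D'.ideal := by
  have key : ∀ D D' : HilbertBurch, degPart D.ideal 8 = degPart D'.ideal 8 →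
      D.ideal ≤ D'.ideal := by
    intro D D' h
    have h1 := degPart_le_of_le D'.saturated h.le
    exact HilbertBurch.ideal_le (h1 3 (by norm_num) ⟨D.cub₁_mem, D.cub₁_hom⟩).1
      (h1 3 (by norm_num) ⟨D.cub₂_mem, D.cub₂_hom⟩).1
      (h1 4 (by norm_num) ⟨D.quart_mem, D.quart_hom⟩).1
  exact le_antisymm (key D D' h) (key D' D h.symm)

/-! ### Polar octahedra are given by apolar Hilbert–Burch matrices -/

-- Resolution-generality enters only through the Hilbert function: 2 cubics, 7 quartics, 13
-- quintics. The cubics of an apolar ideal are apolar, and coprime because the pencil is general, so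
-- the counting form of Hilbert–Burch applies. Conversely, apolarity is tested on quartics, which
-- come from linear multiples of the cubics and from the quartic minor.
open GeneralPencil in
theorem isPolarPolyhedron_iff {F : Fin 2 → Poly 2} (hF : ∀ i, (F i).IsHomogeneous 4)
    (G : GeneralPencil (formFunctional fun m : Mon 2 4 => coeff m.1 (F 0))
      (formFunctional fun m : Mon 2 4 => coeff m.1 (F 1))) (I : Ideal (Poly 2)) :
    IsPolarPolyhedron 8 (Submodule.span ℂ (Set.range F)) I ↔
      ∃ D : HilbertBurch, D.ideal = I ∧
        IsApolarTo (formFunctional fun m : Mon 2 4 => coeff m.1 (F 0))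
          (formFunctional fun m : Mon 2 4 => coeff m.1 (F 1)) D := by
  constructor
  · rintro ⟨hs, hr, ha⟩
    rw [isApolar_span_iff hs.homogeneous hF] at ha
    have f3 := two_mul_finrank_form_two 3
    have f4 := two_mul_finrank_form_two 4
    have f5 := two_mul_finrank_form_two 5
    have d3 := hr.finrank_degPart 0
    have d4 := hr.finrank_degPart 1
    have d5 := hr.finrank_degPart 2
    simp only [Nat.reduceAdd] at d3 d4 d5
    have hN : ∀ f ∈ degPart I 3, f ∈ apolarCubics
        (formFunctional fun m : Mon 2 4 => coeff m.1 (F 0))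
        (formFunctional fun m : Mon 2 4 => coeff m.1 (F 1)) := by
      intro f hf
      have h1 : ∀ i, X i * f ∈ degPart I 4 := fun i =>
        ⟨Ideal.mul_mem_left _ _ hf.1, mul_comm f (X i) ▸ IsHomogeneous.mul hf.2 (isHomogeneous_X ℂ i)⟩
      exact ⟨hf.2, fun i => ⟨ha _ (h1 i) 0, ha _ (h1 i) 1⟩⟩
    obtain ⟨D, rfl⟩ := exists_hilbertBurch_of_isSchemeIdeal hs (by omega) (by omega) (by omega)
      fun b hb hli => G.isRelPrime (fun i => hN _ (hb i)) hli
    have hq : D.quart ∈ degPart D.ideal 4 := ⟨D.quart_mem, D.quart_hom⟩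
    exact ⟨D, rfl, hN _ ⟨D.cub₁_mem, D.cub₁_hom⟩, hN _ ⟨D.cub₂_mem, D.cub₂_hom⟩, ha _ hq 0,
      ha _ hq 1⟩
  · rintro ⟨D, rfl, hA⟩
    refine ⟨D.isSchemeIdeal, D.isResolutionGeneral, (isApolar_span_iff D.homogeneous hF).2 ?_⟩
    intro f hf i
    obtain ⟨x, y, c, hx, hy, rfl⟩ := D.exists_of_mem_degPart_four hf
    obtain ⟨x1, x2⟩ := apolar_mul_eq_zero hA.cub₁ hx
    obtain ⟨y1, y2⟩ := apolar_mul_eq_zero hA.cub₂ hy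
    fin_cases i
    · change formFunctional (fun m : Mon 2 4 => coeff m.1 (F 0)) _ = 0
      rw [map_add, map_add, map_C_mul, x1, y1, hA.lam]
      simp
    · change formFunctional (fun m : Mon 2 4 => coeff m.1 (F 1)) _ = 0
      rw [map_add, map_add, map_C_mul, x2, y2, hA.mu]
      simp

end General

/-! ### The family of polar octahedra of a general pencil -/

section Family

open MvPolynomial

theorem exists_nondegenerate_minor {f g : Poly 2} (hf : f.IsHomogeneous 3) (hg : g.IsHomogeneous 3)
    (h : LinearIndependent ℂ ![f, g]) :
    ∃ m m' : Mon 2 3, coeff m.1 f * coeff m'.1 g - coeff m'.1 f * coeff m.1 g ≠ 0 := by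
  by_contra hcon
  push Not at hcon
  rw [LinearIndependent.pair_iff] at h
  have hf0 : f ≠ 0 := by
    rintro rfl
    simpa using h 1 0 (by simp)
  obtain ⟨m, hm⟩ : ∃ m : Mon 2 3, coeff m.1 f ≠ 0 := by
    by_contra hc
    push Not at hc
    exact hf0 (form_ext hf (isHomogeneous_zero _ _ _) fun m => by simpa using hc m)
  refine hm (neg_eq_zero.1 (h (coeff m.1 g) (-coeff m.1 f) ?_).2)
  refine form_ext (d := 3) ?_ (isHomogeneous_zero _ _ _) fun m' => ?_
  · rw [smul_eq_C_mul, smul_eq_C_mul]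
    exact (hf.C_mul _).add (hg.C_mul _)
  · rw [coeff_add, coeff_smul, coeff_smul, smul_eq_mul, smul_eq_mul, coeff_zero]
    linear_combination -hcon m m'

theorem linearIndependent_of_minor {f g : Poly 2} {m m' : Fin 3 →₀ ℕ}
    (h : coeff m f * coeff m' g - coeff m' f * coeff m g ≠ 0) : LinearIndependent ℂ ![f, g] := by
  rw [LinearIndependent.pair_iff]
  intro a b hab
  have h1 := congrArg (coeff m) hab
  have h2 := congrArg (coeff m') hab
  simp only [coeff_add, coeff_smul, smul_eq_mul, coeff_zero] at h1 h2
  constructor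
  · refine (mul_eq_zero.1 (?_ : a * _ = 0)).resolve_right h
    linear_combination coeff m' g * h1 - coeff m g * h2
  · refine (mul_eq_zero.1 (?_ : b * _ = 0)).resolve_right h
    linear_combination -coeff m' f * h1 + coeff m f * h2

instance (n d : ℕ) : Nonempty (Mon n d) :=
  ⟨⟨Finsupp.single 0 d, by simp [Finset.mem_finsuppAntidiag, Finsupp.single_apply]⟩⟩

theorem isPluckerPoint_exists (D : HilbertBurch) :
    ∃ z : HilbSpace 2 8, IsPluckerPoint (degPart D.ideal 8) z :=
  exists_isPluckerPoint inf_le_right D.finrank_degPart_eight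

open Classical in
/-- The associated point of the scheme with Plücker point `z`. -/
def assocPoint (z : HilbSpace 2 8) : ProjSp (Fin 3) :=
  if h : ∃ (p : ProjSp (Fin 3)) (D : HilbertBurch), IsPluckerPoint (degPart D.ideal 8) z ∧
    IsFrame p.rep D.l then h.choose else Classical.arbitrary _

/-- The choice in `assocPoint` is harmless: the octics determine the ideal, and the ideal determines
the point through its colon ideal. -/
theorem assocPoint_eq {z : HilbSpace 2 8} {D : HilbertBurch}
    (hz : IsPluckerPoint (degPart D.ideal 8) z) {p : ProjSp (Fin 3)} (hp : IsFrame p.rep D.l) :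
    assocPoint z = p := by
  have h : ∃ (p : ProjSp (Fin 3)) (D : HilbertBurch), IsPluckerPoint (degPart D.ideal 8) z ∧
    IsFrame p.rep D.l := ⟨p, D, hz, hp⟩
  rw [assocPoint, dif_pos h]
  obtain ⟨D', hz', hp'⟩ := h.choose_spec
  have e : D'.ideal = D.ideal :=
    HilbertBurch.ideal_eq_of_degPart_eight_eq (hz'.ext hz inf_le_right inf_le_right)
  rw [← D.isAssociatedPoint_iff, IsAssociatedPoint] at hp
  rw [← D'.isAssociatedPoint_iff, IsAssociatedPoint, e] at hp'
  exact pointIdeal_injective (hp'.symm.trans hp)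

theorem isFrame_assocPoint {z : HilbSpace 2 8} {D : HilbertBurch}
    (hz : IsPluckerPoint (degPart D.ideal 8) z) : IsFrame (assocPoint z).rep D.l := by
  obtain ⟨p, hp⟩ := D.exists_isAssociatedPoint
  rw [D.isAssociatedPoint_iff] at hp
  rwa [assocPoint_eq hz hp]

namespace GeneralPencil

variable {lam mu : Poly 2 →ₗ[ℂ] ℂ} 

/-- The Plücker points of the schemes whose Hilbert–Burch matrix is apolar to the pencil. -/
def family (lam mu : Poly 2 →ₗ[ℂ] ℂ) : Set (HilbSpace 2 8) :=
  {z | ∃ D : HilbertBurch, IsApolarTo lam mu D ∧ IsPluckerPoint (degPart D.ideal 8) z}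

open Classical in
/-- The point of the family with a given associated point. -/
def octahedronAt (lam mu : Poly 2 →ₗ[ℂ] ℂ) (p : ProjSp (Fin 3)) : HilbSpace 2 8 :=
  if h : ∃ (z : HilbSpace 2 8) (D : HilbertBurch), IsApolarTo lam mu D ∧
    IsPluckerPoint (degPart D.ideal 8) z ∧ IsFrame p.rep D.l then h.choose
  else Classical.arbitrary _

variable (G : GeneralPencil lam mu)

include G in
theorem octahedronAt_eq {z : HilbSpace 2 8} {D : HilbertBurch} (hA : IsApolarTo lam mu D)
    (hz : IsPluckerPoint (degPart D.ideal 8) z) {p : ProjSp (Fin 3)} (hp : IsFrame p.rep D.l)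
    (hg : p ∈ G.goodSet) : octahedronAt lam mu p = z := by
  have h : ∃ (z : HilbSpace 2 8) (D : HilbertBurch), IsApolarTo lam mu D ∧
    IsPluckerPoint (degPart D.ideal 8) z ∧ IsFrame p.rep D.l := ⟨z, D, hA, hz, hp⟩
  rw [octahedronAt, dif_pos h]
  obtain ⟨D', hA', hz', hp'⟩ := h.choose_spec
  have e : D'.ideal = D.ideal := HilbertBurch.ideal_eq_of_degPart_three_eq hp' hp
    ((G.degPart_three_eq hp' hA' hg).trans (G.degPart_three_eq hp hA hg).symm)
  rw [e] at hz'
  exact hz'.unique hz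

theorem isOpen_goodSet : IsOpen G.goodSet := by
  have : G.goodSet = ⋃ (m : Mon 2 3) (m' : Mon 2 3), {p : ProjSp (Fin 3) |
      coeff m.1 (G.s.cubic p.rep) * coeff m'.1 (G.t.cubic p.rep) -
        coeff m'.1 (G.s.cubic p.rep) * coeff m.1 (G.t.cubic p.rep) ≠ 0} := by
    ext p
    simp only [Set.mem_iUnion]
    constructor
    · intro h
      exact exists_nondegenerate_minor (mem_apolarCubicsAt.1 (G.s_cubic_mem _)).1.1
        (mem_apolarCubicsAt.1 (G.t_cubic_mem _)).1.1 h
    · rintro ⟨m, m', h⟩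
      exact linearIndependent_of_minor h
  rw [this]
  refine isOpen_iUnion fun m => isOpen_iUnion fun m' => ?_
  exact isOpen_ne_zero (((G.s.homForm_cubic m.1).mul (G.t.homForm_cubic m'.1)).sub
    ((G.s.homForm_cubic m'.1).mul (G.t.homForm_cubic m.1)))

/-- A point on the auxiliary line is good. -/
theorem mem_goodSet_of_line {p : ProjSp (Fin 3)} (h : p.rep 0 + p.rep 1 + p.rep 2 = 0) :
    p ∈ G.goodSet := G.line _ p.rep_nonzero h

theorem dense_goodSet : Dense G.goodSet := by
  refine G.isOpen_goodSet.dense ?_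
  -- Any point of the auxiliary line would do; an open nonempty set is dense because the plane is
  -- irreducible.
  have hv : (![1, -1, 0] : Fin 3 → ℂ) ≠ 0 := fun h => one_ne_zero (congrFun h 0)
  refine ⟨Projectivization.mk ℂ _ hv, G.mem_goodSet_of_line ?_⟩
  have h : HomFun 1 fun p : Fin 3 → ℂ => p 0 + p 1 + p 2 :=
    ((homFun_coord 0).add (homFun_coord 1)).add (homFun_coord 2)
  exact not_not.1 fun hne => (h.ne_zero_congr hv).1 hne (by simp)

theorem octahedronAt_mem {p : ProjSp (Fin 3)} (hp : p ∈ G.goodSet) :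
    octahedronAt lam mu p ∈ family lam mu := by
  obtain ⟨D, hD, hA⟩ := G.exists_of_mem_goodSet hp
  obtain ⟨z, hz⟩ := isPluckerPoint_exists D
  rw [G.octahedronAt_eq hA hz hD hp]
  exact ⟨D, hA, hz⟩

theorem assocPoint_octahedronAt {p : ProjSp (Fin 3)} (hp : p ∈ G.goodSet) :
    assocPoint (octahedronAt lam mu p) = p := by
  obtain ⟨D, hD, hA⟩ := G.exists_of_mem_goodSet hp
  obtain ⟨z, hz⟩ := isPluckerPoint_exists D
  rw [G.octahedronAt_eq hA hz hD hp]
  exact assocPoint_eq hz hD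

theorem octahedronAt_assocPoint {z : HilbSpace 2 8} (hz : z ∈ family lam mu)
    (hp : assocPoint z ∈ G.goodSet) : octahedronAt lam mu (assocPoint z) = z := by
  obtain ⟨D, hA, hDz⟩ := hz
  exact G.octahedronAt_eq hA hDz (isFrame_assocPoint hDz) hp

/-- The two radicals depend on p through forms of degree 2, so the Plücker section for this pair of
cubics gives the map locally. -/
theorem isRegularOn_octahedronAt : IsRegularOn (octahedronAt lam mu) G.goodSet := by
  refine isRegularOn_of_homFun fun p₀ hp₀ => ?_
  obtain ⟨D₀, hD₀, hA₀⟩ := G.exists_of_mem_goodSet hp₀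
  obtain ⟨d, g, hg, hg0, h⟩ := exists_plucker_section (e := fun _ => 2)
    (K := ![G.s.cubic, G.t.cubic]) (fun i => by
      fin_cases i
      · exact G.s.homForm_cubic
      · exact G.t.homForm_cubic) (fun i p => by
      fin_cases i
      · exact (mem_apolarCubicsAt.1 (G.s_cubic_mem _)).1.1
      · exact (mem_apolarCubicsAt.1 (G.t_cubic_mem _)).1.1) hD₀ (G.degPart_three_eq hD₀ hA₀ hp₀)
  refine ⟨d, g, hg, hg0, fun p hp hgp => ?_⟩
  obtain ⟨D, hD, hA⟩ := G.exists_of_mem_goodSet hp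
  exact G.octahedronAt_eq hA (h p D hD (G.degPart_three_eq hD hA hp) hgp) hD hp

end GeneralPencil

end Family

/-! ### Moving along a curve -/

section Curve

open MvPolynomial

/-- Every form of positive degree has a zero on the line `x₀ + x₁ + x₂ = 0`. -/
theorem exists_zero_on_line {f : Poly 2} {d : ℕ} (hf : f.IsHomogeneous d) (hd : d ≠ 0) :
    ∃ p : Fin 3 → ℂ, p ≠ 0 ∧ p 0 + p 1 + p 2 = 0 ∧ eval p f = 0 := by
  set v : ℂ → Fin 3 → ℂ := fun t => ![t, 1, -1 - t] with hv
  have hv0 : ∀ t, v t ≠ 0 := fun t h => one_ne_zero (congrFun h 1)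
  have hvs : ∀ t, v t 0 + v t 1 + v t 2 = 0 := fun t => by
    simp [hv]
    ring
  set q : Polynomial ℂ :=
    aeval (![Polynomial.X, 1, -1 - Polynomial.X] : Fin 3 → Polynomial ℂ) f with hq
  have hqe : ∀ t, q.eval t = eval (v t) f := by
    intro t
    have h1 : ((Polynomial.aeval t).comp
        (aeval (![Polynomial.X, 1, -1 - Polynomial.X] : Fin 3 → Polynomial ℂ)) :
        Poly 2 →ₐ[ℂ] ℂ) = aeval (v t) := by
      ext i
      fin_cases i <;> simp [hv]
    have h2 := DFunLike.congr_fun h1 f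
    rw [AlgHom.comp_apply, ← hq] at h2
    rw [← Polynomial.coe_aeval_eq_eval, ← aeval_eq_eval]
    exact h2
  -- A nonzero constant q has no root, because the only zero of the restriction is the point at
  -- infinity of this parametrisation. The second parametrisation then restricts f to c tᵈ, with
  -- root t = 0.
  by_cases hdeg : q.degree = 0
  · set w : ℂ → Fin 3 → ℂ := fun t => ![1, t, -1 - t] with hw
    set r : Polynomial ℂ :=
      aeval (![1, Polynomial.X, -1 - Polynomial.X] : Fin 3 → Polynomial ℂ) f with hr
    have hre : ∀ t, r.eval t = eval (w t) f := by
      intro t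
      have h1 : ((Polynomial.aeval t).comp
          (aeval (![1, Polynomial.X, -1 - Polynomial.X] : Fin 3 → Polynomial ℂ)) :
          Poly 2 →ₐ[ℂ] ℂ) = aeval (w t) := by
        ext i
        fin_cases i <;> simp [hw]
      have h2 := DFunLike.congr_fun h1 f
      rw [AlgHom.comp_apply, ← hr] at h2
      rw [← Polynomial.coe_aeval_eq_eval, ← aeval_eq_eval]
      exact h2
    obtain ⟨c, hc⟩ : ∃ c, q = Polynomial.C c := ⟨_, Polynomial.eq_C_of_degree_eq_zero hdeg⟩
    have hrc : r = Polynomial.C c * Polynomial.X ^ d := by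
      refine Polynomial.eq_of_infinite_eval_eq _ _ (Set.Infinite.mono (s := {t : ℂ | t ≠ 0}) ?_ ?_)
      · intro t ht
        have h1 : w t = t • v t⁻¹ := by
          have ht' : t ≠ 0 := ht
          ext i
          fin_cases i
          · exact (mul_inv_cancel₀ ht').symm
          · exact (mul_one t).symm
          · change -1 - t = t * (-1 - t⁻¹)
            field_simp
            ring
        have h2 : eval (t • v t⁻¹) f = t ^ d * eval (v t⁻¹) f :=
          HomFun.smul_apply ⟨f, hf, fun _ => rfl⟩ t _
        change r.eval t = _
        rw [hre, h1, h2, ← hqe, hc]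
        simp only [Polynomial.eval_C, Polynomial.eval_mul, Polynomial.eval_pow, Polynomial.eval_X]
        ring
      · exact Set.Finite.infinite_compl (Set.finite_singleton (0 : ℂ))
    refine ⟨w 0, fun h => one_ne_zero (congrFun h 0), by simp [hw], ?_⟩
    rw [← hre, hrc]
    simp [hd]
  · obtain ⟨t, ht⟩ := IsAlgClosed.exists_root q hdeg
    exact ⟨v t, hv0 t, hvs t, by rw [← hqe]; exact ht⟩

/-- The radical ideal of an irreducible hypersurface. -/
theorem dvd_of_irreducible_of_zero {f g : Poly 2} (hf : Irreducible f)
    (h : ∀ p, eval p f = 0 → eval p g = 0) : f ∣ g := by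
  have h1 : g ∈ vanishingIdeal ℂ (zeroLocus ℂ (Ideal.span {f})) := by
    rw [mem_vanishingIdeal_iff]
    intro p hp
    rw [zeroLocus_span] at hp
    have := hp f rfl
    rw [aeval_eq_eval] at this ⊢
    exact h p this
  rw [vanishingIdeal_zeroLocus_eq_radical,
    ((Ideal.span_singleton_prime hf.ne_zero).2 hf.prime).radical] at h1
  exact Ideal.mem_span_singleton.1 h1

/-- On a plane curve through `p₀`, outside a curve that does not contain `p₀`, there are points at
which one of the forms `b j` does not vanish, if these have no common zero on a line. -/
theorem exists_zero_of_curve {J : Type*} {e : J → ℕ} {b : J → (Fin 3 → ℂ) → ℂ}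
    (hb : ∀ j, HomFun (e j) (b j))
    (hline : ∀ p : Fin 3 → ℂ, p ≠ 0 → p 0 + p 1 + p 2 = 0 → ∃ j, b j p ≠ 0)
    {d d' : ℕ} {φ ψ : (Fin 3 → ℂ) → ℂ} (hφ : HomFun d φ) (hψ : HomFun d' ψ) {p₀ : Fin 3 → ℂ}
    (hp₀ : φ p₀ = 0) (hp₀' : ψ p₀ ≠ 0) :
    ∃ p : Fin 3 → ℂ, φ p = 0 ∧ ψ p ≠ 0 ∧ ∃ j, b j p ≠ 0 := by
  by_contra hcon
  push Not at hcon
  obtain ⟨h, hh, hφ⟩ := hφ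
  obtain ⟨g, hg, hψ⟩ := hψ
  choose B hB hb using hb
  simp only [hφ, hψ, hb] at *
  -- If φ vanishes identically, any line through `p₀` serves as the curve.
  obtain ⟨h', d₁, hh', hne, hz', hle'⟩ : ∃ (h' : Poly 2) (d₁ : ℕ), h'.IsHomogeneous d₁ ∧ h' ≠ 0 ∧
      eval p₀ h' = 0 ∧ ∀ p, eval p h' = 0 → eval p h = 0 := by
    by_cases h0 : h = 0
    · by_cases hz : p₀ 0 = 0
      · exact ⟨X 0, 1, isHomogeneous_X ℂ 0, X_ne_zero 0, by simpa using hz, by simp [h0]⟩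
      · refine ⟨C (p₀ 0) * X 1 - C (p₀ 1) * X 0, 1,
          (isHomogeneous_C_mul_X _ _).sub (isHomogeneous_C_mul_X _ _), fun h => hz ?_, ?_,
          by simp [h0]⟩
        · simpa using congrArg (eval (Pi.single 1 1)) h
        · simp
          ring
    · exact ⟨h, d, hh, h0, hp₀, fun _ => id⟩
  obtain ⟨h₁, hi, hdiv, hz⟩ : ∃ h₁ : Poly 2, Irreducible h₁ ∧ h₁ ∣ h' ∧ eval p₀ h₁ = 0 := by
    obtain ⟨u, hu⟩ := UniqueFactorizationMonoid.factors_prod hne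
    have h1 : eval p₀ (UniqueFactorizationMonoid.factors h').prod = 0 := by
      refine (mul_eq_zero.1 (?_ : _ * eval p₀ (u : Poly 2) = 0)).resolve_right ?_
      · rw [← map_mul, hu, hz']
      · exact (u.isUnit.map (eval p₀)).ne_zero
    rw [map_multiset_prod, Multiset.prod_eq_zero_iff, Multiset.mem_map] at h1
    obtain ⟨h₁, hm, h0⟩ := h1
    exact ⟨h₁, UniqueFactorizationMonoid.irreducible_of_factor _ hm,
      UniqueFactorizationMonoid.dvd_of_mem_factors hm, h0⟩
  obtain ⟨k, hk⟩ := isHomogeneous_of_dvd hh' hne hdiv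
  have hle : ∀ p, eval p h₁ = 0 → eval p h = 0 := fun p hp => hle' p (by
    obtain ⟨c, rfl⟩ := hdiv
    rw [map_mul, hp, zero_mul])
  have hng : ¬h₁ ∣ g := by
    rintro ⟨c, rfl⟩
    exact hp₀' (by rw [map_mul, hz, zero_mul])
  -- On the component h₁ = 0 through `p₀`, the product g B_j vanishes. The component is irreducible
  -- and g does not vanish at `p₀`, so it lies in B_j = 0. But it meets the line, where not all B_j
  -- vanish.
  have hdvd : ∀ j, h₁ ∣ B j := by
    intro j
    refine (hi.prime.dvd_or_dvd (dvd_of_irreducible_of_zero (g := g * B j) hi fun p hp => ?_)).resolve_left hng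
    rw [map_mul]
    by_cases hgp : eval p g = 0
    · rw [hgp, zero_mul]
    · rw [hcon p (hle p hp) hgp j, mul_zero]
  have hk0 : k ≠ 0 := by
    rintro rfl
    exact hi.not_isUnit (isUnit_of_isHomogeneous_zero hk hi.ne_zero)
  obtain ⟨p, hp, hpl, hp0⟩ := exists_zero_on_line hk hk0
  obtain ⟨j, hj⟩ := hline p hp hpl
  obtain ⟨c, hc⟩ := hdvd j
  exact hj (by rw [hc, map_mul, hp0, zero_mul])

end Curve

/-! ### Octahedra over bad points are limits of octahedra over good points -/

section Density

open MvPolynomial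

variable {lam mu : Poly 2 →ₗ[ℂ] ℂ}

/-- Otherwise evaluation at p would be a combination of the six apolarity conditions, which
`IsUnrelatedAt` with constant 1 excludes. -/
theorem exists_mem_apolarCubics_eval_ne_zero {p : Fin 3 → ℂ} (hp : p ≠ 0)
    (hu : IsUnrelatedAt lam mu p) : ∃ f ∈ apolarCubics lam mu, eval p f ≠ 0 := by
  by_contra hcon
  push Not at hcon
  set L : (Fin 3 ⊕ Fin 3) → Module.Dual ℂ (Form 2 3) := Sum.elim
    (fun i => (lam ∘ₗ LinearMap.mulLeft ℂ (X i)) ∘ₗ (Form 2 3).subtype)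
    (fun i => (mu ∘ₗ LinearMap.mulLeft ℂ (X i)) ∘ₗ (Form 2 3).subtype) with hL
  set K : Module.Dual ℂ (Form 2 3) :=
    (aeval p : Poly 2 →ₐ[ℂ] ℂ).toLinearMap ∘ₗ (Form 2 3).subtype with hK
  have hKe : ∀ f : Form 2 3, K f = eval p f.1 := fun f => by
    rw [hK, LinearMap.comp_apply, AlgHom.toLinearMap_apply, aeval_eq_eval]
    rfl
  have h1 : K ∈ Submodule.span ℂ (Set.range L) := by
    refine mem_span_of_iInf_ker_le_ker fun f hf => ?_
    rw [Submodule.mem_iInf] at hf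
    rw [LinearMap.mem_ker, hKe]
    exact hcon f.1 ⟨f.2, fun i => ⟨hf (Sum.inl i), hf (Sum.inr i)⟩⟩
  obtain ⟨c, hc⟩ := (Submodule.mem_span_range_iff_exists_fun ℂ).1 h1
  obtain ⟨e0, e1⟩ := hu (linForm fun i => c (Sum.inl i)) (linForm fun i => c (Sum.inr i)) 1
    (linForm_hom _) (linForm_hom _) fun f hf => by
      have h2 := DFunLike.congr_fun hc ⟨f, hf⟩
      rw [hKe] at h2
      rw [one_mul, ← h2]
      simp only [hL, Fintype.sum_sum_type, LinearMap.add_apply,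
        LinearMap.smul_apply, smul_eq_mul, Sum.elim_inl, Sum.elim_inr, LinearMap.comp_apply,
        Submodule.subtype_apply, LinearMap.mulLeft_apply, linForm, Fin.sum_univ_three, add_mul,
        map_add, mul_assoc, map_C_mul]
  have hc0 : K = 0 := by
    rw [← hc]
    refine Finset.sum_eq_zero fun j _ => ?_
    rcases j with i | i
    · rw [congrFun (linForm_eq_zero_iff.1 e0) i]
      simp
    · rw [congrFun (linForm_eq_zero_iff.1 e1) i]
      simp
  obtain ⟨f, hf, hf1⟩ := exists_isHomogeneous_eval_eq_one hp 3
  have h3 := hKe ⟨f, hf⟩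
  rw [hc0, hf1] at h3
  exact one_ne_zero h3.symm

theorem HomFun.comp {σ τ : Type} {d e : ℕ} {φ : (τ → ℂ) → ℂ} (hφ : HomFun e φ)
    {g : (σ → ℂ) → τ → ℂ} (hg : ∀ j, HomFun d fun y => g y j) :
    HomFun (d * e) fun y => φ (g y) := by
  obtain ⟨P, hP, hφ⟩ := hφ
  choose Q hQ hg using hg
  refine ⟨aeval Q P, hP.aeval Q hQ, fun y => ?_⟩
  have h1 : g y = fun j => eval y (Q j) := funext fun j => hg j y
  simp only [hφ, h1]
  exact (eval₂Hom_bind₁ (RingHom.id ℂ) y Q P).symm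

theorem exists_span_pair_eq {V : Type*} [AddCommGroup V] [Module ℂ V] {f g x : V}
    (hli : LinearIndependent ℂ ![f, g]) (hx : x ∈ Submodule.span ℂ {f, g}) (hx0 : x ≠ 0) :
    ∃ y ∈ ({f, g} : Set V), Submodule.span ℂ {x, y} = Submodule.span ℂ {f, g} ∧
      LinearIndependent ℂ ![x, y] := by
  have key : ∀ (f g : V) (a b : ℂ), a ≠ 0 → LinearIndependent ℂ ![f, g] →
      Submodule.span ℂ {a • f + b • g, g} = Submodule.span ℂ {f, g} ∧
        LinearIndependent ℂ ![a • f + b • g, g] := by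
    intro f g a b ha hli
    constructor
    · refine le_antisymm (Submodule.span_le.2 ?_) (Submodule.span_le.2 ?_)
      · rintro _ (rfl | rfl)
        · exact Submodule.mem_span_pair.2 ⟨a, b, rfl⟩
        · exact Submodule.subset_span (by simp)
      · rintro _ (rfl | rfl)
        · refine Submodule.mem_span_pair.2 ⟨a⁻¹, -(a⁻¹ * b), ?_⟩
          rw [smul_add, smul_smul, smul_smul, inv_mul_cancel₀ ha, one_smul, neg_smul]
          abel
        · exact Submodule.subset_span (by simp)
    · rw [LinearIndependent.pair_iff] at hli ⊢
      intro s t hst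
      obtain ⟨h1, h2⟩ := hli (s * a) (s * b + t) (by rw [← hst]; module)
      have hs := (mul_eq_zero.1 h1).resolve_right ha
      exact ⟨hs, by simpa [hs] using h2⟩
  obtain ⟨a, b, rfl⟩ := Submodule.mem_span_pair.1 hx
  by_cases ha : a = 0
  · have hb : b ≠ 0 := by
      rintro rfl
      simp [ha] at hx0
    obtain ⟨h1, h2⟩ := key g f b a hb (LinearIndependent.pair_symm_iff.1 hli)
    refine ⟨f, by simp, ?_, ?_⟩
    · rw [add_comm, h1, Set.pair_comm]
    · rw [add_comm]
      exact h2
  · obtain ⟨h1, h2⟩ := key f g a b ha hli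
    exact ⟨g, by simp, h1, h2⟩

theorem homFun_map {σ : Type} {n d e : ℕ} {Φ : (σ → ℂ) → Poly n} (h : HomForm e Φ)
    (hΦ : ∀ y, (Φ y).IsHomogeneous d) (L : Poly n →ₗ[ℂ] ℂ) : HomFun e fun y => L (Φ y) := by
  have h1 : (fun y => L (Φ y)) = fun y => ∑ m : Mon n d, coeff m.1 (Φ y) * L (monomial m.1 1) := by
    ext y
    conv_lhs => rw [form_eq_sum (hΦ y), map_sum]
    refine Finset.sum_congr rfl fun m _ => ?_
    rw [← mul_one (coeff m.1 (Φ y)), ← smul_eq_mul, ← smul_monomial, map_smul, smul_eq_mul,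
      smul_eq_mul, mul_one]
  rw [h1]
  have h2 : ∀ m : Mon n d, HomFun e fun y => coeff m.1 (Φ y) * L (monomial m.1 1) := fun m =>
    (h m.1).mul (homFun_const _)
  exact HomFun.sum _ fun m _ => h2 m

namespace GeneralPencil

variable (G : GeneralPencil lam mu)

include G in
/-- Coordinates on the space of apolar cubics. -/
theorem exists_coordinates : ∃ L : Poly 2 →ₗ[ℂ] (Fin 4 → ℂ),
    ∀ f ∈ apolarCubics lam mu, L f = 0 → f = 0 := by
  have hp : (Pi.single 0 1 : Fin 3 → ℂ) ≠ 0 := by simp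
  set p : Fin 3 → ℂ := Pi.single 0 1
  set N := apolarCubics lam mu with hN
  have hNF : N ≤ Form 2 3 := fun f hf => hf.1
  have : FiniteDimensional ℂ N := Submodule.finiteDimensional_of_le hNF
  set ev : N →ₗ[ℂ] ℂ := (aeval p : Poly 2 →ₐ[ℂ] ℂ).toLinearMap ∘ₗ N.subtype
  have h1 := ev.finrank_range_add_finrank_ker
  have h2 : Module.finrank ℂ (LinearMap.range ev) ≤ 1 :=
    (Submodule.finrank_le _).trans (Module.finrank_self ℂ).le
  have h3 : Module.finrank ℂ (LinearMap.ker ev) ≤ 3 := by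
    have h4 : (LinearMap.ker ev).map N.subtype = apolarCubicsAt lam mu p := by
      rw [LinearMap.ker_comp, Submodule.map_comap_subtype]
      rfl
    rw [(Submodule.equivMapOfInjective N.subtype N.injective_subtype _).finrank_eq, h4]
    exact G.finrank_le p hp
  -- Vanishing at a point is one condition, and it cuts N down to dimension at most 3.
  have h5 : Module.finrank ℂ N ≤ 4 := by omega
  obtain ⟨i, hi⟩ : ∃ i : N →ₗ[ℂ] (Fin 4 → ℂ), Function.Injective i := by
    rw [← finrank_le_iff_exists_linearMap]
    simpa using h5
  obtain ⟨L, hL⟩ := LinearMap.exists_extend i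
  refine ⟨L, fun f hf h0 => ?_⟩
  have h6 : i ⟨f, hf⟩ = 0 := by rw [← hL]; exact h0
  exact congrArg Subtype.val (hi (h6.trans (map_zero i).symm))

/-- At a bad point the pencil of cubics is spanned by the radical `s.cubic` and one more cubic D'.
It suffices to move D' along a curve through the point that contains good points, in such a way that
there the moved pencil is the pencil of an octahedron; the Plücker section is then nonzero on an
open part of the curve. -/
theorem family_subset_closure :
    family lam mu ⊆ closure (family lam mu ∩ assocPoint ⁻¹' G.goodSet) := by
  rintro z₀ ⟨D₀, hA₀, hz₀⟩
  rw [mem_closure_iff_homFun]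
  intro d φ hφ hφ0
  set p₀ := assocPoint z₀ with hp₀
  have hD₀ : IsFrame p₀.rep D₀.l := isFrame_assocPoint hz₀
  by_cases hgood : p₀ ∈ G.goodSet
  · exact ⟨z₀, ⟨⟨D₀, hA₀, hz₀⟩, hgood⟩, hφ0⟩
  have hsc : ∀ p, G.s.cubic p ∈ apolarCubics lam mu := fun p =>
    (mem_apolarCubicsAt.1 (G.s_cubic_mem p)).1
  have htc : ∀ p, G.t.cubic p ∈ apolarCubics lam mu := fun p =>
    (mem_apolarCubicsAt.1 (G.t_cubic_mem p)).1
  obtain ⟨D', hD', hE₀, hli₀⟩ : ∃ D' ∈ ({D₀.cub₁, D₀.cub₂} : Set (Poly 2)),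
      Submodule.span ℂ {G.s.cubic p₀.rep, D'} = degPart D₀.ideal 3 ∧
        LinearIndependent ℂ ![G.s.cubic p₀.rep, D'] := by
    rw [D₀.degPart_three]
    refine exists_span_pair_eq D₀.cub_independent ?_
      (G.s.cubic_ne_zero p₀.rep_nonzero (G.unrelated _ p₀.rep_nonzero)
        (G.radical_s _ p₀.rep_nonzero))
    rw [← D₀.degPart_three]
    exact (G.quart_eq_zero_iff p₀.rep_nonzero hD₀ hA₀.cub₁ hA₀.cub₂).1.1 hA₀.lam
  have hD'N : D' ∈ apolarCubics lam mu := by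
    rcases hD' with rfl | rfl
    · exact hA₀.cub₁
    · exact hA₀.cub₂
  have hD'0 : eval p₀.rep D' = 0 := by
    rcases hD' with rfl | rfl
    · simp [HilbertBurch.cub₁, hD₀.eval]
    · simp [HilbertBurch.cub₂, hD₀.eval]
  obtain ⟨n, hn, hn0⟩ := exists_mem_apolarCubics_eval_ne_zero p₀.rep_nonzero
    (G.unrelated _ p₀.rep_nonzero)
  have hnev : HomFun 3 fun p => eval p n := ⟨n, hn.1, fun _ => rfl⟩
  have hDev : HomFun 3 fun p => eval p D' := ⟨D', hD'N.1, fun _ => rfl⟩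
  -- The moving cubic: n(p) D' - D'(p) n is apolar, vanishes at p, and is a nonzero multiple of D'
  -- at `p₀`.
  set Δ : (Fin 3 → ℂ) → Poly 2 := fun p => C (eval p n) * D' - C (eval p D') * n with hΔ
  have hΔhom : HomForm 3 Δ := (HomForm.C_mul hnev (HomForm.const D')).sub
    (HomForm.C_mul hDev (HomForm.const n))
  have hΔ3 : ∀ p, (Δ p).IsHomogeneous 3 := fun p => (hD'N.1.C_mul _).sub (hn.1.C_mul _)
  have hΔ0 : Δ p₀.rep = eval p₀.rep n • D' := by
    rw [hΔ, smul_eq_C_mul]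
    simp [hD'0]
  have hE₀' : degPart D₀.ideal 3 = Submodule.span ℂ {G.s.cubic p₀.rep, Δ p₀.rep} := by
    rw [← hE₀, hΔ0, Submodule.span_insert, Submodule.span_insert,
      Submodule.span_singleton_smul_eq (IsUnit.mk0 _ hn0)]
  obtain ⟨m, m', hmin⟩ := exists_nondegenerate_minor (hsc _).1 hD'N.1 hli₀
  obtain ⟨d', g, hg, hg0, hsec⟩ := exists_plucker_section (e := ![2, 3])
    (K := ![G.s.cubic, Δ]) (fun i => by
      fin_cases i
      · exact G.s.homForm_cubic
      · exact hΔhom) (fun i p => by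
      fin_cases i
      · exact (hsc p).1
      · exact hΔ3 p) hD₀ hE₀'
  obtain ⟨c₀, hc₀⟩ := Function.ne_iff.1 hg0
  have hφg : φ (g p₀.rep) ≠ 0 := by
    rw [← hφ.ne_zero_congr hg0, ← hz₀.unique (hsec p₀ D₀ hD₀ hE₀' hg0)]
    exact hφ0
  obtain ⟨L, hL⟩ := G.exists_coordinates
  -- The determinant of both radicals, D' and n in coordinates of the space of apolar cubics. Its
  -- zero set contains `p₀`, where the two radicals are dependent.
  set M : (Fin 3 → ℂ) → Matrix (Fin 4) (Fin 4) ℂ := fun p =>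
    Matrix.of ![L (G.s.cubic p), L (G.t.cubic p), L D', L n] with hM
  have hMdet : HomFun _ fun p => (M p).det := HomFun.det (r := ![2, 2, 0, 0]) fun i j => by
    fin_cases i
    · exact homFun_map G.s.homForm_cubic (fun p => (hsc p).1) (LinearMap.proj j ∘ₗ L)
    · exact homFun_map G.t.homForm_cubic (fun p => (htc p).1) (LinearMap.proj j ∘ₗ L)
    · exact homFun_const _
    · exact homFun_const _
  have hM₀ : (M p₀.rep).det = 0 := by
    have h1 : ¬LinearIndependent ℂ ![G.s.cubic p₀.rep, G.t.cubic p₀.rep] := hgood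
    rw [LinearIndependent.pair_iff] at h1
    push Not at h1
    obtain ⟨a, b, hab, hne⟩ := h1
    refine Matrix.exists_vecMul_eq_zero_iff.1 ⟨![a, b, 0, 0], fun h => ?_, ?_⟩
    · exact hne (congrFun h 0) (congrFun h 1)
    · ext j
      have h2 := congrFun (congrArg L hab) j
      simpa [Matrix.vecMul, dotProduct, Fin.sum_univ_four, hM] using h2
  -- The factors respectively keep the image in the given open set, the Plücker section nonzero, n
  -- nonzero at p, and the pair `s.cubic`, Δ independent.
  have hψ : HomFun _ fun p => φ (g p) * g p c₀ * eval p n *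
      (coeff m.1 (G.s.cubic p) * coeff m'.1 (Δ p) - coeff m'.1 (G.s.cubic p) * coeff m.1 (Δ p)) :=
    (((hφ.comp hg).mul (hg c₀)).mul hnev).mul (((G.s.homForm_cubic m.1).mul (hΔhom m'.1)).sub
      ((G.s.homForm_cubic m'.1).mul (hΔhom m.1)))
  obtain ⟨p, hp1, hp2, ⟨k, k'⟩, hp3⟩ := exists_zero_of_curve
    (b := fun (j : Mon 2 3 × Mon 2 3) p => coeff j.1.1 (G.s.cubic p) * coeff j.2.1 (G.t.cubic p) -
        coeff j.2.1 (G.s.cubic p) * coeff j.1.1 (G.t.cubic p))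
    (fun j => ((G.s.homForm_cubic j.1.1).mul (G.t.homForm_cubic j.2.1)).sub
      ((G.s.homForm_cubic j.2.1).mul (G.t.homForm_cubic j.1.1)))
    (fun p hp hl => by
      obtain ⟨k, k', h⟩ := exists_nondegenerate_minor (hsc p).1 (htc p).1 (G.line p hp hl)
      exact ⟨(k, k'), h⟩) hMdet hψ hM₀ (by
      refine mul_ne_zero (mul_ne_zero (mul_ne_zero hφg hc₀) hn0) ?_
      rw [hΔ0, coeff_smul, coeff_smul, smul_eq_mul, smul_eq_mul]
      rw [show ∀ a b x y c : ℂ, a * (c * x) - b * (c * y) = c * (a * x - b * y) from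
        fun _ _ _ _ _ => by ring]
      exact mul_ne_zero hn0 hmin)
  have hp : p ≠ 0 := by
    rintro rfl
    have h1 := hnev.smul_apply 0 (0 : Fin 3 → ℂ)
    rw [smul_zero, zero_pow (by norm_num), zero_mul] at h1
    exact hp2 (by rw [h1]; ring)
  rw [← hψ.ne_zero_congr hp] at hp2
  rw [← not_ne_iff, ← hMdet.ne_zero_congr hp, not_ne_iff] at hp1
  have hq : Projectivization.mk ℂ p hp ∈ G.goodSet := by
    have h1 := (((G.s.homForm_cubic k.1).mul (G.t.homForm_cubic k'.1)).sub
      ((G.s.homForm_cubic k'.1).mul (G.t.homForm_cubic k.1))).ne_zero_congr hp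
    exact linearIndependent_of_minor (h1.2 hp3)
  set q := Projectivization.mk ℂ p hp with hqdef
  have hgq : g q.rep ≠ 0 := Function.ne_iff.2 ⟨c₀, fun h => hp2 (by rw [h]; simp)⟩
  have hnq : eval q.rep n ≠ 0 := fun h => hp2 (by rw [h]; ring)
  have hli : LinearIndependent ℂ ![G.s.cubic q.rep, Δ q.rep] :=
    linearIndependent_of_minor fun h => hp2 (by rw [h, mul_zero])
  have hφq : φ (g q.rep) ≠ 0 := fun h => hp2 (by rw [h]; ring)
  obtain ⟨D, hD, hA⟩ := G.exists_of_mem_goodSet hq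
  have hE := G.degPart_three_eq hD hA hq
  have hmem : Δ q.rep ∈ Submodule.span ℂ {G.s.cubic q.rep, G.t.cubic q.rep} := by
    obtain ⟨v, hv, hvM⟩ := Matrix.exists_vecMul_eq_zero_iff.2 hp1
    have h1 : C (v 0) * G.s.cubic q.rep + C (v 1) * G.t.cubic q.rep + C (v 2) * D' +
        C (v 3) * n = 0 := by
      refine hL _ ?_ ?_
      · simp only [← smul_eq_C_mul]
        exact add_mem (add_mem (add_mem (Submodule.smul_mem _ _ (hsc _))
          (Submodule.smul_mem _ _ (htc _))) (Submodule.smul_mem _ _ hD'N))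
          (Submodule.smul_mem _ _ hn)
      · ext j
        have h2 := congrFun hvM j
        simpa [Matrix.vecMul, dotProduct, Fin.sum_univ_four, hM, ← smul_eq_C_mul] using h2
    have h2 := congrArg (eval q.rep) h1
    simp only [map_add, map_mul, eval_C, map_zero,
      (mem_apolarCubicsAt.1 (G.s_cubic_mem q.rep)).2, (mem_apolarCubicsAt.1 (G.t_cubic_mem q.rep)).2,
      mul_zero, zero_add] at h2
    -- Evaluating the linear relation at q leaves v₂ D'(q) + v₃ n(q) = 0. If v₂ = 0, then v₃ = 0 and
    -- the two radicals would be dependent at a good point. So the relation can be solved for Δ in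
    -- terms of the radicals.
    have hv2 : v 2 ≠ 0 := by
      intro h
      rw [h, zero_mul, zero_add] at h2
      have h3 := (mul_eq_zero.1 h2).resolve_right hnq
      rw [h, h3, C_0, zero_mul, zero_mul, add_zero, add_zero, ← smul_eq_C_mul,
        ← smul_eq_C_mul] at h1
      obtain ⟨h4, h5⟩ := LinearIndependent.pair_iff.1 hq _ _ h1
      refine hv (funext fun i => ?_)
      fin_cases i
      · exact h4
      · exact h5
      · exact h
      · exact h3
    rw [← Submodule.smul_mem_iff _ hv2, Submodule.mem_span_pair]
    refine ⟨-(eval q.rep n * v 0), -(eval q.rep n * v 1), ?_⟩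
    have h3 : (C (v 2) * C (eval q.rep D') + C (v 3) * C (eval q.rep n) : Poly 2) = 0 := by
      rw [← C_mul, ← C_mul, ← C_add, h2, C_0]
    simp only [smul_eq_C_mul, hΔ, C_neg, C_mul]
    linear_combination -C (eval q.rep n) * h1 + n * h3
  have hE' : degPart D.ideal 3 = Submodule.span ℂ {G.s.cubic q.rep, Δ q.rep} := by
    rw [hE]
    symm
    have : FiniteDimensional ℂ (Submodule.span ℂ {G.s.cubic q.rep, G.t.cubic q.rep}) :=
      FiniteDimensional.span_of_finite ℂ (Set.toFinite _)
    refine Submodule.eq_of_le_of_finrank_le (Submodule.span_le.2 ?_) ?_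
    · rintro f (rfl | rfl)
      · exact Submodule.subset_span (by simp)
      · exact hmem
    · rw [← range_pair, ← range_pair, finrank_span_eq_card hq, finrank_span_eq_card hli]
  have hz := hsec q D hD hE' hgq
  refine ⟨_, ⟨⟨D, hA, hz⟩, ?_⟩, (hφ.ne_zero_congr hgq).2 hφq⟩
  rw [Set.mem_preimage, assocPoint_eq hz hD]
  exact hq

end GeneralPencil

end Density

/-! ### The graded pieces of an ideal from its Plücker point -/

section Colon

open MvPolynomial

variable {n d k s t : ℕ} {ι : Type} (L : ι → Poly n →ₗ[ℂ] ℂ)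

/-- The forms of degree `t` that are annihilated by `L` and whose multiples by forms of degree `s`
lie in `W`. -/
def colonForms (W : Submodule ℂ (Poly n)) (s t : ℕ) : Submodule ℂ (Poly n) :=
  (Form n t ⊓ ⨅ m : Mon n s, W.comap (LinearMap.mulLeft ℂ (monomial m.1 1))) ⊓
    ⨅ i, LinearMap.ker (L i)

theorem mem_colonForms {W : Submodule ℂ (Poly n)} {f : Poly n} :
    f ∈ colonForms L W s t ↔ f.IsHomogeneous t ∧ (∀ m : Mon n s, monomial m.1 1 * f ∈ W) ∧
      ∀ i, L i f = 0 := by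
  simp only [colonForms, Submodule.mem_inf, Submodule.mem_iInf, Submodule.mem_comap,
    LinearMap.mem_ker, LinearMap.mulLeft_apply, and_assoc]
  rfl

theorem colonForms_le (W : Submodule ℂ (Poly n)) : colonForms L W s t ≤ Form n t :=
  fun _ hf => ((mem_colonForms L).1 hf).1

/-- The linear equations of `colonForms` in terms of Plücker coordinates. -/
def colonMatrix (s t : ℕ) (z : (Fin k → Mon n d) → ℂ) :
    Matrix ((Mon n s × (Fin (k + 1) → Mon n d)) ⊕ (ι × (Fin k → Mon n d))) (Mon n t) ℂ :=
  Matrix.of (Sum.elim (fun r m => pluckerEq z r.2 (monomial r.1.1 1 * monomial m.1 1))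
    fun r m => L r.1 (monomial m.1 1) * z r.2)

theorem homFun_colonMatrix (i) (j) :
    HomFun 1 fun z : (Fin k → Mon n d) → ℂ => colonMatrix L s t z i j := by
  rcases i with i | i
  · change HomFun 1 fun z : (Fin k → Mon n d) → ℂ =>
      pluckerEq z i.2 (monomial i.1.1 1 * monomial j.1 1)
    exact HomFun.sum _ fun l _ => (homFun_coord _).const_mul _
  · exact (homFun_coord _).const_mul _

theorem pluckerEq_add (z : (Fin k → Mon n d) → ℂ) (c : Fin (k + 1) → Mon n d) (f g : Poly n) :
    pluckerEq z c (f + g) = pluckerEq z c f + pluckerEq z c g := by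
  simp only [pluckerEq, coeff_add, mul_add, add_mul, Finset.sum_add_distrib]

theorem pluckerEq_smul_right (a : ℂ) (z : (Fin k → Mon n d) → ℂ) (c : Fin (k + 1) → Mon n d)
    (f : Poly n) : pluckerEq z c (a • f) = a * pluckerEq z c f := by
  simp only [pluckerEq, Finset.mul_sum, coeff_smul, smul_eq_mul]
  exact Finset.sum_congr rfl fun j _ => by ring

/-- The equations of `colonForms` are linear functionals. -/
def pluckerFunctional (z : (Fin k → Mon n d) → ℂ) (c : Fin (k + 1) → Mon n d) :
    Poly n →ₗ[ℂ] ℂ where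
  toFun := pluckerEq z c
  map_add' := pluckerEq_add z c
  map_smul' a f := pluckerEq_smul_right a z c f

theorem map_form_eq_sum {f : Poly n} (hf : f.IsHomogeneous t) (φ : Poly n →ₗ[ℂ] ℂ) :
    φ f = ∑ m : Mon n t, φ (monomial m.1 1) * coeff m.1 f := by
  conv_lhs => rw [form_eq_sum hf, map_sum]
  refine Finset.sum_congr rfl fun m _ => ?_
  rw [← mul_one (coeff m.1 f), ← smul_eq_mul, ← smul_monomial, map_smul, smul_eq_mul, smul_eq_mul,
    mul_one, mul_comm]

/-- The rows for `L` are multiplied by every Plücker coordinate, so that all rows are linear in z;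
since some coordinate is nonzero, no condition is lost. -/
theorem mulVec_colonMatrix_eq_zero_iff {W : Submodule ℂ (Poly n)} {z : ProjSp (Fin k → Mon n d)}
    (hz : IsPluckerPoint W z) (hW : W ≤ Form n d) (hst : s + t = d) {f : Poly n}
    (hf : f.IsHomogeneous t) :
    (colonMatrix L s t z.rep).mulVec (fun m => coeff m.1 f) = 0 ↔ f ∈ colonForms L W s t := by
  have h1 : ∀ r : Mon n s × (Fin (k + 1) → Mon n d),
      (colonMatrix L s t z.rep).mulVec (fun m => coeff m.1 f) (Sum.inl r) =
        pluckerEq z.rep r.2 (monomial r.1.1 1 * f) := fun r =>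
    (map_form_eq_sum hf (pluckerFunctional z.rep r.2 ∘ₗ LinearMap.mulLeft ℂ
      (monomial r.1.1 1))).symm
  have h2 : ∀ r : ι × (Fin k → Mon n d),
      (colonMatrix L s t z.rep).mulVec (fun m => coeff m.1 f) (Sum.inr r) =
        z.rep r.2 * L r.1 f := fun r => by
    rw [map_form_eq_sum hf, Finset.mul_sum]
    exact Finset.sum_congr rfl fun m _ => by
      change L r.1 (monomial m.1 1) * z.rep r.2 * _ = _
      ring
  have hmem : ∀ m : Mon n s, (monomial m.1 1 * f : Poly n).IsHomogeneous d := fun m =>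
    hst ▸ (isHomogeneous_mon m 1).mul hf
  rw [mem_colonForms]
  constructor
  · intro h
    refine ⟨hf, fun m => (hz.mem_iff hW (hmem m)).2 fun c => ?_, fun i => ?_⟩
    · rw [← h1 (m, c), h]
      rfl
    · obtain ⟨c, hc⟩ := Function.ne_iff.1 z.rep_nonzero
      refine (mul_eq_zero.1 ?_).resolve_left hc
      rw [← h2 (i, c), h]
      rfl
  · rintro ⟨-, h3, h4⟩
    ext r
    rcases r with r | r
    · rw [h1, (hz.mem_iff hW (hmem r.1)).1 (h3 r.1)]
      rfl
    · rw [h2, h4, mul_zero]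
      rfl

/-- The dimension of a space of forms from the rank of its equations. -/
theorem rank_add_finrank_of_mulVec {ι' : Type*} {M : Matrix ι' (Mon n t) ℂ}
    {V : Submodule ℂ (Poly n)} (hV : V ≤ Form n t)
    (h : ∀ f : Poly n, f.IsHomogeneous t → (M.mulVec (fun m => coeff m.1 f) = 0 ↔ f ∈ V)) :
    M.rank + Module.finrank ℂ V = Module.finrank ℂ (Form n t) := by
  have h1 := rank_add_finrank_ker M
  have h2 : (LinearMap.ker M.mulVecLin).map
      ((Form n t).subtype ∘ₗ (formEquiv n t).symm.toLinearMap) = V := by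
    ext f
    rw [Submodule.mem_map]
    constructor
    · rintro ⟨v, hv, rfl⟩
      rw [LinearMap.comp_apply, LinearEquiv.coe_coe, Submodule.subtype_apply,
        ← h _ ((formEquiv n t).symm v).2]
      have h3 := (formEquiv n t).apply_symm_apply v
      convert hv using 1
      rw [LinearMap.mem_ker, Matrix.mulVecLin_apply]
      conv_rhs => rw [← h3]
      rfl
    · intro hf
      have hf' := hV hf
      refine ⟨formEquiv n t ⟨f, hf'⟩, ?_, by simp⟩
      rw [LinearMap.mem_ker, Matrix.mulVecLin_apply]
      exact (h f hf').2 hf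
  have hinj : Function.Injective ((Form n t).subtype ∘ₗ (formEquiv n t).symm.toLinearMap) :=
    (Form n t).injective_subtype.comp (formEquiv n t).symm.injective
  rw [← h2, ← (Submodule.equivMapOfInjective _ hinj _).finrank_eq, (formEquiv n t).finrank_eq,
    Module.finrank_fintype_fun_eq_card]
  exact h1

theorem rank_colonMatrix {W : Submodule ℂ (Poly n)} {z : ProjSp (Fin k → Mon n d)}
    (hz : IsPluckerPoint W z) (hW : W ≤ Form n d) (hst : s + t = d) :
    (colonMatrix L s t z.rep).rank + Module.finrank ℂ (colonForms L W s t) =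
      Module.finrank ℂ (Form n t) :=
  rank_add_finrank_of_mulVec (colonForms_le L W) fun _ hf =>
    mulVec_colonMatrix_eq_zero_iff L hz hW hst hf

theorem mem_of_monomial_mul_mem {J : Ideal (Poly n)}
    (hJ : ∀ f : Poly n, (∀ i, X i * f ∈ J) → f ∈ J) (s : ℕ) {f : Poly n}
    (h : ∀ m : Mon n s, monomial m.1 1 * f ∈ J) : f ∈ J := by
  induction s with
  | zero =>
    have := h ⟨0, mem_mon (map_zero _)⟩
    rwa [show (monomial (0 : Fin (n + 1) →₀ ℕ) (1 : ℂ) : Poly n) = 1 from rfl, one_mul] at this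
  | succ s ih =>
    refine ih fun m => hJ _ fun i => ?_
    have h1 := h ⟨m.1 + Finsupp.single i 1, mem_mon (by
      rw [map_add, mon_degree, Finsupp.degree_single])⟩
    rw [← mul_assoc]
    convert h1 using 2
    rw [X, monomial_mul, one_mul, add_comm (Finsupp.single i 1) m.1]

/-- By saturation a form lies in the ideal as soon as all its multiples of one fixed degree do. So
lower graded pieces are visible in the Plücker point. -/
theorem HilbertBurch.colonForms_eq (D : HilbertBurch) (hst : s + t = d) (L : ι → Poly 2 →ₗ[ℂ] ℂ) :
    colonForms L (degPart D.ideal d) s t = degPart D.ideal t ⊓ ⨅ i, LinearMap.ker (L i) := by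
  ext f
  rw [mem_colonForms, Submodule.mem_inf, Submodule.mem_iInf, ← and_assoc]
  refine and_congr ?_ Iff.rfl
  constructor
  · rintro ⟨h1, h2⟩
    exact ⟨mem_of_monomial_mul_mem D.saturated s fun m => (h2 m).1, h1⟩
  · rintro ⟨h1, h2⟩
    exact ⟨h2, fun m => ⟨Ideal.mul_mem_left _ _ h1, hst ▸ (isHomogeneous_mon m 1).mul h2⟩⟩

end Colon

/-! ### The associated point depends regularly on the scheme -/

section Section

open MvPolynomial

/-- The degree t part of the ideal is the kernel of `colonMatrix`. Its dimension does not vary, so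
the rank is constant and `exists_kernel_section` extends `f₀`. -/
theorem exists_degPart_section {t s r : ℕ} (hst : s + t = 8) {Y : Set (HilbSpace 2 8)}
    (hY : ∀ z ∈ Y, ∃ D : HilbertBurch, IsPluckerPoint (degPart D.ideal 8) z)
    (hr : ∀ D : HilbertBurch, Module.finrank ℂ (Form 2 t) = r + Module.finrank ℂ (degPart D.ideal t))
    {z₀ : HilbSpace 2 8} (hz₀ : z₀ ∈ Y) {D₀ : HilbertBurch}
    (hD₀ : IsPluckerPoint (degPart D₀.ideal 8) z₀) {f₀ : Poly 2} (hf₀ : f₀ ∈ degPart D₀.ideal t) :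
    ∃ (e : ℕ) (Φ : ((Fin ((2 + 8).choose 2 - 8) → Mon 2 8) → ℂ) → Poly 2), HomForm e Φ ∧
      (∀ z, (Φ z).IsHomogeneous t) ∧
      (∀ z ∈ Y, ∀ D : HilbertBurch, IsPluckerPoint (degPart D.ideal 8) z →
        Φ z.rep ∈ degPart D.ideal t) ∧ ∃ c : ℂ, c ≠ 0 ∧ Φ z₀.rep = C c * f₀ := by
  have key : ∀ (z : HilbSpace 2 8) (D : HilbertBurch) (f : Poly 2), f.IsHomogeneous t →
      IsPluckerPoint (degPart D.ideal 8) z →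
      ((colonMatrix (Empty.elim : Empty → Poly 2 →ₗ[ℂ] ℂ) s t z.rep).mulVec
        (fun m => coeff m.1 f) = 0 ↔ f ∈ degPart D.ideal t) := fun z D f hf hz => by
    rw [mulVec_colonMatrix_eq_zero_iff _ hz inf_le_right hst hf, D.colonForms_eq hst]
    simp
  obtain ⟨e, v, hv, hvX, c, hc, hvc⟩ := exists_kernel_section
    (X := {w | ∃ z ∈ Y, w = z.rep})
    (M := colonMatrix (Empty.elim : Empty → Poly 2 →ₗ[ℂ] ℂ) s t) (r := r)
    (homFun_colonMatrix _) (by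
      rintro _ ⟨z, hz, rfl⟩
      obtain ⟨D, hD⟩ := hY z hz
      have h1 := rank_colonMatrix (Empty.elim : Empty → Poly 2 →ₗ[ℂ] ℂ) hD inf_le_right hst
      rw [D.colonForms_eq hst, hr D, iInf_of_empty, inf_top_eq] at h1
      exact Nat.add_right_cancel h1) ⟨z₀, hz₀, rfl⟩ ((key z₀ D₀ f₀ hf₀.2 hD₀).2 hf₀)
  set Φ : ((Fin ((2 + 8).choose 2 - 8) → Mon 2 8) → ℂ) → Poly 2 := fun z =>
    (formEquiv 2 t).symm (v z) with hΦ
  have hΦ3 : ∀ z, (Φ z).IsHomogeneous t := fun z => ((formEquiv 2 t).symm (v z)).2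
  have hco : ∀ z (m : Mon 2 t), coeff m.1 (Φ z) = v z m := fun z m =>
    congrFun ((formEquiv 2 t).apply_symm_apply (v z)) m
  clear_value Φ
  refine ⟨e, Φ, fun m => ?_, hΦ3, fun z hz D hD => ?_, c, hc, ?_⟩
  · by_cases hm : m.degree = t
    · have h1 : (fun z => coeff m (Φ z)) = fun z => v z ⟨m, mem_mon hm⟩ :=
        funext fun z => hco z ⟨m, mem_mon hm⟩
      rw [h1]
      exact hv _
    · have h1 : (fun z => coeff m (Φ z)) = fun z => 0 :=
        funext fun z => (hΦ3 z).coeff_eq_zero hm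
      rw [h1]
      exact homFun_zero e
  · rw [← key z D _ (hΦ3 _) hD, show (fun m : Mon 2 t => coeff m.1 (Φ z.rep)) = v z.rep from
      funext (hco _)]
    exact hvX _ ⟨z, hz, rfl⟩
  · refine form_ext (hΦ3 _) (hf₀.2.C_mul c) fun m => ?_
    rw [coeff_C_mul]
    exact (hco _ m).trans (congrFun hvc m)

/-! ### Functionals given by determinants -/

section Residual

variable {ι : Type} [Fintype ι] [DecidableEq ι] (L : Poly 2 →ₗ[ℂ] (Option ι → ℂ)) (g : ι → Poly 2)

/-- The functional `f ↦ det (f, g)`, in terms of coordinates `L`. -/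
def residualFunctional : Poly 2 →ₗ[ℂ] ℂ :=
  (Matrix.detRowAlternating (R := ℂ) (n := Option ι)).toMultilinearMap.toLinearMap
    (fun j => L (j.elim 0 g)) none ∘ₗ L

theorem residualFunctional_apply (f : Poly 2) :
    residualFunctional L g f = (Matrix.of fun j => L (j.elim f g)).det := by
  change Matrix.det (Function.update (fun j : Option ι => L (j.elim 0 g)) none (L f)) = _
  congr 1
  ext j i
  rcases j with - | j
  · simp
  · simp

theorem residualFunctional_self (i : ι) : residualFunctional L g (g i) = 0 := by
  rw [residualFunctional_apply]
  exact Matrix.det_zero_of_row_eq (i := none) (j := some i) (by simp) rfl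

theorem residualFunctional_of_dependent {c : ι → ℂ} (hc : c ≠ 0) (h : ∑ i, c i • g i = 0)
    (f : Poly 2) : residualFunctional L g f = 0 := by
  rw [residualFunctional_apply]
  refine Matrix.exists_vecMul_eq_zero_iff.1 ⟨fun j => j.elim 0 c, fun h0 => ?_, ?_⟩
  · exact hc (funext fun i => congrFun h0 (some i))
  · have h1 := congrArg L h
    rw [map_sum, map_zero] at h1
    ext k
    have h2 := congrFun h1 k
    rw [Finset.sum_apply] at h2
    simp only [Matrix.vecMul, dotProduct, Fintype.sum_option, Option.elim_none, zero_mul, zero_add,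
      Option.elim_some, Matrix.of_apply]
    simpa only [map_smul, Pi.smul_apply, smul_eq_mul] using h2

theorem residualFunctional_smul_ne_zero {c : ι → ℂ} (hc : ∀ i, c i ≠ 0) {f : Poly 2}
    (h : residualFunctional L g f ≠ 0) : residualFunctional L (fun i => c i • g i) f ≠ 0 := by
  rw [residualFunctional_apply] at h ⊢
  have h1 : (Matrix.of fun j : Option ι => L (j.elim f fun i => c i • g i)) =
      Matrix.of fun j k => (j.elim 1 c) * (Matrix.of fun j => L (j.elim f g)) j k := by
    ext j k
    rcases j with - | x
    · simp
    · simp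
  rw [h1, Matrix.det_mul_column]
  refine mul_ne_zero (Finset.prod_ne_zero_iff.2 fun j _ => ?_) h
  rcases j with - | x
  · exact one_ne_zero
  · exact hc _

theorem homFun_residualFunctional {σ : Type} {e : ι → ℕ} {e' d d' : ℕ}
    {g : ι → (σ → ℂ) → Poly 2} (hg : ∀ i, HomForm (e i) (g i))
    (hgd : ∀ i y, (g i y).IsHomogeneous d) {f : (σ → ℂ) → Poly 2} (hf : HomForm e' f)
    (hfd : ∀ y, (f y).IsHomogeneous d') :
    HomFun (∑ j : Option ι, j.elim e' e) fun y => residualFunctional L (fun i => g i y) (f y) := by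
  simp only [residualFunctional_apply]
  refine HomFun.det fun i j => ?_
  rcases i with - | i
  · exact homFun_map hf hfd (LinearMap.proj j ∘ₗ L)
  · exact homFun_map (hg i) (hgd i) (LinearMap.proj j ∘ₗ L)

/-- A left inverse of the map of linear combinations serves as coordinates in which the independent
forms become the unit vectors. -/
theorem exists_residualFunctional_ne_zero {g : ι → Poly 2} {f : Poly 2}
    (h : LinearIndependent ℂ fun j : Option ι => j.elim f g) :
    ∃ L : Poly 2 →ₗ[ℂ] (Option ι → ℂ), residualFunctional L g f ≠ 0 := by
  obtain ⟨L, hL⟩ := LinearMap.exists_leftInverse_of_injective (Fintype.linearCombination ℂ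
    fun j : Option ι => j.elim f g) (LinearMap.ker_eq_bot.2 h.fintypeLinearCombination_injective)
  refine ⟨L, ?_⟩
  have h1 : ∀ j : Option ι, L (j.elim f g) = Pi.single j 1 := fun j => by
    have := DFunLike.congr_fun hL (Pi.single j 1)
    rw [LinearMap.comp_apply, Fintype.linearCombination_apply_single, one_smul] at this
    exact this
  have h2 : (Matrix.of fun j : Option ι => L (j.elim f g)) = 1 := by
    ext j k
    rw [Matrix.of_apply, h1, Matrix.one_apply, Pi.single_apply]
    exact if_congr eq_comm rfl rfl
  rw [residualFunctional_apply, h2, Matrix.det_one]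
  exact one_ne_zero

end Residual

/-- The quintic multiples of two cubics. -/
def quinticGen (K : Fin 2 → Poly 2) (x : Fin 2 × Mon 2 2) : Poly 2 := monomial x.2.1 1 * K x.1

theorem isHomogeneous_quinticGen {K : Fin 2 → Poly 2} (hK : ∀ i, (K i).IsHomogeneous 3)
    (x : Fin 2 × Mon 2 2) : (quinticGen K x).IsHomogeneous 5 :=
  (isHomogeneous_mon x.2 1).mul (hK x.1)

theorem sum_quinticGen (K : Fin 2 → Poly 2) (c : Fin 2 × Mon 2 2 → ℂ) :
    ∑ x, c x • quinticGen K x = ∑ k, (∑ m : Mon 2 2, monomial m.1 (c (k, m))) * K k := by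
  rw [Fintype.sum_prod_type]
  refine Finset.sum_congr rfl fun k _ => ?_
  rw [Finset.sum_mul]
  refine Finset.sum_congr rfl fun m _ => ?_
  rw [quinticGen, ← smul_mul_assoc, smul_monomial, smul_eq_mul, mul_one]

/-! ### The determinant functional of the quintic multiples of two cubics -/

section Quintic

variable {ι : Type} [Fintype ι] [DecidableEq ι] {L : Poly 2 →ₗ[ℂ] (Option ι → ℂ)}
  {K : Fin 2 → Poly 2} (ix : ι ≃ Fin 2 × Mon 2 2)

theorem residualFunctional_mul (i : Fin 2) {x : Poly 2} (hx : x.IsHomogeneous 2) :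
    residualFunctional L (quinticGen K ∘ ix) (x * K i) = 0 := by
  rw [← LinearMap.mem_ker]
  refine mul_mem_span_of_isHomogeneous hx fun m => ?_
  rw [LinearMap.mem_ker]
  have h := residualFunctional_self L (quinticGen K ∘ ix) (ix.symm (i, m))
  rwa [Function.comp_apply, Equiv.apply_symm_apply] at h

/-- A relation between the cubics, multiplied by any one quadratic monomial, is a relation between
their quintic multiples. -/
theorem residualFunctional_quinticGen_of_dependent (h : ¬LinearIndependent ℂ ![K 0, K 1])
    (f : Poly 2) : residualFunctional L (quinticGen K ∘ ix) f = 0 := by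
  rw [LinearIndependent.pair_iff] at h
  push Not at h
  obtain ⟨a, b, hab, hne⟩ := h
  obtain ⟨m⟩ : Nonempty (Mon 2 2) := inferInstance
  refine residualFunctional_of_dependent L _
    (c := fun x => if (ix x).2 = m then ![a, b] (ix x).1 else 0) (fun h => ?_) ?_ f
  · exact hne (by simpa using congrFun h (ix.symm (0, m)))
      (by simpa using congrFun h (ix.symm (1, m)))
  · have h1 := ix.sum_comp fun x => (if x.2 = m then ![a, b] x.1 else 0) • quinticGen K x
    refine h1.trans ?_
    rw [Fintype.sum_prod_type, Fin.sum_univ_two]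
    simp only [ite_smul, zero_smul, Finset.sum_ite_eq', Finset.mem_univ, if_true, quinticGen,
      Matrix.cons_val_zero, Matrix.cons_val_one]
    rw [← mul_smul_comm, ← mul_smul_comm, ← mul_add, hab, mul_zero]

end Quintic

namespace HilbertBurch

variable (D : HilbertBurch)

theorem eq_zero_of_cub_relation {x y : Poly 2} (hx : x.IsHomogeneous 2)
    (h : x * D.cub₁ + y * D.cub₂ = 0) : x = 0 ∧ y = 0 := by
  obtain ⟨z, rfl, rfl⟩ := syzygy_of_isRelPrime D.isRelPrime D.cub₂_ne_zero h
  have h1 : z * D.cub₂ = 0 := by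
    rw [← homogeneousComponent_eq_self hx]
    exact homogeneousComponent_mul_right_of_lt D.cub₂_hom z (by norm_num)
  have hz := (mul_eq_zero.1 h1).resolve_right D.cub₂_ne_zero
  simp [hz]

/-- The cubics are coprime, so their 12 quintic multiples are independent. A multiple of X_i times
the quartic lies in the ideal of the cubics only if it vanishes at p, where X_i does not. -/
theorem linearIndependent_quinticGen {p : Fin 3 → ℂ} (hp : IsFrame p D.l) {i : Fin 3}
    (hi : p i ≠ 0) : LinearIndependent ℂ fun j : Option (Fin 2 × Mon 2 2) =>
      j.elim (X i * D.quart) (quinticGen ![D.cub₁, D.cub₂]) := by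
  rw [Fintype.linearIndependent_iff]
  intro c hc
  set x : Fin 2 → Poly 2 := fun k => ∑ m : Mon 2 2, monomial m.1 (c (some (k, m))) with hxdef
  have hx : ∀ k, (x k).IsHomogeneous 2 := fun k =>
    Submodule.sum_mem (Form 2 2) fun m _ => isHomogeneous_mon m _
  have h1 : x 0 * D.cub₁ + x 1 * D.cub₂ + C (c none) * X i * D.quart = 0 := by
    rw [← hc, Fintype.sum_option]
    simp only [Option.elim_none, Option.elim_some]
    rw [sum_quinticGen _ fun y => c (some y), Fin.sum_univ_two, smul_eq_C_mul]
    simp only [Matrix.cons_val_zero, Matrix.cons_val_one, hxdef]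
    ring
  have h3 : c none = 0 := by
    have h4 : C (c none) * X i ∈ Ideal.span {D.l 0, D.l 1} := by
      rw [← D.mul_quart_mem_cubicIdeal, D.mem_cubicIdeal]
      exact ⟨-x 0, -x 1, by linear_combination -h1⟩
    obtain ⟨u, w, huw⟩ := Ideal.mem_span_pair.1 h4
    have h5 := congrArg (eval p) huw
    simp only [map_add, map_mul, hp.eval, mul_zero, add_zero, eval_C, eval_X] at h5
    exact (mul_eq_zero.1 h5.symm).resolve_right hi
  rw [h3, C_0, zero_mul, zero_mul, add_zero] at h1
  obtain ⟨h6, h7⟩ := D.eq_zero_of_cub_relation (hx 0) h1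
  have h8 : ∀ k, x k = 0 := fun k => by
    fin_cases k
    · exact h6
    · exact h7
  rintro (- | ⟨k, m⟩)
  · exact h3
  · have h9 := congrFun ((formEquiv 2 2).apply_symm_apply fun m => c (some (k, m))) m
    rw [← h9]
    change coeff m.1 (x k) = 0
    rw [h8, coeff_zero]

/-- The linear form p_j X_i - p_i X_j vanishes at p, so its product with Q lies in the ideal of the
cubics and the functional kills it. Thus the values at X_i Q are proportional to the coordinates of
p. -/
theorem residualFunctional_proportional {ι : Type} [Fintype ι] [DecidableEq ι]
    (ix : ι ≃ Fin 2 × Mon 2 2) {p : Fin 3 → ℂ} (hp0 : p ≠ 0) (hp : IsFrame p D.l)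
    (L : Poly 2 →ₗ[ℂ] (Option ι → ℂ)) {K : Fin 2 → Poly 2} {Q : Poly 2}
    (hK : ∀ i, K i ∈ degPart D.ideal 3) (hQ : Q ∈ degPart D.ideal 4) (i j : Fin 3) :
    p j * residualFunctional L (quinticGen K ∘ ix) (X i * Q) = p i * residualFunctional L (quinticGen K ∘ ix) (X j * Q) := by
  by_cases hli : LinearIndependent ℂ ![K 0, K 1]
  · have hE : Submodule.span ℂ {K 0, K 1} = degPart D.ideal 3 := by
      refine Submodule.eq_of_le_of_finrank_le (Submodule.span_le.2 ?_) ?_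
      · rintro _ (rfl | rfl)
        · exact hK 0
        · exact hK 1
      · rw [D.degPart_three, ← GeneralPencil.range_pair, ← GeneralPencil.range_pair,
          finrank_span_eq_card hli, finrank_span_eq_card D.cub_independent]
    have hmul : ∀ f ∈ degPart D.ideal 3, ∀ x : Poly 2, x.IsHomogeneous 2 →
        residualFunctional L (quinticGen K ∘ ix) (x * f) = 0 := by
      intro f hf x hx
      rw [← hE] at hf
      obtain ⟨a, b, rfl⟩ := Submodule.mem_span_pair.1 hf
      rw [mul_add, mul_smul_comm, mul_smul_comm, map_add, map_smul, map_smul,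
        residualFunctional_mul ix 0 hx, residualFunctional_mul ix 1 hx]
      simp
    have hl : (C (p j) * X i - C (p i) * X j : Poly 2).IsHomogeneous (0 + 1) :=
      (isHomogeneous_C_mul_X _ _).sub (isHomogeneous_C_mul_X _ _)
    obtain ⟨u, w, hu, hw, huw⟩ := hp.exists_eq hp0 hl (by simp; ring)
    obtain ⟨x, y, c, hx, hy, rfl⟩ := D.exists_of_mem_degPart_four hQ
    have e0 := D.relation 0
    have e1 := D.relation 1
    have h1 : (C (p j) * X i - C (p i) * X j) * (x * D.cub₁ + y * D.cub₂ + C c * D.quart) =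
        ((C (p j) * X i - C (p i) * X j) * x + C c * (u * D.a 1 - w * D.a 0)) * D.cub₁ +
        ((C (p j) * X i - C (p i) * X j) * y + C c * (u * D.b 1 - w * D.b 0)) * D.cub₂ := by
      linear_combination C c * D.quart * huw - C c * u * e1 + C c * w * e0
    have h2 := congrArg (residualFunctional L (quinticGen K ∘ ix)) h1
    have hmix : ∀ a : Fin 2 → Poly 2, (∀ i, (a i).IsHomogeneous 2) →
        (C c * (u * a 1 - w * a 0)).IsHomogeneous 2 := fun a ha =>
      ((hu.mul (ha 1)).sub (hw.mul (ha 0))).C_mul c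
    have hlx : ((C (p j) * X i - C (p i) * X j) * x).IsHomogeneous 2 := hl.mul hx
    have hly : ((C (p j) * X i - C (p i) * X j) * y).IsHomogeneous 2 := hl.mul hy
    have h3 := hmul D.cub₁ ⟨D.cub₁_mem, D.cub₁_hom⟩ _ (hlx.add (hmix _ D.ha))
    have h4 := hmul D.cub₂ ⟨D.cub₂_mem, D.cub₂_hom⟩ _ (hly.add (hmix _ D.hb))
    rw [map_add, h3, h4, add_zero, sub_mul, map_sub, mul_assoc, mul_assoc, map_C_mul,
      map_C_mul] at h2
    exact sub_eq_zero.1 h2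
  · rw [residualFunctional_quinticGen_of_dependent ix hli, residualFunctional_quinticGen_of_dependent ix hli, mul_zero,
      mul_zero]

end HilbertBurch

theorem mk_eq_of_proportional {p : ProjSp (Fin 3)} {v : Fin 3 → ℂ} (hv : v ≠ 0)
    (h : ∀ i j, p.rep j * v i = p.rep i * v j) : p = Projectivization.mk ℂ v hv := by
  rw [← p.mk_rep, Projectivization.mk_eq_mk_iff']
  obtain ⟨k, hk⟩ := Function.ne_iff.1 hv
  refine ⟨p.rep k / v k, ?_⟩
  ext i
  rw [Pi.smul_apply, smul_eq_mul, div_mul_eq_mul_div, div_eq_iff hk]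
  exact h i k

/-- Near a given scheme, choose sections of the cubics and of the quartic. The determinants of X_j Q
with the 12 quintic multiples are then forms in the Plücker coordinates, and together they are the
homogeneous coordinates of the associated point. -/
theorem isRegularOn_assocPoint {Y : Set (HilbSpace 2 8)}
    (hY : ∀ z ∈ Y, ∃ D : HilbertBurch, IsPluckerPoint (degPart D.ideal 8) z) :
    IsRegularOn assocPoint Y := by
  refine isRegularOn_of_homFun fun z₀ hz₀ => ?_
  obtain ⟨D₀, hD₀⟩ := hY z₀ hz₀
  have hr3 : ∀ D : HilbertBurch,
      Module.finrank ℂ (Form 2 3) = 8 + Module.finrank ℂ (degPart D.ideal 3) := fun D =>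
    (D.isResolutionGeneral.finrank_degPart 0).trans (add_comm _ _)
  have hr4 : ∀ D : HilbertBurch,
      Module.finrank ℂ (Form 2 4) = 8 + Module.finrank ℂ (degPart D.ideal 4) := fun D =>
    (D.isResolutionGeneral.finrank_degPart 1).trans (add_comm _ _)
  obtain ⟨e₁, K₁, hK₁, hK₁3, hK₁X, c₁, hc₁, hK₁c⟩ := exists_degPart_section (s := 5) rfl hY hr3 hz₀
    hD₀ ⟨D₀.cub₁_mem, D₀.cub₁_hom⟩
  obtain ⟨e₂, K₂, hK₂, hK₂3, hK₂X, c₂, hc₂, hK₂c⟩ := exists_degPart_section (s := 5) rfl hY hr3 hz₀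
    hD₀ ⟨D₀.cub₂_mem, D₀.cub₂_hom⟩
  obtain ⟨e₃, Q, hQ, hQ4, hQX, c₃, hc₃, hQc⟩ := exists_degPart_section (s := 4) rfl hY hr4 hz₀
    hD₀ ⟨D₀.quart_mem, D₀.quart_hom⟩
  obtain ⟨i, hi⟩ := Function.ne_iff.1 (assocPoint z₀).rep_nonzero
  obtain ⟨n, ⟨ix⟩⟩ : ∃ n, Nonempty (Fin n ≃ Fin 2 × Mon 2 2) :=
    ⟨_, ⟨(Fintype.equivFin (Fin 2 × Mon 2 2)).symm⟩⟩
  have hli : LinearIndependent ℂ fun j : Option (Fin n) =>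
      j.elim (X i * D₀.quart) (quinticGen ![D₀.cub₁, D₀.cub₂] ∘ ix) := by
    have h := (D₀.linearIndependent_quinticGen (isFrame_assocPoint hD₀) hi).comp _
      ix.optionCongr.injective
    convert h using 1
    funext j
    rcases j with - | j <;> rfl
  obtain ⟨L, hL⟩ := exists_residualFunctional_ne_zero hli
  set K : Fin 2 → ((Fin ((2 + 8).choose 2 - 8) → Mon 2 8) → ℂ) → Poly 2 := ![K₁, K₂] with hKdef
  have hK : ∀ k, HomForm ((![e₁, e₂] : Fin 2 → ℕ) k) (K k) := fun k => by
    fin_cases k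
    · exact hK₁
    · exact hK₂
  have hK3 : ∀ k y, (K k y).IsHomogeneous 3 := fun k y => by
    fin_cases k
    · exact hK₁3 y
    · exact hK₂3 y
  have hKX : ∀ z ∈ Y, ∀ D : HilbertBurch, IsPluckerPoint (degPart D.ideal 8) z →
      ∀ k, K k z.rep ∈ degPart D.ideal 3 := fun z hz D hD k => by
    fin_cases k
    · exact hK₁X z hz D hD
    · exact hK₂X z hz D hD
  have hKc : quinticGen (fun k => K k z₀.rep) ∘ ix = fun x =>
      (![c₁, c₂] : Fin 2 → ℂ) (ix x).1 • (quinticGen ![D₀.cub₁, D₀.cub₂] ∘ ix) x := by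
    funext x
    simp only [quinticGen, Function.comp_apply]
    generalize ix x = y
    obtain ⟨k, m⟩ := y
    rw [← mul_smul_comm, smul_eq_C_mul]
    fin_cases k
    · exact congrArg _ hK₁c
    · exact congrArg _ hK₂c
  clear_value K
  refine ⟨_, fun z j => residualFunctional L ((quinticGen fun k => K k z) ∘ ix) (X j * Q z), fun j =>
    homFun_residualFunctional L (g := fun x z => quinticGen (fun k => K k z) (ix x))
      (fun x => (HomForm.const (monomial (ix x).2.1 1)).mul (hK (ix x).1))
      (fun x y => isHomogeneous_quinticGen (hK3 · y) (ix x))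
      ((HomForm.const (X j)).mul hQ) fun y => (isHomogeneous_X ℂ j).mul (hQ4 y),
    Function.ne_iff.2 ⟨i, ?_⟩, fun z hz hne => ?_⟩
  · change residualFunctional L ((quinticGen fun k => K k z₀.rep) ∘ ix) (X i * Q z₀.rep) ≠ 0
    rw [hQc, hKc, mul_left_comm, map_C_mul, smul_eq_mul]
    refine mul_ne_zero hc₃ (residualFunctional_smul_ne_zero L _ ?_ hL)
    intro x
    generalize (ix x).1 = k
    fin_cases k
    · exact hc₁
    · exact hc₂
  · obtain ⟨D, hD⟩ := hY z hz
    refine mk_eq_of_proportional hne fun j k => ?_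
    refine D.residualFunctional_proportional ix (Projectivization.rep_nonzero _)
      (isFrame_assocPoint hD) L (hKX z hz D hD) (hQX z hz D hD) j k

end Section

/-! ### The family is a rational surface -/

section Surface

open MvPolynomial

theorem mul_mem_colonForms {t s k e : ℕ} {ι ι' : Type} {L : ι → Poly 2 →ₗ[ℂ] ℂ}
    {L' : ι' → Poly 2 →ₗ[ℂ] ℂ} [IsEmpty ι'] {W : Submodule ℂ (Poly 2)} (he : e + s = k)
    {f g : Poly 2} (hf : f ∈ colonForms L W k t) (hg : g.IsHomogeneous s) :
    g * f ∈ colonForms L' W e (s + t) := by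
  rw [mem_colonForms] at hf ⊢
  refine ⟨hg.mul hf.1, fun m => ?_, fun i => isEmptyElim i⟩
  rw [← mul_assoc]
  exact mul_mem_span_of_isHomogeneous (he ▸ (isHomogeneous_mon m 1).mul hg) hf.2.1

namespace GeneralPencil

variable {lam mu : Poly 2 →ₗ[ℂ] ℂ}

/-- The apolarity conditions on quartics. -/
def quarticConditions (lam mu : Poly 2 →ₗ[ℂ] ℂ) : Fin 2 → Poly 2 →ₗ[ℂ] ℂ := ![lam, mu]

/-- The apolarity conditions on cubics. -/
def cubicConditions (lam mu : Poly 2 →ₗ[ℂ] ℂ) (x : Fin 3 × Fin 2) : Poly 2 →ₗ[ℂ] ℂ :=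
  quarticConditions lam mu x.2 ∘ₗ LinearMap.mulLeft ℂ (X x.1)

theorem colonForms_le_apolarCubics (W : Submodule ℂ (Poly 2)) (s : ℕ) :
    colonForms (cubicConditions lam mu) W s 3 ≤ apolarCubics lam mu := by
  intro f hf
  rw [mem_colonForms] at hf
  exact ⟨hf.1, fun i => ⟨hf.2.2 (i, 0), hf.2.2 (i, 1)⟩⟩

theorem IsApolarTo.quartic {D : HilbertBurch} (hA : IsApolarTo lam mu D) {f : Poly 2}
    (hf : f ∈ degPart D.ideal 4) : lam f = 0 ∧ mu f = 0 := by
  obtain ⟨x, y, c, hx, hy, rfl⟩ := D.exists_of_mem_degPart_four hf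
  obtain ⟨x1, x2⟩ := apolar_mul_eq_zero hA.cub₁ hx
  obtain ⟨y1, y2⟩ := apolar_mul_eq_zero hA.cub₂ hy
  rw [map_add, map_add, map_C_mul, x1, y1, hA.lam, map_add, map_add, map_C_mul, x2, y2, hA.mu]
  simp

variable (G : GeneralPencil lam mu)

-- The dimensions alone recover a Hilbert–Burch matrix whose octics lie in W; both spaces have
-- dimension 37, so they coincide. The apolarity conditions are built into the spaces of quartics
-- and cubics, which also makes the cubics coprime.
include G in
theorem mem_family_iff {W : Submodule ℂ (Poly 2)} {z : HilbSpace 2 8} (hz : IsPluckerPoint W z)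
    (hW : W ≤ Form 2 8) : z ∈ family lam mu ↔
      7 ≤ Module.finrank ℂ (colonForms (quarticConditions lam mu) W 4 4) ∧
      2 ≤ Module.finrank ℂ (colonForms (cubicConditions lam mu) W 5 3) ∧
      Module.finrank ℂ (colonForms (Empty.elim : Empty → Poly 2 →ₗ[ℂ] ℂ) W 3 5) ≤ 13 := by
  constructor
  · rintro ⟨D, hA, hD⟩
    obtain rfl := hz.ext hD hW inf_le_right
    have d3 := D.isResolutionGeneral.finrank_degPart 0
    have d4 := D.isResolutionGeneral.finrank_degPart 1
    have d5 := D.isResolutionGeneral.finrank_degPart 2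
    have f3 := two_mul_finrank_form_two 3
    have f4 := two_mul_finrank_form_two 4
    have f5 := two_mul_finrank_form_two 5
    simp only [Nat.reduceAdd] at d3 d4 d5
    have e3 : degPart D.ideal 3 ⊓ ⨅ i, LinearMap.ker (cubicConditions lam mu i) =
        degPart D.ideal 3 := by
      refine inf_eq_left.2 fun f hf => ?_
      rw [D.degPart_three] at hf
      have hf' : f ∈ apolarCubics lam mu := by
        refine Submodule.span_le.2 ?_ hf
        rintro _ (rfl | rfl)
        · exact hA.cub₁
        · exact hA.cub₂
      rw [Submodule.mem_iInf]
      rintro ⟨i, j⟩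
      rcases Fin.exists_fin_two.1 ⟨j, rfl⟩ with rfl | rfl
      · exact (hf'.2 i).1
      · exact (hf'.2 i).2
    have e4 : degPart D.ideal 4 ⊓ ⨅ i, LinearMap.ker (quarticConditions lam mu i) =
        degPart D.ideal 4 := by
      refine inf_eq_left.2 fun f hf => ?_
      rw [Submodule.mem_iInf]
      intro j
      fin_cases j
      · exact (hA.quartic hf).1
      · exact (hA.quartic hf).2
    rw [D.colonForms_eq (show 4 + 4 = 8 from rfl), D.colonForms_eq (show 5 + 3 = 8 from rfl),
      D.colonForms_eq (show 3 + 5 = 8 from rfl), e3, e4, iInf_of_empty, inf_top_eq]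
    omega
  · rintro ⟨h4, h3, h5⟩
    obtain ⟨D, hD₁, hD₂, hD₃⟩ := exists_hilbertBurch_of_submodules (colonForms_le _ W)
      (colonForms_le _ W) (colonForms_le _ W) h3 h4 h5
      (fun f hf g hg => mul_mem_colonForms (s := 2) (t := 3) rfl hf hg)
      (fun f hf g hg => mul_mem_colonForms (s := 1) (t := 4) rfl hf hg)
      fun b hb hli => G.isRelPrime (fun i => colonForms_le_apolarCubics W 5 (hb i)) hli
    have hA := colonForms_le_apolarCubics W 5 hD₁
    have hA' := colonForms_le_apolarCubics W 5 hD₂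
    rw [mem_colonForms] at hD₁ hD₂ hD₃
    refine ⟨D, ⟨hA, hA', hD₃.2.2 0, hD₃.2.2 1⟩, ?_⟩
    have hle : degPart D.ideal 8 ≤ W := by
      rw [← D.span_octicGen, Submodule.span_le]
      rintro _ ⟨(m | m) | m, rfl⟩
      · exact hD₁.2.1 m
      · exact hD₂.2.1 m
      · exact hD₃.2.1 m
    have : FiniteDimensional ℂ W := Submodule.finiteDimensional_of_le hW
    rw [Submodule.eq_of_le_of_finrank_eq hle (D.finrank_degPart_eight.trans hz.finrank.symm)]
    exact hz

include G in
theorem isLocallyClosed_family : IsLocallyClosed (family lam mu) := by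
  -- In terms of ranks the bounds 7, 2 and 13 become at most 15 - 7 = 8, at most 10 - 2 = 8 and at
  -- least 21 - 13 = 8. The last one is open, the others are closed.
  refine ⟨{z | (colonMatrix (Empty.elim : Empty → Poly 2 →ₗ[ℂ] ℂ) 3 5 z.rep).rank ≤ 7}ᶜ,
    grassmannian 2 8 ((2 + 8).choose 2 - 8) ∩
      ({z | (colonMatrix (quarticConditions lam mu) 4 4 z.rep).rank ≤ 8} ∩
       {z | (colonMatrix (cubicConditions lam mu) 5 3 z.rep).rank ≤ 8}),
    (isClosed_rank_le (homFun_colonMatrix _) 7).isOpen_compl,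
    (isClosed_grassmannian _ _ _).inter ((isClosed_rank_le (homFun_colonMatrix _) 8).inter
      (isClosed_rank_le (homFun_colonMatrix _) 8)), ?_⟩
  have key : ∀ (W : Submodule ℂ (Poly 2)) (z : HilbSpace 2 8), IsPluckerPoint W z → W ≤ Form 2 8 →
      (z ∈ family lam mu ↔
        ¬(colonMatrix (Empty.elim : Empty → Poly 2 →ₗ[ℂ] ℂ) 3 5 z.rep).rank ≤ 7 ∧
        (colonMatrix (quarticConditions lam mu) 4 4 z.rep).rank ≤ 8 ∧
        (colonMatrix (cubicConditions lam mu) 5 3 z.rep).rank ≤ 8) := by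
    intro W z hz hW
    rw [G.mem_family_iff hz hW]
    have r5 := rank_colonMatrix (Empty.elim : Empty → Poly 2 →ₗ[ℂ] ℂ) hz hW
      (show 3 + 5 = 8 from rfl)
    have r4 := rank_colonMatrix (quarticConditions lam mu) hz hW (show 4 + 4 = 8 from rfl)
    have r3 := rank_colonMatrix (cubicConditions lam mu) hz hW (show 5 + 3 = 8 from rfl)
    have f3 := two_mul_finrank_form_two 3
    have f4 := two_mul_finrank_form_two 4
    have f5 := two_mul_finrank_form_two 5
    omega
  ext z
  constructor
  · intro h
    obtain ⟨D, hA, hD⟩ := id h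
    obtain ⟨h1, h2⟩ := (key _ z hD inf_le_right).1 h
    exact ⟨h1, ⟨_, inf_le_right, hD⟩, h2⟩
  · rintro ⟨h1, ⟨W, hW, hz⟩, h2⟩
    exact (key W z hz hW).2 ⟨h1, h2⟩

theorem image_octahedronAt :
    octahedronAt lam mu '' G.goodSet = family lam mu ∩ assocPoint ⁻¹' G.goodSet := by
  ext z
  constructor
  · rintro ⟨p, hp, rfl⟩
    exact ⟨G.octahedronAt_mem hp, by rw [Set.mem_preimage, G.assocPoint_octahedronAt hp]; exact hp⟩
  · rintro ⟨hz, hp⟩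
    exact ⟨_, hp, G.octahedronAt_assocPoint hz hp⟩

-- The part over the good set is the image of an open part of the plane under a regular, hence
-- continuous, map. It is dense in the family, and irreducibility passes to and from closures.
include G in
theorem isIrreducible_family : IsIrreducible (family lam mu) := by
  have h1 : IsIrreducible G.goodSet :=
    ⟨G.dense_goodSet.nonempty, (PreirreducibleSpace.isPreirreducible_univ).open_subset
      G.isOpen_goodSet (Set.subset_univ _)⟩
  have h2 := h1.image _ G.isRegularOn_octahedronAt.continuousOn
  rw [G.image_octahedronAt] at h2
  refine ⟨h2.1.mono Set.inter_subset_left, ?_⟩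
  have h3 := (isPreirreducible_iff_closure (s := family lam mu ∩ assocPoint ⁻¹' G.goodSet)).2 h2.2
  rw [← isPreirreducible_iff_closure]
  have h4 : closure (family lam mu) = closure (family lam mu ∩ assocPoint ⁻¹' G.goodSet) :=
    (closure_minimal G.family_subset_closure isClosed_closure).antisymm
      (closure_mono Set.inter_subset_left)
  rwa [h4]

theorem isRegularOn_assocPoint_family : IsRegularOn assocPoint (family lam mu) :=
  isRegularOn_assocPoint fun _ ⟨D, _, hD⟩ => ⟨D, hD⟩

include G in
theorem hasRationalInverse : HasRationalInverse assocPoint (family lam mu) :=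
  ⟨G.goodSet, octahedronAt lam mu, G.isOpen_goodSet, G.dense_goodSet, G.family_subset_closure,
    G.isRegularOn_octahedronAt, fun _ hp => G.octahedronAt_mem hp,
    fun _ hq => G.assocPoint_octahedronAt hq, fun _ hx hp => G.octahedronAt_assocPoint hx hp⟩

include G in
theorem isRationalVariety : IsRationalVariety 2 (family lam mu) := by
  refine ⟨G.isLocallyClosed_family, G.isIrreducible_family, ?_⟩
  obtain ⟨V, hV, hVe⟩ := (continuousOn_iff'.1
    (isRegularOn_assocPoint_family (lam := lam) (mu := mu)).continuousOn) _ G.isOpen_goodSet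
  have hmem : ∀ z, z ∈ family lam mu ∩ V ↔ z ∈ family lam mu ∧ assocPoint z ∈ G.goodSet := by
    intro z
    rw [Set.inter_comm, ← hVe]
    exact and_comm
  have hmaps : Set.MapsTo (octahedronAt lam mu) G.goodSet (family lam mu ∩ V) := fun p hp =>
    (hmem _).2 ⟨G.octahedronAt_mem hp, by rw [G.assocPoint_octahedronAt hp]; exact hp⟩
  obtain ⟨p, hp⟩ := G.dense_goodSet.nonempty
  refine ⟨V, G.goodSet, assocPoint, octahedronAt lam mu, hV, ⟨_, hmaps hp⟩, G.isOpen_goodSet,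
    ⟨p, hp⟩, isRegularOn_assocPoint_family.mono Set.inter_subset_left, fun z hz =>
    ((hmem z).1 hz).2, G.isRegularOn_octahedronAt, hmaps, fun z hz => ?_, fun q hq =>
    G.assocPoint_octahedronAt hq⟩
  exact G.octahedronAt_assocPoint ((hmem z).1 hz).1 ((hmem z).1 hz).2

end GeneralPencil

open GeneralPencil in
theorem polarFamily_eq {F : Fin 2 → Poly 2} (hF : ∀ i, (F i).IsHomogeneous 4)
    (G : GeneralPencil (formFunctional fun m : Mon 2 4 => coeff m.1 (F 0))
      (formFunctional fun m : Mon 2 4 => coeff m.1 (F 1))) :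
    polarFamily 8 (Submodule.span ℂ (Set.range F)) =
      family (formFunctional fun m : Mon 2 4 => coeff m.1 (F 0))
        (formFunctional fun m : Mon 2 4 => coeff m.1 (F 1)) := by
  ext z
  constructor
  · rintro ⟨I, hI, hz⟩
    obtain ⟨D, rfl, hA⟩ := (isPolarPolyhedron_iff hF G I).1 hI
    exact ⟨D, hA, hz⟩
  · rintro ⟨D, hA, hz⟩
    exact ⟨D.ideal, (isPolarPolyhedron_iff hF G _).2 ⟨D, rfl, hA⟩, hz⟩

theorem isAssociatedPoint_assocPoint {F : Fin 2 → Poly 2} (hF : ∀ i, (F i).IsHomogeneous 4)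
    (G : GeneralPencil (formFunctional fun m : Mon 2 4 => coeff m.1 (F 0))
      (formFunctional fun m : Mon 2 4 => coeff m.1 (F 1))) {I : Ideal (Poly 2)}
    (hI : IsPolarPolyhedron 8 (Submodule.span ℂ (Set.range F)) I) {z : HilbSpace 2 8}
    (hz : IsHilbPoint 8 I z) : IsAssociatedPoint I (assocPoint z) := by
  obtain ⟨D, rfl, -⟩ := (isPolarPolyhedron_iff hF G I).1 hI
  exact D.isAssociatedPoint_iff.2 (isFrame_assocPoint hz)

end Surface

/-! ### Genericity -/

section Generic

open MvPolynomial

/-- The forms of degree `t` that are annihilated by some functionals. -/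
def kernelForms {n : ℕ} {ι : Type*} (φ : ι → Poly n →ₗ[ℂ] ℂ) (t : ℕ) : Submodule ℂ (Poly n) :=
  Form n t ⊓ ⨅ i, LinearMap.ker (φ i)

theorem mem_kernelForms {n t : ℕ} {ι : Type*} {φ : ι → Poly n →ₗ[ℂ] ℂ} {f : Poly n} :
    f ∈ kernelForms φ t ↔ f.IsHomogeneous t ∧ ∀ i, φ i f = 0 := by
  simp only [kernelForms, Submodule.mem_inf, Submodule.mem_iInf, LinearMap.mem_ker]
  rfl

theorem rank_add_finrank_kernelForms {n t : ℕ} {ι : Type*} (φ : ι → Poly n →ₗ[ℂ] ℂ) :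
    (Matrix.of fun i (m : Mon n t) => φ i (monomial m.1 1)).rank +
      Module.finrank ℂ (kernelForms φ t) = Module.finrank ℂ (Form n t) := by
  refine rank_add_finrank_of_mulVec inf_le_left fun f hf => ?_
  rw [mem_kernelForms, and_iff_right hf, funext_iff]
  refine forall_congr' fun i => ?_
  rw [map_form_eq_sum hf]
  rfl

theorem BiHom.exists_param {κ σ : Type*} {d : ℕ} {f : (κ → ℂ) → (σ → ℂ) → ℂ} (h : BiHom d f)
    (y : σ → ℂ) : ∃ G : MvPolynomial κ ℂ, ∀ a, eval a G = f a y := by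
  obtain ⟨P, -, hP⟩ := h
  refine ⟨eval (fun i => C (y i)) P, fun a => ?_⟩
  rw [hP, eval_map, ← coe_eval₂Hom, ← RingHom.comp_apply]
  refine congrFun (congrArg DFunLike.coe (?_ : _ = (_ : MvPolynomial σ (MvPolynomial κ ℂ) →+* ℂ))) P
  ext i <;> simp

/-- Functionals with a small common kernel are linearly independent. -/
theorem eq_zero_of_sum_eq_zero {n t : ℕ} {ι : Type*} [Fintype ι] {φ : ι → Poly n →ₗ[ℂ] ℂ}
    (h : Fintype.card ι + Module.finrank ℂ (kernelForms φ t) ≤ Module.finrank ℂ (Form n t))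
    {c : ι → ℂ} (hc : ∀ f : Poly n, f.IsHomogeneous t → ∑ i, c i * φ i f = 0) : c = 0 := by
  have h1 := rank_add_finrank_kernelForms (t := t) φ
  set M := Matrix.of fun i (m : Mon n t) => φ i (monomial m.1 1) with hM
  have hrank : M.rank = Fintype.card ι := by
    have h2 := M.rank_le_card_height
    omega
  have hli : LinearIndependent ℂ M.row := by
    rw [linearIndependent_iff_card_eq_finrank_span, ← hrank, Matrix.rank_eq_finrank_span_row]
    rfl
  refine funext (Fintype.linearIndependent_iff.1 hli c ?_)
  ext m
  rw [Finset.sum_apply]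
  exact hc _ (isHomogeneous_mon m 1)

/-- The dimension of a space of forms is upper semicontinuous. -/
theorem exists_generic_finrank_le {κ σ : Type*} [Fintype σ] {ι : Type*} [Fintype ι] {n t d s : ℕ}
    {φ : ι → (κ → ℂ) → (σ → ℂ) → Poly n →ₗ[ℂ] ℂ}
    (hφ : ∀ i (m : Mon n t), BiHom d fun a y => φ i a y (monomial m.1 1)) (a₀ : κ → ℂ)
    (h₀ : ∀ y, y ≠ 0 → Module.finrank ℂ (kernelForms (fun i => φ i a₀ y) t) ≤ s) :
    ∃ G : MvPolynomial κ ℂ, eval a₀ G ≠ 0 ∧ ∀ a, eval a G ≠ 0 → ∀ y, y ≠ 0 →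
      Module.finrank ℂ (kernelForms (fun i => φ i a y) t) ≤ s := by
  classical
  set N := Module.finrank ℂ (Form n t) with hN
  set M : (κ → ℂ) → (σ → ℂ) → Matrix ι (Mon n t) ℂ := fun a y =>
    Matrix.of fun i m => φ i a y (monomial m.1 1) with hM
  have key : ∀ a y, Module.finrank ℂ (kernelForms (fun i => φ i a y) t) ≤ s ↔
      -- A kernel of dimension at most s means rank at least N - s, that is, some det(AMB) of this
      -- size is nonzero. These determinants are the equations handed to `elimination`.
      ∃ j : Matrix (Fin (N - s)) ι ℂ × Matrix (Mon n t) (Fin (N - s)) ℂ,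
        (j.1 * M a y * j.2).det ≠ 0 := by
    intro a y
    rw [Prod.exists, ← le_rank_iff]
    have := rank_add_finrank_kernelForms (t := t) fun i => φ i a y
    change (M a y).rank + _ = N at this
    omega
  simp only [key] at h₀ ⊢
  have hdet : ∀ j : Matrix (Fin (N - s)) ι ℂ × Matrix (Mon n t) (Fin (N - s)) ℂ,
      BiHom (∑ _ : Fin (N - s), (0 + d + 0)) fun a y => (j.1 * M a y * j.2).det := fun j =>
    BiHom.det fun i k => BiHom.matrix_mul i k (fun k => BiHom.matrix_mul (M := fun _ _ => j.1)
      (N := M) i k (fun k => biHom_const _) fun l => hφ l k) fun k => biHom_const _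
  exact elimination hdet a₀ h₀

/-- A functional that depends polynomially on parameters, applied to a family of forms. -/
theorem biHom_map {κ σ : Type*} {n t d : ℕ} {L : (κ → ℂ) → Poly n →ₗ[ℂ] ℂ}
    (hL : ∀ m : Fin (n + 1) →₀ ℕ, BiHom 0 fun a (_ : σ → ℂ) => L a (monomial m 1))
    {Φ : (κ → ℂ) → (σ → ℂ) → Poly n} (hΦ : BiForm d Φ) (ht : ∀ a y, (Φ a y).IsHomogeneous t) :
    BiHom d fun a y => L a (Φ a y) := by
  have h : (fun a y => L a (Φ a y)) = fun a y => ∑ m : Mon n t,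
      L a (monomial m.1 1) * coeff m.1 (Φ a y) := by
    ext a y
    rw [map_form_eq_sum (ht a y)]
  rw [h]
  exact BiHom.sum _ fun m _ => ((hL m.1).mul (hΦ m.1)).cast (zero_add _)

theorem not_linearIndependent_of_finrank_le_one {V : Submodule ℂ (Poly 2)} {t : ℕ}
    (hV : V ≤ Form 2 t) (h : Module.finrank ℂ V ≤ 1) {f g : Poly 2} (hf : f ∈ V) (hg : g ∈ V) :
    ¬LinearIndependent ℂ ![f, g] := by
  intro hli
  have : FiniteDimensional ℂ V := Submodule.finiteDimensional_of_le hV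
  have h1 := finrank_span_eq_card hli
  have h2 := Submodule.finrank_mono (Submodule.span_le.2 (?_ : Set.range ![f, g] ⊆ V))
  · rw [h1, Fintype.card_fin] at h2
    omega
  · rw [GeneralPencil.range_pair]
    rintro _ (rfl | rfl)
    · exact hf
    · exact hg

/-! ### Apolar cubics through a point as a kernel -/

section Conditions

variable {lam mu : Poly 2 →ₗ[ℂ] ℂ}

/-- The seven conditions that define `apolarCubicsAt`, all made homogeneous of degree three. -/
def pointConditions (lam mu : Poly 2 →ₗ[ℂ] ℂ) (p : Fin 3 → ℂ) :
    Unit ⊕ (Mon 2 3 × Fin 3 × Fin 2) → Poly 2 →ₗ[ℂ] ℂ :=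
  Sum.elim (fun _ => (aeval p : Poly 2 →ₐ[ℂ] ℂ).toLinearMap) fun x =>
    eval p (monomial x.1.1 1 : Poly 2) • GeneralPencil.cubicConditions lam mu x.2

theorem kernelForms_pointConditions {p : Fin 3 → ℂ} (hp : p ≠ 0) :
    kernelForms (pointConditions lam mu p) 3 = apolarCubicsAt lam mu p := by
  ext f
  rw [mem_kernelForms, mem_apolarCubicsAt]
  constructor
  · rintro ⟨h3, h⟩
    obtain ⟨k, hk⟩ := Function.ne_iff.1 hp
    have hz : ∀ x, GeneralPencil.cubicConditions lam mu x f = 0 := by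
      intro x
      -- The cube of a coordinate that does not vanish at p removes the artificial cubic factor.
      have h1 := h (Sum.inr (⟨Finsupp.single k 3, mem_mon (Finsupp.degree_single _ _)⟩, x))
      change eval p (monomial (Finsupp.single k 3) 1 : Poly 2) *
        GeneralPencil.cubicConditions lam mu x f = 0 at h1
      refine (mul_eq_zero.1 h1).resolve_left ?_
      rw [eval_monomial, one_mul, Finsupp.prod_single_index (by simp)]
      exact pow_ne_zero _ hk
    refine ⟨⟨h3, fun i => ⟨hz (i, 0), hz (i, 1)⟩⟩, ?_⟩
    have h2 := h (Sum.inl ())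
    rwa [← aeval_eq_eval]
  · rintro ⟨⟨h3, h⟩, h0⟩
    refine ⟨h3, ?_⟩
    rintro (- | ⟨m, i, j⟩)
    · rw [← aeval_eq_eval] at h0
      exact h0
    · change _ * GeneralPencil.cubicConditions lam mu (i, j) f = 0
      rcases Fin.exists_fin_two.1 ⟨j, rfl⟩ with rfl | rfl
      · exact mul_eq_zero_of_right _ (h i).1
      · exact mul_eq_zero_of_right _ (h i).2

/-- Cubics have dimension 10, so a common kernel of dimension at most 3 forces the seven conditions,
six of apolarity and one evaluation, to be independent. -/
theorem isUnrelatedAt_of_finrank_le {p : Fin 3 → ℂ}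
    (h : Module.finrank ℂ (apolarCubicsAt lam mu p) ≤ 3) : IsUnrelatedAt lam mu p := by
  intro g k c hg hk hrel
  obtain ⟨x, rfl⟩ := exists_linForm hg
  obtain ⟨y, rfl⟩ := exists_linForm hk
  set E : Option (Fin 3 × Fin 2) → Poly 2 →ₗ[ℂ] ℂ := fun j =>
    j.elim (aeval p : Poly 2 →ₐ[ℂ] ℂ).toLinearMap (GeneralPencil.cubicConditions lam mu) with hE
  have hEk : kernelForms E 3 = apolarCubicsAt lam mu p := by
    ext f
    rw [mem_kernelForms, mem_apolarCubicsAt, ← aeval_eq_eval]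
    constructor
    · rintro ⟨h3, h⟩
      exact ⟨⟨h3, fun i => ⟨h (some (i, 0)), h (some (i, 1))⟩⟩, h none⟩
    · rintro ⟨⟨h3, h⟩, h0⟩
      refine ⟨h3, ?_⟩
      rintro (- | ⟨i, j⟩)
      · exact h0
      · rcases Fin.exists_fin_two.1 ⟨j, rfl⟩ with rfl | rfl
        · exact (h i).1
        · exact (h i).2
  have f3 := two_mul_finrank_form_two 3
  have hcard : Fintype.card (Option (Fin 3 × Fin 2)) = 7 := by simp
  have hz := eq_zero_of_sum_eq_zero (t := 3) (φ := E)
    (c := fun j => j.elim (-c) fun z => ![x z.1, y z.1] z.2) (by rw [hEk]; omega) fun f hf => by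
      have h4 := hrel f hf
      rw [Fintype.sum_option, Fintype.sum_prod_type]
      simp only [linForm, add_mul, map_add, mul_assoc, map_C_mul, smul_eq_mul] at h4
      rw [← aeval_eq_eval] at h4
      have e0 : E none f = aeval p f := rfl
      have e1 : ∀ i, E (some (i, 0)) f = lam (X i * f) := fun i => rfl
      have e2 : ∀ i, E (some (i, 1)) f = mu (X i * f) := fun i => rfl
      simp only [Fin.sum_univ_two, Fin.sum_univ_three, Option.elim_none,
        Option.elim_some, Matrix.cons_val_zero, Matrix.cons_val_one, e0, e1, e2]
      linear_combination h4
  exact ⟨linForm_eq_zero_iff.2 (funext fun i => congrFun hz (some (i, 0))),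
    linForm_eq_zero_iff.2 (funext fun i => congrFun hz (some (i, 1)))⟩

end Conditions

/-! ### The transfer operator as a polynomial in the coefficients -/

section Transfer

/-- The matrix of the bilinear form `q, q' ↦ lam (q * q')` on quadratic forms. -/
def quadMatrix (lam : Poly 2 →ₗ[ℂ] ℂ) : Matrix (Mon 2 2) (Mon 2 2) ℂ :=
  Matrix.of fun m m' => lam (monomial m.1 1 * monomial m'.1 1)

/-- The transfer map in terms of the adjugate matrix. -/
def transferMap (lam mu : Poly 2 →ₗ[ℂ] ℂ) : Poly 2 →ₗ[ℂ] Poly 2 where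
  toFun f := ∑ m : Mon 2 2, monomial m.1
    (((quadMatrix lam).adjugate * quadMatrix mu).mulVec (fun m' => coeff m'.1 f) m)
  map_add' f g := by
    rw [← Finset.sum_add_distrib]
    refine Finset.sum_congr rfl fun m _ => ?_
    rw [← map_add]
    congr 1
    simp only [coeff_add]
    exact congrFun (Matrix.mulVec_add _ (fun m' : Mon 2 2 => coeff m'.1 f) fun m' => coeff m'.1 g) m
  map_smul' c f := by
    rw [Finset.smul_sum]
    refine Finset.sum_congr rfl fun m _ => ?_
    rw [smul_monomial]
    congr 1
    simp only [coeff_smul]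
    exact congrFun (Matrix.mulVec_smul _ c fun m' : Mon 2 2 => coeff m'.1 f) m

theorem coeff_transferMap (lam mu : Poly 2 →ₗ[ℂ] ℂ) (f : Poly 2) (m : Mon 2 2) :
    coeff m.1 (transferMap lam mu f) =
      ((quadMatrix lam).adjugate * quadMatrix mu).mulVec (fun m' => coeff m'.1 f) m :=
  congrFun ((formEquiv 2 2).apply_symm_apply
    (((quadMatrix lam).adjugate * quadMatrix mu).mulVec fun m' => coeff m'.1 f)) m

theorem isHomogeneous_transferMap (lam mu : Poly 2 →ₗ[ℂ] ℂ) (f : Poly 2) :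
    (transferMap lam mu f).IsHomogeneous 2 :=
  Submodule.sum_mem (Form 2 2) fun m _ => isHomogeneous_mon m _

theorem map_mul_eq_quadMatrix (lam : Poly 2 →ₗ[ℂ] ℂ) {q q' : Poly 2} (hq : q.IsHomogeneous 2)
    (hq' : q'.IsHomogeneous 2) : lam (q * q') =
      (fun m : Mon 2 2 => coeff m.1 q') ⬝ᵥ (quadMatrix lam).mulVec fun m => coeff m.1 q := by
  have h1 : lam (q * q') = ∑ m : Mon 2 2, lam (q * monomial m.1 1) * coeff m.1 q' :=
    map_form_eq_sum hq' (lam ∘ₗ LinearMap.mulLeft ℂ q)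
  rw [h1, dotProduct]
  refine Finset.sum_congr rfl fun m _ => ?_
  rw [mul_comm]
  congr 1
  rw [mul_comm]
  exact map_form_eq_sum hq (lam ∘ₗ LinearMap.mulLeft ℂ (monomial m.1 1))

/-- The transfer map, if the bilinear form is nondegenerate. -/
def transferOfDet {lam : Poly 2 →ₗ[ℂ] ℂ} (mu : Poly 2 →ₗ[ℂ] ℂ) (h : (quadMatrix lam).det ≠ 0) :
    Transfer lam mu where
  T := transferMap lam mu
  -- The adjugate in place of the inverse keeps T polynomial in both functionals, at the price of
  -- this scalar.
  δ := (quadMatrix lam).det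
  δ_ne := h
  hom := isHomogeneous_transferMap lam mu
  apply q q' hq hq' := by
    rw [map_mul_eq_quadMatrix lam (isHomogeneous_transferMap lam mu q) hq',
      map_mul_eq_quadMatrix mu hq hq']
    simp only [coeff_transferMap]
    rw [show (fun m : Mon 2 2 => ((quadMatrix lam).adjugate * quadMatrix mu).mulVec
      (fun m' => coeff m'.1 q) m) = ((quadMatrix lam).adjugate * quadMatrix mu).mulVec
      (fun m' => coeff m'.1 q) from rfl, Matrix.mulVec_mulVec, ← Matrix.mul_assoc,
      Matrix.mul_adjugate, Matrix.smul_mul, Matrix.one_mul, Matrix.smul_mulVec,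
      dotProduct_smul, smul_eq_mul]
  nondeg q hq h0 := by
    by_contra hne
    refine h (Matrix.exists_mulVec_eq_zero_iff.1 ⟨fun m => coeff m.1 q, fun hz => hne ?_, ?_⟩)
    · exact form_ext hq (isHomogeneous_zero _ _ _) fun m => by simpa using congrFun hz m
    · ext m
      have h1 := h0 (monomial m.1 1) (isHomogeneous_mon m 1)
      rw [mul_comm] at h1
      rw [Pi.zero_apply, ← h1]
      exact (map_form_eq_sum hq (lam ∘ₗ LinearMap.mulLeft ℂ (monomial m.1 1))).symm

variable {κ σ : Type*} {lam mu : (κ → ℂ) → Poly 2 →ₗ[ℂ] ℂ}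
  (hlam : ∀ m, BiHom 0 fun a (_ : σ → ℂ) => lam a (monomial m 1))
  (hmu : ∀ m, BiHom 0 fun a (_ : σ → ℂ) => mu a (monomial m 1))

include hlam in
theorem biHom_quadMatrix (m m') : BiHom 0 fun a (_ : σ → ℂ) => quadMatrix (lam a) m m' :=
  biHom_map (t := 2 + 2) hlam (BiForm.const _) fun _ _ => (isHomogeneous_mon m 1).mul
    (isHomogeneous_mon m' 1)

include hlam in
theorem biHom_det_quadMatrix : BiHom 0 fun a (_ : σ → ℂ) => (quadMatrix (lam a)).det :=
  (BiHom.det (r := fun _ => 0) (biHom_quadMatrix hlam)).cast (by simp)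

include hlam hmu in
theorem biForm_transferMap (f : Poly 2) :
    BiForm 0 fun a (_ : σ → ℂ) => transferMap (lam a) (mu a) f := by
  have hadj : ∀ m m', BiHom 0 fun a (_ : σ → ℂ) => (quadMatrix (lam a)).adjugate m m' := by
    intro m m'
    simp only [Matrix.adjugate_apply]
    refine (BiHom.det (r := fun _ => 0) fun i j => ?_).cast (by simp)
    by_cases h : i = m'
    · subst h
      simp only [Matrix.updateRow_self]
      exact biHom_const _
    · simp only [Matrix.updateRow_ne h]
      exact biHom_quadMatrix hlam i j
  have hprod : ∀ m m', BiHom 0 fun a (_ : σ → ℂ) =>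
      ((quadMatrix (lam a)).adjugate * quadMatrix (mu a)) m m' := fun m m' =>
    BiHom.matrix_mul m m' (hadj m) fun j => biHom_quadMatrix hmu j m'
  intro m
  by_cases hm : m.degree = 2
  · have h1 : (fun a (_ : σ → ℂ) => coeff m (transferMap (lam a) (mu a) f)) =
        fun a _ => ∑ m' : Mon 2 2, ((quadMatrix (lam a)).adjugate * quadMatrix (mu a))
          ⟨m, mem_mon hm⟩ m' * coeff m'.1 f := by
      ext a y
      exact coeff_transferMap (lam a) (mu a) f ⟨m, mem_mon hm⟩
    rw [h1]
    exact BiHom.sum _ fun m' _ => ((hprod _ m').mul (biHom_const _)).cast (zero_add _)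
  · have h1 : (fun a (_ : σ → ℂ) => coeff m (transferMap (lam a) (mu a) f)) = fun a _ => 0 := by
      ext a y
      exact (isHomogeneous_transferMap _ _ f).coeff_eq_zero hm
    rw [h1]
    exact biHom_zero 0

end Transfer

end Generic

/-! ### Pencils are general if two examples are -/

section GenericPencil

open MvPolynomial GeneralPencil

/-- The functionals of the pencil with given coefficients. -/
def pencilFunctional (a : Fin 2 × Mon 2 4 → ℂ) (e : Fin 2) : Poly 2 →ₗ[ℂ] ℂ :=
  formFunctional fun m : Mon 2 4 => a (e, m)

theorem biHom_pencilFunctional {σ : Type*} (e : Fin 2) (m : Fin 3 →₀ ℕ) :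
    BiHom 0 fun (a : Fin 2 × Mon 2 4 → ℂ) (_ : σ → ℂ) => pencilFunctional a e (monomial m 1) := by
  simp only [pencilFunctional, formFunctional_apply]
  exact BiHom.sum _ fun m' _ => (((biHom_param _).const_mul _).mul (biHom_const _)).cast (zero_add _)

theorem biHom_cubicConditions {σ : Type*} {d t : ℕ} (x : Fin 3 × Fin 2)
    {Φ : (Fin 2 × Mon 2 4 → ℂ) → (σ → ℂ) → Poly 2} (hΦ : BiForm d Φ)
    (ht : ∀ a y, (Φ a y).IsHomogeneous t) : BiHom d fun a y =>
      cubicConditions (pencilFunctional a 0) (pencilFunctional a 1) x (Φ a y) := by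
  have h : ∀ e, BiHom d fun a y => pencilFunctional a e (X x.1 * Φ a y) := fun e =>
    (biHom_map (t := 1 + t) (biHom_pencilFunctional e) ((BiForm.const (X x.1)).mul hΦ)
      fun a y => (isHomogeneous_X ℂ x.1).mul (ht a y)).cast (zero_add _)
  rcases x with ⟨i, j⟩
  rcases Fin.exists_fin_two.1 ⟨j, rfl⟩ with rfl | rfl
  · exact h 0
  · exact h 1

/-- The conditions that the product of a quadratic form with a linear form is apolar. -/
def lineConditions (lam mu : Poly 2 →ₗ[ℂ] ℂ) (y : Fin 3 → ℂ) (x : Fin 3 × Fin 2) :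
    Poly 2 →ₗ[ℂ] ℂ := cubicConditions lam mu x ∘ₗ LinearMap.mulLeft ℂ (linForm y)

/-- The conditions that the product of a linear form with a quadratic form is apolar. -/
def conicConditions (lam mu : Poly 2 →ₗ[ℂ] ℂ) (y : Mon 2 2 → ℂ) (x : Fin 3 × Fin 2) :
    Poly 2 →ₗ[ℂ] ℂ :=
  cubicConditions lam mu x ∘ₗ LinearMap.mulLeft ℂ ((formEquiv 2 2).symm y : Poly 2)

theorem lineConditions_apply (lam mu : Poly 2 →ₗ[ℂ] ℂ) (y : Fin 3 → ℂ) (x : Fin 3 × Fin 2)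
    (f : Poly 2) : lineConditions lam mu y x f = cubicConditions lam mu x (linForm y * f) := rfl

theorem conicConditions_apply (lam mu : Poly 2 →ₗ[ℂ] ℂ) (y : Mon 2 2 → ℂ) (x : Fin 3 × Fin 2)
    (f : Poly 2) : conicConditions lam mu y x f =
      cubicConditions lam mu x (((formEquiv 2 2).symm y : Poly 2) * f) := rfl

theorem pointConditions_inr (lam mu : Poly 2 →ₗ[ℂ] ℂ) (p : Fin 3 → ℂ) (m : Mon 2 3)
    (x : Fin 3 × Fin 2) (f : Poly 2) : pointConditions lam mu p (Sum.inr (m, x)) f =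
      eval p (monomial m.1 1 : Poly 2) * cubicConditions lam mu x f := rfl

theorem biHom_lineConditions (x : Fin 3 × Fin 2) {f : Poly 2} (hf : f.IsHomogeneous 2) :
    BiHom 1 fun (a : Fin 2 × Mon 2 4 → ℂ) (y : Fin 3 → ℂ) =>
      lineConditions (pencilFunctional a 0) (pencilFunctional a 1) y x f := by
  simp only [lineConditions_apply]
  have h1 : ∀ i : Fin 3, BiForm 1 fun (_ : Fin 2 × Mon 2 4 → ℂ) (y : Fin 3 → ℂ) =>
      C (y i) * X i := fun i => BiForm.C_mul (biHom_coord i) (BiForm.const (X i))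
  exact biHom_cubicConditions x
    ((BiForm.mul (((h1 0).add (h1 1)).add (h1 2)) (BiForm.const f)).cast (add_zero _))
    fun _ y => (linForm_hom y).mul hf

theorem biForm_formEquiv_symm {κ : Type*} : BiForm 1 fun (_ : κ → ℂ) (y : Mon 2 2 → ℂ) =>
    ((formEquiv 2 2).symm y : Poly 2) := by
  intro m
  by_cases hm : m.degree = 2
  · have e : (fun (_ : κ → ℂ) (y : Mon 2 2 → ℂ) =>
        coeff m ((formEquiv 2 2).symm y : Poly 2)) = fun _ y => y ⟨m, mem_mon hm⟩ := by
      ext a y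
      exact congrFun ((formEquiv 2 2).apply_symm_apply y) ⟨m, mem_mon hm⟩
    rw [e]
    exact biHom_coord _
  · have e : (fun (_ : κ → ℂ) (y : Mon 2 2 → ℂ) =>
        coeff m ((formEquiv 2 2).symm y : Poly 2)) = fun _ y => 0 := by
      ext a y
      exact ((formEquiv 2 2).symm y).2.coeff_eq_zero hm
    rw [e]
    exact biHom_zero 1

theorem biHom_conicConditions (x : Fin 3 × Fin 2) {f : Poly 2} (hf : f.IsHomogeneous 1) :
    BiHom 1 fun (a : Fin 2 × Mon 2 4 → ℂ) (y : Mon 2 2 → ℂ) =>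
      conicConditions (pencilFunctional a 0) (pencilFunctional a 1) y x f := by
  simp only [conicConditions_apply]
  exact biHom_cubicConditions x
    ((BiForm.mul biForm_formEquiv_symm (BiForm.const f)).cast (add_zero _))
    fun _ y => ((formEquiv 2 2).symm y).2.mul hf

theorem biHom_pointConditions (i : Unit ⊕ (Mon 2 3 × Fin 3 × Fin 2)) {f : Poly 2}
    (hf : f.IsHomogeneous 3) : BiHom 3 fun (a : Fin 2 × Mon 2 4 → ℂ) (p : Fin 3 → ℂ) =>
      pointConditions (pencilFunctional a 0) (pencilFunctional a 1) p i f := by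
  rcases i with - | ⟨m, x⟩
  · have h1 : HomFun 3 fun p : Fin 3 → ℂ => aeval p f :=
      ⟨f, hf, fun p => congrArg (· f) (aeval_eq_eval p)⟩
    exact h1.biHom
  · have h1 : HomFun 3 fun p : Fin 3 → ℂ => eval p (monomial m.1 1 : Poly 2) :=
      ⟨_, isHomogeneous_mon m 1, fun _ => rfl⟩
    simp only [pointConditions_inr]
    exact (h1.biHom.mul (biHom_cubicConditions x (BiForm.const f) fun _ _ => hf)).cast (add_zero _)

theorem mem_kernelForms_lineConditions {lam mu : Poly 2 →ₗ[ℂ] ℂ} {y : Fin 3 → ℂ} {q : Poly 2} :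
    q ∈ kernelForms (lineConditions lam mu y) 2 ↔ q.IsHomogeneous 2 ∧
      linForm y * q ∈ apolarCubics lam mu := by
  rw [mem_kernelForms]
  refine and_congr_right fun hq => ⟨fun h => ⟨(linForm_hom y).mul hq, fun i =>
    ⟨h (i, 0), h (i, 1)⟩⟩, fun h => ?_⟩
  rintro ⟨i, j⟩
  rcases Fin.exists_fin_two.1 ⟨j, rfl⟩ with rfl | rfl
  · exact (h.2 i).1
  · exact (h.2 i).2

theorem mem_kernelForms_conicConditions {lam mu : Poly 2 →ₗ[ℂ] ℂ} {y : Mon 2 2 → ℂ} {l : Poly 2} :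
    l ∈ kernelForms (conicConditions lam mu y) 1 ↔ l.IsHomogeneous 1 ∧
      ((formEquiv 2 2).symm y : Poly 2) * l ∈ apolarCubics lam mu := by
  rw [mem_kernelForms]
  refine and_congr_right fun hl => ⟨fun h => ⟨((formEquiv 2 2).symm y).2.mul hl, fun i =>
    ⟨h (i, 0), h (i, 1)⟩⟩, fun h => ?_⟩
  rintro ⟨i, j⟩
  rcases Fin.exists_fin_two.1 ⟨j, rfl⟩ with rfl | rfl
  · exact (h.2 i).1
  · exact (h.2 i).2

/-- The conditions on a pencil that define an open set, except for the one on linear forms. -/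
structure IsGeneralExample (lam mu : Poly 2 →ₗ[ℂ] ℂ) : Prop where
  det_lam : (quadMatrix lam).det ≠ 0
  det_mu : (quadMatrix mu).det ≠ 0
  finrank_point : ∀ p : Fin 3 → ℂ, p ≠ 0 → Module.finrank ℂ (apolarCubicsAt lam mu p) ≤ 3
  finrank_conic : ∀ y : Mon 2 2 → ℂ, y ≠ 0 →
    Module.finrank ℂ (kernelForms (conicConditions lam mu y) 1) ≤ 1
  radical_lam : ∀ p : Fin 3 → ℂ, p ≠ 0 → radicalOf lam (transferMap lam mu) p ≠ 0
  radical_mu : ∀ p : Fin 3 → ℂ, p ≠ 0 → radicalOf mu (transferMap mu lam) p ≠ 0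
  line : ∀ p : Fin 3 → ℂ, p ≠ 0 → p 0 + p 1 + p 2 = 0 →
    LinearIndependent ℂ ![cubicAt lam (transferMap lam mu) p, cubicAt mu (transferMap mu lam) p]

theorem isHomogeneous_cubicAt {lam mu : Poly 2 →ₗ[ℂ] ℂ} (h : (quadMatrix lam).det ≠ 0)
    (p : Fin 3 → ℂ) : (cubicAt lam (transferMap lam mu) p).IsHomogeneous 3 := by
  have h1 := (mem_apolarCubicsAt.1 ((transferOfDet mu h).cubic_mem p)).1.1
  rwa [Transfer.cubic_eq] at h1

/-- A general pencil, from the open conditions. -/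
def IsGeneralExample.generalPencil {lam mu : Poly 2 →ₗ[ℂ] ℂ} (h : IsGeneralExample lam mu)
    (hl : ∀ y : Fin 3 → ℂ, y ≠ 0 → Module.finrank ℂ (kernelForms (lineConditions lam mu y) 2) ≤ 1) :
    GeneralPencil lam mu where
  s := transferOfDet mu h.det_lam
  t := transferOfDet lam h.det_mu
  finrank_le := h.finrank_point
  unrelated p hp := isUnrelatedAt_of_finrank_le (h.finrank_point p hp)
  radical_s := h.radical_lam
  radical_t := h.radical_mu
  line_mul l q q' hlin hq hq' hl0 h1 h2 := by
    obtain ⟨y, rfl⟩ := exists_linForm hlin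
    refine not_linearIndependent_of_finrank_le_one inf_le_left (hl y fun hy => hl0 ?_)
      (mem_kernelForms_lineConditions.2 ⟨hq, h1⟩) (mem_kernelForms_lineConditions.2 ⟨hq', h2⟩)
    exact linForm_eq_zero_iff.2 hy
  conic_mul q l l' hq hlin hlin' hq0 h1 h2 := by
    have e : ((formEquiv 2 2).symm (formEquiv 2 2 ⟨q, hq⟩) : Poly 2) = q := by simp
    refine not_linearIndependent_of_finrank_le_one inf_le_left
      (h.finrank_conic (formEquiv 2 2 ⟨q, hq⟩) fun hy => hq0 ?_)
      (mem_kernelForms_conicConditions.2 ⟨hlin, by rwa [e]⟩)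
      (mem_kernelForms_conicConditions.2 ⟨hlin', by rwa [e]⟩)
    rw [← e, hy]
    simp
  line p hp h0 := by
    rw [Transfer.cubic_eq, Transfer.cubic_eq]
    exact h.line p hp h0

/-- Each condition is either the nonvanishing of a determinant or the absence of nonzero solutions
of homogeneous equations, so `elimination` spreads it from the example to an open set. -/
theorem exists_generic_example {a₀ : Fin 2 × Mon 2 4 → ℂ}
    (h : IsGeneralExample (pencilFunctional a₀ 0) (pencilFunctional a₀ 1)) :
    ∃ G : MvPolynomial (Fin 2 × Mon 2 4) ℂ, G ≠ 0 ∧ ∀ a, eval a G ≠ 0 →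
      IsGeneralExample (pencilFunctional a 0) (pencilFunctional a 1) := by
  have hL : ∀ {σ : Type} (e : Fin 2) (m : Fin 3 →₀ ℕ), BiHom 0
      fun (a : Fin 2 × Mon 2 4 → ℂ) (_ : σ → ℂ) => pencilFunctional a e (monomial m 1) :=
    biHom_pencilFunctional
  obtain ⟨G₀, hG₀⟩ := (biHom_det_quadMatrix (σ := Empty) (hL 0)).exists_param Empty.elim
  obtain ⟨G₁, hG₁⟩ := (biHom_det_quadMatrix (σ := Empty) (hL 1)).exists_param Empty.elim
  obtain ⟨G₂, h₂, hG₂⟩ := exists_generic_finrank_le (n := 2) (t := 3) (d := 3) (s := 3)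
    (φ := fun i a p => pointConditions (pencilFunctional a 0) (pencilFunctional a 1) p i)
    (fun i m => biHom_pointConditions i (isHomogeneous_mon m 1)) a₀
    (fun p hp => by
      rw [kernelForms_pointConditions hp]
      exact h.finrank_point p hp)
  obtain ⟨G₃, h₃, hG₃⟩ := exists_generic_finrank_le (n := 2) (t := 1) (d := 1) (s := 1)
    (φ := fun i a y => conicConditions (pencilFunctional a 0) (pencilFunctional a 1) y i)
    (fun x m => biHom_conicConditions x (isHomogeneous_mon m 1)) a₀ h.finrank_conic
  have hT : ∀ {σ : Type} (e e' : Fin 2) (f : Poly 2), BiForm 0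
      fun (a : Fin 2 × Mon 2 4 → ℂ) (_ : σ → ℂ) =>
        transferMap (pencilFunctional a e) (pencilFunctional a e') f := fun e e' f =>
    biForm_transferMap (hL e) (hL e') f
  have hTT : ∀ {σ : Type} (e e' : Fin 2) (i j i' j' : Fin 3), BiHom 0
      fun (a : Fin 2 × Mon 2 4 → ℂ) (_ : σ → ℂ) => pencilFunctional a e
        (transferMap (pencilFunctional a e) (pencilFunctional a e') (X i * X j) *
          transferMap (pencilFunctional a e) (pencilFunctional a e') (X i' * X j')) :=
    fun e e' i j i' j' => biHom_map (t := 2 + 2) (hL e) ((hT e e' _).mul (hT e e' _))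
      fun _ _ => (isHomogeneous_transferMap _ _ _).mul (isHomogeneous_transferMap _ _ _)
  have hrad : ∀ e e' : Fin 2, (∀ p : Fin 3 → ℂ, p ≠ 0 → radicalOf (pencilFunctional a₀ e)
      (transferMap (pencilFunctional a₀ e) (pencilFunctional a₀ e')) p ≠ 0) →
      ∃ G : MvPolynomial (Fin 2 × Mon 2 4) ℂ, eval a₀ G ≠ 0 ∧ ∀ a, eval a G ≠ 0 →
        ∀ p : Fin 3 → ℂ, p ≠ 0 → radicalOf (pencilFunctional a e)
          (transferMap (pencilFunctional a e) (pencilFunctional a e')) p ≠ 0 := by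
    intro e e' h0
    simp only [Function.ne_iff, Pi.zero_apply] at h0
    obtain ⟨G, hG, hGa⟩ := elimination (fun i => biHom_radicalOf (hTT e e') i) a₀
      (fun p hp => h0 p (Function.ne_iff.1 hp))
    exact ⟨G, hG, fun a ha p hp => Function.ne_iff.2 (hGa a ha p hp)⟩
  obtain ⟨G₄, h₄, hG₄⟩ := hrad 0 1 h.radical_lam
  obtain ⟨G₅, h₅, hG₅⟩ := hrad 1 0 h.radical_mu
  have hc : ∀ e e' : Fin 2, BiForm 2 fun (a : Fin 2 × Mon 2 4 → ℂ) p =>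
      cubicAt (pencilFunctional a e)
        (transferMap (pencilFunctional a e) (pencilFunctional a e')) p := fun e e' =>
    biForm_cubicAt (hTT e e') fun i j => hT e e' _
  -- The equation of the auxiliary line joins the minors of the two cubics, so a common zero would
  -- be a bad point on this line.
  obtain ⟨G₆, h₆, hG₆⟩ := elimination (κ := Fin 2 × Mon 2 4) (σ := Fin 3)
    (J := Option (Mon 2 3 × Mon 2 3)) (d := fun j => j.elim 1 fun _ => 2 + 2)
    (f := fun j a p => j.elim (p 0 + p 1 + p 2) fun m =>
      coeff m.1.1 (cubicAt (pencilFunctional a 0)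
        (transferMap (pencilFunctional a 0) (pencilFunctional a 1)) p) *
      coeff m.2.1 (cubicAt (pencilFunctional a 1)
        (transferMap (pencilFunctional a 1) (pencilFunctional a 0)) p) -
      coeff m.2.1 (cubicAt (pencilFunctional a 0)
        (transferMap (pencilFunctional a 0) (pencilFunctional a 1)) p) *
      coeff m.1.1 (cubicAt (pencilFunctional a 1)
        (transferMap (pencilFunctional a 1) (pencilFunctional a 0)) p))
    (by
      rintro (- | m)
      · exact ((biHom_coord 0).add (biHom_coord 1)).add (biHom_coord 2)
      · exact ((hc 0 1 m.1.1).mul (hc 1 0 m.2.1)).sub ((hc 0 1 m.2.1).mul (hc 1 0 m.1.1))) a₀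
    (fun p hp => by
      by_cases h0 : p 0 + p 1 + p 2 = 0
      · obtain ⟨m, m', hm⟩ := exists_nondegenerate_minor (isHomogeneous_cubicAt h.det_lam p)
          (isHomogeneous_cubicAt h.det_mu p) (h.line p hp h0)
        exact ⟨some (m, m'), hm⟩
      · exact ⟨none, h0⟩)
  have hne : ∀ G : MvPolynomial (Fin 2 × Mon 2 4) ℂ, eval a₀ G ≠ 0 → G ≠ 0 := by
    rintro _ h0 rfl
    exact h0 (map_zero _)
  refine ⟨G₀ * G₁ * G₂ * G₃ * G₄ * G₅ * G₆, ?_, fun a ha => ?_⟩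
  · simp only [mul_ne_zero_iff]
    exact ⟨⟨⟨⟨⟨⟨hne _ (hG₀ a₀ ▸ h.det_lam), hne _ (hG₁ a₀ ▸ h.det_mu)⟩, hne _ h₂⟩, hne _ h₃⟩,
      hne _ h₄⟩, hne _ h₅⟩, hne _ h₆⟩
  · simp only [map_mul, mul_ne_zero_iff] at ha
    obtain ⟨⟨⟨⟨⟨⟨a0, a1⟩, a2⟩, a3⟩, a4⟩, a5⟩, a6⟩ := ha
    refine ⟨hG₀ a ▸ a0, hG₁ a ▸ a1, fun p hp => ?_, hG₃ a a3, hG₄ a a4, hG₅ a a5,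
      fun p hp h0 => ?_⟩
    · rw [← kernelForms_pointConditions hp]
      exact hG₂ a a2 p hp
    · obtain ⟨- | m, hm⟩ := hG₆ a a6 p hp
      · exact absurd h0 hm
      · exact linearIndependent_of_minor hm

theorem exists_generic_line {a₁ : Fin 2 × Mon 2 4 → ℂ}
    (h : ∀ y : Fin 3 → ℂ, y ≠ 0 → Module.finrank ℂ (kernelForms
      (lineConditions (pencilFunctional a₁ 0) (pencilFunctional a₁ 1) y) 2) ≤ 1) :
    ∃ G : MvPolynomial (Fin 2 × Mon 2 4) ℂ, G ≠ 0 ∧ ∀ a, eval a G ≠ 0 →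
      ∀ y : Fin 3 → ℂ, y ≠ 0 → Module.finrank ℂ (kernelForms
        (lineConditions (pencilFunctional a 0) (pencilFunctional a 1) y) 2) ≤ 1 := by
  obtain ⟨G, hG, hGa⟩ := exists_generic_finrank_le (n := 2) (t := 2) (d := 1) (s := 1)
    (φ := fun i a y => lineConditions (pencilFunctional a 0) (pencilFunctional a 1) y i)
    (fun x m => biHom_lineConditions x (isHomogeneous_mon m 1)) a₁ h
  refine ⟨G, ?_, hGa⟩
  rintro rfl
  exact hG (map_zero _)

end GenericPencil

/-! ### Functionals on quartic forms with given weights -/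

section Weights

open MvPolynomial

/-- The quadratic form with given coefficients. -/
def quadForm (c : Fin 6 → ℂ) : Poly 2 :=
  C (c 0) * X 0 ^ 2 + C (c 1) * X 1 ^ 2 + C (c 2) * X 2 ^ 2 + C (c 3) * (X 0 * X 1) +
    C (c 4) * (X 0 * X 2) + C (c 5) * (X 1 * X 2)

/-- The cubic form with given coefficients. -/
def cubicForm (c : Fin 10 → ℂ) : Poly 2 :=
  C (c 0) * X 0 ^ 3 + C (c 1) * X 1 ^ 3 + C (c 2) * X 2 ^ 3 + C (c 3) * (X 0 ^ 2 * X 1) +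
    C (c 4) * (X 0 ^ 2 * X 2) + C (c 5) * (X 0 * X 1 ^ 2) + C (c 6) * (X 1 ^ 2 * X 2) +
    C (c 7) * (X 0 * X 2 ^ 2) + C (c 8) * (X 1 * X 2 ^ 2) + C (c 9) * (X 0 * X 1 * X 2)

theorem isHomogeneous_quadForm (c : Fin 6 → ℂ) : (quadForm c).IsHomogeneous 2 := by
  have h1 : ∀ (a : ℂ) (i : Fin 3), (C a * X i ^ 2 : Poly 2).IsHomogeneous 2 := fun a i =>
    (isHomogeneous_X_pow i 2).C_mul a
  have h2 : ∀ (a : ℂ) (i j : Fin 3), (C a * (X i * X j) : Poly 2).IsHomogeneous 2 := fun a i j =>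
    ((isHomogeneous_X ℂ i).mul (isHomogeneous_X ℂ j)).C_mul a
  exact (((((h1 _ _).add (h1 _ _)).add (h1 _ _)).add (h2 _ _ _)).add (h2 _ _ _)).add (h2 _ _ _)

theorem exists_eq_sum_X_mul {d : ℕ} {f : Poly 2} (hf : f.IsHomogeneous (d + 1)) :
    ∃ g : Fin 3 → Poly 2, (∀ i, (g i).IsHomogeneous d) ∧
      f = X 0 * g 0 + X 1 * g 1 + X 2 * g 2 := by
  suffices h : Form 2 (d + 1) ≤ ⨆ i : Fin 3, (Form 2 d).map (LinearMap.mulLeft ℂ (X i)) by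
    obtain ⟨g, hg, hs⟩ := (Submodule.mem_iSup_iff_exists_finsupp _ _).1 (h hf)
    choose k hk hkg using hg
    refine ⟨k, hk, ?_⟩
    rw [← hs, Finsupp.sum_fintype _ _ fun _ => rfl, Fin.sum_univ_three, ← hkg, ← hkg, ← hkg]
    rfl
  intro f hf
  rw [form_eq_sum hf]
  refine Submodule.sum_mem _ fun m _ => ?_
  obtain ⟨i, hi⟩ : ∃ i, m.1 i ≠ 0 := by
    by_contra! h0
    have h1 := mon_degree m
    rw [show m.1 = 0 from Finsupp.ext h0, map_zero] at h1
    omega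
  refine Submodule.mem_iSup_of_mem i ⟨monomial (m.1 - Finsupp.single i 1) (coeff m.1 f), ?_, ?_⟩
  · refine isHomogeneous_monomial _ ?_
    have h1 := mon_degree m
    rw [← tsub_add_cancel_of_le (Finsupp.single_le_iff.2 (Nat.one_le_iff_ne_zero.2 hi)),
      map_add, Finsupp.degree_single] at h1
    omega
  · rw [LinearMap.mulLeft_apply, X, monomial_mul, one_mul, add_tsub_cancel_of_le
      (Finsupp.single_le_iff.2 (Nat.one_le_iff_ne_zero.2 hi))]

theorem exists_quadForm {q : Poly 2} (hq : q.IsHomogeneous 2) : ∃ c, q = quadForm c := by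
  obtain ⟨g, hg, rfl⟩ := exists_eq_sum_X_mul hq
  choose a ha using fun i => exists_linForm (hg i)
  refine ⟨![a 0 0, a 1 1, a 2 2, a 0 1 + a 1 0, a 0 2 + a 2 0, a 1 2 + a 2 1], ?_⟩
  simp only [ha, linForm, quadForm, Matrix.cons_val, map_add]
  ring

theorem exists_cubicForm {f : Poly 2} (hf : f.IsHomogeneous 3) : ∃ c, f = cubicForm c := by
  obtain ⟨g, hg, rfl⟩ := exists_eq_sum_X_mul hf
  choose a ha using fun i => exists_quadForm (hg i)
  refine ⟨![a 0 0, a 1 1, a 2 2, a 0 3 + a 1 0, a 0 4 + a 2 0, a 0 1 + a 1 3, a 1 5 + a 2 1,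
    a 0 2 + a 2 4, a 1 2 + a 2 5, a 0 5 + a 1 4 + a 2 3], ?_⟩
  simp only [ha, quadForm, cubicForm, Matrix.cons_val, map_add]
  ring

/-- The functional takes given values on the monomials of degree four. -/
def HasWeights (L : Poly 2 →ₗ[ℂ] ℂ) (w : ℕ → ℕ → ℕ → ℂ) : Prop :=
  ∀ i j k, i + j + k = 4 → L (X 0 ^ i * X 1 ^ j * X 2 ^ k) = w i j k

theorem exists_hasWeights (w : Fin 2 → ℕ → ℕ → ℕ → ℂ) :
    ∃ a : Fin 2 × Mon 2 4 → ℂ, ∀ e, HasWeights (pencilFunctional a e) (w e) := by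
  -- `formFunctional` weights coefficients by products of factorials; dividing by them makes the
  -- values on monomials equal to the prescribed weights.
  refine ⟨fun x => w x.1 (x.2.1 0) (x.2.1 1) (x.2.1 2) / expFactorial x.2.1, fun e i j k h => ?_⟩
  have h1 : (X 0 ^ i * X 1 ^ j * X 2 ^ k : Poly 2) = monomial
      (Finsupp.single 0 i + Finsupp.single 1 j + Finsupp.single 2 k) 1 := by
    simp [X_pow_eq_monomial, monomial_mul]
  set m : Fin 3 →₀ ℕ := Finsupp.single 0 i + Finsupp.single 1 j + Finsupp.single 2 k with hm
  have hm4 : m.degree = 4 := by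
    rw [hm, map_add, map_add, Finsupp.degree_single, Finsupp.degree_single, Finsupp.degree_single, h]
  rw [h1, pencilFunctional, formFunctional_apply,
    Finset.sum_eq_single_of_mem ⟨m, mem_mon hm4⟩ (Finset.mem_univ _)]
  · rw [mul_div_cancel₀ _ (expFactorial_ne_zero _)]
    simp [hm]
  · intro m' _ hne
    rw [coeff_monomial, if_neg fun h => hne (Subtype.ext h.symm), mul_zero]

theorem HasWeights.map_quadForm_mul {L : Poly 2 →ₗ[ℂ] ℂ} {w : ℕ → ℕ → ℕ → ℂ} (h : HasWeights L w)
    (c b : Fin 6 → ℂ) : L (quadForm c * quadForm b) = c 0 * b 0 * w 4 0 0 + c 1 * b 1 * w 0 4 0 +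
      c 2 * b 2 * w 0 0 4 + (c 0 * b 3 + c 3 * b 0) * w 3 1 0 + (c 0 * b 4 + c 4 * b 0) * w 3 0 1 +
      (c 1 * b 3 + c 3 * b 1) * w 1 3 0 + (c 1 * b 5 + c 5 * b 1) * w 0 3 1 +
      (c 2 * b 4 + c 4 * b 2) * w 1 0 3 + (c 2 * b 5 + c 5 * b 2) * w 0 1 3 +
      (c 0 * b 1 + c 1 * b 0 + c 3 * b 3) * w 2 2 0 +
      (c 0 * b 2 + c 2 * b 0 + c 4 * b 4) * w 2 0 2 +
      (c 1 * b 2 + c 2 * b 1 + c 5 * b 5) * w 0 2 2 +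
      (c 0 * b 5 + c 5 * b 0 + c 3 * b 4 + c 4 * b 3) * w 2 1 1 +
      (c 1 * b 4 + c 4 * b 1 + c 3 * b 5 + c 5 * b 3) * w 1 2 1 +
      (c 2 * b 3 + c 3 * b 2 + c 4 * b 5 + c 5 * b 4) * w 1 1 2 := by
  have e : quadForm c * quadForm b = C (c 0 * b 0) * (X 0 ^ 4 * X 1 ^ 0 * X 2 ^ 0) +
      C (c 1 * b 1) * (X 0 ^ 0 * X 1 ^ 4 * X 2 ^ 0) +
      C (c 2 * b 2) * (X 0 ^ 0 * X 1 ^ 0 * X 2 ^ 4) +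
      C (c 0 * b 3 + c 3 * b 0) * (X 0 ^ 3 * X 1 ^ 1 * X 2 ^ 0) +
      C (c 0 * b 4 + c 4 * b 0) * (X 0 ^ 3 * X 1 ^ 0 * X 2 ^ 1) +
      C (c 1 * b 3 + c 3 * b 1) * (X 0 ^ 1 * X 1 ^ 3 * X 2 ^ 0) +
      C (c 1 * b 5 + c 5 * b 1) * (X 0 ^ 0 * X 1 ^ 3 * X 2 ^ 1) +
      C (c 2 * b 4 + c 4 * b 2) * (X 0 ^ 1 * X 1 ^ 0 * X 2 ^ 3) +
      C (c 2 * b 5 + c 5 * b 2) * (X 0 ^ 0 * X 1 ^ 1 * X 2 ^ 3) +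
      C (c 0 * b 1 + c 1 * b 0 + c 3 * b 3) * (X 0 ^ 2 * X 1 ^ 2 * X 2 ^ 0) +
      C (c 0 * b 2 + c 2 * b 0 + c 4 * b 4) * (X 0 ^ 2 * X 1 ^ 0 * X 2 ^ 2) +
      C (c 1 * b 2 + c 2 * b 1 + c 5 * b 5) * (X 0 ^ 0 * X 1 ^ 2 * X 2 ^ 2) +
      C (c 0 * b 5 + c 5 * b 0 + c 3 * b 4 + c 4 * b 3) * (X 0 ^ 2 * X 1 ^ 1 * X 2 ^ 1) +
      C (c 1 * b 4 + c 4 * b 1 + c 3 * b 5 + c 5 * b 3) * (X 0 ^ 1 * X 1 ^ 2 * X 2 ^ 1) +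
      C (c 2 * b 3 + c 3 * b 2 + c 4 * b 5 + c 5 * b 4) * (X 0 ^ 1 * X 1 ^ 1 * X 2 ^ 2) := by
    simp only [quadForm, map_add, map_mul]
    ring
  simp only [e, map_add L, map_C_mul, smul_eq_mul]
  rw [h 4 0 0 rfl, h 0 4 0 rfl, h 0 0 4 rfl, h 3 1 0 rfl, h 3 0 1 rfl, h 1 3 0 rfl, h 0 3 1 rfl,
    h 1 0 3 rfl, h 0 1 3 rfl, h 2 2 0 rfl, h 2 0 2 rfl, h 0 2 2 rfl, h 2 1 1 rfl, h 1 2 1 rfl,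
    h 1 1 2 rfl]

theorem X_mul_linForm_zero (y : Fin 3 → ℂ) :
    X 0 * linForm y = quadForm ![y 0, 0, 0, y 1, y 2, 0] := by
  simp [linForm, quadForm]
  ring

theorem X_mul_linForm_one (y : Fin 3 → ℂ) :
    X 1 * linForm y = quadForm ![0, y 1, 0, y 0, 0, y 2] := by
  simp [linForm, quadForm]
  ring

theorem X_mul_linForm_two (y : Fin 3 → ℂ) :
    X 2 * linForm y = quadForm ![0, 0, y 2, 0, y 0, y 1] := by
  simp [linForm, quadForm]
  ring

/-- A space on which some functionals have no common zero. -/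
theorem finrank_le_of_forall_eq_zero {V : Submodule ℂ (Poly 2)} {s : ℕ}
    (φ : Fin s → Poly 2 →ₗ[ℂ] ℂ) (h : ∀ f ∈ V, (∀ i, φ i f = 0) → f = 0) :
    Module.finrank ℂ V ≤ s := by
  have h1 : Function.Injective ((LinearMap.pi φ).comp V.subtype) := by
    refine (injective_iff_map_eq_zero _).2 fun f hf => ?_
    exact Subtype.ext (h f.1 f.2 (congrFun hf))
  simpa using LinearMap.finrank_le_finrank_of_injective h1

theorem det_quadMatrix_ne_zero {L : Poly 2 →ₗ[ℂ] ℂ}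
    (h : ∀ c, (∀ b, L (quadForm c * quadForm b) = 0) → c = 0) : (quadMatrix L).det ≠ 0 := by
  intro hdet
  obtain ⟨v, hv, hMv⟩ := Matrix.exists_mulVec_eq_zero_iff.2 hdet
  have hq := ((formEquiv 2 2).symm v).2
  obtain ⟨c, hc⟩ := exists_quadForm hq
  have e : (fun m : Mon 2 2 => coeff m.1 ((formEquiv 2 2).symm v : Poly 2)) = v :=
    (formEquiv 2 2).apply_symm_apply v
  have h0 := h c fun b => by
    rw [← hc, map_mul_eq_quadMatrix L hq (isHomogeneous_quadForm b), e, hMv, dotProduct_zero]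
  rw [h0] at hc
  refine hv (e ▸ ?_)
  rw [hc]
  ext m
  simp [quadForm]

end Weights

/-! ### A pencil that satisfies the open conditions -/

section GeneralExample

open MvPolynomial

/-- The weights of a combination of products of two squares. -/
def squareWeights (r s t : ℂ) (i j k : ℕ) : ℂ :=
  if (i, j, k) = (2, 2, 0) then r else if (i, j, k) = (2, 0, 2) then s else
    if (i, j, k) = (0, 2, 2) then t else 0

variable {L M : Poly 2 →ₗ[ℂ] ℂ} {r s t r' s' t' : ℂ}

theorem map_quadForm_mul_of_squareWeights (h : HasWeights L (squareWeights r s t))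
    (c b : Fin 6 → ℂ) : L (quadForm c * quadForm b) =
      (c 0 * b 1 + c 1 * b 0 + c 3 * b 3) * r + (c 0 * b 2 + c 2 * b 0 + c 4 * b 4) * s +
        (c 1 * b 2 + c 2 * b 1 + c 5 * b 5) * t := by
  rw [h.map_quadForm_mul]
  simp [squareWeights]

theorem map_X_mul_cubicForm_zero (h : HasWeights L (squareWeights r s t)) (c : Fin 10 → ℂ) :
    L (X 0 * cubicForm c) = c 5 * r + c 7 * s := by
  have e : X 0 * cubicForm c = quadForm ![1, 0, 0, 0, 0, 0] * quadForm ![c 0, c 5, c 7, c 3, c 4, c 9]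
      + quadForm ![0, 0, 0, 1, 0, 0] * quadForm ![0, c 1, c 8, 0, 0, c 6]
      + quadForm ![0, 0, 0, 0, 1, 0] * quadForm ![0, 0, c 2, 0, 0, 0] := by
    simp [cubicForm, quadForm]
    ring
  rw [e, map_add, map_add]
  simp only [map_quadForm_mul_of_squareWeights h, Matrix.cons_val]
  ring

theorem map_X_mul_cubicForm_one (h : HasWeights L (squareWeights r s t)) (c : Fin 10 → ℂ) :
    L (X 1 * cubicForm c) = c 3 * r + c 8 * t := by
  have e : X 1 * cubicForm c = quadForm ![0, 1, 0, 0, 0, 0] * quadForm ![c 3, c 1, c 8, c 5, c 9, c 6]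
      + quadForm ![0, 0, 0, 1, 0, 0] * quadForm ![c 0, 0, c 7, 0, c 4, 0]
      + quadForm ![0, 0, 0, 0, 0, 1] * quadForm ![0, 0, c 2, 0, 0, 0] := by
    simp [cubicForm, quadForm]
    ring
  rw [e, map_add, map_add]
  simp only [map_quadForm_mul_of_squareWeights h, Matrix.cons_val]
  ring

theorem map_X_mul_cubicForm_two (h : HasWeights L (squareWeights r s t)) (c : Fin 10 → ℂ) :
    L (X 2 * cubicForm c) = c 4 * s + c 6 * t := by
  have e : X 2 * cubicForm c = quadForm ![0, 0, 1, 0, 0, 0] * quadForm ![c 4, c 6, c 2, c 9, c 7, c 8]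
      + quadForm ![0, 0, 0, 0, 1, 0] * quadForm ![c 0, c 5, 0, c 3, 0, 0]
      + quadForm ![0, 0, 0, 0, 0, 1] * quadForm ![0, c 1, 0, 0, 0, 0] := by
    simp [cubicForm, quadForm]
    ring
  rw [e, map_add, map_add]
  simp only [map_quadForm_mul_of_squareWeights h, Matrix.cons_val]
  ring

theorem det_ne_zero_of_squareWeights (h : HasWeights L (squareWeights r s t)) (hr : r ≠ 0)
    (hs : s ≠ 0) (ht : t ≠ 0) : (quadMatrix L).det ≠ 0 := by
  refine det_quadMatrix_ne_zero fun c hc => ?_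
  simp only [map_quadForm_mul_of_squareWeights h] at hc
  have h0 := hc ![1, 0, 0, 0, 0, 0]
  have h1 := hc ![0, 1, 0, 0, 0, 0]
  have h2 := hc ![0, 0, 1, 0, 0, 0]
  have h3 := hc ![0, 0, 0, 1, 0, 0]
  have h4 := hc ![0, 0, 0, 0, 1, 0]
  have h5 := hc ![0, 0, 0, 0, 0, 1]
  simp only [Matrix.cons_val, mul_zero, mul_one, add_zero, zero_add, zero_mul] at h0 h1 h2 h3 h4 h5
  have e0 : r * s * c 0 = 0 := by linear_combination (s * h1 + r * h2 - t * h0) / 2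
  have e1 : r * t * c 1 = 0 := by linear_combination (t * h0 + r * h2 - s * h1) / 2
  have e2 : s * t * c 2 = 0 := by linear_combination (t * h0 + s * h1 - r * h2) / 2
  simp only [mul_eq_zero, hr, hs, ht, false_or, or_false] at e0 e1 e2 h3 h4 h5
  ext i
  fin_cases i <;> assumption

/-- Nondegeneracy determines the transfer, so a candidate image found by solving linear equations
only has to be verified, and no adjugate is computed. -/
theorem transferMap_quadForm (hL : (quadMatrix L).det ≠ 0) {c c' : Fin 6 → ℂ}
    (h : ∀ b, L (quadForm c' * quadForm b) = M (quadForm c * quadForm b)) :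
    transferMap L M (quadForm c) = C (quadMatrix L).det * quadForm c' := by
  have h1 := (transferOfDet M hL).nondeg (transferMap L M (quadForm c) -
    C (quadMatrix L).det * quadForm c') (((isHomogeneous_transferMap _ _ _).sub
      ((isHomogeneous_quadForm c').C_mul _))) fun q' hq' => by
    obtain ⟨b, rfl⟩ := exists_quadForm hq'
    have h2 := (transferOfDet M hL).apply _ _ (isHomogeneous_quadForm c) hq'
    change L (transferMap L M _ * _) = (quadMatrix L).det * _ at h2
    rw [sub_mul, map_sub, h2, mul_assoc, map_C_mul, h, smul_eq_mul, sub_self]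
  exact sub_eq_zero.1 h1

/-- The coefficients of the products of two variables under a map that multiplies the mixed
products by scalars. -/
def squareTable (A : Fin 3 → Fin 3 → ℂ) (m : Fin 3 → ℂ) : Fin 3 → Fin 3 → Fin 6 → ℂ :=
  ![![![A 0 0, A 0 1, A 0 2, 0, 0, 0], ![0, 0, 0, m 0, 0, 0], ![0, 0, 0, 0, m 1, 0]],
    ![![0, 0, 0, m 0, 0, 0], ![A 1 0, A 1 1, A 1 2, 0, 0, 0], ![0, 0, 0, 0, 0, m 2]],
    ![![0, 0, 0, 0, m 1, 0], ![0, 0, 0, 0, 0, m 2], ![A 2 0, A 2 1, A 2 2, 0, 0, 0]]]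

theorem X_mul_X_eq_quadForm (i j : Fin 3) :
    (X i * X j : Poly 2) = quadForm (squareTable (fun a b => if a = b then 1 else 0) 1 i j) := by
  fin_cases i <;> fin_cases j <;> simp [quadForm, squareTable] <;> ring

variable {T : Poly 2 →ₗ[ℂ] Poly 2} {A : Fin 3 → Fin 3 → ℂ} {m : Fin 3 → ℂ} {δ : ℂ}

theorem radicalOf_of_squareTable (h : HasWeights L (squareWeights r s t))
    (hT : ∀ i j, T (X i * X j) = C δ * quadForm (squareTable A m i j)) (p : Fin 3 → ℂ) :
    radicalOf L T p = ![
      δ ^ 2 * p 0 * ((A 1 0 * A 2 1 + A 1 1 * A 2 0) * r + (A 1 0 * A 2 2 + A 1 2 * A 2 0) * s +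
        (A 1 1 * A 2 2 + A 1 2 * A 2 1) * t - m 2 ^ 2 * t),
      δ ^ 2 * p 1 * ((A 0 0 * A 2 1 + A 0 1 * A 2 0) * r + (A 0 0 * A 2 2 + A 0 2 * A 2 0) * s +
        (A 0 1 * A 2 2 + A 0 2 * A 2 1) * t - m 1 ^ 2 * s),
      δ ^ 2 * p 2 * ((A 1 0 * A 0 1 + A 1 1 * A 0 0) * r + (A 1 0 * A 0 2 + A 1 2 * A 0 0) * s +
        (A 1 1 * A 0 2 + A 1 2 * A 0 1) * t - m 0 ^ 2 * r)] := by
  have h2 : ∀ i j k l, L (T (X i * X j) * T (X k * X l)) = δ * (δ *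
      L (quadForm (squareTable A m i j) * quadForm (squareTable A m k l))) := fun i j k l => by
    rw [hT, hT, mul_mul_mul_comm, mul_assoc, map_C_mul, map_C_mul, smul_eq_mul, smul_eq_mul]
  simp only [radicalOf, map_triple, h2, map_quadForm_mul_of_squareWeights h]
  ext i
  fin_cases i <;> simp [squareTable] <;> ring

end GeneralExample

/-! ### Verification for the weights (1, 1, 1) and (1, 2, -1) -/

section GeneralExample

open MvPolynomial

variable {L M : Poly 2 →ₗ[ℂ] ℂ} (hL : HasWeights L (squareWeights 1 1 1))
  (hM : HasWeights M (squareWeights 1 2 (-1)))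

include hL hM

/-- The six conditions split into three invertible 2 × 2 systems, one for each variable, and kill
all monomials X_i² X_j with i ≠ j. So the apolar cubics are spanned by the three cubes and X₀X₁X₂.
-/
theorem mixed_eq_zero {c : Fin 10 → ℂ} (hf : cubicForm c ∈ apolarCubics L M) :
    c 3 = 0 ∧ c 4 = 0 ∧ c 5 = 0 ∧ c 6 = 0 ∧ c 7 = 0 ∧ c 8 = 0 := by
  obtain ⟨a0, b0⟩ := hf.2 0
  obtain ⟨a1, b1⟩ := hf.2 1
  obtain ⟨a2, b2⟩ := hf.2 2
  rw [map_X_mul_cubicForm_zero hL] at a0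
  rw [map_X_mul_cubicForm_zero hM] at b0
  rw [map_X_mul_cubicForm_one hL] at a1
  rw [map_X_mul_cubicForm_one hM] at b1
  rw [map_X_mul_cubicForm_two hL] at a2
  rw [map_X_mul_cubicForm_two hM] at b2
  refine ⟨?_, ?_, ?_, ?_, ?_, ?_⟩
  · linear_combination (a1 + b1) / 2
  · linear_combination (a2 + b2) / 3
  · linear_combination 2 * a0 - b0
  · linear_combination (2 * a2 - b2) / 3
  · linear_combination b0 - a0
  · linear_combination (a1 - b1) / 2

theorem finrank_apolarCubicsAt_le {p : Fin 3 → ℂ} (hp : p ≠ 0) :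
    Module.finrank ℂ (apolarCubicsAt L M p) ≤ 3 := by
  have ev : ∀ (x : Fin 3 → ℂ) (f : Poly 2),
      (aeval x : Poly 2 →ₐ[ℂ] ℂ).toLinearMap f = eval x f := fun x f => by
    rw [AlgHom.toLinearMap_apply, aeval_eq_eval]
  have key : ∀ f ∈ apolarCubicsAt L M p, ∃ c : Fin 4 → ℂ,
      f = C (c 0) * X 0 ^ 3 + C (c 1) * X 1 ^ 3 + C (c 2) * X 2 ^ 3 + C (c 3) * (X 0 * X 1 * X 2) ∧
      c 0 * p 0 ^ 3 + c 1 * p 1 ^ 3 + c 2 * p 2 ^ 3 + c 3 * (p 0 * p 1 * p 2) = 0 := by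
    intro f hf
    obtain ⟨hf, hfp⟩ := mem_apolarCubicsAt.1 hf
    obtain ⟨c, rfl⟩ := exists_cubicForm hf.1
    obtain ⟨h3, h4, h5, h6, h7, h8⟩ := mixed_eq_zero hL hM hf
    simp only [cubicForm, h3, h4, h5, h6, h7, h8, C_0, zero_mul, add_zero] at hfp ⊢
    refine ⟨![c 0, c 1, c 2, c 9], rfl, ?_⟩
    simpa using hfp
  obtain ⟨k, hk⟩ := Function.ne_iff.1 hp
  rw [Pi.zero_apply] at hk
  have hd : ∀ c : Fin 4 → ℂ, eval ![1, 1, 1] (C (c 0) * X 0 ^ 3 + C (c 1) * X 1 ^ 3 +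
      C (c 2) * X 2 ^ 3 + C (c 3) * (X 0 * X 1 * X 2) : Poly 2) = c 0 + c 1 + c 2 + c 3 := by
    intro c
    simp
  have hi : ∀ (c : Fin 4 → ℂ) (i : Fin 3), eval (Pi.single i 1) (C (c 0) * X 0 ^ 3 +
      C (c 1) * X 1 ^ 3 + C (c 2) * X 2 ^ 3 + C (c 3) * (X 0 * X 1 * X 2) : Poly 2) =
        c i.castSucc := by
    intro c i
    fin_cases i <;> simp
  -- With p_k ≠ 0, these functionals read off the coefficients of the other two cubes and the sum of
  -- all coefficients except that of X_k³. If they vanish, only X_k³ is left, and vanishing at p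
  -- excludes it.
  refine finrank_le_of_forall_eq_zero (fun i : Fin 3 => if i = k then
    (aeval (![1, 1, 1] : Fin 3 → ℂ) : Poly 2 →ₐ[ℂ] ℂ).toLinearMap -
      (aeval (Pi.single k 1 : Fin 3 → ℂ) : Poly 2 →ₐ[ℂ] ℂ).toLinearMap else
    (aeval (Pi.single i 1 : Fin 3 → ℂ) : Poly 2 →ₐ[ℂ] ℂ).toLinearMap) fun f hf h => ?_
  obtain ⟨c, rfl, hc⟩ := key f hf
  have hne : ∀ i, i ≠ k → c i.castSucc = 0 := fun i hik => by
    have h1 := h i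
    rwa [if_neg hik, ev, hi] at h1
  have h1 := h k
  rw [if_pos rfl, LinearMap.sub_apply, ev, ev, hi, hd] at h1
  have hall : c 0 = 0 ∧ c 1 = 0 ∧ c 2 = 0 ∧ c 3 = 0 := by
    fin_cases k
    · have c1 : c 1 = 0 := hne 1 (by decide)
      have c2 : c 2 = 0 := hne 2 (by decide)
      have c3 : c 3 = 0 := by simpa [c1, c2] using h1
      simp only [c1, c2, c3, zero_mul, add_zero] at hc
      exact ⟨(mul_eq_zero.1 hc).resolve_right (pow_ne_zero _ hk), c1, c2, c3⟩
    · have c0 : c 0 = 0 := hne 0 (by decide)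
      have c2 : c 2 = 0 := hne 2 (by decide)
      have c3 : c 3 = 0 := by simpa [c0, c2] using h1
      simp only [c0, c2, c3, zero_mul, add_zero, zero_add] at hc
      exact ⟨c0, (mul_eq_zero.1 hc).resolve_right (pow_ne_zero _ hk), c2, c3⟩
    · have c0 : c 0 = 0 := hne 0 (by decide)
      have c1 : c 1 = 0 := hne 1 (by decide)
      have c3 : c 3 = 0 := by simpa [c0, c1] using h1
      simp only [c0, c1, c3, zero_mul, add_zero, zero_add] at hc
      exact ⟨c0, c1, (mul_eq_zero.1 hc).resolve_right (pow_ne_zero _ hk), c3⟩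
  simp [hall]

theorem finrank_conicConditions_le {y : Mon 2 2 → ℂ} (hy : y ≠ 0) :
    Module.finrank ℂ (kernelForms (conicConditions L M y) 1) ≤ 1 := by
  obtain ⟨c, hc⟩ := exists_quadForm ((formEquiv 2 2).symm y).2
  have hc0 : c ≠ 0 := by
    rintro rfl
    refine hy ((formEquiv 2 2).symm.injective (Subtype.ext ?_))
    rw [hc]
    simp [quadForm]
  have key : ∀ l ∈ kernelForms (conicConditions L M y) 1, ∃ x, l = linForm x ∧
      c 0 * x 1 + c 3 * x 0 = 0 ∧ c 0 * x 2 + c 4 * x 0 = 0 ∧ c 1 * x 0 + c 3 * x 1 = 0 ∧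
      c 1 * x 2 + c 5 * x 1 = 0 ∧ c 2 * x 0 + c 4 * x 2 = 0 ∧ c 2 * x 1 + c 5 * x 2 = 0 := by
    intro l hl
    obtain ⟨hl1, hl2⟩ := mem_kernelForms_conicConditions.1 hl
    obtain ⟨x, rfl⟩ := exists_linForm hl1
    have e : quadForm c * linForm x = cubicForm ![c 0 * x 0, c 1 * x 1, c 2 * x 2,
        c 0 * x 1 + c 3 * x 0, c 0 * x 2 + c 4 * x 0, c 1 * x 0 + c 3 * x 1, c 1 * x 2 + c 5 * x 1,
        c 2 * x 0 + c 4 * x 2, c 2 * x 1 + c 5 * x 2, c 3 * x 2 + c 4 * x 1 + c 5 * x 0] := by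
      simp only [quadForm, linForm, cubicForm, Matrix.cons_val, map_add, map_mul]
      ring
    rw [hc, e] at hl2
    exact ⟨x, rfl, mixed_eq_zero hL hM hl2⟩
  have ev : ∀ x i, (aeval (Pi.single i 1 : Fin 3 → ℂ) : Poly 2 →ₐ[ℂ] ℂ).toLinearMap (linForm x) =
      x i := by
    intro x i
    rw [AlgHom.toLinearMap_apply, aeval_eq_eval, eval_linForm]
    fin_cases i <;> simp
  have main : ∀ i : Fin 3, (∀ x : Fin 3 → ℂ, x i = 0 → c 0 * x 1 + c 3 * x 0 = 0 →
      c 0 * x 2 + c 4 * x 0 = 0 → c 1 * x 0 + c 3 * x 1 = 0 → c 1 * x 2 + c 5 * x 1 = 0 →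
      c 2 * x 0 + c 4 * x 2 = 0 → c 2 * x 1 + c 5 * x 2 = 0 → x 0 = 0 ∧ x 1 = 0 ∧ x 2 = 0) →
      Module.finrank ℂ (kernelForms (conicConditions L M y) 1) ≤ 1 := by
    intro i h
    refine finrank_le_of_forall_eq_zero (fun _ : Fin 1 =>
      (aeval (Pi.single i 1 : Fin 3 → ℂ) : Poly 2 →ₐ[ℂ] ℂ).toLinearMap) fun l hl h0 => ?_
    obtain ⟨x, rfl, e1, e2, e3, e4, e5, e6⟩ := key l hl
    obtain ⟨x0, x1, x2⟩ := h x (ev x i ▸ h0 0) e1 e2 e3 e4 e5 e6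
    simp [linForm, x0, x1, x2]
  -- If the conic has a nonzero X_i² coefficient, the linear form is determined by its i-th
  -- coefficient. If all squares are absent, a nonzero mixed coefficient plays this role for the
  -- variable it omits.
  by_cases c0 : c 0 = 0
  · by_cases c1 : c 1 = 0
    · by_cases c2 : c 2 = 0
      · simp only [c0, c1, c2, zero_mul, zero_add, mul_eq_zero] at main
        by_cases c3 : c 3 = 0
        · by_cases c4 : c 4 = 0
          · have c5 : c 5 ≠ 0 := fun c5 => hc0 (by ext i; fin_cases i <;> assumption)
            exact main 0 fun x h _ _ _ e4 _ e6 => ⟨h, e4.resolve_left c5, e6.resolve_left c5⟩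
          · exact main 1 fun x h _ e2 _ _ e5 _ => ⟨e2.resolve_left c4, h, e5.resolve_left c4⟩
        · exact main 2 fun x h e1 _ e3 _ _ _ => ⟨e1.resolve_left c3, e3.resolve_left c3, h⟩
      · exact main 2 fun x h e1 e2 e3 e4 e5 e6 => by simpa [h, c2] using And.intro e5 e6
    · exact main 1 fun x h e1 e2 e3 e4 e5 e6 => by simpa [h, c1] using And.intro e3 e4
  · exact main 0 fun x h e1 e2 e3 e4 e5 e6 => by simpa [h, c0] using And.intro e1 e2

/-- On mixed products the operator multiplies by the ratios 1, 2, -1 of the weights. On squares, its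
rows solve a 3 × 3 system for each square, such as c₁ + c₂ = 0, c₀ + c₂ = 1, c₀ + c₁ = 2 for X₀². -/
theorem transferMap_left (i j : Fin 3) : transferMap L M (X i * X j) =
    C (quadMatrix L).det * quadForm (squareTable ![![3 / 2, 1 / 2, -1 / 2], ![-1, 0, 1],
      ![-3 / 2, 3 / 2, 1 / 2]] ![1, 2, -1] i j) := by
  rw [X_mul_X_eq_quadForm]
  refine transferMap_quadForm (det_ne_zero_of_squareWeights hL (by simp) (by simp) (by simp))
    fun b => ?_
  rw [map_quadForm_mul_of_squareWeights hL, map_quadForm_mul_of_squareWeights hM]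
  fin_cases i <;> fin_cases j <;> simp [squareTable] <;> ring

theorem transferMap_right (i j : Fin 3) : transferMap M L (X i * X j) =
    C (quadMatrix M).det * quadForm (squareTable ![![3 / 4, 1 / 2, -1 / 4], ![1 / 2, 0, 1 / 2],
      ![3 / 4, 3 / 2, -1 / 4]] ![1, 1 / 2, -1] i j) := by
  rw [X_mul_X_eq_quadForm]
  refine transferMap_quadForm (det_ne_zero_of_squareWeights hM (by simp) (by simp) (by simp))
    fun b => ?_
  rw [map_quadForm_mul_of_squareWeights hL, map_quadForm_mul_of_squareWeights hM]
  fin_cases i <;> fin_cases j <;> simp [squareTable] <;> ring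

/-- The radical is diagonal in p with nonzero entries, so it never vanishes at a nonzero p. -/
theorem radicalOf_left (p : Fin 3 → ℂ) : radicalOf L (transferMap L M) p =
    (quadMatrix L).det ^ 2 • ![-3 * p 0, -(3 / 2) * p 1, p 2] := by
  rw [radicalOf_of_squareTable hL (transferMap_left hL hM)]
  ext i
  fin_cases i <;> simp <;> ring

theorem radicalOf_right (p : Fin 3 → ℂ) : radicalOf M (transferMap M L) p =
    (quadMatrix M).det ^ 2 • ![3 / 2 * p 0, 3 / 4 * p 1, -(1 / 2) * p 2] := by
  rw [radicalOf_of_squareTable hM (transferMap_right hL hM)]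
  ext i
  fin_cases i <;> simp <;> ring

theorem cubicAt_left (p x : Fin 3 → ℂ) : eval x (cubicAt L (transferMap L M) p) =
    -3 * (quadMatrix L).det ^ 3 * (p 1 * p 2 * x 0 ^ 3 + p 0 * p 2 * x 1 ^ 3 +
      p 0 * p 1 * x 2 ^ 3 - (p 0 ^ 2 + p 1 ^ 2 + p 2 ^ 2) * (x 0 * x 1 * x 2)) := by
  simp only [cubicAt, radicalOf_left hL hM, transferMap_left hL hM, triple]
  simp [quadForm, squareTable]
  ring

theorem cubicAt_right (p x : Fin 3 → ℂ) : eval x (cubicAt M (transferMap M L) p) =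
    3 / 4 * (quadMatrix M).det ^ 3 * (-p 1 * p 2 * x 0 ^ 3 + 2 * p 0 * p 2 * x 1 ^ 3 +
      p 0 * p 1 * x 2 ^ 3 + (p 0 ^ 2 - 2 * p 1 ^ 2 - p 2 ^ 2) * (x 0 * x 1 * x 2)) := by
  simp only [cubicAt, radicalOf_right hL hM, transferMap_right hL hM, triple]
  simp [quadForm, squareTable]
  ring

/-- The coordinate points are bad for this pencil, since both cubics there are multiples of X₀X₁X₂;
the auxiliary line avoids them. On that line at most one coordinate of p vanishes. If none does, the
coefficients of two cubes give independent equations in u and v; otherwise one cube together with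
X₀X₁X₂ does. -/
theorem linearIndependent_cubicAt {p : Fin 3 → ℂ} (hp : p ≠ 0) (h0 : p 0 + p 1 + p 2 = 0) :
    LinearIndependent ℂ ![cubicAt L (transferMap L M) p, cubicAt M (transferMap M L) p] := by
  have hdL := det_ne_zero_of_squareWeights hL (by simp) (by simp) (by simp)
  have hdM := det_ne_zero_of_squareWeights hM (by simp) (by simp) (by simp)
  refine LinearIndependent.pair_iff.2 fun a b hab => ?_
  have hx : ∀ x : Fin 3 → ℂ, a * eval x (cubicAt L (transferMap L M) p) +
      b * eval x (cubicAt M (transferMap M L) p) = 0 := fun x => by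
    have h1 := congrArg (eval x) hab
    rwa [map_add, smul_eval, smul_eval, map_zero] at h1
  simp only [cubicAt_left hL hM, cubicAt_right hL hM] at hx
  set u := a * (quadMatrix L).det ^ 3 with hu
  set v := b * (quadMatrix M).det ^ 3 with hv
  suffices u = 0 ∧ v = 0 by simpa [hu, hv, hdL, hdM] using this
  have e0 := hx ![1, 0, 0]
  have e1 := hx ![0, 1, 0]
  have e2 := hx ![0, 0, 1]
  have e3 := hx ![1, 1, 1]
  simp only [Matrix.cons_val] at e0 e1 e2 e3
  have f0 : p 1 * p 2 * (4 * u + v) = 0 := by linear_combination -4 / 3 * e0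
  have f1 : p 0 * p 2 * (2 * u - v) = 0 := by linear_combination -2 / 3 * e1
  have f2 : p 0 * p 1 * (4 * u - v) = 0 := by linear_combination -4 / 3 * e2
  have f3 : 4 * (p 0 ^ 2 + p 1 ^ 2 + p 2 ^ 2) * u + (p 0 ^ 2 - 2 * p 1 ^ 2 - p 2 ^ 2) * v = 0 := by
    linear_combination 4 / 3 * (e3 - e0 - e1 - e2)
  have hp2 : p 2 = -p 0 - p 1 := by linear_combination h0
  rw [hp2] at f0 f1 f3
  have hsolve : ∀ {α β γ κ : ℂ}, α * κ - β * γ ≠ 0 → α * u + β * v = 0 → γ * u + κ * v = 0 →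
      u = 0 ∧ v = 0 := by
    intro α β γ κ hne h1 h2
    constructor
    · refine (mul_eq_zero.1 (?_ : (α * κ - β * γ) * u = 0)).resolve_left hne
      linear_combination κ * h1 - β * h2
    · refine (mul_eq_zero.1 (?_ : (α * κ - β * γ) * v = 0)).resolve_left hne
      linear_combination α * h2 - γ * h1
  by_cases p0 : p 0 = 0
  · have p1 : p 1 ≠ 0 := fun p1 => hp (by
      ext i
      fin_cases i
      · exact p0
      · exact p1
      · simpa [p0, p1] using hp2)
    rw [p0] at f0 f3
    refine hsolve (α := 4) (β := 1) (γ := 8) (κ := -3) (by norm_num) ?_ ?_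
    · refine (mul_eq_zero.1 (?_ : p 1 ^ 2 * _ = 0)).resolve_left (pow_ne_zero 2 p1)
      linear_combination -f0
    · refine (mul_eq_zero.1 (?_ : p 1 ^ 2 * _ = 0)).resolve_left (pow_ne_zero 2 p1)
      linear_combination f3
  · by_cases p1 : p 1 = 0
    · rw [p1] at f1 f3
      refine hsolve (α := 2) (β := -1) (γ := 8) (κ := 0) (by norm_num) ?_ ?_
      · refine (mul_eq_zero.1 (?_ : p 0 ^ 2 * _ = 0)).resolve_left (pow_ne_zero 2 p0)
        linear_combination -f1
      · refine (mul_eq_zero.1 (?_ : p 0 ^ 2 * _ = 0)).resolve_left (pow_ne_zero 2 p0)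
        linear_combination f3
    · have g2 := (mul_eq_zero.1 f2).resolve_left (mul_ne_zero p0 p1)
      by_cases hs : p 2 = 0
      · have h1 : p 1 = -p 0 := by linear_combination h0 - hs
        rw [h1] at f3
        refine hsolve (α := 4) (β := -1) (γ := 8) (κ := -1) (by norm_num)
          (by linear_combination g2) ?_
        refine (mul_eq_zero.1 (?_ : p 0 ^ 2 * _ = 0)).resolve_left (pow_ne_zero 2 p0)
        linear_combination f3
      · rw [← hp2] at f1
        have g1 := (mul_eq_zero.1 f1).resolve_left (mul_ne_zero p0 hs)
        exact hsolve (α := 4) (β := -1) (γ := 2) (κ := -1) (by norm_num)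
          (by linear_combination g2) (by linear_combination g1)

theorem isGeneralExample : IsGeneralExample L M where
  det_lam := det_ne_zero_of_squareWeights hL (by simp) (by simp) (by simp)
  det_mu := det_ne_zero_of_squareWeights hM (by simp) (by simp) (by simp)
  finrank_point _ := finrank_apolarCubicsAt_le hL hM
  finrank_conic _ := finrank_conicConditions_le hL hM
  radical_lam p hp h0 := by
    have hd := det_ne_zero_of_squareWeights hL (by simp) (by simp) (by simp)
    rw [radicalOf_left hL hM, smul_eq_zero_iff_right (pow_ne_zero 2 hd)] at h0
    refine hp (funext fun i => ?_)
    have h1 := congrFun h0 i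
    fin_cases i <;> simpa using h1
  radical_mu p hp h0 := by
    have hd := det_ne_zero_of_squareWeights hM (by simp) (by simp) (by simp)
    rw [radicalOf_right hL hM, smul_eq_zero_iff_right (pow_ne_zero 2 hd)] at h0
    refine hp (funext fun i => ?_)
    have h1 := congrFun h0 i
    fin_cases i <;> simpa using h1
  line _ := linearIndependent_cubicAt hL hM

end GeneralExample

/-! ### A pencil with few apolar multiples of a linear form -/

section LineExample

open MvPolynomial

/-- The weights of the first functional. -/
def lineWeights (i j k : ℕ) : ℂ :=
  if (i, j, k) = (1, 2, 1) then 1 else if (i, j, k) = (3, 1, 0) then 1 else 0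

/-- The weights of the second functional. -/
def lineWeights' (i j k : ℕ) : ℂ :=
  if (i, j, k) = (2, 0, 2) then 1 else if (i, j, k) = (0, 1, 3) then 1 else
    if (i, j, k) = (0, 2, 2) then -1 else 0

theorem map_quadForm_mul_of_lineWeights {L : Poly 2 →ₗ[ℂ] ℂ} (h : HasWeights L lineWeights)
    (c b : Fin 6 → ℂ) : L (quadForm c * quadForm b) =
      c 0 * b 3 + c 3 * b 0 + c 1 * b 4 + c 4 * b 1 + c 3 * b 5 + c 5 * b 3 := by
  rw [h.map_quadForm_mul]
  simp [lineWeights]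
  ring

theorem map_quadForm_mul_of_lineWeights' {M : Poly 2 →ₗ[ℂ] ℂ} (h : HasWeights M lineWeights')
    (c b : Fin 6 → ℂ) : M (quadForm c * quadForm b) =
      c 2 * b 5 + c 5 * b 2 + c 0 * b 2 + c 2 * b 0 + c 4 * b 4 -
        (c 1 * b 2 + c 2 * b 1 + c 5 * b 5) := by
  rw [h.map_quadForm_mul]
  simp [lineWeights']
  ring

theorem exists_quadForm_coeff (i : Fin 6) :
    ∃ φ : Poly 2 →ₗ[ℂ] ℂ, ∀ c, φ (quadForm c) = c i := by
  let ε : (Fin 3 → ℂ) → Poly 2 →ₗ[ℂ] ℂ := fun x => (aeval x : Poly 2 →ₐ[ℂ] ℂ).toLinearMap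
  have hε : ∀ x c, ε x (quadForm c) = c 0 * x 0 ^ 2 + c 1 * x 1 ^ 2 + c 2 * x 2 ^ 2 +
      c 3 * (x 0 * x 1) + c 4 * (x 0 * x 2) + c 5 * (x 1 * x 2) := fun x c => by
    simp [ε, quadForm]
  have h0 := hε ![1, 0, 0]
  have h1 := hε ![0, 1, 0]
  have h2 := hε ![0, 0, 1]
  have h3 := hε ![1, 1, 0]
  have h4 := hε ![1, 0, 1]
  have h5 := hε ![0, 1, 1]
  simp only [Matrix.cons_val] at h0 h1 h2 h3 h4 h5
  fin_cases i
  · exact ⟨ε ![1, 0, 0], fun c => by rw [h0]; simp⟩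
  · exact ⟨ε ![0, 1, 0], fun c => by rw [h1]; simp⟩
  · exact ⟨ε ![0, 0, 1], fun c => by rw [h2]; simp⟩
  · exact ⟨ε ![1, 1, 0] - ε ![1, 0, 0] - ε ![0, 1, 0], fun c => by
      rw [LinearMap.sub_apply, LinearMap.sub_apply, h3, h0, h1]; simp; ring⟩
  · exact ⟨ε ![1, 0, 1] - ε ![1, 0, 0] - ε ![0, 0, 1], fun c => by
      rw [LinearMap.sub_apply, LinearMap.sub_apply, h4, h0, h2]; simp; ring⟩
  · exact ⟨ε ![0, 1, 1] - ε ![0, 1, 0] - ε ![0, 0, 1], fun c => by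
      rw [LinearMap.sub_apply, LinearMap.sub_apply, h5, h1, h2]; simp; ring⟩

/-- A second pencil is needed because in the first one X₀ · X₀² and X₀ · X₁X₂ are both apolar. Here,
for every linear form, a suitable coefficient of the quadratic form determines it. -/
theorem finrank_lineConditions_le {L M : Poly 2 →ₗ[ℂ] ℂ} (hL : HasWeights L lineWeights)
    (hM : HasWeights M lineWeights') {y : Fin 3 → ℂ} (hy : y ≠ 0) :
    Module.finrank ℂ (kernelForms (lineConditions L M y) 2) ≤ 1 := by
  have main : ∀ i : Fin 6, (∀ c : Fin 6 → ℂ, c i = 0 →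
      y 0 * c 3 + y 1 * c 0 + y 2 * c 1 + y 1 * c 5 = 0 →
      y 1 * c 4 + y 0 * c 0 + y 0 * c 5 + y 2 * c 3 = 0 →
      y 0 * c 1 + y 1 * c 3 = 0 →
      y 0 * c 2 + y 2 * c 4 = 0 →
      y 2 * c 2 - y 1 * c 2 - y 2 * c 5 = 0 →
      y 2 * c 5 + y 1 * c 2 + y 2 * c 0 + y 0 * c 4 - (y 2 * c 1 + y 1 * c 5) = 0 → c = 0) →
      Module.finrank ℂ (kernelForms (lineConditions L M y) 2) ≤ 1 := by
    intro i h
    obtain ⟨φ, hφ⟩ := exists_quadForm_coeff i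
    refine finrank_le_of_forall_eq_zero (fun _ : Fin 1 => φ) fun q hq h0 => ?_
    obtain ⟨hq2, hq⟩ := mem_kernelForms_lineConditions.1 hq
    obtain ⟨c, rfl⟩ := exists_quadForm hq2
    obtain ⟨a0, b0⟩ := hq.2 0
    obtain ⟨a1, b1⟩ := hq.2 1
    obtain ⟨a2, b2⟩ := hq.2 2
    rw [← mul_assoc, X_mul_linForm_zero] at a0 b0
    rw [← mul_assoc, X_mul_linForm_one] at a1 b1
    rw [← mul_assoc, X_mul_linForm_two] at a2 b2
    rw [map_quadForm_mul_of_lineWeights hL] at a0 a1 a2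
    rw [map_quadForm_mul_of_lineWeights' hM] at b0 b1 b2
    simp only [Matrix.cons_val, zero_mul, add_zero, zero_add, sub_zero] at a0 a1 a2 b0 b1 b2
    rw [h c (hφ c ▸ h0 0) (by linear_combination a0) (by linear_combination a1)
      (by linear_combination a2) (by linear_combination b0) (by linear_combination b1)
      (by linear_combination b2)]
    simp [quadForm]
  have hext : ∀ c : Fin 6 → ℂ, c 0 = 0 → c 1 = 0 → c 2 = 0 → c 3 = 0 → c 4 = 0 → c 5 = 0 →
      c = 0 := fun c h0 h1 h2 h3 h4 h5 => by ext i; fin_cases i <;> assumption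
  -- The coefficient to test depends on which coordinates of the linear form vanish: that of X₁² if
  -- y₁ ≠ 0, of X₁X₂ if only y₁ is known to vanish and y₀ ≠ 0, and of X₂² for a multiple of X₂.
  by_cases y1 : y 1 = 0
  · by_cases y0 : y 0 = 0
    · have y2 : y 2 ≠ 0 := fun y2 => hy (by ext i; fin_cases i <;> assumption)
      refine main 2 fun c h a0 a1 a2 b0 b1 b2 => ?_
      simp only [y0, y1, h, zero_mul, mul_zero, zero_add, add_zero, zero_sub, neg_eq_zero, sub_self,
        mul_eq_zero, y2, false_or] at a0 a1 b0 b1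
      simp only [y0, y1, h, a0, b1, zero_mul, mul_zero, zero_add, add_zero, sub_zero,
        mul_eq_zero, y2, false_or] at b2
      exact hext c b2 a0 h a1 b0 b1
    · refine main 5 fun c h a0 a1 a2 b0 b1 b2 => ?_
      simp only [y1, zero_mul, add_zero, mul_eq_zero, y0, false_or] at a2
      simp only [y1, a2, h, zero_mul, mul_zero, add_zero, mul_eq_zero, y0, false_or] at a0
      simp only [y1, a0, h, zero_mul, mul_zero, zero_add, add_zero, mul_eq_zero, y0, false_or] at a1
      simp only [y1, a1, a2, h, zero_mul, mul_zero, zero_add, add_zero, sub_zero, mul_eq_zero, y0,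
        false_or] at b2
      simp only [b2, mul_zero, add_zero, mul_eq_zero, y0, false_or] at b0
      exact hext c a1 a2 b0 a0 b2 h
  · refine main 1 fun c h a0 a1 a2 b0 b1 b2 => ?_
    simp only [h, mul_zero, zero_add, mul_eq_zero, y1, false_or] at a2
    have h5 : c 0 + c 5 = 0 := (mul_eq_zero.1 (?_ : y 1 * (c 0 + c 5) = 0)).resolve_left y1
    · have h4 : c 4 = 0 := by
        refine (mul_eq_zero.1 (?_ : y 1 * c 4 = 0)).resolve_left y1
        linear_combination a1 - y 2 * a2 - y 0 * h5
      have h25 : c 2 - c 5 = 0 := by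
        refine (mul_eq_zero.1 (?_ : y 1 * (c 2 - c 5) = 0)).resolve_left y1
        linear_combination b2 - y 2 * h5 - y 0 * h4 + y 2 * h
      have h2 : c 2 = 0 := by
        refine (mul_eq_zero.1 (?_ : y 1 * c 2 = 0)).resolve_left y1
        linear_combination -b1 + y 2 * h25
      exact hext c (by linear_combination h5 + h25 - h2) h h2 a2 h4 (by linear_combination h2 - h25)
    · linear_combination a0 - y 0 * a2 - y 2 * h

end LineExample

/-- A general pencil of quartics is general in the sense of `GeneralPencil`. -/
theorem exists_generic_generalPencil : ∃ G : MvPolynomial (Fin 2 × Mon 2 4) ℂ, G ≠ 0 ∧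
    ∀ a, MvPolynomial.eval a G ≠ 0 →
      Nonempty (GeneralPencil (pencilFunctional a 0) (pencilFunctional a 1)) := by
  obtain ⟨a₀, h₀⟩ := exists_hasWeights ![squareWeights 1 1 1, squareWeights 1 2 (-1)]
  obtain ⟨a₁, h₁⟩ := exists_hasWeights ![lineWeights, lineWeights']
  obtain ⟨G, hG, hGa⟩ := exists_generic_example (isGeneralExample (h₀ 0) (h₀ 1))
  obtain ⟨H, hH, hHa⟩ := exists_generic_line fun y hy =>
    finrank_lineConditions_le (h₁ 0) (h₁ 1) hy
  refine ⟨G * H, mul_ne_zero hG hH, fun a ha => ?_⟩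
  rw [map_mul, mul_ne_zero_iff] at ha
  exact ⟨(hGa a ha.1).generalPencil (hHa a ha.2)⟩

end Apolar

end

/-! ### The main theorem -/

theorem mainTheorem2 :
    Apolar.ForGeneralSubspace 2 4 2 (fun Λ =>
      (∃ α : Apolar.HilbSpace 2 8 → Apolar.ProjSp (Fin 3),
        (∀ I : Ideal (Apolar.Poly 2), Apolar.IsPolarPolyhedron 8 Λ I →
          ∀ z : Apolar.HilbSpace 2 8, Apolar.IsHilbPoint 8 I z →
            Apolar.IsAssociatedPoint I (α z)) ∧
        Apolar.IsRegularOn α (Apolar.polarFamily 8 Λ) ∧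
        Apolar.HasRationalInverse α (Apolar.polarFamily 8 Λ)) ∧
      Apolar.IsRationalVariety 2 (Apolar.polarFamily 8 Λ)) := by
  obtain ⟨G, hG, h⟩ := Apolar.exists_generic_generalPencil
  refine ⟨G, hG, fun F hF _ hFG => ?_⟩
  obtain ⟨P⟩ := h _ hFG
  have P' : Apolar.GeneralPencil
      (Apolar.formFunctional fun m : Apolar.Mon 2 4 => MvPolynomial.coeff m.1 (F 0))
      (Apolar.formFunctional fun m : Apolar.Mon 2 4 => MvPolynomial.coeff m.1 (F 1)) := P
  refine ⟨⟨Apolar.assocPoint, fun I hI z hz => Apolar.isAssociatedPoint_assocPoint hF P' hI hz,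
    ?_, ?_⟩, ?_⟩
  · rw [Apolar.polarFamily_eq hF P']
    exact Apolar.GeneralPencil.isRegularOn_assocPoint_family
  · rw [Apolar.polarFamily_eq hF P']
    exact P'.hasRationalInverse
  · rw [Apolar.polarFamily_eq hF P']
    exact P'.isRationalVariety
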